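/- **Setting.** Let $\mathbb D$ be the open unit disk, $T_y(z)=\frac{z-y}{1-z\bar y}$, and let $d_{\mathbb H}(y,z)=\log\frac{1+|T_y(z)|}{1-|T_y(z)|}$ be the hyperbolic distance. For $j\in\mathbb N$ let $\zeta_j=\tanh(j/2)\in[0,1)$, so that $d_{\mathbb H}(0,\zeta_j)=j$. Let $U\subseteq\mathbb D$ be open and contain a neighbourhood of $i$ relative to $\mathbb D$. Let $\mathbf W$ be a centered Gaussian field that is *BRW-like in $U$*, that is: (a) for every $z\in U$ the function $w\mapsto\mathbb E[\mathbf W(z)\mathbf W(w)]$ is harmonic in $U$; (b) there is $C>0$ with $\operatorname{Var}(\mathbf W(z)-\mathbf W(w))\le C\,d_{\mathbb H}(z,w)^2$ for all $z,w\in U$ with $d_{\mathbb H}(z,w)\le1$; (c) there is $C>0$ with $|\mathbb E[\mathbf W(y)(\mathbf W(z)-\mathbf W(w))]|\le C\,d_{\mathbb H}(z,w)$ for all $y,z,w\in U$ with $d_{\mathbb H}(z,w)\le 1$; (d) there is a continuous $K:\mathbb T^2\to\mathbb R$ such that for all $\zeta_he^{i\theta_1},\zeta_je^{i\theta_2}\in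 U$ one has $\mathbb E[\mathbf W(\zeta_he^{i\theta_1})\mathbf W(\zeta_je^{i\theta_2})]=\frac12\min\{-\log|\sin\frac{\theta_1-\theta_2}2|,h,j\}+K(\theta_1,\theta_2)+O(1)$, where the error is bounded and tends to $0$ uniformly as $\min\{h,j\}+\log|\sin\frac{\theta_1-\theta_2}{2}|\to\infty$. For each $N\in\mathbb N$ let $\mathbf W_N$ be a real random field whose values at the points of $U$ are random variables. Fix a sequence of natural numbers $\eta=\eta_N\to\infty$ with $\eta_N=o(\log N)$. For $\delta>0$ put $n=\lceil\log N\rceil$, $n_0=\lfloor(1-\delta)n\rfloor$ and $b_k=k\lfloor n_0/\eta\rfloor$. Let $r$ be the smallest natural number such that every $z\in\mathbb D$ with $d_{\mathbb H}(0,z)>b_r$ satisfies $|z|>1-N^{-2\delta}$, and put $b^*=b_r$. Let $$\Omega=\{e^{i(\frac\pi2+he^{-n_0})}:h\in\mathbb Z,\ |h|<N^{-\delta}e^{n_0}\},\qquad \mathcal D_{N,\delta}=\{ire^{i\theta}: 1-N^{-\delta}\le r\le1-N^{-1+\delta},\ |\theta|\le N^{-\delta}\},$$ and for $\omega\in\Omega$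 let $\mathfrak B_\omega(\mathbf F)=2\mathbf F(\omega\zeta_{n_0})-2\mathbf F(i\zeta_{b^*})$. Let $\mathfrak W_{\ell,\delta}(\mathfrak B_\omega)$ be the set of functionals $\mathbf F\mapsto\mathfrak B_\omega(\mathbf F)+\sum_{z\in\mathbf z}2\mathbf F(z)-\sum_{w\in\mathbf w}2\mathbf F(w)$, where $\mathbf z,\mathbf w\subset\mathcal D_{N,\delta}$, $|\mathbf z|=|\mathbf w|=\ell$, and, with $Z=\mathbf z\cup\{\omega\zeta_{n_0}\}$ and $W=\mathbf w\cup\{i\zeta_{b^*}\}$, there is a bijection $\phi:Z\to W$ such that for all $z\in\mathbf z$ $$d_{\mathbb H}(z,\phi(z))\le\min\Big\{\min_{z'\in Z\setminus\{z\}}d_{\mathbb H}(z,z'),\ \min_{w\in W\setminus\{\phi(z)\}}d_{\mathbb H}(w,\phi(z))\Big\}.$$ **Assumption $\operatorname{MEM}(\ell)$.** For all sufficiently small $\delta>0$: (1) for all large $N$, almost surely $\mathbf W_N$ is harmonic in $\mathcal D_{N,\delta}$; (2) as $N\to\infty$, uniformly in $\omega\in\Omega$ and $\mathfrak B\in\mathfrak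 W_{\ell,\delta}(\mathfrak B_\omega)$, the expectation $\mathbb E[e^{\mathfrak B(\mathbf W_N)}]$ is finite and equals $\mathbb E[e^{\mathfrak B(\mathbf W)}](1+O(N^{-\delta}))$. **Proposition.** Fix $\ell\in\mathbb N$ and suppose that $\operatorname{MEM}(\ell)$ holds. Then for all sufficiently small $\delta>0$ and all $0<\alpha<1$ there is a constant $C$ (depending on $\ell$, $\alpha$, $\delta$ and on the given fields and sequence $\eta$, but not on $N$, $\omega$ or the points below) such that for all sufficiently large $N$, all $\omega\in\Omega$ and all points $z_1,\dots,z_\ell,y_1,\dots,y_\ell\in\mathcal D_{N,\delta}$ the following holds. Put $\mathfrak B=\mathfrak B_\omega$, $\mathfrak B_i(\mathbf F)=2\mathbf F(z_i)-2\mathbf F(y_i)$ and $\mu(\cdot)=\mathbb E[\mathbf W(\cdot)\mathfrak B(\mathbf W)]$. Then all the expectations below are those of integrable variables, and $$\left|\frac{\mathbb E\big[e^{\mathfrak B(\mathbf W_N)}\prod_{i=1}^\ell\mathfrak B_i(\mathbf W_N)\big]}{\mathbb E\big[e^{\mathfrak B(\mathbf W_N)}\big]}-\mathbb E\Big[\prod_{i=1}^\ell\mathfrak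 B_i(\mu+\mathbf W)\Big]\right|\le C\,e^{-(\log N)^\alpha}.$$ -/

import Mathlib

open MeasureTheory ProbabilityTheory Filter Topology

namespace LogField

noncomputable section

/-- The disk automorphism `T_y : z ↦ (z - y) / (1 - z ȳ)`. -/
def diskAut (y z : ℂ) : ℂ := (z - y) / (1 - z * (starRingEnd ℂ) y)

/-- The hyperbolic distance on the unit disk,
`d(y, z) = log ((1 + |T_y z|) / (1 - |T_y z|))`. Only used for points of the open unit disk. -/
def hypDist (y z : ℂ) : ℝ := Real.log ((1 + ‖diskAut y z‖) / (1 - ‖diskAut y z‖))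

/-- The point `ζ_j ∈ [0, 1)` at hyperbolic distance `j` from the origin. -/
def zeta (j : ℕ) : ℂ := (Real.tanh ((j : ℝ) / 2) : ℂ)

/-- `min {-log |sin (θ/2)|, h, j}`, where `-log 0 = +∞`. -/
def branchHeight (θ : ℝ) (h j : ℕ) : ℝ :=
  if Real.sin (θ / 2) = 0 then min (h : ℝ) j
  else min (-Real.log |Real.sin (θ / 2)|) (min (h : ℝ) j)

/-- `W` (as a family of real random variables indexed by the points of `U`) is a centered
Gaussian field. The values `W x z` for `z ∉ U` play no role. -/
def IsCenteredGaussianField {E : Type*} [MeasurableSpace E] (Q : Measure E)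
    (W : E → ℂ → ℝ) (U : Set ℂ) : Prop :=
  IsGaussianProcess (fun (z : U) (x : E) => W x (z : ℂ)) Q ∧ ∀ z ∈ U, ∫ x, W x z ∂Q = 0

/-- The covariance `𝔼[W(z) W(w)]` of a centered field. -/
def fieldCov {E : Type*} [MeasurableSpace E] (Q : Measure E) (W : E → ℂ → ℝ) (z w : ℂ) : ℝ :=
  ∫ x, W x z * W x w ∂Q

/-- The covariance of the field at `ζ_h e^{iθ₁}`, `ζ_j e^{iθ₂}`, minus its prescribed main part
`(1/2) min {-log |sin ((θ₁ - θ₂)/2)|, h, j} + K(θ₁, θ₂)`. -/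
def branchError {E : Type*} [MeasurableSpace E] (Q : Measure E) (W : E → ℂ → ℝ)
    (K : Circle × Circle → ℝ) (h j : ℕ) (θ₁ θ₂ : ℝ) : ℝ :=
  fieldCov Q W (zeta h * (Circle.exp θ₁ : ℂ)) (zeta j * (Circle.exp θ₂ : ℂ))
    - (branchHeight (θ₁ - θ₂) h j / 2 + K (Circle.exp θ₁, Circle.exp θ₂))

/-- A centered Gaussian field which is BRW-like in the set `U`. -/
structure IsBRWLike {E : Type*} [MeasurableSpace E] (Q : Measure E)
    (W : E → ℂ → ℝ) (U : Set ℂ) : Prop where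
  gaussian : IsCenteredGaussianField Q W U
  harmonic : ∀ z ∈ U, InnerProductSpace.HarmonicOnNhd (fun w => fieldCov Q W z w) U
  variance_le : ∃ C > 0, ∀ z ∈ U, ∀ w ∈ U, hypDist z w ≤ 1 →
    Var[fun x => W x z - W x w; Q] ≤ C * hypDist z w ^ 2
  cov_le : ∃ C > 0, ∀ y ∈ U, ∀ z ∈ U, ∀ w ∈ U, hypDist z w ≤ 1 →
    |∫ x, W x y * (W x z - W x w) ∂Q| ≤ C * hypDist z w
  branching : ∃ K : Circle × Circle → ℝ, Continuous K ∧
    (∃ C, ∀ (h j : ℕ) (θ₁ θ₂ : ℝ),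
      zeta h * (Circle.exp θ₁ : ℂ) ∈ U → zeta j * (Circle.exp θ₂ : ℂ) ∈ U →
      |branchError Q W K h j θ₁ θ₂| ≤ C) ∧
    (∀ ε > 0, ∃ M : ℝ, ∀ (h j : ℕ) (θ₁ θ₂ : ℝ),
      zeta h * (Circle.exp θ₁ : ℂ) ∈ U → zeta j * (Circle.exp θ₂ : ℂ) ∈ U →
      Real.sin ((θ₁ - θ₂) / 2) ≠ 0 →
      M ≤ min (h : ℝ) j + Real.log |Real.sin ((θ₁ - θ₂) / 2)| →
      |branchError Q W K h j θ₁ θ₂| ≤ ε)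

/-- `n = ⌈log N⌉`. -/
def nN (N : ℕ) : ℕ := ⌈Real.log N⌉₊

/-- `n₀ = ⌊(1 - δ) n⌋`. -/
def n0 (N : ℕ) (δ : ℝ) : ℕ := ⌊(1 - δ) * (nN N : ℝ)⌋₊

/-- `b_k = k ⌊n₀ / η⌋` (division of natural numbers rounds down). -/
def bHeight (η : ℕ → ℕ) (N : ℕ) (δ : ℝ) (k : ℕ) : ℕ := k * (n0 N δ / η N)

/-- The smallest `r` such that every `z` in the unit disk with `d(0, z) > b_r` has
`|z| > 1 - N^{-2δ}`. -/
def rIndex (η : ℕ → ℕ) (N : ℕ) (δ : ℝ) : ℕ :=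
  sInf {k : ℕ | ∀ z ∈ Metric.ball (0 : ℂ) 1, (bHeight η N δ k : ℝ) < hypDist 0 z →
    1 - (N : ℝ) ^ (-2 * δ) < ‖z‖}

/-- `b^* = b_r`. -/
def bStar (η : ℕ → ℕ) (N : ℕ) (δ : ℝ) : ℕ := bHeight η N δ (rIndex η N δ)

/-- `Ω = {e^{i(π/2 + h e^{-n₀})} : h ∈ ℤ, |h| < N^{-δ} e^{n₀}}`. -/
def directions (N : ℕ) (δ : ℝ) : Set ℂ :=
  {ω | ∃ h : ℤ, |(h : ℝ)| < (N : ℝ) ^ (-δ) * Real.exp (n0 N δ) ∧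
    ω = Complex.exp (Complex.I * ((Real.pi / 2 + h * Real.exp (-(n0 N δ : ℝ)) : ℝ) : ℂ))}

/-- `𝒟_{N,δ} = {i r e^{iθ} : 1 - N^{-δ} ≤ r ≤ 1 - N^{-1+δ}, |θ| ≤ N^{-δ}}`. -/
def domain (N : ℕ) (δ : ℝ) : Set ℂ :=
  {z | ∃ r θ : ℝ, 1 - (N : ℝ) ^ (-δ) ≤ r ∧ r ≤ 1 - (N : ℝ) ^ (-1 + δ) ∧
    |θ| ≤ (N : ℝ) ^ (-δ) ∧ z = Complex.I * (r : ℂ) * Complex.exp (Complex.I * (θ : ℂ))}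

/-- The bias `𝔅_ω : F ↦ 2 F(ω ζ_{n₀}) - 2 F(i ζ_{b^*})`. -/
def baseBias (η : ℕ → ℕ) (N : ℕ) (δ : ℝ) (ω : ℂ) (F : ℂ → ℝ) : ℝ :=
  2 * F (ω * zeta (n0 N δ)) - 2 * F (Complex.I * zeta (bStar η N δ))

/-- The increment `F ↦ 2 F(z) - 2 F(y)`. -/
def incBias (z y : ℂ) (F : ℂ → ℝ) : ℝ := 2 * F z - 2 * F y

open scoped Classical in
/-- The pairing condition on `𝐳`, `𝐰` relative to the two base points `p` (added to `𝐳`) and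
`q` (added to `𝐰`): with `Z = 𝐳 ∪ {p}` and `W = 𝐰 ∪ {q}` there is a bijection `φ : Z → W` with
`d(z, φ z) ≤ min {min_{z' ∈ Z ∖ {z}} d(z, z'), min_{w ∈ W ∖ {φ z}} d(w, φ z)}` for `z ∈ 𝐳`. -/
def Paired (p q : ℂ) (zs ws : Finset ℂ) : Prop :=
  ∃ φ : ℂ → ℂ, Set.BijOn φ (insert p zs : Finset ℂ) (insert q ws : Finset ℂ) ∧
    ∀ z ∈ zs,
      (∀ z' ∈ insert p zs, z' ≠ z → hypDist z (φ z) ≤ hypDist z z') ∧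
      (∀ w ∈ insert q ws, w ≠ φ z → hypDist z (φ z) ≤ hypDist w (φ z))

/-- The class `𝔚_{ℓ,δ}(𝔅_ω)` of local perturbations
`F ↦ 𝔅_ω(F) + ∑_{z ∈ 𝐳} 2 F(z) - ∑_{w ∈ 𝐰} 2 F(w)` of `𝔅_ω`. -/
def perturbedBiases (ℓ : ℕ) (η : ℕ → ℕ) (N : ℕ) (δ : ℝ) (ω : ℂ) : Set ((ℂ → ℝ) → ℝ) :=
  {B | ∃ zs ws : Finset ℂ, (zs : Set ℂ) ⊆ domain N δ ∧ (ws : Set ℂ) ⊆ domain N δ ∧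
    zs.card = ℓ ∧ ws.card = ℓ ∧
    Paired (ω * zeta (n0 N δ)) (Complex.I * zeta (bStar η N δ)) zs ws ∧
    B = fun F => baseBias η N δ ω F + ∑ z ∈ zs, 2 * F z - ∑ w ∈ ws, 2 * F w}

/-- The mixed exponential moment assumption `MEM(ℓ)`: for all sufficiently small `δ > 0`, for `N`
large, `W_N` is almost surely harmonic in `𝒟_{N,δ}`, and
`𝔼[e^{𝔅(W_N)}] = 𝔼[e^{𝔅(W)}] (1 + O(N^{-δ}))` (the left side being finite), uniformly in
`ω ∈ Ω` and `𝔅 ∈ 𝔚_{ℓ,δ}(𝔅_ω)`. -/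
def MEM (ℓ : ℕ) (η : ℕ → ℕ) {S : ℕ → Type*} [∀ N, MeasurableSpace (S N)]
    (P : ∀ N, Measure (S N)) (WN : ∀ N, S N → ℂ → ℝ)
    {E : Type*} [MeasurableSpace E] (Q : Measure E) (W : E → ℂ → ℝ) : Prop :=
  ∃ δ₀ > 0, ∀ δ : ℝ, 0 < δ → δ < δ₀ →
    (∀ᶠ N : ℕ in atTop,
      ∀ᵐ x ∂(P N), InnerProductSpace.HarmonicOnNhd (WN N x) (domain N δ)) ∧
    ∃ C : ℝ, ∀ᶠ N : ℕ in atTop, ∀ ω ∈ directions N δ, ∀ B ∈ perturbedBiases ℓ η N δ ω,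
      Integrable (fun x => Real.exp (B (WN N x))) (P N) ∧
      |(∫ x, Real.exp (B (WN N x)) ∂(P N)) - ∫ x, Real.exp (B (W x)) ∂Q|
        ≤ C * (N : ℝ) ^ (-δ) * ∫ x, Real.exp (B (W x)) ∂Q

/-- The biased expectation `𝔼[e^{𝔅(X)} φ(X)] / 𝔼[e^{𝔅(X)}]` of a statistic `φ` of a field `X`. -/
def biasedExp {E : Type*} [MeasurableSpace E] (P : Measure E) (X : E → ℂ → ℝ)
    (B φ : (ℂ → ℝ) → ℝ) : ℝ :=
  (∫ x, Real.exp (B (X x)) * φ (X x) ∂P) / ∫ x, Real.exp (B (X x)) ∂P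

/-- The mean `μ(ζ) = 𝔼[W(ζ) 𝔅(W)]` of `W` under the bias `𝔅`. -/
def biasMean {E : Type*} [MeasurableSpace E] (Q : Measure E) (W : E → ℂ → ℝ)
    (B : (ℂ → ℝ) → ℝ) (ζ : ℂ) : ℝ :=
  ∫ x, W x ζ * B (W x) ∂Q

end

end LogField

/-!
The law of `W_N` is biased by `e^{𝔅}`, where `𝔅 = 2 F(p) - 2 F(q)` with base points `p`, `q`. By the
Cameron-Martin formula, biasing the Gaussian field `W` in this way amounts to adding the mean `μ`.
Hence `MEM` says that the exponential moments of `ℓ` increments over admissible pairs of points are,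
up to a factor `1 + O(N^{-δ})`, the same for `W_N` under the biased measure and for `μ + W`
(`BiasComparison.incrementComparison`). It remains to pass from exponential moments to products of
increments, and from admissible pairs to arbitrary ones.

*Linearization.* For short pairs that are separated from each other and from the base points, all
sign patterns of increments are admissible. Since `t = sinh t + O(cosh t - 1)` and the error is
again a combination of exponentials, closeness of the exponential moments yields closeness of the
moments of products (`ExpMomentsClose.abs_integral_prod_sub_le_of_cosh`,
`IncrementComparison.abs_integral_prod_sub_le`).

*Chains.* For arbitrary pairs, the end points are moved slightly into the interior of the domain and
joined to a common root by chains of about `M log N` steps of hyperbolic length about `1 / M`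
(`exists_chain`), and the product of the increments is expanded over the steps. Tuples of separated
steps are compared by linearization. The other tuples are a fraction of about `1 / M` of all tuples,
and Hölder's inequality bounds their contribution, given bounds for the moments of single steps
(`Frame.abs_integral_prod_chain_sub_le`).

*Moments of the steps.* Away from `p` and `q` they are bounded by exponential moments. Near `q`, the
test pairs `(q, z)` with `z` on a circle around `q`, and harmonicity inside the circle, give the
bound (`Frame.momLE_near_right`). This device is not available for `p`, which may lie just below the
domain for `δ`. The domain for a smaller parameter contains a neighbourhood of `p`, but there `MEM`
concerns another bias, and so the bias at `p` has to be undone. If the mean deviation of the field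
over a circle around `p` is `A`, the bias is at most `e^{A/2}`, up to factors that depend on
increments away from `p`; so it suffices that, without the bias, large values of `A` have
probability of order `e^{-A}` (`momLE_near_base`). This follows from a polynomial bound for the
expectation of `e^{2 F(u) - 2 F(q')}`, for `u` near `p`. Such a bound comes from `MEM` with a
parameter `δ' < δ`, whose base point `p'` lies below `p`: perturbing `2 F(p') - 2 F(q')` by the pair
`(u, p')` moves the base point from `p'` to `u` (`BiasComparison.integral_exp_le`), and the variance
of `W` is `O(log N)`. The bound is polynomial in `N`, but moments only feel its logarithm.

*The parameter `δ'`.* The pair `(u, p')` is admissible only if `p'` lies in the domain for `δ'`,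
which depends on the fractional part of `(1 - δ') ⌈log N⌉`. If the estimate failed for infinitely
many `N`, then by Baire's theorem some `δ'` would have the required property for infinitely many of
these `N` (`exists_frequently_le_leftHeight`), and for such `N` the argument applies
(`eventually_productComparison`).

With `α < β < 1`, a displacement of relative size `t = e^{-(log N)^β}` and `M` about `e^{(ℓ + 1)
(log N)^β}` make all the errors smaller than `e^{-(log N)^α}` (`exists_errors_le`), so the constant
`C = 1` suffices.
-/

open MeasureTheory ProbabilityTheory Filter Topology

namespace LogField

/-! ### Hyperbolic geometry of the disk -/

lemma normSq_one_sub_mul_conj (y z : ℂ) :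
    ‖1 - z * (starRingEnd ℂ) y‖ ^ 2 = ‖z - y‖ ^ 2 + (1 - ‖z‖ ^ 2) * (1 - ‖y‖ ^ 2) := by
  simp only [← Complex.normSq_eq_norm_sq, Complex.normSq_apply]
  simp
  ring

lemma norm_diskAut_sq {y z : ℂ} :
    ‖diskAut y z‖ ^ 2 = ‖z - y‖ ^ 2 / (‖z - y‖ ^ 2 + (1 - ‖z‖ ^ 2) * (1 - ‖y‖ ^ 2)) := by
  rw [diskAut, norm_div, div_pow, normSq_one_sub_mul_conj]

lemma gap_pos {z : ℂ} (hz : ‖z‖ < 1) : 0 < 1 - ‖z‖ ^ 2 := by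
  nlinarith [norm_nonneg z]

lemma norm_diskAut_lt_one {y z : ℂ} (hy : ‖y‖ < 1) (hz : ‖z‖ < 1) : ‖diskAut y z‖ < 1 := by
  have h1 := gap_pos hy
  have h2 := gap_pos hz
  have h3 : ‖diskAut y z‖ ^ 2 < 1 := by
    rw [norm_diskAut_sq, div_lt_one (by positivity)]
    nlinarith [mul_pos h1 h2]
  nlinarith [norm_nonneg (diskAut y z)]

lemma hypDist_self (z : ℂ) : hypDist z z = 0 := by
  simp [hypDist, diskAut]

/-- The hyperbolic distance is an increasing function of
`‖y - z‖² / ((1 - ‖y‖²) (1 - ‖z‖²))`, so two distances can be compared without logarithms. -/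
lemma hypDist_le_hypDist {y z y' z' : ℂ} (hy : ‖y‖ < 1) (hz : ‖z‖ < 1) (hy' : ‖y'‖ < 1)
    (hz' : ‖z'‖ < 1)
    (h : ‖y - z‖ ^ 2 * ((1 - ‖y'‖ ^ 2) * (1 - ‖z'‖ ^ 2)) ≤
      ‖y' - z'‖ ^ 2 * ((1 - ‖y‖ ^ 2) * (1 - ‖z‖ ^ 2))) :
    hypDist y z ≤ hypDist y' z' := by
  have g1 := mul_pos (gap_pos hy) (gap_pos hz)
  have g2 := mul_pos (gap_pos hy') (gap_pos hz')
  have key : ‖diskAut y z‖ ≤ ‖diskAut y' z'‖ := by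
    rw [← sq_le_sq₀ (norm_nonneg _) (norm_nonneg _), norm_diskAut_sq, norm_diskAut_sq,
      div_le_div_iff₀ (by nlinarith [sq_nonneg ‖z - y‖]) (by nlinarith [sq_nonneg ‖z' - y'‖]),
      norm_sub_rev z y, norm_sub_rev z' y']
    nlinarith
  have l1 := norm_diskAut_lt_one hy hz
  have l2 := norm_diskAut_lt_one hy' hz'
  unfold hypDist
  apply Real.log_le_log
  · apply div_pos <;> linarith [norm_nonneg (diskAut y z)]
  · rw [div_le_div_iff₀ (by linarith) (by linarith)]
    nlinarith

lemma hypDist_nonneg {y z : ℂ} (hy : ‖y‖ < 1) (hz : ‖z‖ < 1) : 0 ≤ hypDist y z := by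
  rw [← hypDist_self y]
  apply hypDist_le_hypDist hy hy hy hz
  simp only [sub_self, norm_zero]
  have := mul_pos (gap_pos hy) (gap_pos hy)
  nlinarith [mul_nonneg (sq_nonneg ‖y - z‖) this.le]

lemma hypDist_comm (y z : ℂ) : hypDist y z = hypDist z y := by
  have : ‖diskAut y z‖ = ‖diskAut z y‖ := by
    rw [← sq_eq_sq₀ (norm_nonneg _) (norm_nonneg _), norm_diskAut_sq, norm_diskAut_sq,
      norm_sub_rev z y]
    ring
  simp [hypDist, this]

lemma hypDist_le_of_norm_diskAut_le {y z : ℂ} {r : ℝ} (h : ‖diskAut y z‖ ≤ r) (hr : r ≤ 1 / 4) :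
    hypDist y z ≤ 3 * r := by
  have h0 := norm_nonneg (diskAut y z)
  set x := ‖diskAut y z‖ with hx
  have hlog : hypDist y z ≤ (1 + x) / (1 - x) - 1 := by
    unfold hypDist
    rw [← hx]
    apply Real.log_le_sub_one_of_pos
    apply div_pos <;> linarith
  have : (1 + x) / (1 - x) - 1 ≤ 3 * x := by
    have h1 : (0 : ℝ) < 1 - x := by linarith
    rw [div_sub_one h1.ne', div_le_iff₀ h1]
    nlinarith
  linarith

/-- The height of a point above the boundary of the disk. -/
noncomputable def ht (z : ℂ) : ℝ := 1 - ‖z‖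

lemma ht_pos {z : ℂ} (hz : ‖z‖ < 1) : 0 < ht z := by unfold ht; linarith

lemma ht_sub_le (z w : ℂ) : ht z - ht w ≤ ‖z - w‖ := by
  unfold ht
  have := norm_sub_norm_le w z
  rw [norm_sub_rev] at this
  linarith

lemma abs_ht_sub_le (z w : ℂ) : |ht z - ht w| ≤ ‖z - w‖ := by
  rw [abs_le]
  have := ht_sub_le w z
  rw [norm_sub_rev] at this
  constructor <;> linarith [ht_sub_le z w]

lemma ht_le_gap {z : ℂ} (hz : ‖z‖ < 1) : ht z ≤ 1 - ‖z‖ ^ 2 := by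
  unfold ht; nlinarith [norm_nonneg z]

lemma gap_le_two_ht (z : ℂ) : 1 - ‖z‖ ^ 2 ≤ 2 * ht z := by
  unfold ht; nlinarith [sq_nonneg (1 - ‖z‖)]

lemma hypDist_le_of_norm_sub_le {y z : ℂ} (hy : ‖y‖ < 1) (hz : ‖z‖ < 1) {s : ℝ}
    (hs : s ≤ 1 / 4) (h : ‖y - z‖ ≤ s * ht y) : hypDist y z ≤ 3 * s := by
  refine hypDist_le_of_norm_diskAut_le ?_ hs
  have h1 : ht y ≤ ‖1 - z * (starRingEnd ℂ) y‖ := by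
    have := norm_sub_norm_le (1 : ℂ) (z * (starRingEnd ℂ) y)
    simp only [norm_one, norm_mul, RCLike.norm_conj] at this
    unfold ht
    nlinarith [norm_nonneg z, norm_nonneg y]
  rw [diskAut, norm_div, div_le_iff₀ (lt_of_lt_of_le (ht_pos hy) h1), norm_sub_rev]
  have hs0 : 0 ≤ s := by
    by_contra hneg
    nlinarith [norm_nonneg (y - z), ht_pos hy]
  nlinarith

/-- If `z` is at relative Euclidean distance at least `τ` from `x` and `y` is eight times closer
to `x` than that, then `y` is hyperbolically closer to `x` than `z` is. -/
lemma hypDist_le_of_sep {x y z : ℂ} (hx : ‖x‖ < 1) (hy : ‖y‖ < 1) (hz : ‖z‖ < 1) {τ : ℝ}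
    (hτ0 : 0 < τ) (hτ : τ ≤ 4) (hxy : ‖x - y‖ ≤ τ / 8 * ht x)
    (hxz : τ * (ht x + ht z) ≤ ‖x - z‖) :
    hypDist x y ≤ hypDist x z ∧ hypDist x y ≤ hypDist z y := by
  have hx0 := ht_pos hx
  have hz0 := ht_pos hz
  have hy1 : ht x / 2 ≤ ht y := by
    have := ht_sub_le x y
    nlinarith
  have gx := ht_le_gap hx
  have gy := ht_le_gap hy
  have gz := gap_le_two_ht z
  have gz0 := gap_pos hz
  have hsq : ‖x - y‖ ^ 2 ≤ (τ / 8 * ht x) ^ 2 := by gcongr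
  have base : ‖x - y‖ ^ 2 * (1 - ‖z‖ ^ 2) ≤ τ ^ 2 / 32 * ht x ^ 2 * ht z := by
    calc ‖x - y‖ ^ 2 * (1 - ‖z‖ ^ 2) ≤ (τ / 8 * ht x) ^ 2 * (2 * ht z) := by gcongr
      _ = _ := by ring
  have am : ht x * ht z ≤ (ht x + ht z) ^ 2 / 4 := by nlinarith [sq_nonneg (ht x - ht z)]
  constructor
  · apply hypDist_le_hypDist hx hy hx hz
    have h2 : (τ * (ht x + ht z)) ^ 2 ≤ ‖x - z‖ ^ 2 := by gcongr
    have h3 : τ ^ 2 / 32 * ht x ^ 2 * ht z ≤ (τ * (ht x + ht z)) ^ 2 * (ht x / 2) := by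
      have : τ ^ 2 / 32 * ht x ^ 2 * ht z = (τ ^ 2 * ht x / 32) * (ht x * ht z) := by ring
      rw [this]
      calc (τ ^ 2 * ht x / 32) * (ht x * ht z)
          ≤ (τ ^ 2 * ht x / 32) * ((ht x + ht z) ^ 2 / 4) := by gcongr
        _ ≤ _ := by nlinarith [mul_nonneg (mul_nonneg (sq_nonneg τ) hx0.le)
                      (sq_nonneg (ht x + ht z))]
    have h4 : ‖x - y‖ ^ 2 * (1 - ‖z‖ ^ 2) ≤ ‖x - z‖ ^ 2 * (1 - ‖y‖ ^ 2) := by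
      calc _ ≤ _ := base
        _ ≤ _ := h3
        _ ≤ ‖x - z‖ ^ 2 * (1 - ‖y‖ ^ 2) := by gcongr; linarith
    nlinarith [gap_pos hx]
  · apply hypDist_le_hypDist hx hy hz hy
    have hd : 7 / 8 * (τ * (ht x + ht z)) ≤ ‖z - y‖ := by
      have h1 : ‖x - z‖ ≤ ‖x - y‖ + ‖z - y‖ := by
        have := norm_add_le (x - y) (y - z)
        rw [sub_add_sub_cancel, norm_sub_rev y z] at this
        exact this
      nlinarith
    have h2 : (7 / 8 * (τ * (ht x + ht z))) ^ 2 ≤ ‖z - y‖ ^ 2 := by gcongr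
    have h3 : τ ^ 2 / 32 * ht x ^ 2 * ht z ≤ (7 / 8 * (τ * (ht x + ht z))) ^ 2 * ht x := by
      have : τ ^ 2 / 32 * ht x ^ 2 * ht z = (τ ^ 2 * ht x / 32) * (ht x * ht z) := by ring
      rw [this]
      calc (τ ^ 2 * ht x / 32) * (ht x * ht z)
          ≤ (τ ^ 2 * ht x / 32) * ((ht x + ht z) ^ 2 / 4) := by gcongr
        _ ≤ _ := by nlinarith [mul_nonneg (mul_nonneg (sq_nonneg τ) hx0.le)
                      (sq_nonneg (ht x + ht z))]
    have h4 : ‖x - y‖ ^ 2 * (1 - ‖z‖ ^ 2) ≤ ‖z - y‖ ^ 2 * (1 - ‖x‖ ^ 2) := by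
      calc _ ≤ _ := base
        _ ≤ _ := h3
        _ ≤ _ := by gcongr
    nlinarith [gap_pos hy]

/-! ### Pairings of points -/

/-- Indexed form of the pairing condition: the point `c i` is matched with `d i`, and the base
point `p` with the base point `q`. -/
structure IndexedPairing {ℓ : ℕ} (p q : ℂ) (c d : Fin ℓ → ℂ) : Prop where
  inj_left : Function.Injective c
  inj_right : Function.Injective d
  left_ne : ∀ i, c i ≠ p
  right_ne : ∀ i, d i ≠ q
  le_left : ∀ i j, j ≠ i → hypDist (c i) (d i) ≤ hypDist (c i) (c j)
  le_left_base : ∀ i, hypDist (c i) (d i) ≤ hypDist (c i) p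
  le_right : ∀ i j, j ≠ i → hypDist (c i) (d i) ≤ hypDist (d j) (d i)
  le_right_base : ∀ i, hypDist (c i) (d i) ≤ hypDist q (d i)

open scoped Classical in
lemma IndexedPairing.paired {ℓ : ℕ} {p q : ℂ} {c d : Fin ℓ → ℂ} (h : IndexedPairing p q c d) :
    Paired p q (Finset.univ.image c) (Finset.univ.image d) := by
  set φ : ℂ → ℂ := fun z => if hz : ∃ i, c i = z then d hz.choose else q with hφ
  have φc : ∀ i, φ (c i) = d i := by
    intro i
    have hz : ∃ j, c j = c i := ⟨i, rfl⟩
    simp only [hφ, hz, dif_pos]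
    rw [h.inj_left hz.choose_spec]
  have φp : φ p = q := by
    have : ¬ ∃ i, c i = p := fun ⟨i, hi⟩ => h.left_ne i hi
    simp only [hφ, this, dif_neg, not_false_eq_true]
  refine ⟨φ, ⟨?_, ?_, ?_⟩, ?_⟩
  · intro z hz
    simp only [Finset.coe_insert, Finset.coe_image, Finset.coe_univ, Set.image_univ,
      Set.mem_insert_iff, Set.mem_range] at hz ⊢
    rcases hz with rfl | ⟨i, rfl⟩
    · exact Or.inl φp
    · exact Or.inr ⟨i, (φc i).symm⟩
  · intro z hz w hw hzw
    simp only [Finset.coe_insert, Finset.coe_image, Finset.coe_univ, Set.image_univ,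
      Set.mem_insert_iff, Set.mem_range] at hz hw
    rcases hz with rfl | ⟨i, rfl⟩ <;> rcases hw with rfl | ⟨j, rfl⟩
    · rfl
    · rw [φp, φc] at hzw; exact absurd hzw.symm (h.right_ne j)
    · rw [φp, φc] at hzw; exact absurd hzw (h.right_ne i)
    · rw [φc, φc] at hzw; rw [h.inj_right hzw]
  · intro w hw
    simp only [Finset.coe_insert, Finset.coe_image, Finset.coe_univ, Set.image_univ,
      Set.mem_insert_iff, Set.mem_range, Set.mem_image] at hw ⊢
    rcases hw with rfl | ⟨i, rfl⟩
    · exact ⟨p, Or.inl rfl, φp⟩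
    · exact ⟨c i, Or.inr ⟨i, rfl⟩, φc i⟩
  · intro z hz
    simp only [Finset.mem_image, Finset.mem_univ, true_and] at hz
    obtain ⟨i, rfl⟩ := hz
    rw [φc]
    constructor
    · intro z' hz' hne
      simp only [Finset.mem_insert, Finset.mem_image, Finset.mem_univ, true_and] at hz'
      rcases hz' with rfl | ⟨j, rfl⟩
      · exact h.le_left_base i
      · exact h.le_left i j (fun hji => hne (by rw [hji]))
    · intro w hw hne
      simp only [Finset.mem_insert, Finset.mem_image, Finset.mem_univ, true_and] at hw
      rcases hw with rfl | ⟨j, rfl⟩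
      · exact h.le_right_base i
      · exact h.le_right i j (fun hji => hne (by rw [hji]))

open scoped Classical in
/-- An indexed pairing of points of the domain yields an admissible perturbation of the bias. -/
lemma IndexedPairing.mem_perturbedBiases {ℓ : ℕ} {η : ℕ → ℕ} {N : ℕ} {δ : ℝ} {ω : ℂ}
    {c d : Fin ℓ → ℂ}
    (h : IndexedPairing (ω * zeta (n0 N δ)) (Complex.I * zeta (bStar η N δ)) c d)
    (hc : ∀ i, c i ∈ domain N δ) (hd : ∀ i, d i ∈ domain N δ) :
    (fun F : ℂ → ℝ => baseBias η N δ ω F + ∑ i, (2 * F (c i) - 2 * F (d i)))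
      ∈ perturbedBiases ℓ η N δ ω := by
  refine ⟨Finset.univ.image c, Finset.univ.image d, ?_, ?_, ?_, ?_, h.paired, ?_⟩
  · simpa [Set.range_subset_iff] using hc
  · simpa [Set.range_subset_iff] using hd
  · rw [Finset.card_image_of_injective _ h.inj_left, Finset.card_fin]
  · rw [Finset.card_image_of_injective _ h.inj_right, Finset.card_fin]
  · funext F
    rw [Finset.sum_image (fun a _ b _ hab => h.inj_left hab),
      Finset.sum_image (fun a _ b _ hab => h.inj_right hab), Finset.sum_sub_distrib]
    ring

/-! ### From exponential moments to mixed moments -/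

lemma abs_le_abs_sinh (x : ℝ) : |x| ≤ |Real.sinh x| := by
  rw [Real.abs_sinh]
  exact Real.self_le_sinh_iff.2 (abs_nonneg x)

lemma abs_sinh_sub_self_le (x : ℝ) : |Real.sinh x - x| ≤ Real.cosh x - 1 := by
  have h1 := Real.add_one_le_exp x
  have h2 := Real.add_one_le_exp (-x)
  have h3 := Real.cosh_sub_sinh x
  have h4 := Real.cosh_add_sinh x
  rw [abs_le]
  constructor <;> linarith

lemma abs_sinh_le {x ε : ℝ} (hε : 0 < ε) (hε1 : ε ≤ 1) :
    |Real.sinh x| ≤ (Real.cosh x - 1) / ε + ε := by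
  have hc : 0 ≤ Real.cosh x - 1 := by linarith [Real.one_le_cosh x]
  apply abs_le_of_sq_le_sq' _ (by positivity) |> abs_le.2
  have h1 : Real.sinh x ^ 2 = (Real.cosh x - 1) * (Real.cosh x - 1 + 2) := by
    have := Real.cosh_sq x
    linarith
  rw [h1]
  set c := Real.cosh x - 1
  have h2 : c ≤ c / ε := by
    rw [le_div_iff₀ hε]; nlinarith
  have h3 : (c / ε + ε) ^ 2 = (c / ε) ^ 2 + 2 * c + ε ^ 2 := by
    field_simp
    ring
  rw [h3]
  nlinarith [sq_nonneg ε]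

lemma cosh_sub_one_le {x ε : ℝ} (hε : 0 < ε) (hε1 : ε ≤ 1) :
    Real.cosh x - 1 ≤ ε ^ 2 * Real.cosh (x / ε) := by
  have h1 := Real.hasSum_cosh x
  have h2 := ((Real.hasSum_cosh (x / ε)).mul_left (ε ^ 2)).add (hasSum_ite_eq (0 : ℕ) (1 : ℝ))
  suffices Real.cosh x ≤ ε ^ 2 * Real.cosh (x / ε) + 1 by linarith
  refine hasSum_le (fun n => ?_) h1 h2
  rcases Nat.eq_zero_or_pos n with rfl | hn
  · simp [sq_nonneg]
  · have hn0 : n ≠ 0 := hn.ne'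
    simp only [hn0, if_false, add_zero]
    rw [div_pow, ← mul_div_assoc, ← mul_div_assoc, pow_mul, pow_mul]
    gcongr
    rw [le_div_iff₀ (by positivity), mul_comm]
    gcongr
    calc (ε ^ 2) ^ n ≤ (ε ^ 2) ^ 1 := by
          apply pow_le_pow_of_le_one (by positivity) (by nlinarith) hn
      _ = ε ^ 2 := pow_one _

lemma pow_le_factorial_mul_cosh_sub_one {ℓ : ℕ} (hℓ : 1 ≤ ℓ) (x : ℝ) :
    x ^ (2 * ℓ) ≤ (2 * ℓ).factorial * (Real.cosh x - 1) := by
  have h := sum_le_hasSum ({0, ℓ} : Finset ℕ)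
    (fun n _ => by rw [pow_mul]; positivity) (Real.hasSum_cosh x)
  rw [Finset.sum_pair (by omega)] at h
  simp only [mul_zero, pow_zero, Nat.factorial_zero, Nat.cast_one, div_one] at h
  have hf : (0 : ℝ) < (2 * ℓ).factorial := by positivity
  have : x ^ (2 * ℓ) / (2 * ℓ).factorial ≤ Real.cosh x - 1 := by linarith
  rw [div_le_iff₀ hf] at this
  linarith

lemma sum_signType (f : SignType → ℝ) : ∑ σ, f σ = f 0 + f (-1) + f 1 := by
  rw [show (Finset.univ : Finset SignType) = {0, -1, 1} from rfl]
  rw [Finset.sum_insert (by decide), Finset.sum_pair (by decide)]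
  ring

lemma abs_prod_sub_prod_le {ι : Type*} [DecidableEq ι] (s : Finset ι) (x y C M : ι → ℝ)
    (hx : ∀ i, |x i| ≤ M i) (hy : ∀ i, |y i| ≤ M i) (hxy : ∀ i, |x i - y i| ≤ C i) :
    |∏ i ∈ s, x i - ∏ i ∈ s, y i| ≤ ∑ k ∈ s, ∏ i ∈ s, if i = k then C i else M i := by
  have hM : ∀ i, 0 ≤ M i := fun i => (abs_nonneg _).trans (hx i)
  have hC : ∀ i, 0 ≤ C i := fun i => (abs_nonneg _).trans (hxy i)
  induction s using Finset.induction_on with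
  | empty => simp
  | insert a s ha ih =>
    rw [Finset.prod_insert ha, Finset.prod_insert ha, Finset.sum_insert ha]
    have e1 : x a * ∏ i ∈ s, x i - y a * ∏ i ∈ s, y i
        = (x a - y a) * ∏ i ∈ s, x i + y a * (∏ i ∈ s, x i - ∏ i ∈ s, y i) := by ring
    have e2 : ∏ i ∈ insert a s, (if i = a then C i else M i) = C a * ∏ i ∈ s, M i := by
      rw [Finset.prod_insert ha, if_pos rfl]
      congr 1
      refine Finset.prod_congr rfl fun i hi => if_neg ?_
      rintro rfl
      exact ha hi
    have e3 : ∑ k ∈ s, ∏ i ∈ insert a s, (if i = k then C i else M i)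
        = M a * ∑ k ∈ s, ∏ i ∈ s, (if i = k then C i else M i) := by
      rw [Finset.mul_sum]
      refine Finset.sum_congr rfl fun k hk => ?_
      rw [Finset.prod_insert ha, if_neg]
      rintro rfl
      exact ha hk
    rw [e1, e2, e3]
    refine (abs_add_le _ _).trans (add_le_add ?_ ?_)
    · rw [abs_mul, Finset.abs_prod]
      gcongr
      · exact hC a
      · exact hxy a
      · exact hx _
    · rw [abs_mul]
      gcongr
      · exact hM a
      · exact hy a

section Linearization

variable {S E : Type*} [MeasurableSpace S] [MeasurableSpace E] {ν : Measure S} {Q : Measure E}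
  {ℓ : ℕ}

/-- Agreement up to `η` of the exponential moments of two families of `ℓ` random variables, for
all sign patterns with entries in `{-1, 0, 1}`. -/
structure ExpMomentsClose (ν : Measure S) (Q : Measure E) (X : Fin ℓ → S → ℝ) (Y : Fin ℓ → E → ℝ)
    (η : ℝ) : Prop where
  integrable_left : ∀ σ : Fin ℓ → SignType,
    Integrable (fun x => Real.exp (∑ i, (σ i : ℝ) * X i x)) ν
  integrable_right : ∀ σ : Fin ℓ → SignType,
    Integrable (fun x => Real.exp (∑ i, (σ i : ℝ) * Y i x)) Q
  close : ∀ σ : Fin ℓ → SignType, |∫ x, Real.exp (∑ i, (σ i : ℝ) * X i x) ∂ν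
    - ∫ x, Real.exp (∑ i, (σ i : ℝ) * Y i x) ∂Q| ≤ η

lemma prod_sum_exp (c : Fin ℓ → SignType → ℝ) (t : Fin ℓ → ℝ) :
    ∏ i, ∑ σ, c i σ * Real.exp ((σ : ℝ) * t i)
      = ∑ σ : Fin ℓ → SignType, (∏ i, c i (σ i)) * Real.exp (∑ i, (σ i : ℝ) * t i) := by
  rw [Finset.prod_univ_sum, Fintype.piFinset_univ]
  refine Finset.sum_congr rfl fun σ _ => ?_
  rw [Finset.prod_mul_distrib, Real.exp_sum]

lemma integrable_prod_sum_exp {X : Fin ℓ → S → ℝ}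
    (hX : ∀ σ : Fin ℓ → SignType, Integrable (fun x => Real.exp (∑ i, (σ i : ℝ) * X i x)) ν)
    (c : Fin ℓ → SignType → ℝ) :
    Integrable (fun x => ∏ i, ∑ σ, c i σ * Real.exp ((σ : ℝ) * X i x)) ν := by
  simp_rw [prod_sum_exp]
  exact integrable_finsetSum _ fun σ _ => (hX σ).const_mul _

lemma ExpMomentsClose.abs_integral_prod_sub_le {X : Fin ℓ → S → ℝ} {Y : Fin ℓ → E → ℝ} {η : ℝ}
    (h : ExpMomentsClose ν Q X Y η) (c : Fin ℓ → SignType → ℝ) (L : Fin ℓ → ℝ)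
    (hc : ∀ i, ∑ σ, |c i σ| ≤ L i) :
    |∫ x, ∏ i, ∑ σ, c i σ * Real.exp ((σ : ℝ) * X i x) ∂ν
      - ∫ x, ∏ i, ∑ σ, c i σ * Real.exp ((σ : ℝ) * Y i x) ∂Q| ≤ (∏ i, L i) * η := by
  have hη : 0 ≤ η := (abs_nonneg _).trans (h.close 0)
  simp_rw [prod_sum_exp]
  rw [integral_finsetSum _ fun σ _ => (h.integrable_left σ).const_mul _,
    integral_finsetSum _ fun σ _ => (h.integrable_right σ).const_mul _,
    ← Finset.sum_sub_distrib]
  simp_rw [integral_const_mul, ← mul_sub]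
  calc _ ≤ ∑ σ : Fin ℓ → SignType, (∏ i, |c i (σ i)|) * η := by
        refine (Finset.abs_sum_le_sum_abs _ _).trans (Finset.sum_le_sum fun σ _ => ?_)
        rw [abs_mul, Finset.abs_prod]
        gcongr
        exact h.close σ
    _ = (∏ i, ∑ σ, |c i σ|) * η := by
        rw [← Finset.sum_mul, Finset.prod_univ_sum, Fintype.piFinset_univ]
    _ ≤ _ := by
        gcongr
        exact hc _

/-- The coefficients of `cosh t - 1` in `1`, `e^{-t}`, `e^t`. -/
noncomputable def coshSubOneCoef : SignType → ℝ
  | 0 => -1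
  | _ => 1 / 2

/-- The coefficients of `sinh t` in `1`, `e^{-t}`, `e^t`. -/
noncomputable def sinhCoef (σ : SignType) : ℝ := (σ : ℝ) / 2

/-- The coefficients of `(cosh t - 1) / ε + ε` in `1`, `e^{-t}`, `e^t`. -/
noncomputable def majCoef (ε : ℝ) : SignType → ℝ
  | 0 => -1 / ε + ε
  | _ => 1 / 2 / ε

lemma sum_coshSubOneCoef (t : ℝ) :
    ∑ σ, coshSubOneCoef σ * Real.exp ((σ : ℝ) * t) = Real.cosh t - 1 := by
  rw [sum_signType, Real.cosh_eq]
  have h1 : coshSubOneCoef 1 = 1 / 2 := rfl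
  have h2 : coshSubOneCoef (-1) = 1 / 2 := rfl
  have h3 : coshSubOneCoef 0 = -1 := rfl
  simp [h1, h2, h3]
  ring

lemma sum_sinhCoef (t : ℝ) : ∑ σ, sinhCoef σ * Real.exp ((σ : ℝ) * t) = Real.sinh t := by
  rw [sum_signType, Real.sinh_eq]
  simp [sinhCoef]
  ring

lemma sum_majCoef (ε t : ℝ) :
    ∑ σ, majCoef ε σ * Real.exp ((σ : ℝ) * t) = (Real.cosh t - 1) / ε + ε := by
  rw [sum_signType, Real.cosh_eq]
  have h1 : majCoef ε 1 = 1 / 2 / ε := rfl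
  have h2 : majCoef ε (-1) = 1 / 2 / ε := rfl
  have h3 : majCoef ε 0 = -1 / ε + ε := rfl
  simp [h1, h2, h3]
  ring

lemma sum_abs_coshSubOneCoef : ∑ σ, |coshSubOneCoef σ| ≤ 2 := by
  rw [sum_signType]
  have h1 : coshSubOneCoef 1 = 1 / 2 := rfl
  have h2 : coshSubOneCoef (-1) = 1 / 2 := rfl
  have h3 : coshSubOneCoef 0 = -1 := rfl
  rw [h1, h2, h3]
  norm_num [abs_of_pos]

lemma sum_abs_sinhCoef : ∑ σ, |sinhCoef σ| ≤ 1 := by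
  rw [sum_signType]
  norm_num [sinhCoef, abs_of_pos]

lemma sum_abs_majCoef {ε : ℝ} (hε : 0 < ε) (hε1 : ε ≤ 1) : ∑ σ, |majCoef ε σ| ≤ 3 / ε := by
  rw [sum_signType]
  have h1 : majCoef ε 1 = 1 / 2 / ε := rfl
  have h2 : majCoef ε (-1) = 1 / 2 / ε := rfl
  have h3 : majCoef ε 0 = -1 / ε + ε := rfl
  have h4 : |(-1 / ε + ε)| ≤ 1 / ε + ε := by
    refine (abs_add_le _ _).trans ?_
    rw [abs_of_pos hε, neg_div, abs_neg, abs_of_pos (by positivity)]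
  have h5 : ε ≤ 1 / ε := by rw [le_div_iff₀ hε]; nlinarith
  rw [h1, h2, h3, abs_of_pos (by positivity : 0 < 1 / 2 / ε)]
  have : (3 : ℝ) / ε = 1 / ε + 1 / ε + (1 / 2 / ε + 1 / 2 / ε) := by ring
  linarith

/-- If two families of random variables have the same exponential moments up to `η`, for all sign
patterns, and the second one is of size `ε` with exponential tails, then their mixed moments agree
up to `ε^{ℓ+1}` and `η ε^{-ℓ}`. The first moments are read off from
`t = sinh t + O(cosh t - 1)`; the error terms are again combinations of exponentials, so that they
can be transferred to the second family. -/
theorem ExpMomentsClose.abs_integral_prod_sub_le_of_cosh {X : Fin ℓ → S → ℝ} {Y : Fin ℓ → E → ℝ}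
    {η ε K : ℝ} (h : ExpMomentsClose ν Q X Y η) (hε : 0 < ε) (hε1 : ε ≤ 1)
    (hXm : ∀ i, AEMeasurable (X i) ν) (hYm : ∀ i, AEMeasurable (Y i) Q)
    (hK : Integrable (fun x => ∏ i, Real.cosh (Y i x / ε)) Q)
    (hK' : ∫ x, ∏ i, Real.cosh (Y i x / ε) ∂Q ≤ K) :
    Integrable (fun x => ∏ i, X i x) ν ∧ Integrable (fun x => ∏ i, Y i x) Q ∧
    |∫ x, ∏ i, X i x ∂ν - ∫ x, ∏ i, Y i x ∂Q|
      ≤ (4 * ℓ * 3 ^ ℓ + 1) * (K * ε ^ (ℓ + 1) + η / ε ^ ℓ) := by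
  have hη : 0 ≤ η := (abs_nonneg _).trans (h.close 0)
  -- the majorant of `|∏ tᵢ - ∏ sinh tᵢ|`
  set T : (Fin ℓ → ℝ) → ℝ := fun t => ∑ k : Fin ℓ, ∏ i, if i = k then Real.cosh (t i) - 1
    else (Real.cosh (t i) - 1) / ε + ε with hT
  set cf : Fin ℓ → Fin ℓ → SignType → ℝ := fun k i => if i = k then coshSubOneCoef else majCoef ε
  have hTc : ∀ t, T t = ∑ k : Fin ℓ, ∏ i, ∑ σ, cf k i σ * Real.exp ((σ : ℝ) * t i) := by
    intro t
    refine Finset.sum_congr rfl fun k _ => Finset.prod_congr rfl fun i _ => ?_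
    by_cases hik : i = k
    · simp only [cf, hik, if_true, sum_coshSubOneCoef]
    · simp only [cf, hik, if_false, sum_majCoef]
  have hsub : ∀ t : Fin ℓ → ℝ, |∏ i, t i - ∏ i, Real.sinh (t i)| ≤ T t := by
    intro t
    refine abs_prod_sub_prod_le Finset.univ _ _ (fun i => Real.cosh (t i) - 1) _
      (fun i => ?_) (fun i => ?_) (fun i => ?_)
    · exact (abs_le_abs_sinh _).trans (abs_sinh_le hε hε1)
    · exact abs_sinh_le hε hε1
    · rw [abs_sub_comm]; exact abs_sinh_sub_self_le _
  have hTX : Integrable (fun x => T fun i => X i x) ν := by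
    simp_rw [hTc]
    exact integrable_finsetSum _ fun k _ => integrable_prod_sum_exp h.integrable_left _
  have hTY : Integrable (fun x => T fun i => Y i x) Q := by
    simp_rw [hTc]
    exact integrable_finsetSum _ fun k _ => integrable_prod_sum_exp h.integrable_right _
  have hsX : Integrable (fun x => ∏ i, Real.sinh (X i x)) ν := by
    simpa only [sum_sinhCoef] using
      integrable_prod_sum_exp h.integrable_left (fun _ => sinhCoef)
  have hsY : Integrable (fun x => ∏ i, Real.sinh (Y i x)) Q := by
    simpa only [sum_sinhCoef] using
      integrable_prod_sum_exp h.integrable_right (fun _ => sinhCoef)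
  have hdX : Integrable (fun x => ∏ i, X i x - ∏ i, Real.sinh (X i x)) ν := by
    refine hTX.mono' (AEMeasurable.aestronglyMeasurable ?_) (ae_of_all _ fun x => hsub _)
    exact (Finset.univ.aemeasurable_fun_prod fun i _ => hXm i).sub
      (Finset.univ.aemeasurable_fun_prod fun i _ => Real.measurable_sinh.comp_aemeasurable (hXm i))
  have hdY : Integrable (fun x => ∏ i, Y i x - ∏ i, Real.sinh (Y i x)) Q := by
    refine hTY.mono' (AEMeasurable.aestronglyMeasurable ?_) (ae_of_all _ fun x => hsub _)
    exact (Finset.univ.aemeasurable_fun_prod fun i _ => hYm i).sub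
      (Finset.univ.aemeasurable_fun_prod fun i _ => Real.measurable_sinh.comp_aemeasurable (hYm i))
  have hpX : Integrable (fun x => ∏ i, X i x) ν := (hdX.add hsX).congr (ae_of_all _ fun x => by simp)
  have hpY : Integrable (fun x => ∏ i, Y i x) Q := (hdY.add hsY).congr (ae_of_all _ fun x => by simp)
  refine ⟨hpX, hpY, ?_⟩
  have b1 : |∫ x, ∏ i, X i x ∂ν - ∫ x, ∏ i, Real.sinh (X i x) ∂ν| ≤ ∫ x, T (fun i => X i x) ∂ν := by
    rw [← integral_sub hpX hsX]
    exact (abs_integral_le_integral_abs).trans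
      (integral_mono hdX.abs hTX fun x => hsub _)
  have b2 : |∫ x, ∏ i, Y i x ∂Q - ∫ x, ∏ i, Real.sinh (Y i x) ∂Q| ≤ ∫ x, T (fun i => Y i x) ∂Q := by
    rw [← integral_sub hpY hsY]
    exact (abs_integral_le_integral_abs).trans
      (integral_mono hdY.abs hTY fun x => hsub _)
  have b3 : |∫ x, ∏ i, Real.sinh (X i x) ∂ν - ∫ x, ∏ i, Real.sinh (Y i x) ∂Q| ≤ η := by
    have := h.abs_integral_prod_sub_le (fun _ => sinhCoef) (fun _ => 1)
      (fun _ => sum_abs_sinhCoef)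
    simpa only [sum_sinhCoef, Finset.prod_const_one, one_mul] using this
  -- transfer of the majorant from the first family to the second one
  have b4 : ∫ x, T (fun i => X i x) ∂ν ≤ ∫ x, T (fun i => Y i x) ∂Q + ℓ * ((3 / ε) ^ ℓ * η) := by
    simp_rw [hTc]
    rw [integral_finsetSum _ fun k _ => integrable_prod_sum_exp h.integrable_left _,
      integral_finsetSum _ fun k _ => integrable_prod_sum_exp h.integrable_right _]
    have : (ℓ : ℝ) * ((3 / ε) ^ ℓ * η) = ∑ _k : Fin ℓ, (3 / ε) ^ ℓ * η := by simp
    rw [this, ← Finset.sum_add_distrib]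
    refine Finset.sum_le_sum fun k _ => ?_
    have hk := h.abs_integral_prod_sub_le (cf k) (fun _ => 3 / ε) (fun i => by
      by_cases hik : i = k
      · simp only [cf, hik, if_true]
        refine sum_abs_coshSubOneCoef.trans ?_
        rw [le_div_iff₀ hε]; linarith
      · simp only [cf, hik, if_false]
        exact sum_abs_majCoef hε hε1)
    rw [Finset.prod_const, Finset.card_fin] at hk
    linarith [(abs_le.1 hk).2]
  have b5 : ∫ x, T (fun i => Y i x) ∂Q ≤ ℓ * (2 ^ ℓ * ε ^ (ℓ + 1) * K) := by
    have hpt : ∀ x, T (fun i => Y i x) ≤ ℓ * (2 ^ ℓ * ε ^ (ℓ + 1) * ∏ i, Real.cosh (Y i x / ε)) := by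
      intro x
      have : (ℓ : ℝ) * (2 ^ ℓ * ε ^ (ℓ + 1) * ∏ i, Real.cosh (Y i x / ε))
        = ∑ _k : Fin ℓ, 2 ^ ℓ * ε ^ (ℓ + 1) * ∏ i, Real.cosh (Y i x / ε) := by simp
      rw [this]
      refine Finset.sum_le_sum fun k _ => ?_
      have e : 2 ^ ℓ * ε ^ (ℓ + 1) * ∏ i, Real.cosh (Y i x / ε)
          = ε * ∏ i, (2 * ε * Real.cosh (Y i x / ε)) := by
        rw [Finset.prod_mul_distrib, Finset.prod_const, Finset.card_fin]; ring
      rw [e, ← Finset.mul_prod_erase _ _ (Finset.mem_univ k),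
        ← Finset.mul_prod_erase _ _ (Finset.mem_univ k), if_pos rfl, ← mul_assoc]
      have hc : ∀ i, Real.cosh (Y i x) - 1 ≤ ε ^ 2 * Real.cosh (Y i x / ε) :=
        fun i => cosh_sub_one_le hε hε1
      have hc0 : ∀ i, 0 ≤ Real.cosh (Y i x) - 1 := fun i => by linarith [Real.one_le_cosh (Y i x)]
      have hc1 : ∀ i, 1 ≤ Real.cosh (Y i x / ε) := fun i => Real.one_le_cosh _
      refine mul_le_mul ?_ (Finset.prod_le_prod ?_ ?_) ?_ ?_
      · nlinarith [hc k, hc1 k, mul_pos hε hε]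
      · intro i _
        split_ifs
        · exact hc0 i
        · have := hc0 i; positivity
      · intro i hi
        rw [if_neg (Finset.ne_of_mem_erase hi)]
        have : (Real.cosh (Y i x) - 1) / ε ≤ ε * Real.cosh (Y i x / ε) := by
          rw [div_le_iff₀ hε]; nlinarith [hc i]
        nlinarith [hc1 i]
      · refine Finset.prod_nonneg fun i _ => ?_
        split_ifs
        · exact hc0 i
        · have := hc0 i; positivity
      · have := hc1 k; positivity
    refine (integral_mono hTY ((hK.const_mul _).const_mul _) hpt).trans ?_
    rw [integral_const_mul, integral_const_mul]
    gcongr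
  have hK0 : 0 ≤ K := by
    refine le_trans (integral_nonneg fun x => Finset.prod_nonneg fun i _ => ?_) hK'
    exact (Real.cosh_pos _).le
  have f1 : (ℓ : ℝ) * (2 ^ ℓ * ε ^ (ℓ + 1) * K) ≤ ℓ * 3 ^ ℓ * (K * ε ^ (ℓ + 1)) := by
    have : (2 : ℝ) ^ ℓ ≤ 3 ^ ℓ := by gcongr; norm_num
    calc (ℓ : ℝ) * (2 ^ ℓ * ε ^ (ℓ + 1) * K) = ℓ * 2 ^ ℓ * (K * ε ^ (ℓ + 1)) := by ring
      _ ≤ _ := by gcongr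
  have f2 : (ℓ : ℝ) * ((3 / ε) ^ ℓ * η) = ℓ * 3 ^ ℓ * (η / ε ^ ℓ) := by
    rw [div_pow]; ring
  have f3 : η ≤ η / ε ^ ℓ := by
    rw [le_div_iff₀ (by positivity)]
    exact mul_le_of_le_one_right hη (pow_le_one₀ hε.le hε1)
  have f4 : 0 ≤ K * ε ^ (ℓ + 1) := by positivity
  have f5 : 0 ≤ η / ε ^ ℓ := by positivity
  have f6 : 0 ≤ (ℓ : ℝ) * 3 ^ ℓ * (η / ε ^ ℓ) := by positivity
  have f7 : 0 ≤ (ℓ : ℝ) * 3 ^ ℓ * (K * ε ^ (ℓ + 1)) := by positivity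
  have e1 := abs_le.1 b1
  have e2 := abs_le.1 b2
  have e3 := abs_le.1 b3
  rw [abs_le]
  constructor <;> nlinarith

end Linearization

/-! ### Moment bounds -/

section Moments

variable {S : Type*} [MeasurableSpace S] {ν : Measure S} {m : ℕ} {Y Z : S → ℝ} {Λ Λ' : ℝ}

/-- The random variable `Y` has `L^m` norm at most `Λ`. -/
def MomLE (ν : Measure S) (m : ℕ) (Y : S → ℝ) (Λ : ℝ) : Prop :=
  AEStronglyMeasurable Y ν ∧ eLpNorm Y m ν ≤ ENNReal.ofReal Λ

lemma MomLE.of_lintegral (hm : m ≠ 0) (hY : AEStronglyMeasurable Y ν) (hΛ : 0 ≤ Λ)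
    (h : ∫⁻ x, ENNReal.ofReal (|Y x| ^ m) ∂ν ≤ ENNReal.ofReal (Λ ^ m)) : MomLE ν m Y Λ := by
  refine ⟨hY, ?_⟩
  have hm' : (m : ENNReal) ≠ 0 := by exact_mod_cast hm
  rw [eLpNorm_eq_lintegral_rpow_enorm_toReal hm' (ENNReal.natCast_ne_top m)]
  simp only [ENNReal.toReal_natCast, ENNReal.rpow_natCast]
  have h1 : ∀ x, ‖Y x‖ₑ ^ m = ENNReal.ofReal (|Y x| ^ m) := fun x => by
    rw [← Real.norm_eq_abs, ENNReal.ofReal_pow (norm_nonneg _), ofReal_norm]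
  simp_rw [h1]
  rw [one_div]
  refine (ENNReal.rpow_inv_le_iff (by positivity)).2 ?_
  rw [ENNReal.rpow_natCast, ← ENNReal.ofReal_pow hΛ]
  exact h

lemma MomLE.lintegral_le (hm : m ≠ 0) (hΛ : 0 ≤ Λ) (h : MomLE ν m Y Λ) :
    ∫⁻ x, ENNReal.ofReal (|Y x| ^ m) ∂ν ≤ ENNReal.ofReal (Λ ^ m) := by
  have h2 := h.2
  have hm' : (m : ENNReal) ≠ 0 := by exact_mod_cast hm
  rw [eLpNorm_eq_lintegral_rpow_enorm_toReal hm' (ENNReal.natCast_ne_top m)] at h2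
  simp only [ENNReal.toReal_natCast, ENNReal.rpow_natCast] at h2
  have h1 : ∀ x, ‖Y x‖ₑ ^ m = ENNReal.ofReal (|Y x| ^ m) := fun x => by
    rw [← Real.norm_eq_abs, ENNReal.ofReal_pow (norm_nonneg _), ofReal_norm]
  simp_rw [h1] at h2
  rw [one_div, ENNReal.rpow_inv_le_iff (by positivity), ENNReal.rpow_natCast,
    ← ENNReal.ofReal_pow hΛ] at h2
  exact h2

lemma MomLE.of_integral (hm : m ≠ 0) (hY : AEStronglyMeasurable Y ν) (hΛ : 0 ≤ Λ)
    (hi : Integrable (fun x => |Y x| ^ m) ν) (h : ∫ x, |Y x| ^ m ∂ν ≤ Λ ^ m) : MomLE ν m Y Λ := by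
  refine MomLE.of_lintegral hm hY hΛ ?_
  rw [← ofReal_integral_eq_lintegral_ofReal hi (ae_of_all _ fun x => by positivity)]
  exact ENNReal.ofReal_le_ofReal h

lemma MomLE.integrable_pow (hm : m ≠ 0) (hΛ : 0 ≤ Λ) (h : MomLE ν m Y Λ) :
    Integrable (fun x => |Y x| ^ m) ν := by
  refine ⟨?_, ?_⟩
  · exact (continuous_abs.comp_aestronglyMeasurable h.1).pow m
  · rw [hasFiniteIntegral_iff_ofReal (ae_of_all _ fun x => by positivity)]
    exact (h.lintegral_le hm hΛ).trans_lt ENNReal.ofReal_lt_top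

lemma MomLE.integral_pow_le (hm : m ≠ 0) (hΛ : 0 ≤ Λ) (h : MomLE ν m Y Λ) :
    ∫ x, |Y x| ^ m ∂ν ≤ Λ ^ m := by
  rw [integral_eq_lintegral_of_nonneg_ae (ae_of_all _ fun x => by positivity)
    (h.integrable_pow hm hΛ).1]
  exact ENNReal.toReal_le_of_le_ofReal (by positivity) (h.lintegral_le hm hΛ)

lemma MomLE.mono (h : MomLE ν m Y Λ) (hΛ : Λ ≤ Λ') : MomLE ν m Y Λ' :=
  ⟨h.1, h.2.trans (ENNReal.ofReal_le_ofReal hΛ)⟩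

lemma MomLE.of_abs_le (h : MomLE ν m Z Λ) (hY : AEStronglyMeasurable Y ν)
    (hYZ : ∀ᵐ x ∂ν, |Y x| ≤ |Z x|) : MomLE ν m Y Λ :=
  ⟨hY, (eLpNorm_mono_ae hYZ).trans h.2⟩

lemma MomLE.add (hm : m ≠ 0) (hΛ : 0 ≤ Λ) (hΛ' : 0 ≤ Λ') (h : MomLE ν m Y Λ)
    (h' : MomLE ν m Z Λ') : MomLE ν m (fun x => Y x + Z x) (Λ + Λ') := by
  refine ⟨h.1.add h'.1, ?_⟩
  have hm1 : (1 : ENNReal) ≤ m := by exact_mod_cast Nat.one_le_iff_ne_zero.2 hm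
  refine (eLpNorm_add_le h.1 h'.1 hm1).trans ?_
  rw [ENNReal.ofReal_add hΛ hΛ']
  exact add_le_add h.2 h'.2

lemma MomLE.neg (h : MomLE ν m Y Λ) : MomLE ν m (fun x => -Y x) Λ :=
  h.of_abs_le h.1.neg (ae_of_all _ fun x => by rw [abs_neg])

lemma MomLE.sub (hm : m ≠ 0) (hΛ : 0 ≤ Λ) (hΛ' : 0 ≤ Λ') (h : MomLE ν m Y Λ)
    (h' : MomLE ν m Z Λ') : MomLE ν m (fun x => Y x - Z x) (Λ + Λ') := by
  simpa only [sub_eq_add_neg] using h.add hm hΛ hΛ' h'.neg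

lemma MomLE.abs (h : MomLE ν m Y Λ) : MomLE ν m (fun x => |Y x|) Λ :=
  h.of_abs_le (continuous_abs.comp_aestronglyMeasurable h.1) (ae_of_all _ fun x => by rw [abs_abs])

lemma MomLE.const_mul {c : ℝ} (hc : 0 ≤ c) (h : MomLE ν m Y Λ) :
    MomLE ν m (fun x => c * Y x) (c * Λ) := by
  refine ⟨h.1.const_mul c, ?_⟩
  have := eLpNorm_const_smul c Y m ν
  have e : (c • Y) = fun x => c * Y x := rfl
  rw [e] at this
  rw [this, ENNReal.ofReal_mul hc, Real.enorm_of_nonneg hc]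
  gcongr
  exact h.2

lemma MomLE.const [IsProbabilityMeasure ν] (hm : m ≠ 0) {c : ℝ} (hc : 0 ≤ c) :
    MomLE ν m (fun _ => c) c := by
  refine MomLE.of_integral hm aestronglyMeasurable_const hc (integrable_const _) ?_
  simp [abs_of_nonneg hc]

lemma MomLE.of_cosh {ℓ : ℕ} (hℓ : 1 ≤ ℓ) (hY : AEStronglyMeasurable Y ν) (hΛ : 0 ≤ Λ)
    (hi : Integrable (fun x => Real.cosh (Y x) - 1) ν)
    (h : (2 * ℓ).factorial * ∫ x, (Real.cosh (Y x) - 1) ∂ν ≤ Λ ^ (2 * ℓ)) :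
    MomLE ν (2 * ℓ) Y Λ := by
  have hpt : ∀ x, |Y x| ^ (2 * ℓ) ≤ (2 * ℓ).factorial * (Real.cosh (Y x) - 1) := fun x => by
    have := pow_le_factorial_mul_cosh_sub_one hℓ |Y x|
    rwa [Real.cosh_abs] at this
  have hint : Integrable (fun x => |Y x| ^ (2 * ℓ)) ν := by
    refine (hi.const_mul ((2 * ℓ).factorial : ℝ)).mono'
      ((continuous_abs.comp_aestronglyMeasurable hY).pow _) (ae_of_all _ fun x => ?_)
    rw [Real.norm_of_nonneg (by positivity)]
    exact hpt x
  refine MomLE.of_integral (by omega) hY hΛ hint (le_trans ?_ h)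
  rw [← integral_const_mul]
  exact integral_mono hint (hi.const_mul _) hpt

lemma prod_abs_le_one_add_sum {ℓ : ℕ} (y : Fin ℓ → ℝ) :
    ∏ i, |y i| ≤ 1 + ∑ i, |y i| ^ (2 * ℓ) := by
  by_cases h : ∃ i, 1 < |y i|
  · obtain ⟨i₀, hi₀⟩ := h
    obtain ⟨j, -, hj⟩ := Finset.exists_max_image Finset.univ (fun i => |y i|) ⟨i₀, Finset.mem_univ _⟩
    have hj1 : 1 ≤ |y j| := hi₀.le.trans (hj i₀ (Finset.mem_univ _))
    calc ∏ i, |y i| ≤ ∏ _i : Fin ℓ, |y j| :=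
          Finset.prod_le_prod (fun i _ => abs_nonneg _) fun i _ => hj i (Finset.mem_univ _)
      _ = |y j| ^ ℓ := by simp
      _ ≤ |y j| ^ (2 * ℓ) := pow_le_pow_right₀ hj1 (by omega)
      _ ≤ ∑ i, |y i| ^ (2 * ℓ) :=
          Finset.single_le_sum (f := fun i => |y i| ^ (2 * ℓ)) (fun i _ => by positivity)
            (Finset.mem_univ j)
      _ ≤ _ := by linarith
  · push Not at h
    have h1 : ∏ i, |y i| ≤ 1 := Finset.prod_le_one (fun i _ => abs_nonneg _) fun i _ => h i
    have h2 : 0 ≤ ∑ i, |y i| ^ (2 * ℓ) := Finset.sum_nonneg fun i _ => by positivity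
    linarith

/-- A form of Hölder's inequality for products of `ℓ` random variables. -/
lemma integral_prod_le_of_momLE [IsProbabilityMeasure ν] {ℓ : ℕ} {Y : Fin ℓ → S → ℝ}
    {Λ : Fin ℓ → ℝ} (hΛ : ∀ i, 0 < Λ i) (h : ∀ i, MomLE ν (2 * ℓ) (Y i) (Λ i)) :
    Integrable (fun x => ∏ i, Y i x) ν ∧ |∫ x, ∏ i, Y i x ∂ν| ≤ (1 + ℓ) * ∏ i, Λ i := by
  rcases Nat.eq_zero_or_pos ℓ with rfl | hℓ
  · simp
  have hm : 2 * ℓ ≠ 0 := by omega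
  have hpt : ∀ x, |∏ i, Y i x| ≤ (∏ i, Λ i) * (1 + ∑ i, |Y i x| ^ (2 * ℓ) / Λ i ^ (2 * ℓ)) := by
    intro x
    have h1 := prod_abs_le_one_add_sum fun i => Y i x / Λ i
    have h2 : ∏ i, |Y i x| = (∏ i, Λ i) * ∏ i, |Y i x / Λ i| := by
      rw [← Finset.prod_mul_distrib]
      refine Finset.prod_congr rfl fun i _ => ?_
      rw [abs_div, abs_of_pos (hΛ i), mul_div_cancel₀ _ (hΛ i).ne']
    rw [Finset.abs_prod, h2]
    refine mul_le_mul_of_nonneg_left (h1.trans_eq ?_) (Finset.prod_nonneg fun i _ => (hΛ i).le)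
    congr 1
    refine Finset.sum_congr rfl fun i _ => ?_
    rw [abs_div, abs_of_pos (hΛ i), div_pow]
  have hI : Integrable (fun x => (∏ i, Λ i) * (1 + ∑ i, |Y i x| ^ (2 * ℓ) / Λ i ^ (2 * ℓ))) ν :=
    ((integrable_const _).add (integrable_finsetSum _ fun i _ =>
      ((h i).integrable_pow hm (hΛ i).le).div_const _)).const_mul _
  have hint : Integrable (fun x => ∏ i, Y i x) ν :=
    hI.mono' (Finset.univ.aestronglyMeasurable_fun_prod fun i _ => (h i).1) (ae_of_all _ hpt)
  refine ⟨hint, abs_integral_le_integral_abs.trans ((integral_mono hint.abs hI hpt).trans ?_)⟩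
  rw [integral_const_mul, integral_add (integrable_const _) (integrable_finsetSum _ fun i _ =>
      ((h i).integrable_pow hm (hΛ i).le).div_const _), integral_finsetSum _ fun i _ =>
      ((h i).integrable_pow hm (hΛ i).le).div_const _, mul_comm]
  refine mul_le_mul_of_nonneg_right ?_ (Finset.prod_nonneg fun i _ => (hΛ i).le)
  simp_rw [integral_div]
  have : ∑ i, (∫ x, |Y i x| ^ (2 * ℓ) ∂ν) / Λ i ^ (2 * ℓ) ≤ ∑ _i : Fin ℓ, (1 : ℝ) := by
    refine Finset.sum_le_sum fun i _ => ?_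
    have := hΛ i
    rw [div_le_one (by positivity)]
    exact (h i).integral_pow_le hm this.le
  simp at this ⊢
  exact this

/-- Replacing the factors of a product of `ℓ` random variables by nearby ones. -/
lemma integral_prod_sub_prod_le_of_momLE [IsProbabilityMeasure ν] {ℓ : ℕ} {X X' : Fin ℓ → S → ℝ}
    {τ Λ : ℝ} (hτ : 0 < τ) (hτ1 : τ ≤ 1) (hΛ : 1 ≤ Λ)
    (h : ∀ i, MomLE ν (2 * ℓ) (fun x => X i x - X' i x) τ)
    (h' : ∀ i, MomLE ν (2 * ℓ) (X' i) Λ) :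
    Integrable (fun x => ∏ i, X i x) ν ∧ Integrable (fun x => ∏ i, X' i x) ν ∧
    |∫ x, ∏ i, X i x ∂ν - ∫ x, ∏ i, X' i x ∂ν| ≤ 2 ^ ℓ * ((1 + ℓ) * (τ * Λ ^ ℓ)) := by
  classical
  have hΛ0 : 0 < Λ := by linarith
  set G : Finset (Fin ℓ) → S → ℝ := fun s x =>
    ∏ i, if i ∈ s then X i x - X' i x else X' i x with hG
  have hGi : ∀ s, Integrable (G s) ν ∧
      |∫ x, G s x ∂ν| ≤ (1 + ℓ) * ∏ i, (if i ∈ s then τ else Λ) := by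
    intro s
    refine integral_prod_le_of_momLE (Y := fun i x => if i ∈ s then X i x - X' i x else X' i x)
      (Λ := fun i => if i ∈ s then τ else Λ) (fun i => ?_) (fun i => ?_)
    · split_ifs <;> assumption
    · by_cases hi : i ∈ s
      · simp only [hi, if_true]; exact h i
      · simp only [hi, if_false]; exact h' i
  have hsum : ∀ x, ∏ i, X i x = ∑ s ∈ Finset.univ.powerset, G s x := by
    intro x
    have := Finset.prod_add (fun i => X i x - X' i x) (fun i => X' i x) Finset.univ
    simp only [sub_add_cancel] at this
    rw [this]
    refine Finset.sum_congr rfl fun s _ => ?_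
    simp only [hG]
    rw [Finset.prod_ite]
    congr 1
    · refine Finset.prod_congr ?_ fun _ _ => rfl
      ext i; simp
    · refine Finset.prod_congr ?_ fun _ _ => rfl
      ext i; simp
  have hempty : G ∅ = fun x => ∏ i, X' i x := by
    funext x; simp [hG]
  have hX : Integrable (fun x => ∏ i, X i x) ν := by
    simp_rw [hsum]
    exact integrable_finsetSum _ fun s _ => (hGi s).1
  refine ⟨hX, hempty ▸ (hGi ∅).1, ?_⟩
  simp_rw [hsum]
  rw [integral_finsetSum _ fun s _ => (hGi s).1,
    ← Finset.add_sum_erase _ _ (Finset.empty_mem_powerset _), hempty, add_sub_cancel_left]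
  calc _ ≤ ∑ s ∈ Finset.univ.powerset.erase ∅, (1 + (ℓ : ℝ)) * (τ * Λ ^ ℓ) := by
        refine (Finset.abs_sum_le_sum_abs _ _).trans (Finset.sum_le_sum fun s hs => ?_)
        refine (hGi s).2.trans (mul_le_mul_of_nonneg_left ?_ (by positivity))
        obtain ⟨j, hj⟩ := Finset.nonempty_iff_ne_empty.2 (Finset.ne_of_mem_erase hs)
        rw [← Finset.mul_prod_erase _ _ (Finset.mem_univ j), if_pos hj]
        refine mul_le_mul_of_nonneg_left ?_ hτ.le
        calc ∏ i ∈ Finset.univ.erase j, (if i ∈ s then τ else Λ)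
            ≤ ∏ _i ∈ Finset.univ.erase j, Λ := by
              refine Finset.prod_le_prod (fun i _ => ?_) fun i _ => ?_
              · split_ifs <;> positivity
              · split_ifs
                · linarith
                · exact le_rfl
          _ = Λ ^ (ℓ - 1) := by simp
          _ ≤ Λ ^ ℓ := pow_le_pow_right₀ hΛ (by omega)
    _ ≤ ∑ s ∈ (Finset.univ : Finset (Fin ℓ)).powerset, (1 + (ℓ : ℝ)) * (τ * Λ ^ ℓ) := by
        refine Finset.sum_le_sum_of_subset_of_nonneg (Finset.erase_subset _ _) fun _ _ _ => ?_
        positivity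
    _ = _ := by simp

end Moments

/-! ### Averages over circles and harmonic functions -/

/-- The uniform distribution on `(0, 2π]`, the parameter interval of circle averages. -/
noncomputable def angleMeasure : Measure ℝ :=
  ENNReal.ofReal (2 * Real.pi)⁻¹ • volume.restrict (Set.Ioc 0 (2 * Real.pi))

instance : IsProbabilityMeasure angleMeasure := by
  constructor
  rw [angleMeasure, Measure.smul_apply, Measure.restrict_apply_univ, Real.volume_Ioc, smul_eq_mul,
    ← ENNReal.ofReal_mul (by positivity), sub_zero, inv_mul_cancel₀ (by positivity),
    ENNReal.ofReal_one]

lemma circleAverage_eq_integral_angleMeasure (f : ℂ → ℝ) (c : ℂ) (R : ℝ) :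
    Real.circleAverage f c R = ∫ θ, f (circleMap c R θ) ∂angleMeasure := by
  rw [angleMeasure, integral_smul_measure, Real.circleAverage_def,
    intervalIntegral.integral_of_le (by positivity), ENNReal.toReal_ofReal (by positivity)]

/-- A Tonelli-type bound for a family that is continuous in the second variable but only
measurable, for each value of the second variable, in the first one. -/
lemma lintegral_lintegral_le_of_continuous {S : Type*} [MeasurableSpace S] {ν : Measure S}
    (κ : Measure ℝ) [IsProbabilityMeasure κ] {f : S → ℝ → ENNReal} {M : ENNReal}
    (hf : ∀ᵐ x ∂ν, Continuous (f x)) (hm : ∀ θ, AEMeasurable (fun x => f x θ) ν)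
    (hM : ∀ θ, ∫⁻ x, f x θ ∂ν ≤ M) :
    ∫⁻ x, ∫⁻ θ, f x θ ∂κ ∂ν ≤ M := by
  -- the second variable is rounded down to multiples of `1 / (n + 1)`
  set k : ℕ → ℝ → ℤ := fun n θ => ⌊(n + 1 : ℝ) * θ⌋
  have hk : ∀ n, Measurable (k n) := fun n => Int.measurable_floor.comp (measurable_const_mul _)
  set r : ℕ → ℝ → ℝ := fun n θ => (k n θ : ℝ) / (n + 1)
  have hr : ∀ θ, Tendsto (fun n => r n θ) atTop (𝓝 θ) := by
    intro θ
    have h1 : ∀ n : ℕ, θ - 1 / ((n : ℝ) + 1) ≤ r n θ := by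
      intro n
      have hn : (0 : ℝ) < n + 1 := by positivity
      have := Int.lt_floor_add_one ((n + 1 : ℝ) * θ)
      simp only [r, k]
      rw [sub_le_iff_le_add, ← add_div, le_div_iff₀ hn]
      linarith
    have h2 : ∀ n : ℕ, r n θ ≤ θ := by
      intro n
      have hn : (0 : ℝ) < n + 1 := by positivity
      have := Int.floor_le ((n + 1 : ℝ) * θ)
      simp only [r, k]
      rw [div_le_iff₀ hn]
      linarith
    refine tendsto_of_tendsto_of_tendsto_of_le_of_le ?_ tendsto_const_nhds h1 h2
    simpa using tendsto_const_nhds.sub (tendsto_one_div_add_atTop_nhds_zero_nat (𝕜 := ℝ))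
  have hsum : ∀ n x, ∫⁻ θ, f x (r n θ) ∂κ
      = ∑' j : ℤ, f x ((j : ℝ) / (n + 1)) * (κ.map (k n)) {j} := by
    intro n x
    have : ∫⁻ θ, f x (r n θ) ∂κ = ∫⁻ j : ℤ, f x ((j : ℝ) / (n + 1)) ∂(κ.map (k n)) := by
      rw [lintegral_map (measurable_of_countable _) (hk n)]
    rw [this, lintegral_countable']
  have hmeas : ∀ n, AEMeasurable (fun x => ∫⁻ θ, f x (r n θ) ∂κ) ν := by
    intro n
    simp_rw [hsum]
    exact AEMeasurable.tsum fun j => (hm _).mul_const _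
  have hbd : ∀ n, ∫⁻ x, ∫⁻ θ, f x (r n θ) ∂κ ∂ν ≤ M := by
    intro n
    simp_rw [hsum]
    rw [lintegral_tsum fun j => (hm _).mul_const _]
    calc _ = ∑' j : ℤ, (∫⁻ x, f x ((j : ℝ) / (n + 1)) ∂ν) * (κ.map (k n)) {j} := by
          congr 1
          funext j
          rw [lintegral_mul_const'' _ (hm _)]
      _ ≤ ∑' j : ℤ, M * (κ.map (k n)) {j} := by
          gcongr with j
          exact hM _
      _ = ∫⁻ _j : ℤ, M ∂(κ.map (k n)) := by rw [lintegral_countable']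
      _ = M := by
          have : IsProbabilityMeasure (κ.map (k n)) :=
            Measure.isProbabilityMeasure_map (hk n).aemeasurable
          rw [lintegral_const, measure_univ, mul_one]
  calc ∫⁻ x, ∫⁻ θ, f x θ ∂κ ∂ν
      ≤ ∫⁻ x, liminf (fun n => ∫⁻ θ, f x (r n θ) ∂κ) atTop ∂ν := by
        refine lintegral_mono_ae ?_
        filter_upwards [hf] with x hx
        have h1 : ∀ θ, f x θ = liminf (fun n => f x (r n θ)) atTop := fun θ =>
          (((hx.tendsto θ).comp (hr θ)).liminf_eq).symm
        rw [lintegral_congr h1]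
        refine lintegral_liminf_le fun n => ?_
        have : (fun θ => f x (r n θ)) = (fun j : ℤ => f x ((j : ℝ) / (n + 1))) ∘ k n := rfl
        rw [this]
        exact (measurable_of_countable _).comp (hk n)
    _ ≤ liminf (fun n => ∫⁻ x, ∫⁻ θ, f x (r n θ) ∂κ ∂ν) atTop := lintegral_liminf_le' hmeas
    _ ≤ M := by
        refine (liminf_le_liminf (Eventually.of_forall hbd)).trans ?_
        rw [liminf_const]

section Harmonic

variable {F : ℂ → ℝ} {a z w : ℂ} {R : ℝ}

open InnerProductSpace

lemma norm_circleMap_sub_eq (hR : 0 < R) (θ : ℝ) : ‖circleMap a R θ - a‖ = R := by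
  simp [circleMap, abs_of_pos hR]

lemma continuous_comp_circleMap (hR : 0 < R) (hF : ContinuousOn F (Metric.closedBall a R)) :
    Continuous fun θ => F (circleMap a R θ) := by
  refine hF.comp_continuous (continuous_circleMap a R) fun θ => ?_
  exact circleMap_mem_closedBall a hR.le θ

lemma integrable_angleMeasure {g : ℝ → ℝ} (hg : Continuous g) : Integrable g angleMeasure := by
  refine Integrable.smul_measure ?_ ENNReal.ofReal_ne_top
  exact (hg.integrableOn_Icc (a := 0) (b := 2 * Real.pi)).mono_set Set.Ioc_subset_Icc_self

/-- The mean absolute deviation of `F` from the constant `c` over the circle of radius `R`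
around `a`. -/
noncomputable def circleDev (F : ℂ → ℝ) (a : ℂ) (R c : ℝ) : ℝ :=
  ∫ θ, |F (circleMap a R θ) - c| ∂angleMeasure

lemma circleDev_nonneg (F : ℂ → ℝ) (a : ℂ) (R c : ℝ) : 0 ≤ circleDev F a R c :=
  integral_nonneg fun _ => abs_nonneg _

lemma norm_sub_lower (hR : 0 < R) {θ : ℝ} :
    R - ‖z - a‖ ≤ ‖circleMap a R θ - a - (z - a)‖ := by
  have := norm_sub_norm_le (circleMap a R θ - a) (z - a)
  rwa [norm_circleMap_sub_eq hR] at this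

lemma abs_poissonKernel_sub_one_le (hz : ‖z - a‖ < R) (θ : ℝ) :
    |poissonKernel a z (circleMap a R θ) - 1| ≤ 2 * ‖z - a‖ / (R - ‖z - a‖) := by
  have hR : 0 < R := (norm_nonneg _).trans_lt hz
  have h1 := norm_sub_lower (z := z) (a := a) hR (θ := θ)
  have h2 := norm_sub_le (circleMap a R θ - a) (z - a)
  rw [poissonKernel_def, norm_circleMap_sub_eq hR]
  rw [norm_circleMap_sub_eq hR] at h2
  set s := ‖z - a‖
  set D := ‖circleMap a R θ - a - (z - a)‖
  have hs : 0 ≤ s := norm_nonneg _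
  have hD : 0 < D := by linarith
  rw [div_sub_one (by positivity), abs_div, abs_of_pos (by positivity : 0 < D ^ 2),
    div_le_div_iff₀ (by positivity) (by linarith)]
  have h3 : |R ^ 2 - s ^ 2 - D ^ 2| ≤ 2 * s * D := by
    have e : ∀ y : ℝ, |y| ≤ 2 * s * D ↔ -(2 * s * D) ≤ y ∧ y ≤ 2 * s * D := fun y => abs_le
    rw [e]
    constructor
    · -- `D - s ≤ R`
      nlinarith [norm_sub_norm_le (circleMap a R θ - a - (z - a)) (-(z - a)), show D - s ≤ R by
        have := norm_sub_norm_le (circleMap a R θ - a - (z - a)) (-(z - a))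
        rw [sub_neg_eq_add, sub_add_cancel, norm_circleMap_sub_eq hR, norm_neg] at this
        exact this]
    · nlinarith
  calc |R ^ 2 - s ^ 2 - D ^ 2| * (R - s) ≤ 2 * s * D * D := by
        apply mul_le_mul h3 h1 (by linarith) (by positivity)
    _ = 2 * s * D ^ 2 := by ring

lemma abs_poissonKernel_sub_le (hz : ‖z - a‖ ≤ R / 2) (hw : ‖w - a‖ ≤ R / 2) (hR : 0 < R) (θ : ℝ) :
    |poissonKernel a z (circleMap a R θ) - poissonKernel a w (circleMap a R θ)|
      ≤ 64 * ‖z - w‖ / R := by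
  have h1 := norm_sub_lower (z := z) (a := a) hR (θ := θ)
  have h2 := norm_sub_lower (z := w) (a := a) hR (θ := θ)
  have h1' := norm_sub_le (circleMap a R θ - a) (z - a)
  have h2' := norm_sub_le (circleMap a R θ - a) (w - a)
  rw [poissonKernel_def, poissonKernel_def, norm_circleMap_sub_eq hR]
  rw [norm_circleMap_sub_eq hR] at h1' h2'
  have h3 : |‖circleMap a R θ - a - (z - a)‖ - ‖circleMap a R θ - a - (w - a)‖| ≤ ‖z - w‖ := by
    have := abs_norm_sub_norm_le (circleMap a R θ - a - (z - a)) (circleMap a R θ - a - (w - a))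
    rw [show circleMap a R θ - a - (z - a) - (circleMap a R θ - a - (w - a)) = w - z by ring,
      norm_sub_rev w z] at this
    exact this
  have h4 : |‖z - a‖ - ‖w - a‖| ≤ ‖z - w‖ := by
    have := abs_norm_sub_norm_le (z - a) (w - a)
    rwa [sub_sub_sub_cancel_right] at this
  set s := ‖z - a‖
  set t := ‖w - a‖
  set D := ‖circleMap a R θ - a - (z - a)‖
  set G := ‖circleMap a R θ - a - (w - a)‖
  set e := ‖z - w‖
  have hs : 0 ≤ s := norm_nonneg _
  have ht : 0 ≤ t := norm_nonneg _
  have he : 0 ≤ e := norm_nonneg _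
  have hD : R / 2 ≤ D := by linarith
  have hG : R / 2 ≤ G := by linarith
  have hD' : D ≤ 3 / 2 * R := by linarith
  have hG' : G ≤ 3 / 2 * R := by linarith
  have hD0 : 0 < D := by linarith
  have hG0 : 0 < G := by linarith
  rw [div_sub_div _ _ (by positivity) (by positivity), abs_div,
    abs_of_pos (by positivity : 0 < D ^ 2 * G ^ 2), div_le_div_iff₀ (by positivity) hR]
  have n1 : (R ^ 2 - s ^ 2) * G ^ 2 - D ^ 2 * (R ^ 2 - t ^ 2)
      = (R ^ 2 - s ^ 2) * (G - D) * (G + D) + D ^ 2 * (t - s) * (t + s) := by ring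
  have n2 : |(R ^ 2 - s ^ 2) * G ^ 2 - D ^ 2 * (R ^ 2 - t ^ 2)|
      ≤ R ^ 2 * e * (G + D) + D ^ 2 * e * R := by
    rw [n1]
    refine (abs_add_le _ _).trans (add_le_add ?_ ?_)
    · rw [abs_mul, abs_mul, abs_of_pos (by linarith : 0 < G + D),
        abs_of_nonneg (by nlinarith : 0 ≤ R ^ 2 - s ^ 2), abs_sub_comm]
      gcongr
      nlinarith
    · rw [abs_mul, abs_mul, abs_of_nonneg (sq_nonneg D), abs_of_nonneg (by linarith : 0 ≤ t + s),
        abs_sub_comm]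
      gcongr
      linarith
  -- `R ≤ 2 D` and `R ≤ 2 G` turn all powers of `R` into powers of `D` and `G`
  have hR2 : R ^ 2 ≤ 4 * (D * G) := by nlinarith
  calc |(R ^ 2 - s ^ 2) * G ^ 2 - D ^ 2 * (R ^ 2 - t ^ 2)| * R
      ≤ (R ^ 2 * e * (G + D) + D ^ 2 * e * R) * R := by gcongr
    _ = e * (R ^ 2 * (R * G) + R ^ 2 * (R * D) + D ^ 2 * R ^ 2) := by ring
    _ ≤ e * (R ^ 2 * (2 * D * G) + R ^ 2 * (2 * G * D) + D ^ 2 * (4 * G ^ 2)) := by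
        gcongr
        · linarith
        · linarith
        · nlinarith
    _ ≤ e * (4 * (D * G) * (2 * D * G) + 4 * (D * G) * (2 * G * D) + D ^ 2 * (4 * G ^ 2)) := by
        gcongr
    _ ≤ 64 * e * (D ^ 2 * G ^ 2) := by
        have : 0 ≤ e * (D ^ 2 * G ^ 2) := by positivity
        nlinarith

lemma continuous_poissonKernel_circleMap (hz : ‖z - a‖ < R) :
    Continuous fun θ => poissonKernel a z (circleMap a R θ) := by
  have hR : 0 < R := (norm_nonneg _).trans_lt hz
  simp only [poissonKernel_def]
  refine Continuous.div (by fun_prop) (by fun_prop) fun θ => ?_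
  have := norm_sub_lower (z := z) (a := a) hR (θ := θ)
  have h2 : 0 < ‖circleMap a R θ - a - (z - a)‖ := by linarith
  positivity

lemma poisson_formula (hF : HarmonicOnNhd F (Metric.closedBall a R)) (hz : ‖z - a‖ < R) :
    ∫ θ, poissonKernel a z (circleMap a R θ) * F (circleMap a R θ) ∂angleMeasure = F z := by
  rw [← hF.circleAverage_poissonKernel_smul (w := z) (by simpa [Metric.mem_ball, dist_eq_norm]),
    circleAverage_eq_integral_angleMeasure]
  rfl

lemma mean_value (hR : 0 < R) (hF : HarmonicOnNhd F (Metric.closedBall a R)) :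
    ∫ θ, F (circleMap a R θ) ∂angleMeasure = F a := by
  rw [← circleAverage_eq_integral_angleMeasure]
  exact InnerProductSpace.HarmonicOnNhd.circleAverage_eq (by rwa [abs_of_pos hR])

lemma harmonicOnNhd_const' (c : ℝ) (s : Set ℂ) : HarmonicOnNhd (fun _ : ℂ => c) s := by
  intro x _
  exact harmonicAt_const c

lemma poisson_formula_sub (hF : HarmonicOnNhd F (Metric.closedBall a R)) (hz : ‖z - a‖ < R)
    (c : ℝ) :
    ∫ θ, poissonKernel a z (circleMap a R θ) * (F (circleMap a R θ) - c) ∂angleMeasure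
      = F z - c := by
  have hR : 0 < R := (norm_nonneg _).trans_lt hz
  have hc := poisson_formula (harmonicOnNhd_const' c (Metric.closedBall a R)) hz
  have hK := continuous_poissonKernel_circleMap hz
  have hFc := continuous_comp_circleMap hR hF.continuousOn
  simp_rw [mul_sub]
  have i1 : Integrable (fun θ => poissonKernel a z (circleMap a R θ) * F (circleMap a R θ))
      angleMeasure := integrable_angleMeasure (hK.mul hFc)
  have i2 : Integrable (fun θ => poissonKernel a z (circleMap a R θ) * c) angleMeasure :=
    integrable_angleMeasure (hK.mul continuous_const)
  rw [integral_sub i1 i2, poisson_formula hF hz, hc]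

/-- A gradient estimate for harmonic functions. -/
lemma abs_sub_le_circleDev (hR : 0 < R) (hF : HarmonicOnNhd F (Metric.closedBall a R))
    (hz : ‖z - a‖ ≤ R / 2) (hw : ‖w - a‖ ≤ R / 2) (c : ℝ) :
    |F z - F w| ≤ 64 * ‖z - w‖ / R * circleDev F a R c := by
  have hz' : ‖z - a‖ < R := by linarith
  have hw' : ‖w - a‖ < R := by linarith
  have hFc : Continuous fun θ => F (circleMap a R θ) - c :=
    (continuous_comp_circleMap hR hF.continuousOn).sub continuous_const
  have hKz := continuous_poissonKernel_circleMap hz'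
  have hKw := continuous_poissonKernel_circleMap hw'
  have e : F z - F w = ∫ θ, (poissonKernel a z (circleMap a R θ)
      - poissonKernel a w (circleMap a R θ)) * (F (circleMap a R θ) - c) ∂angleMeasure := by
    simp_rw [sub_mul (poissonKernel _ _ _)]
    have i1 : Integrable (fun θ => poissonKernel a z (circleMap a R θ)
        * (F (circleMap a R θ) - c)) angleMeasure := integrable_angleMeasure (hKz.mul hFc)
    have i2 : Integrable (fun θ => poissonKernel a w (circleMap a R θ)
        * (F (circleMap a R θ) - c)) angleMeasure := integrable_angleMeasure (hKw.mul hFc)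
    rw [integral_sub i1 i2, poisson_formula_sub hF hz' c, poisson_formula_sub hF hw' c]
    ring
  rw [e, circleDev, ← integral_const_mul]
  refine abs_integral_le_integral_abs.trans (integral_mono
    (integrable_angleMeasure ((hKz.sub hKw).mul hFc).abs)
    (integrable_angleMeasure (continuous_const.mul hFc.abs)) fun θ => ?_)
  simp only [abs_mul]
  gcongr
  exact abs_poissonKernel_sub_le hz hw hR θ

/-- Near the centre of a disk the deviation from the central value is a small multiple of the mean
deviation over the boundary circle. -/
lemma abs_sub_center_le_circleDev (hR : 0 < R) (hF : HarmonicOnNhd F (Metric.closedBall a R))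
    (hz : ‖z - a‖ ≤ R / 10) : |F z - F a| ≤ 1 / 4 * circleDev F a R (F a) := by
  have hz' : ‖z - a‖ < R := by linarith
  have hFc : Continuous fun θ => F (circleMap a R θ) - F a :=
    (continuous_comp_circleMap hR hF.continuousOn).sub continuous_const
  have hKz := continuous_poissonKernel_circleMap hz'
  have h0 : ∫ θ, (F (circleMap a R θ) - F a) ∂angleMeasure = 0 := by
    rw [integral_sub (integrable_angleMeasure (continuous_comp_circleMap hR hF.continuousOn))
      (integrable_const _), mean_value hR hF]
    simp
  have e : F z - F a = ∫ θ, (poissonKernel a z (circleMap a R θ) - 1)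
      * (F (circleMap a R θ) - F a) ∂angleMeasure := by
    simp_rw [sub_mul (poissonKernel _ _ _), one_mul]
    have i1 : Integrable (fun θ => poissonKernel a z (circleMap a R θ)
        * (F (circleMap a R θ) - F a)) angleMeasure := integrable_angleMeasure (hKz.mul hFc)
    rw [integral_sub i1 (integrable_angleMeasure hFc), poisson_formula_sub hF hz' (F a), h0]
    ring
  rw [e, circleDev, ← integral_const_mul]
  refine abs_integral_le_integral_abs.trans (integral_mono
    (integrable_angleMeasure ((hKz.sub continuous_const).mul hFc).abs)
    (integrable_angleMeasure (continuous_const.mul hFc.abs)) fun θ => ?_)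
  simp only [abs_mul]
  gcongr
  refine (abs_poissonKernel_sub_one_le hz' θ).trans ?_
  rw [div_le_iff₀ (by linarith)]
  linarith

/-- By the mean value property the positive and negative parts of the deviation from the central
value have the same mean. -/
lemma circleDev_eq_two_mul (hR : 0 < R) (hF : HarmonicOnNhd F (Metric.closedBall a R)) :
    circleDev F a R (F a) = ∫ θ, 2 * max (F (circleMap a R θ) - F a) 0 ∂angleMeasure ∧
    circleDev F a R (F a) = ∫ θ, 2 * max (F a - F (circleMap a R θ)) 0 ∂angleMeasure := by
  have hFc : Continuous fun θ => F (circleMap a R θ) - F a :=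
    (continuous_comp_circleMap hR hF.continuousOn).sub continuous_const
  have h0 : ∫ θ, (F (circleMap a R θ) - F a) ∂angleMeasure = 0 := by
    rw [integral_sub (integrable_angleMeasure (continuous_comp_circleMap hR hF.continuousOn))
      (integrable_const _), mean_value hR hF]
    simp
  constructor
  · have e : ∀ θ, 2 * max (F (circleMap a R θ) - F a) 0
        = |F (circleMap a R θ) - F a| + (F (circleMap a R θ) - F a) := fun θ => by
      rcases le_total 0 (F (circleMap a R θ) - F a) with h | h
      · rw [max_eq_left h, abs_of_nonneg h]; ring
      · rw [max_eq_right h, abs_of_nonpos h]; ring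
    simp_rw [e]
    rw [integral_add (integrable_angleMeasure hFc.abs) (integrable_angleMeasure hFc), h0, add_zero]
    rfl
  · have e : ∀ θ, 2 * max (F a - F (circleMap a R θ)) 0
        = |F (circleMap a R θ) - F a| - (F (circleMap a R θ) - F a) := fun θ => by
      rcases le_total 0 (F (circleMap a R θ) - F a) with h | h
      · rw [max_eq_right (by linarith), abs_of_nonneg h]; ring
      · rw [max_eq_left (by linarith), abs_of_nonpos h]; ring
    simp_rw [e]
    rw [integral_sub (integrable_angleMeasure hFc.abs) (integrable_angleMeasure hFc), h0, sub_zero]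
    rfl

end Harmonic

/-- A random variable dominated by the mean of `L^m`-bounded variables over a circle is
`L^m`-bounded. -/
lemma MomLE.of_le_circle {S : Type*} [MeasurableSpace S] {ν : Measure S} {m : ℕ} (hm : m ≠ 0)
    {Y : S → ℝ} {Z : S → ℝ → ℝ} {c Λ : ℝ} (hc : 0 ≤ c) (hΛ : 0 ≤ Λ)
    (hY : AEStronglyMeasurable Y ν) (hZ : ∀ᵐ x ∂ν, Continuous (Z x))
    (hZm : ∀ θ, MomLE ν m (fun x => Z x θ) Λ)
    (h : ∀ᵐ x ∂ν, |Y x| ≤ c * ∫ θ, |Z x θ| ∂angleMeasure) : MomLE ν m Y (c * Λ) := by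
  refine MomLE.of_lintegral hm hY (by positivity) ?_
  have h1 : ∀ᵐ x ∂ν, ENNReal.ofReal (|Y x| ^ m)
      ≤ ∫⁻ θ, ENNReal.ofReal ((c * |Z x θ|) ^ m) ∂angleMeasure := by
    filter_upwards [h, hZ] with x hx hZx
    have hi : Integrable (fun θ => c * |Z x θ|) angleMeasure :=
      integrable_angleMeasure (continuous_const.mul hZx.abs)
    have hi' : Integrable (fun θ => (c * |Z x θ|) ^ m) angleMeasure :=
      integrable_angleMeasure ((continuous_const.mul hZx.abs).pow m)
    rw [← ofReal_integral_eq_lintegral_ofReal hi' (ae_of_all _ fun θ => by positivity)]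
    refine ENNReal.ofReal_le_ofReal ?_
    have hj := (convexOn_pow m).map_integral_le (μ := angleMeasure) (f := fun θ => c * |Z x θ|)
      (continuousOn_pow m) isClosed_Ici (ae_of_all _ fun θ => by
        simp only [Set.mem_Ici]; positivity) hi hi'
    refine le_trans (pow_le_pow_left₀ (abs_nonneg _) ?_ m) hj
    rw [integral_const_mul]
    exact hx
  refine (lintegral_mono_ae h1).trans (lintegral_lintegral_le_of_continuous _ ?_ ?_ ?_)
  · filter_upwards [hZ] with x hx
    exact ENNReal.continuous_ofReal.comp ((continuous_const.mul hx.abs).pow m)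
  · intro θ
    exact ENNReal.measurable_ofReal.comp_aemeasurable
      ((((continuous_abs.comp_aestronglyMeasurable (hZm θ).1).aemeasurable).const_mul c).pow_const m)
  · intro θ
    have := ((hZm θ).abs.const_mul hc).lintegral_le hm (by positivity)
    simpa only [abs_mul, abs_of_nonneg hc, abs_abs] using this

/-! ### The Gaussian field -/

section Gaussian

variable {E : Type*} {W : E → ℂ → ℝ} {U : Set ℂ}

/-- The space of finite linear combinations of the values of the field at points of `U`. -/
def fieldSpan (W : E → ℂ → ℝ) (U : Set ℂ) : Submodule ℝ (E → ℝ) :=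
  Submodule.span ℝ (Set.range fun (z : U) (x : E) => W x (z : ℂ))

lemma eval_mem_fieldSpan {z : ℂ} (hz : z ∈ U) : (fun x => W x z) ∈ fieldSpan W U :=
  Submodule.subset_span ⟨⟨z, hz⟩, rfl⟩

lemma inc_mem_fieldSpan {z w : ℂ} (hz : z ∈ U) (hw : w ∈ U) :
    (fun x => 2 * W x z - 2 * W x w) ∈ fieldSpan W U :=
  sub_mem ((fieldSpan W U).smul_mem 2 (eval_mem_fieldSpan hz))
    ((fieldSpan W U).smul_mem 2 (eval_mem_fieldSpan hw))

variable [MeasurableSpace E] {Q : Measure E}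

lemma IsCenteredGaussianField.hasGaussianLaw (h : IsCenteredGaussianField Q W U) {X : E → ℝ}
    (hX : X ∈ fieldSpan W U) : HasGaussianLaw X Q := by
  obtain ⟨c, rfl⟩ := Finsupp.mem_span_range_iff_exists_finsupp.1 hX
  have := (h.1.smul (fun i => c i)).hasGaussianLaw_fun_sum (I := c.support)
  have e : (c.sum fun i a => a • fun x : E => W x (i : ℂ))
      = fun x => ∑ i ∈ c.support, c i • W x (i : ℂ) := by
    funext x
    rw [Finsupp.sum, Finset.sum_apply]
    rfl
  rw [e]
  exact this

lemma IsCenteredGaussianField.integral_eq_zero (h : IsCenteredGaussianField Q W U) {X : E → ℝ}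
    (hX : X ∈ fieldSpan W U) : ∫ x, X x ∂Q = 0 := by
  have key : Integrable X Q ∧ ∫ x, X x ∂Q = 0 := by
    refine Submodule.span_induction ?_ ?_ ?_ ?_ hX
    · rintro _ ⟨z, rfl⟩
      exact ⟨(h.hasGaussianLaw (eval_mem_fieldSpan z.2)).integrable, h.2 z z.2⟩
    · exact ⟨integrable_zero _ _ _, by simp⟩
    · rintro X Y - - ⟨h1, h2⟩ ⟨h3, h4⟩
      refine ⟨h1.add h3, ?_⟩
      simp only [Pi.add_apply]
      rw [integral_add h1 h3, h2, h4, add_zero]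
    · rintro a X - ⟨h1, h2⟩
      refine ⟨h1.smul a, ?_⟩
      simp only [Pi.smul_apply, smul_eq_mul]
      rw [integral_const_mul, h2, mul_zero]
  exact key.2

/-- The exponential moments of the elements of the Gaussian space. -/
lemma IsCenteredGaussianField.integral_exp (h : IsCenteredGaussianField Q W U) {X : E → ℝ}
    (hX : X ∈ fieldSpan W U) :
    Integrable (fun x => Real.exp (X x)) Q ∧
      ∫ x, Real.exp (X x) ∂Q = Real.exp ((∫ x, X x ^ 2 ∂Q) / 2) := by
  have hg := h.hasGaussianLaw hX
  have hmap := hg.map_eq_gaussianReal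
  have hmem := hg.memLp_two
  have hP := hg.isProbabilityMeasure
  have h0 := h.integral_eq_zero hX
  have hv : Var[X; Q] = ∫ x, X x ^ 2 ∂Q := by
    rw [variance_eq_sub hmem, h0]
    simp
  constructor
  · have := (integrable_exp_mul_gaussianReal (μ := Q[X]) (v := Var[X; Q].toNNReal) 1)
    rw [← hmap] at this
    have h2 := this.comp_aemeasurable hg.aemeasurable
    simpa [Function.comp_def] using h2
  · have := mgf_gaussianReal hmap 1
    rw [mgf] at this
    simp only [one_mul, mul_one, one_pow] at this
    rw [this, h0, Real.coe_toNNReal _ (variance_nonneg _ _), hv, zero_add]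

lemma IsCenteredGaussianField.integrable_mul (h : IsCenteredGaussianField Q W U) {X Y : E → ℝ}
    (hX : X ∈ fieldSpan W U) (hY : Y ∈ fieldSpan W U) : Integrable (fun x => X x * Y x) Q :=
  (h.hasGaussianLaw hX).memLp_two.integrable_mul (h.hasGaussianLaw hY).memLp_two

/-- Biasing by `e^B` shifts the mean of `X` by the covariance of `X` and `B`. -/
lemma IsCenteredGaussianField.integral_exp_add (h : IsCenteredGaussianField Q W U) {B X : E → ℝ}
    (hB : B ∈ fieldSpan W U) (hX : X ∈ fieldSpan W U) :
    ∫ x, Real.exp (B x + X x) ∂Q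
      = (∫ x, Real.exp (B x) ∂Q) * ∫ x, Real.exp (∫ x', X x' * B x' ∂Q + X x) ∂Q := by
  have h1 := (h.integral_exp (add_mem hB hX)).2
  simp only [Pi.add_apply] at h1
  simp_rw [Real.exp_add (∫ x', X x' * B x' ∂Q)]
  rw [h1, integral_const_mul, (h.integral_exp hB).2, (h.integral_exp hX).2, ← Real.exp_add,
    ← Real.exp_add]
  congr 1
  have e : ∀ x, (B x + X x) ^ 2 = B x * B x + 2 * (X x * B x) + X x * X x := fun x => by ring
  simp_rw [e]
  have i1 : Integrable (fun x => 2 * (X x * B x)) Q := (h.integrable_mul hX hB).const_mul 2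
  have i2 : Integrable (fun x => B x * B x + 2 * (X x * B x)) Q := (h.integrable_mul hB hB).add i1
  rw [integral_add i2 (h.integrable_mul hX hX), integral_add (h.integrable_mul hB hB) i1,
    integral_const_mul]
  simp_rw [sq]
  ring

/-- The field with the mean that it acquires under the bias `2 W(p) - 2 W(q)`. -/
noncomputable def shiftedField (Q : Measure E) (W : E → ℂ → ℝ) (p q : ℂ) (x : E) (ζ : ℂ) : ℝ :=
  (∫ x', W x' ζ * (2 * W x' p - 2 * W x' q) ∂Q) + W x ζ

lemma shiftedField_inc (h : IsCenteredGaussianField Q W U) {p q z w : ℂ} (hp : p ∈ U) (hq : q ∈ U)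
    (hz : z ∈ U) (hw : w ∈ U) (x : E) :
    2 * shiftedField Q W p q x z - 2 * shiftedField Q W p q x w
      = ∫ x', (2 * W x' z - 2 * W x' w) * (2 * W x' p - 2 * W x' q) ∂Q
        + (2 * W x z - 2 * W x w) := by
  have hB := inc_mem_fieldSpan (W := W) hp hq
  have i1 := h.integrable_mul (eval_mem_fieldSpan hz) hB
  have i2 := h.integrable_mul (eval_mem_fieldSpan hw) hB
  have e : ∀ x', (2 * W x' z - 2 * W x' w) * (2 * W x' p - 2 * W x' q)
      = 2 * (W x' z * (2 * W x' p - 2 * W x' q)) - 2 * (W x' w * (2 * W x' p - 2 * W x' q)) :=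
    fun x' => by ring
  simp_rw [e]
  rw [integral_sub (i1.const_mul 2) (i2.const_mul 2), integral_const_mul, integral_const_mul]
  unfold shiftedField
  ring

/-- Exponential moments of linear statistics under the bias are those of the shifted field. -/
lemma integral_exp_bias_add (h : IsCenteredGaussianField Q W U) {p q : ℂ} (hp : p ∈ U) (hq : q ∈ U)
    {ι : Type*} [Fintype ι] {c d : ι → ℂ} (hc : ∀ i, c i ∈ U) (hd : ∀ i, d i ∈ U) :
    ∫ x, Real.exp ((2 * W x p - 2 * W x q) + ∑ i, (2 * W x (c i) - 2 * W x (d i))) ∂Q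
      = (∫ x, Real.exp (2 * W x p - 2 * W x q) ∂Q) *
        ∫ x, Real.exp (∑ i, (2 * shiftedField Q W p q x (c i)
          - 2 * shiftedField Q W p q x (d i))) ∂Q := by
  have hB := inc_mem_fieldSpan (W := W) hp hq
  have hXi : ∀ i, (fun x => 2 * W x (c i) - 2 * W x (d i)) ∈ fieldSpan W U :=
    fun i => inc_mem_fieldSpan (hc i) (hd i)
  have hX : (fun x => ∑ i, (2 * W x (c i) - 2 * W x (d i))) ∈ fieldSpan W U := by
    have := (fieldSpan W U).sum_mem (t := Finset.univ) fun i _ => hXi i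
    convert this using 1
    funext x
    rw [Finset.sum_apply]
  rw [h.integral_exp_add hB hX]
  congr 2
  funext x
  congr 1
  simp_rw [shiftedField_inc h hp hq (hc _) (hd _), Finset.sum_add_distrib, Finset.sum_mul]
  rw [integral_finsetSum _ fun i _ => h.integrable_mul (hXi i) hB]

/-- Constants for which the increments of the field, and their covariances with the field, are
controlled by the hyperbolic distance. -/
structure IncrementBound (Q : Measure E) (W : E → ℂ → ℝ) (U : Set ℂ) (C : ℝ) : Prop where
  one_le : 1 ≤ C
  sq_le : ∀ z ∈ U, ∀ w ∈ U, hypDist z w ≤ 1 → ∫ x, (W x z - W x w) ^ 2 ∂Q ≤ C * hypDist z w ^ 2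
  cov_le : ∀ y ∈ U, ∀ z ∈ U, ∀ w ∈ U, hypDist z w ≤ 1 →
    |∫ x, W x y * (W x z - W x w) ∂Q| ≤ C * hypDist z w

lemma IsBRWLike.exists_incrementBound (h : IsBRWLike Q W U) (hUD : U ⊆ Metric.ball (0 : ℂ) 1) :
    ∃ C, IncrementBound Q W U C := by
  obtain ⟨C₁, hC₁, h1⟩ := h.variance_le
  obtain ⟨C₂, hC₂, h2⟩ := h.cov_le
  have hn : ∀ z ∈ U, ∀ w ∈ U, 0 ≤ hypDist z w := fun z hz w hw =>
    hypDist_nonneg (by simpa using hUD hz) (by simpa using hUD hw)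
  refine ⟨1 + C₁ + C₂, by linarith, fun z hz w hw hd => ?_, fun y hy z hz w hw hd => ?_⟩
  · have hX : (fun x => W x z - W x w) ∈ fieldSpan W U :=
      sub_mem (eval_mem_fieldSpan hz) (eval_mem_fieldSpan hw)
    have hg := h.gaussian.hasGaussianLaw hX
    have hP := hg.isProbabilityMeasure
    have hv : Var[fun x => W x z - W x w; Q] = ∫ x, (W x z - W x w) ^ 2 ∂Q := by
      rw [variance_eq_sub hg.memLp_two, h.gaussian.integral_eq_zero hX]
      simp
    rw [← hv]
    refine (h1 z hz w hw hd).trans ?_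
    gcongr
    linarith
  · refine (h2 y hy z hz w hw hd).trans ?_
    have := hn z hz w hw
    gcongr
    linarith

/-- The coefficients of `cosh t` in `1`, `e^{-t}`, `e^t`. -/
noncomputable def coshCoef : SignType → ℝ
  | 0 => 0
  | _ => 1 / 2

lemma sum_coshCoef (t : ℝ) : ∑ σ, coshCoef σ * Real.exp ((σ : ℝ) * t) = Real.cosh t := by
  rw [sum_signType, Real.cosh_eq]
  have h1 : coshCoef 1 = 1 / 2 := rfl
  have h2 : coshCoef (-1) = 1 / 2 := rfl
  have h3 : coshCoef 0 = 0 := rfl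
  simp [h1, h2, h3]
  ring

lemma coshCoef_nonneg (σ : SignType) : 0 ≤ coshCoef σ := by
  cases σ <;> norm_num [coshCoef]

lemma sum_sum_coshCoef (ℓ : ℕ) : ∑ σ : Fin ℓ → SignType, ∏ i, coshCoef (σ i) = 1 := by
  have : ∏ _i : Fin ℓ, ∑ σ, coshCoef σ = ∑ σ : Fin ℓ → SignType, ∏ i, coshCoef (σ i) := by
    rw [Finset.prod_univ_sum, Fintype.piFinset_univ]
  rw [← this]
  refine Finset.prod_eq_one fun _ _ => ?_
  have := sum_coshCoef 0
  simpa using this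

lemma abs_signType_le (σ : SignType) : |(σ : ℝ)| ≤ 1 := by
  cases σ <;> simp

/-- Increments of the shifted field between points at hyperbolic distance at most `ε` are of size
`ε`, with Gaussian tails. -/
lemma IncrementBound.integral_exp_sign_le {C : ℝ} (hC : IncrementBound Q W U C)
    (h : IsCenteredGaussianField Q W U)
    {p q : ℂ} (hp : p ∈ U) (hq : q ∈ U) {ℓ : ℕ} {a b : Fin ℓ → ℂ} (ha : ∀ i, a i ∈ U)
    (hb : ∀ i, b i ∈ U) {ε : ℝ} (hε : 0 < ε) (hε1 : ε ≤ 1) (hd : ∀ i, hypDist (a i) (b i) ≤ ε)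
    (hd0 : ∀ i, 0 ≤ hypDist (a i) (b i)) (s : Fin ℓ → ℝ) (hs : ∀ i, |s i| ≤ 1) :
    Integrable (fun x => Real.exp (∑ i, s i * ((2 * shiftedField Q W p q x (a i)
        - 2 * shiftedField Q W p q x (b i)) / ε))) Q ∧
    ∫ x, Real.exp (∑ i, s i * ((2 * shiftedField Q W p q x (a i)
        - 2 * shiftedField Q W p q x (b i)) / ε)) ∂Q ≤ Real.exp (8 * C * (ℓ + ℓ ^ 2)) := by
  have hXi : ∀ i, (fun x => s i / ε * (2 * W x (a i) - 2 * W x (b i))) ∈ fieldSpan W U :=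
    fun i => (fieldSpan W U).smul_mem _ (inc_mem_fieldSpan (ha i) (hb i))
  have hX : (fun x => ∑ i, s i / ε * (2 * W x (a i) - 2 * W x (b i))) ∈ fieldSpan W U := by
    have := (fieldSpan W U).sum_mem (t := Finset.univ) fun i _ => hXi i
    convert this using 1
    funext x
    rw [Finset.sum_apply]
  set m : Fin ℓ → ℝ := fun i =>
    ∫ x', (2 * W x' (a i) - 2 * W x' (b i)) * (2 * W x' p - 2 * W x' q) ∂Q with hm
  have hrew : ∀ x, ∑ i, s i * ((2 * shiftedField Q W p q x (a i)
        - 2 * shiftedField Q W p q x (b i)) / ε)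
      = (∑ i, s i / ε * m i) + ∑ i, s i / ε * (2 * W x (a i) - 2 * W x (b i)) := by
    intro x
    rw [← Finset.sum_add_distrib]
    refine Finset.sum_congr rfl fun i _ => ?_
    rw [shiftedField_inc h hp hq (ha i) (hb i)]
    ring
  simp_rw [hrew, Real.exp_add]
  have hexp := h.integral_exp hX
  refine ⟨hexp.1.const_mul _, ?_⟩
  rw [integral_const_mul, hexp.2, ← Real.exp_add]
  refine Real.exp_le_exp.2 ?_
  have hC0 : 0 ≤ C := by linarith [hC.one_le]
  have hmi : ∀ i, |m i| ≤ 8 * C * ε := by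
    intro i
    have c1 := hC.cov_le p hp (a i) (ha i) (b i) (hb i) ((hd i).trans hε1)
    have c2 := hC.cov_le q hq (a i) (ha i) (b i) (hb i) ((hd i).trans hε1)
    have hinc : (fun x => W x (a i) - W x (b i)) ∈ fieldSpan W U :=
      sub_mem (eval_mem_fieldSpan (ha i)) (eval_mem_fieldSpan (hb i))
    have e : m i = 4 * ∫ x, W x p * (W x (a i) - W x (b i)) ∂Q
        - 4 * ∫ x, W x q * (W x (a i) - W x (b i)) ∂Q := by
      rw [← integral_const_mul, ← integral_const_mul, ← integral_sub
        ((h.integrable_mul (eval_mem_fieldSpan hp) hinc).const_mul 4)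
        ((h.integrable_mul (eval_mem_fieldSpan hq) hinc).const_mul 4)]
      simp only [hm]
      congr 1
      funext x
      ring
    have c3 : C * hypDist (a i) (b i) ≤ C * ε := by gcongr; exact hd i
    rw [abs_le] at c1 c2 ⊢
    constructor <;> linarith
  have b1 : ∑ i, s i / ε * m i ≤ 8 * C * ℓ := by
    have : ∀ i, s i / ε * m i ≤ 8 * C := by
      intro i
      refine (le_abs_self _).trans ?_
      rw [abs_mul, abs_div, abs_of_pos hε, div_mul_eq_mul_div, div_le_iff₀ hε]
      calc |s i| * |m i| ≤ 1 * (8 * C * ε) := by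
            gcongr
            · exact hs i
            · exact hmi i
        _ = _ := by ring
    calc ∑ i, s i / ε * m i ≤ ∑ _i : Fin ℓ, 8 * C := Finset.sum_le_sum fun i _ => this i
      _ = _ := by simp; ring
  have hinc : ∀ i, (fun x => W x (a i) - W x (b i)) ∈ fieldSpan W U := fun i =>
    sub_mem (eval_mem_fieldSpan (ha i)) (eval_mem_fieldSpan (hb i))
  have b2 : ∫ x, (∑ i, s i / ε * (2 * W x (a i) - 2 * W x (b i))) ^ 2 ∂Q ≤ 4 * C * ℓ ^ 2 := by
    have hsq : ∀ i, Integrable (fun x => (W x (a i) - W x (b i)) ^ 2) Q := fun i => by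
      simpa only [sq] using h.integrable_mul (hinc i) (hinc i)
    have hpt : ∀ x, (∑ i, s i / ε * (2 * W x (a i) - 2 * W x (b i))) ^ 2
        ≤ ∑ i, ℓ * (4 / ε ^ 2 * (W x (a i) - W x (b i)) ^ 2) := by
      intro x
      have := sq_sum_le_card_mul_sum_sq (s := Finset.univ)
        (f := fun i => s i / ε * (2 * W x (a i) - 2 * W x (b i)))
      rw [Finset.card_fin] at this
      refine this.trans ?_
      rw [Finset.mul_sum]
      refine Finset.sum_le_sum fun i _ => mul_le_mul_of_nonneg_left ?_ (by positivity)
      have h1 : s i ^ 2 ≤ 1 := by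
        rw [← sq_abs]; exact pow_le_one₀ (abs_nonneg _) (hs i)
      have h2 : (s i / ε * (2 * W x (a i) - 2 * W x (b i))) ^ 2
          = s i ^ 2 * (4 / ε ^ 2 * (W x (a i) - W x (b i)) ^ 2) := by
        field_simp
        ring
      rw [h2]
      exact mul_le_of_le_one_left (by positivity) h1
    have hI : Integrable (fun x => ∑ i, (ℓ : ℝ) * (4 / ε ^ 2 * (W x (a i) - W x (b i)) ^ 2)) Q :=
      integrable_finsetSum _ fun i _ => ((hsq i).const_mul _).const_mul _
    refine (integral_mono (by simpa only [sq] using h.integrable_mul hX hX) hI hpt).trans ?_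
    rw [integral_finsetSum _ fun i _ => ((hsq i).const_mul _).const_mul _]
    have : ∀ i, ∫ x, (ℓ : ℝ) * (4 / ε ^ 2 * (W x (a i) - W x (b i)) ^ 2) ∂Q ≤ ℓ * (4 * C) := by
      intro i
      rw [integral_const_mul, integral_const_mul]
      refine mul_le_mul_of_nonneg_left ?_ (by positivity)
      have h1 := hC.sq_le (a i) (ha i) (b i) (hb i) ((hd i).trans hε1)
      have h2 : C * hypDist (a i) (b i) ^ 2 ≤ C * ε ^ 2 := by
        have := hd0 i
        have := hd i
        gcongr
      calc 4 / ε ^ 2 * ∫ x, (W x (a i) - W x (b i)) ^ 2 ∂Q ≤ 4 / ε ^ 2 * (C * ε ^ 2) := by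
            gcongr; linarith
        _ = 4 * C := by field_simp
    calc _ ≤ ∑ _i : Fin ℓ, (ℓ : ℝ) * (4 * C) := Finset.sum_le_sum fun i _ => this i
      _ = _ := by simp; ring
  have : 0 ≤ C * (ℓ : ℝ) ^ 2 := by positivity
  linarith

lemma IncrementBound.integral_prod_cosh_le {C : ℝ} (hC : IncrementBound Q W U C)
    (h : IsCenteredGaussianField Q W U)
    {p q : ℂ} (hp : p ∈ U) (hq : q ∈ U) {ℓ : ℕ} {a b : Fin ℓ → ℂ} (ha : ∀ i, a i ∈ U)
    (hb : ∀ i, b i ∈ U) {ε : ℝ} (hε : 0 < ε) (hε1 : ε ≤ 1) (hd : ∀ i, hypDist (a i) (b i) ≤ ε)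
    (hd0 : ∀ i, 0 ≤ hypDist (a i) (b i)) :
    Integrable (fun x => ∏ i, Real.cosh ((2 * shiftedField Q W p q x (a i)
        - 2 * shiftedField Q W p q x (b i)) / ε)) Q ∧
    ∫ x, ∏ i, Real.cosh ((2 * shiftedField Q W p q x (a i)
        - 2 * shiftedField Q W p q x (b i)) / ε) ∂Q ≤ Real.exp (8 * C * (ℓ + ℓ ^ 2)) := by
  have key := fun σ : Fin ℓ → SignType => hC.integral_exp_sign_le h hp hq ha hb hε hε1 hd hd0
    (fun i => (σ i : ℝ)) (fun i => abs_signType_le _)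
  simp_rw [← sum_coshCoef, prod_sum_exp (fun _ => coshCoef)]
  refine ⟨integrable_finsetSum _ fun σ _ => (key σ).1.const_mul _, ?_⟩
  rw [integral_finsetSum _ fun σ _ => (key σ).1.const_mul _]
  simp_rw [integral_const_mul]
  calc _ ≤ ∑ σ : Fin ℓ → SignType, (∏ i, coshCoef (σ i)) * Real.exp (8 * C * (ℓ + ℓ ^ 2)) := by
        refine Finset.sum_le_sum fun σ _ => mul_le_mul_of_nonneg_left (key σ).2 ?_
        exact Finset.prod_nonneg fun i _ => coshCoef_nonneg _
    _ = _ := by rw [← Finset.sum_mul, sum_sum_coshCoef, one_mul]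

lemma aemeasurable_shiftedField (h : IsCenteredGaussianField Q W U) {p q z : ℂ} (hz : z ∈ U) :
    AEMeasurable (fun x => shiftedField Q W p q x z) Q :=
  (h.hasGaussianLaw (eval_mem_fieldSpan hz)).aemeasurable.const_add _

lemma IncrementBound.momLE_shiftedField {C : ℝ} (hC : IncrementBound Q W U C)
    (h : IsCenteredGaussianField Q W U) {p q : ℂ} (hp : p ∈ U) (hq : q ∈ U) {ℓ : ℕ} (hℓ : 1 ≤ ℓ)
    {a b : ℂ} (ha : a ∈ U) (hb : b ∈ U) {ε : ℝ} (hε : 0 < ε) (hε1 : ε ≤ 1)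
    (hd : hypDist a b ≤ ε) (hd0 : 0 ≤ hypDist a b) :
    MomLE Q (2 * ℓ) (fun x => shiftedField Q W p q x a - shiftedField Q W p q x b)
      ((2 * ℓ).factorial * Real.exp (16 * C) * ε) := by
  have hP := (h.hasGaussianLaw (eval_mem_fieldSpan ha)).isProbabilityMeasure
  have key := hC.integral_prod_cosh_le h hp hq (ℓ := 1) (a := fun _ => a) (b := fun _ => b)
    (fun _ => ha) (fun _ => hb) hε hε1 (fun _ => hd) (fun _ => hd0)
  simp only [Finset.univ_unique, Finset.prod_const, Finset.card_singleton, pow_one, Nat.cast_one,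
    one_pow] at key
  set Y : E → ℝ := fun x =>
    (2 * shiftedField Q W p q x a - 2 * shiftedField Q W p q x b) / ε with hY
  have hYm : AEStronglyMeasurable Y Q :=
    ((((aemeasurable_shiftedField h ha).const_mul 2).sub
      ((aemeasurable_shiftedField h hb).const_mul 2)).div_const ε).aestronglyMeasurable
  set Λ : ℝ := (2 * ℓ).factorial * Real.exp (16 * C) with hΛ
  have hC1 := hC.one_le
  have hΛ1 : 1 ≤ Λ := by
    have h1 : (1 : ℝ) ≤ (2 * ℓ).factorial := by
      exact_mod_cast Nat.one_le_iff_ne_zero.2 (Nat.factorial_ne_zero _)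
    have h2 : 1 ≤ Real.exp (16 * C) := Real.one_le_exp (by linarith)
    rw [hΛ]; nlinarith
  have hmom : MomLE Q (2 * ℓ) Y Λ := by
    refine MomLE.of_cosh hℓ hYm (by linarith) (key.1.sub (integrable_const 1)) ?_
    rw [integral_sub key.1 (integrable_const 1)]
    have h3 : (∫ x, Real.cosh (Y x) ∂Q) - ∫ _x, (1 : ℝ) ∂Q ≤ Real.exp (16 * C) := by
      have := key.2
      have e : 8 * C * (1 + 1) = 16 * C := by ring
      rw [e] at this
      simp only [integral_const, probReal_univ, smul_eq_mul, mul_one]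
      linarith
    calc _ ≤ ((2 * ℓ).factorial : ℝ) * Real.exp (16 * C) := by gcongr
      _ = Λ ^ 1 := by rw [pow_one]
      _ ≤ Λ ^ (2 * ℓ) := pow_le_pow_right₀ hΛ1 (by omega)
  have := hmom.const_mul (c := ε / 2) (by positivity)
  refine MomLE.of_abs_le (this.mono (Λ' := Λ * ε) (by nlinarith)) ?_ ?_
  · exact ((aemeasurable_shiftedField h ha).sub (aemeasurable_shiftedField h hb)).aestronglyMeasurable
  · refine ae_of_all _ fun x => le_of_eq ?_
    congr 1
    simp only [hY]
    field_simp

end Gaussian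

/-! ### Separated points -/

section Separation

/-- The points `x`, `y` of the disk are at relative Euclidean distance at least `τ`: up to
constants, their hyperbolic distance is at least of order `τ`. -/
def Sep (τ : ℝ) (x y : ℂ) : Prop := τ * (ht x + ht y) ≤ ‖x - y‖

lemma Sep.symm {τ : ℝ} {x y : ℂ} (h : Sep τ x y) : Sep τ y x := by
  unfold Sep at *; rw [norm_sub_rev]; linarith

lemma Sep.mono {τ τ' : ℝ} {x y : ℂ} (h : Sep τ x y) (hx : ‖x‖ < 1) (hy : ‖y‖ < 1) (hτ : τ' ≤ τ) :
    Sep τ' x y := by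
  unfold Sep at *
  have := ht_pos hx
  have := ht_pos hy
  nlinarith

lemma Sep.ne {τ : ℝ} {x y : ℂ} (h : Sep τ x y) (hx : ‖x‖ < 1) (hy : ‖y‖ < 1) (hτ : 0 < τ) :
    x ≠ y := by
  rintro rfl
  unfold Sep at h
  have := ht_pos hx
  simp only [sub_self, norm_zero] at h
  nlinarith

lemma Sep.perturb {τ : ℝ} {x y x' y' : ℂ} (h : Sep τ x y) (hx : ‖x‖ < 1) (hy : ‖y‖ < 1)
    (hτ : 0 < τ) (hτ1 : τ ≤ 1) (hx' : ‖x - x'‖ ≤ τ / 8 * ht x) (hy' : ‖y - y'‖ ≤ τ / 8 * ht y) :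
    Sep (τ / 2) x' y' := by
  unfold Sep at *
  have h1 := ht_pos hx
  have h2 := ht_pos hy
  have h3 := ht_sub_le x' x
  have h4 := ht_sub_le y' y
  rw [norm_sub_rev] at h3 h4
  have h5 : ‖x - y‖ ≤ ‖x - x'‖ + ‖x' - y'‖ + ‖y - y'‖ := by
    rw [norm_sub_rev y y']
    calc ‖x - y‖ = ‖(x - x') + (x' - y') + (y' - y)‖ := by ring_nf
      _ ≤ _ := norm_add₃_le
  have h6 : ht x' ≤ 9 / 8 * ht x := by nlinarith
  have h7 : ht y' ≤ 9 / 8 * ht y := by nlinarith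
  nlinarith

lemma sep_of_ht {τ : ℝ} {x y : ℂ} (hy : ‖y‖ < 1) (hτ : 0 < τ) (hτ1 : τ ≤ 1 / 2)
    (h : (1 + 4 * τ) * ht y ≤ ht x) : Sep τ x y := by
  unfold Sep
  have h1 := ht_sub_le x y
  have h2 := ht_pos hy
  nlinarith [mul_le_mul_of_nonneg_left h (show 0 ≤ 1 - τ by linarith),
    mul_nonneg (mul_nonneg hτ.le h2.le) (show 0 ≤ 1 - 2 * τ by linarith)]

lemma IndexedPairing.of_sep {ℓ : ℕ} {p q : ℂ} {c d : Fin ℓ → ℂ} {τ : ℝ} (hτ : 0 < τ)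
    (hτ1 : τ ≤ 1) (hp : ‖p‖ < 1) (hq : ‖q‖ < 1) (hc : ∀ i, ‖c i‖ < 1) (hd : ∀ i, ‖d i‖ < 1)
    (hcd : ∀ i, ‖c i - d i‖ ≤ τ / 8 * ht (c i)) (hcc : ∀ i j, i ≠ j → Sep τ (c i) (c j))
    (hcd' : ∀ i j, i ≠ j → Sep τ (c i) (d j)) (hcp : ∀ i, Sep τ (c i) p)
    (hcq : ∀ i, Sep τ (c i) q) : IndexedPairing p q c d := by
  have key : ∀ i z, ‖z‖ < 1 → Sep τ (c i) z →
      hypDist (c i) (d i) ≤ hypDist (c i) z ∧ hypDist (c i) (d i) ≤ hypDist z (d i) :=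
    fun i z hz hs => hypDist_le_of_sep (hc i) (hd i) hz hτ (by linarith) (hcd i) hs
  have hne : ∀ i z, ‖z‖ < 1 → Sep τ (c i) z → d i ≠ z := by
    rintro i z hz hs rfl
    have h1 := hcd i
    unfold Sep at hs
    have := ht_pos (hc i)
    have := ht_pos hz
    nlinarith
  exact
    { inj_left := fun i j hij => by
        by_contra h
        exact (hcc i j h).ne (hc i) (hc j) hτ hij
      inj_right := fun i j hij => by
        by_contra h
        exact hne i (d j) (hd j) (hcd' i j h) hij
      left_ne := fun i => (hcp i).ne (hc i) hp hτ
      right_ne := fun i => hne i q hq (hcq i)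
      le_left := fun i j hij => (key i _ (hc j) (hcc i j hij.symm)).1
      le_left_base := fun i => (key i _ hp (hcp i)).1
      le_right := fun i j hij => (key i _ (hd j) (hcd' i j hij.symm)).2
      le_right_base := fun i => (key i _ hq (hcq i)).2 }

/-- A single pair `(c₀, d₀)`, completed by coinciding pairs. -/
lemma IndexedPairing.cons {k : ℕ} {p q c₀ d₀ : ℂ} {f : Fin k → ℂ} (hf : Function.Injective f)
    (hf1 : ∀ i, ‖f i‖ < 1) (hp : ‖p‖ < 1) (hq : ‖q‖ < 1) (hc : ‖c₀‖ < 1) (hd : ‖d₀‖ < 1)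
    (hfp : ∀ i, f i ≠ p) (hfq : ∀ i, f i ≠ q) (hfc : ∀ i, f i ≠ c₀) (hfd : ∀ i, f i ≠ d₀)
    (hcp : c₀ ≠ p) (hdq : d₀ ≠ q) (h1 : ∀ i, hypDist c₀ d₀ ≤ hypDist c₀ (f i))
    (h2 : ∀ i, hypDist c₀ d₀ ≤ hypDist (f i) d₀) (h3 : hypDist c₀ d₀ ≤ hypDist c₀ p)
    (h4 : hypDist c₀ d₀ ≤ hypDist q d₀) :
    IndexedPairing p q (Fin.cons c₀ f : Fin (k + 1) → ℂ) (Fin.cons d₀ f : Fin (k + 1) → ℂ) := by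
  have inj : ∀ e : ℂ, (∀ i, f i ≠ e) →
      Function.Injective (Fin.cons e f : Fin (k + 1) → ℂ) := by
    intro e he
    rw [Fin.cons_injective_iff]
    exact ⟨fun ⟨i, hi⟩ => he i hi, hf⟩
  refine ⟨inj _ hfc, inj _ hfd, ?_, ?_, ?_, ?_, ?_, ?_⟩
  · exact Fin.cases (by simpa using hcp) (fun i => by simpa using hfp i)
  · exact Fin.cases (by simpa using hdq) (fun i => by simpa using hfq i)
  · refine Fin.cases ?_ fun i => ?_
    · refine Fin.cases (by simp) fun j _ => ?_
      simpa using h1 j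
    · refine Fin.cases ?_ fun j => ?_
      · intro _
        simp only [Fin.cons_succ, Fin.cons_zero, hypDist_self]
        exact hypDist_nonneg (hf1 i) hc
      · intro _
        simp only [Fin.cons_succ, hypDist_self]
        exact hypDist_nonneg (hf1 i) (hf1 j)
  · refine Fin.cases (by simpa using h3) fun i => ?_
    simp only [Fin.cons_succ, hypDist_self]
    exact hypDist_nonneg (hf1 i) hp
  · refine Fin.cases ?_ fun i => ?_
    · refine Fin.cases (by simp) fun j _ => ?_
      simpa using h2 j
    · refine Fin.cases ?_ fun j => ?_
      · intro _
        simp only [Fin.cons_succ, Fin.cons_zero, hypDist_self]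
        exact hypDist_nonneg hd (hf1 i)
      · intro _
        simp only [Fin.cons_succ, hypDist_self]
        exact hypDist_nonneg (hf1 j) (hf1 i)
  · refine Fin.cases (by simpa using h4) fun i => ?_
    simp only [Fin.cons_succ, hypDist_self]
    exact hypDist_nonneg hq (hf1 i)

end Separation

/-! ### Comparison of biased exponential moments -/

section Comparison

variable {S E : Type*} [MeasurableSpace S] [MeasurableSpace E]

/-- The exponential moments of the fields `F`, `W` under the perturbations of the bias
`2 F(p) - 2 F(q)` by `ℓ` admissible pairs in `D` agree up to the relative error `κ`. -/
structure BiasComparison (P : Measure S) (Q : Measure E) (F : S → ℂ → ℝ) (W : E → ℂ → ℝ)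
    (D : Set ℂ) (p q : ℂ) (ℓ : ℕ) (κ : ℝ) : Prop where
  integrable : ∀ c d : Fin ℓ → ℂ, (∀ i, c i ∈ D) → (∀ i, d i ∈ D) → IndexedPairing p q c d →
    Integrable (fun x => Real.exp ((2 * F x p - 2 * F x q)
      + ∑ i, (2 * F x (c i) - 2 * F x (d i)))) P
  close : ∀ c d : Fin ℓ → ℂ, (∀ i, c i ∈ D) → (∀ i, d i ∈ D) → IndexedPairing p q c d →
    |∫ x, Real.exp ((2 * F x p - 2 * F x q) + ∑ i, (2 * F x (c i) - 2 * F x (d i))) ∂P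
      - ∫ x, Real.exp ((2 * W x p - 2 * W x q) + ∑ i, (2 * W x (c i) - 2 * W x (d i))) ∂Q|
      ≤ κ * ∫ x, Real.exp ((2 * W x p - 2 * W x q) + ∑ i, (2 * W x (c i) - 2 * W x (d i))) ∂Q

/-- The exponential moments of `ℓ` increments of the fields `F`, `G` over admissible pairs in `D`
agree up to the relative error `κ`. -/
structure IncrementComparison (ν : Measure S) (Q : Measure E) (F : S → ℂ → ℝ) (G : E → ℂ → ℝ)
    (D : Set ℂ) (p q : ℂ) (ℓ : ℕ) (κ : ℝ) : Prop where
  integrable : ∀ c d : Fin ℓ → ℂ, (∀ i, c i ∈ D) → (∀ i, d i ∈ D) → IndexedPairing p q c d →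
    Integrable (fun x => Real.exp (∑ i, (2 * F x (c i) - 2 * F x (d i)))) ν
  close : ∀ c d : Fin ℓ → ℂ, (∀ i, c i ∈ D) → (∀ i, d i ∈ D) → IndexedPairing p q c d →
    |∫ x, Real.exp (∑ i, (2 * F x (c i) - 2 * F x (d i))) ∂ν
      - ∫ x, Real.exp (∑ i, (2 * G x (c i) - 2 * G x (d i))) ∂Q|
      ≤ κ * ∫ x, Real.exp (∑ i, (2 * G x (c i) - 2 * G x (d i))) ∂Q

/-- The probability measure biased by `e^{2 F(p) - 2 F(q)}`. -/
noncomputable def biasedMeasure (P : Measure S) (F : S → ℂ → ℝ) (p q : ℂ) : Measure S :=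
  P.tilted fun x => 2 * F x p - 2 * F x q

variable {P : Measure S} {Q : Measure E} {F : S → ℂ → ℝ} {W : E → ℂ → ℝ} {U D : Set ℂ}
  {p q : ℂ} {ℓ : ℕ} {κ : ℝ}

/-- Normalization turns a comparison of exponential moments under the biases into a comparison of
exponential moments under the biased measures. The normalizing constants are compared by means of
the coinciding pairs `(f i, f i)`. -/
lemma BiasComparison.incrementComparison (h : BiasComparison P Q F W D p q ℓ κ)
    (hW : IsCenteredGaussianField Q W U) (hp : p ∈ U) (hq : q ∈ U) (hD : D ⊆ U) (hκ : κ ≤ 1 / 2)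
    {f : Fin ℓ → ℂ} (hf : ∀ i, f i ∈ D) (hf' : IndexedPairing p q f f) :
    Integrable (fun x => Real.exp (2 * F x p - 2 * F x q)) P ∧
    1 / 2 * ∫ x, Real.exp (2 * W x p - 2 * W x q) ∂Q ≤ ∫ x, Real.exp (2 * F x p - 2 * F x q) ∂P ∧
    IncrementComparison (biasedMeasure P F p q) Q F (shiftedField Q W p q) D p q ℓ (4 * κ) := by
  have h1 := h.integrable f f hf hf hf'
  have h2 := h.close f f hf hf hf'
  simp only [sub_self, Finset.sum_const_zero, add_zero] at h1 h2
  have hZ : 0 < ∫ x, Real.exp (2 * W x p - 2 * W x q) ∂Q := by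
    rw [(hW.integral_exp (inc_mem_fieldSpan hp hq)).2]
    exact Real.exp_pos _
  set Z := ∫ x, Real.exp (2 * W x p - 2 * W x q) ∂Q with hZdef
  set Y := ∫ x, Real.exp (2 * F x p - 2 * F x q) ∂P with hYdef
  have hκ0 : 0 ≤ κ := by
    by_contra hneg
    have := abs_nonneg (Y - Z)
    nlinarith
  have hY : 1 / 2 * Z ≤ Y := by
    have := (abs_le.1 h2).1
    nlinarith
  have hYpos : 0 < Y := by linarith
  refine ⟨h1, hY, ?_, ?_⟩
  · intro c d hc hd hcd
    unfold biasedMeasure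
    rw [integrable_tilted_iff h1]
    refine (h.integrable c d hc hd hcd).congr (ae_of_all _ fun x => ?_)
    simp only [smul_eq_mul]
    rw [Real.exp_add]
  · intro c d hc hd hcd
    have h3 := h.close c d hc hd hcd
    rw [integral_exp_bias_add hW hp hq (fun i => hD (hc i)) (fun i => hD (hd i))] at h3
    unfold biasedMeasure
    rw [integral_tilted]
    set A := ∫ x, Real.exp (∑ i, (2 * shiftedField Q W p q x (c i)
      - 2 * shiftedField Q W p q x (d i))) ∂Q with hA
    have hA0 : 0 ≤ A := integral_nonneg fun x => (Real.exp_pos _).le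
    have e : ∫ x, (Real.exp (2 * F x p - 2 * F x q) / ∫ x, Real.exp (2 * F x p - 2 * F x q) ∂P) •
        Real.exp (∑ i, (2 * F x (c i) - 2 * F x (d i))) ∂P
        = (∫ x, Real.exp ((2 * F x p - 2 * F x q) + ∑ i, (2 * F x (c i) - 2 * F x (d i))) ∂P)
          / Y := by
      rw [← integral_div]
      congr 1
      funext x
      rw [Real.exp_add, smul_eq_mul]
      ring
    rw [e]
    set X := ∫ x, Real.exp ((2 * F x p - 2 * F x q) + ∑ i, (2 * F x (c i) - 2 * F x (d i))) ∂P
    rw [← hZdef] at h3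
    have e2 : X / Y - A = ((X - Z * A) - A * (Y - Z)) / Y := by
      field_simp
      ring
    rw [e2, abs_div, abs_of_pos hYpos, div_le_iff₀ hYpos]
    calc |X - Z * A - A * (Y - Z)| ≤ |X - Z * A| + |A * (Y - Z)| := abs_sub _ _
      _ ≤ κ * (Z * A) + A * (κ * Z) := by
          rw [abs_mul, abs_of_nonneg hA0]
          gcongr
      _ = 2 * κ * Z * A := by ring
      _ ≤ 4 * κ * A * Y := by nlinarith [mul_nonneg hκ0 hA0]

variable {ν : Measure S} {C : ℝ}

/-- The exponential moments of increments over separated short pairs agree. -/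
lemma IncrementComparison.expMomentsClose
    (h : IncrementComparison ν Q F (shiftedField Q W p q) D p q ℓ κ) (hκ : 0 ≤ κ)
    (hC : IncrementBound Q W U C) (hW : IsCenteredGaussianField Q W U)
    (hU : U ⊆ Metric.ball (0 : ℂ) 1) (hD : D ⊆ U) (hp : p ∈ U) (hq : q ∈ U)
    {τ s : ℝ} (hτ : 0 < τ) (hτ1 : τ ≤ 1) (hs : 0 < s) (hsτ : s ≤ τ / 32)
    {a b : Fin ℓ → ℂ} (ha : ∀ i, a i ∈ D) (hb : ∀ i, b i ∈ D)
    (hab : ∀ i, ‖a i - b i‖ ≤ s * ht (a i)) (haa : ∀ i j, i ≠ j → Sep τ (a i) (a j))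
    (hap : ∀ i, Sep τ (a i) p) (haq : ∀ i, Sep τ (a i) q) :
    ExpMomentsClose ν Q (fun i x => 2 * F x (a i) - 2 * F x (b i))
      (fun i x => 2 * shiftedField Q W p q x (a i) - 2 * shiftedField Q W p q x (b i))
      (κ * Real.exp (8 * C * (ℓ + ℓ ^ 2))) := by
  have hn : ∀ {z}, z ∈ U → ‖z‖ < 1 := fun hz => by simpa using hU hz
  have han := fun i => hn (hD (ha i))
  have hbn := fun i => hn (hD (hb i))
  have hpn := hn hp
  have hqn := hn hq
  set c : (Fin ℓ → SignType) → Fin ℓ → ℂ := fun σ i => if σ i = -1 then b i else a i with hc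
  set d : (Fin ℓ → SignType) → Fin ℓ → ℂ := fun σ i => if σ i = 1 then b i else a i with hd
  have hcD : ∀ σ i, c σ i ∈ D := fun σ i => by
    simp only [hc]; split_ifs; exacts [hb i, ha i]
  have hdD : ∀ σ i, d σ i ∈ D := fun σ i => by
    simp only [hd]; split_ifs; exacts [hb i, ha i]
  have hnear : ∀ i, ‖a i - b i‖ ≤ τ / 8 * ht (a i) := fun i =>
    (hab i).trans (mul_le_mul_of_nonneg_right (by linarith) (ht_pos (han i)).le)
  have hnear0 : ∀ i, ‖a i - a i‖ ≤ τ / 8 * ht (a i) := fun i => by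
    rw [sub_self, norm_zero]; exact mul_nonneg (by linarith) (ht_pos (han i)).le
  have hca : ∀ σ i, ‖a i - c σ i‖ ≤ τ / 8 * ht (a i) := fun σ i => by
    simp only [hc]; split_ifs; exacts [hnear i, hnear0 i]
  have hda : ∀ σ i, ‖a i - d σ i‖ ≤ τ / 8 * ht (a i) := fun σ i => by
    simp only [hd]; split_ifs; exacts [hnear i, hnear0 i]
  have hpair : ∀ σ, IndexedPairing p q (c σ) (d σ) := by
    intro σ
    refine IndexedPairing.of_sep (τ := τ / 2) (by linarith) (by linarith) hpn hqn
      (fun i => hn (hD (hcD σ i))) (fun i => hn (hD (hdD σ i))) (fun i => ?_)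
      (fun i j hij => (haa i j hij).perturb (han i) (han j) hτ hτ1 (hca σ i) (hca σ j))
      (fun i j hij => (haa i j hij).perturb (han i) (han j) hτ hτ1 (hca σ i) (hda σ j))
      (fun i => (hap i).perturb (han i) hpn hτ hτ1 (hca σ i) ?_)
      (fun i => (haq i).perturb (han i) hqn hτ hτ1 (hca σ i) ?_)
    · have h1 : ‖c σ i - d σ i‖ ≤ s * ht (a i) := by
        have h0 : 0 ≤ s * ht (a i) := mul_nonneg hs.le (ht_pos (han i)).le
        simp only [hc, hd]
        split_ifs with h1 h2 h2
        · rw [h1] at h2; exact absurd h2 (by decide)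
        · rw [norm_sub_rev]; exact hab i
        · exact hab i
        · simpa using h0
      have h2 := ht_sub_le (a i) (c σ i)
      have h3 := hca σ i
      have h4 := ht_pos (han i)
      have h5 : 7 / 8 * ht (a i) ≤ ht (c σ i) := by nlinarith
      have h6 : s * ht (a i) ≤ τ / 32 * ht (a i) := by gcongr
      have h7 : τ / 16 * (7 / 8 * ht (a i)) ≤ τ / 16 * ht (c σ i) := by gcongr
      have h8 : 0 ≤ τ * ht (a i) := by positivity
      linarith
    · rw [sub_self, norm_zero]; exact mul_nonneg (by linarith) (ht_pos hpn).le
    · rw [sub_self, norm_zero]; exact mul_nonneg (by linarith) (ht_pos hqn).le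
  have hsum : ∀ (Φ : ℂ → ℝ) (σ : Fin ℓ → SignType),
      ∑ i, (2 * Φ (c σ i) - 2 * Φ (d σ i)) = ∑ i, (σ i : ℝ) * (2 * Φ (a i) - 2 * Φ (b i)) := by
    intro Φ σ
    refine Finset.sum_congr rfl fun i _ => ?_
    simp only [hc, hd]
    rcases SignType.trichotomy (σ i) with h1 | h1 | h1 <;> simp [h1]
  have hG := fun σ : Fin ℓ → SignType => hC.integral_exp_sign_le hW hp hq
    (fun i => hD (ha i)) (fun i => hD (hb i)) (ε := 3 * s) (by linarith) (by linarith)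
    (fun i => hypDist_le_of_norm_sub_le (han i) (hbn i) (by linarith) (hab i))
    (fun i => hypDist_nonneg (han i) (hbn i)) (fun i => (σ i : ℝ) * (3 * s)) (fun i => by
      rw [abs_mul, abs_of_pos (show 0 < 3 * s by linarith)]
      have := abs_signType_le (σ i)
      nlinarith)
  have hcancel : ∀ (σ : Fin ℓ → SignType) x, ∑ i, (σ i : ℝ) * (3 * s) *
      ((2 * shiftedField Q W p q x (a i) - 2 * shiftedField Q W p q x (b i)) / (3 * s))
      = ∑ i, (σ i : ℝ) *
        (2 * shiftedField Q W p q x (a i) - 2 * shiftedField Q W p q x (b i)) := by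
    intro σ x
    refine Finset.sum_congr rfl fun i _ => ?_
    field_simp
  simp only [hcancel] at hG
  refine ⟨fun σ => ?_, fun σ => (hG σ).1, fun σ => ?_⟩
  · have := h.integrable _ _ (hcD σ) (hdD σ) (hpair σ)
    simpa only [hsum] using this
  · have := h.close _ _ (hcD σ) (hdD σ) (hpair σ)
    simp only [hsum] at this
    exact this.trans (mul_le_mul_of_nonneg_left (hG σ).2 hκ)

/-- Products of increments over separated short pairs have nearly the same expectations. -/
lemma IncrementComparison.abs_integral_prod_sub_le
    (h : IncrementComparison ν Q F (shiftedField Q W p q) D p q ℓ κ) (hκ : 0 ≤ κ)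
    (hC : IncrementBound Q W U C) (hW : IsCenteredGaussianField Q W U)
    (hU : U ⊆ Metric.ball (0 : ℂ) 1) (hD : D ⊆ U) (hp : p ∈ U) (hq : q ∈ U)
    (hF : ∀ z ∈ U, AEMeasurable (fun x => F x z) ν)
    {τ s : ℝ} (hτ : 0 < τ) (hτ1 : τ ≤ 1) (hs : 0 < s) (hsτ : s ≤ τ / 32)
    {a b : Fin ℓ → ℂ} (ha : ∀ i, a i ∈ D) (hb : ∀ i, b i ∈ D)
    (hab : ∀ i, ‖a i - b i‖ ≤ s * ht (a i)) (haa : ∀ i j, i ≠ j → Sep τ (a i) (a j))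
    (hap : ∀ i, Sep τ (a i) p) (haq : ∀ i, Sep τ (a i) q) :
    |∫ x, ∏ i, (2 * F x (a i) - 2 * F x (b i)) ∂ν
      - ∫ x, ∏ i, (2 * shiftedField Q W p q x (a i) - 2 * shiftedField Q W p q x (b i)) ∂Q|
      ≤ (4 * ℓ * 3 ^ ℓ + 1) * Real.exp (8 * C * (ℓ + ℓ ^ 2)) *
        ((3 * s) ^ (ℓ + 1) + κ / (3 * s) ^ ℓ) := by
  have hn : ∀ {z}, z ∈ U → ‖z‖ < 1 := fun hz => by simpa using hU hz
  have han := fun i => hn (hD (ha i))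
  have hbn := fun i => hn (hD (hb i))
  have h1 := h.expMomentsClose hκ hC hW hU hD hp hq hτ hτ1 hs hsτ ha hb hab haa hap haq
  have hK := hC.integral_prod_cosh_le hW hp hq
    (fun i => hD (ha i)) (fun i => hD (hb i)) (ε := 3 * s) (by linarith) (by linarith)
    (fun i => hypDist_le_of_norm_sub_le (han i) (hbn i) (by linarith) (hab i))
    (fun i => hypDist_nonneg (han i) (hbn i))
  have h2 := (h1.abs_integral_prod_sub_le_of_cosh (ε := 3 * s) (by linarith) (by linarith)
    (fun i => ((hF _ (hD (ha i))).const_mul 2).sub ((hF _ (hD (hb i))).const_mul 2))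
    (fun i => ((aemeasurable_shiftedField hW (hD (ha i))).const_mul 2).sub
      ((aemeasurable_shiftedField hW (hD (hb i))).const_mul 2)) hK.1 hK.2).2.2
  refine h2.trans (le_of_eq ?_)
  ring

/-- The increment over a single short pair, separated from the base points and from the auxiliary
points `f i`, has small moments. -/
lemma IncrementComparison.momLE_of_sep [IsProbabilityMeasure ν] [IsProbabilityMeasure Q] {k : ℕ}
    (h : IncrementComparison ν Q F (shiftedField Q W p q) D p q (k + 1) κ) (hκ : 0 ≤ κ)
    (hC : IncrementBound Q W U C) (hW : IsCenteredGaussianField Q W U)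
    (hU : U ⊆ Metric.ball (0 : ℂ) 1) (hD : D ⊆ U) (hp : p ∈ U) (hq : q ∈ U)
    (hF : ∀ z ∈ U, AEMeasurable (fun x => F x z) ν)
    {τ s : ℝ} (hτ : 0 < τ) (hτ1 : τ ≤ 1) (hs : 0 < s) (hsτ : s ≤ τ / 32)
    {a b : ℂ} {f : Fin k → ℂ} (ha : a ∈ D) (hb : b ∈ D) (hf : ∀ i, f i ∈ D)
    (hab : ‖a - b‖ ≤ s * ht a) (haf : ∀ i, Sep τ a (f i)) (hff : ∀ i j, i ≠ j → Sep τ (f i) (f j))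
    (hap : Sep τ a p) (haq : Sep τ a q) (hfp : ∀ i, Sep τ (f i) p) (hfq : ∀ i, Sep τ (f i) q)
    {Λ : ℝ} (hΛ0 : 0 ≤ Λ)
    (hΛ : (2 * (k + 1)).factorial * (Real.exp (32 * C * (k + 2) ^ 2) * (9 * s ^ 2 + κ))
      ≤ Λ ^ (2 * (k + 1))) :
    MomLE ν (2 * (k + 1)) (fun x => F x a - F x b) Λ := by
  have hn : ∀ {z}, z ∈ U → ‖z‖ < 1 := fun hz => by simpa using hU hz
  have han := hn (hD ha)
  have hbn := hn (hD hb)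
  have hC1 := hC.one_le
  have h1 := h.expMomentsClose (a := Fin.cons a f) (b := Fin.cons b f) hκ hC hW hU hD hp hq
    hτ hτ1 hs hsτ (Fin.cases (by simpa using ha) fun i => by simpa using hf i)
    (Fin.cases (by simpa using hb) fun i => by simpa using hf i)
    (Fin.cases (by simpa using hab) fun i => by
      simpa using mul_nonneg hs.le (ht_pos (hn (hD (hf i)))).le)
    (by
      refine Fin.cases ?_ fun i => ?_
      · refine Fin.cases (by simp) fun j _ => ?_
        simpa using haf j
      · refine Fin.cases (fun _ => ?_) fun j hij => ?_
        · simpa using (haf i).symm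
        · simpa using hff i j (fun e => hij (by rw [e])))
    (Fin.cases (by simpa using hap) fun i => by simpa using hfp i)
    (Fin.cases (by simpa using haq) fun i => by simpa using hfq i)
  set X : S → ℝ := fun x => 2 * F x a - 2 * F x b with hX
  set Y : E → ℝ := fun x => 2 * shiftedField Q W p q x a - 2 * shiftedField Q W p q x b with hY
  set K := Real.exp (8 * C * ((k + 1 : ℕ) + (k + 1 : ℕ) ^ 2)) with hKdef
  have hKle : K ≤ Real.exp (32 * C * (k + 2) ^ 2) := by
    refine Real.exp_le_exp.2 ?_
    push_cast
    have : 0 ≤ C * ((k : ℝ) + 2) ^ 2 := by positivity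
    nlinarith [mul_nonneg (by linarith : 0 ≤ C) (Nat.cast_nonneg (α := ℝ) k),
      mul_nonneg (by linarith : 0 ≤ C) (sq_nonneg (k : ℝ))]
  have hK1 : 1 ≤ K := Real.one_le_exp (by positivity)
  have e1 : ∀ (t : SignType) (x : S), ∑ i, ((Fin.cons t (fun _ => 0) : Fin (k + 1) → SignType) i : ℝ)
      * (2 * F x ((Fin.cons a f : Fin (k + 1) → ℂ) i)
        - 2 * F x ((Fin.cons b f : Fin (k + 1) → ℂ) i)) = (t : ℝ) * X x := by
    intro t x
    rw [Fin.sum_univ_succ]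
    simp [hX]
  have e2 : ∀ (t : SignType) (x : E), ∑ i, ((Fin.cons t (fun _ => 0) : Fin (k + 1) → SignType) i : ℝ)
      * (2 * shiftedField Q W p q x ((Fin.cons a f : Fin (k + 1) → ℂ) i)
        - 2 * shiftedField Q W p q x ((Fin.cons b f : Fin (k + 1) → ℂ) i)) = (t : ℝ) * Y x := by
    intro t x
    rw [Fin.sum_univ_succ]
    simp [hY]
  have iX := fun t : SignType => h1.integrable_left (Fin.cons t fun _ => 0)
  have iY := fun t : SignType => h1.integrable_right (Fin.cons t fun _ => 0)
  have cl := fun t : SignType => h1.close (Fin.cons t fun _ => 0)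
  simp only [e1] at iX cl
  simp only [e2] at iY cl
  have ip := iX 1
  have im := iX (-1)
  have jp := iY 1
  have jm := iY (-1)
  have cp := cl 1
  have cm := cl (-1)
  simp only [SignType.coe_one, SignType.coe_neg_one, one_mul, neg_one_mul] at ip im jp jm cp cm
  have hXm : AEStronglyMeasurable X ν :=
    (((hF _ (hD ha)).const_mul 2).sub ((hF _ (hD hb)).const_mul 2)).aestronglyMeasurable
  have ic : Integrable (fun x => Real.cosh (X x)) ν := by
    simp_rw [Real.cosh_eq]; exact (ip.add im).div_const 2
  have jc : Integrable (fun x => Real.cosh (Y x)) Q := by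
    simp_rw [Real.cosh_eq]; exact (jp.add jm).div_const 2
  have hcosh : ∫ x, Real.cosh (X x) ∂ν ≤ ∫ x, Real.cosh (Y x) ∂Q + κ * K := by
    simp_rw [Real.cosh_eq]
    rw [integral_div, integral_div, integral_add ip im, integral_add jp jm]
    rw [abs_le] at cp cm
    linarith [cp.2, cm.2]
  have hg := hC.integral_prod_cosh_le hW hp hq (ℓ := 1) (a := fun _ => a) (b := fun _ => b)
    (fun _ => hD ha) (fun _ => hD hb) (ε := 3 * s) (by linarith) (by linarith)
    (fun _ => hypDist_le_of_norm_sub_le han hbn (by linarith) hab)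
    (fun _ => hypDist_nonneg han hbn)
  simp only [Finset.univ_unique, Finset.prod_const, Finset.card_singleton, pow_one, Nat.cast_one,
    one_pow] at hg
  have hg2 : ∫ x, (Real.cosh (Y x) - 1) ∂Q ≤ (3 * s) ^ 2 * Real.exp (32 * C * (k + 2) ^ 2) := by
    calc ∫ x, (Real.cosh (Y x) - 1) ∂Q
        ≤ ∫ x, (3 * s) ^ 2 * Real.cosh (Y x / (3 * s)) ∂Q := by
          refine integral_mono (jc.sub (integrable_const 1)) (hg.1.const_mul _) fun x => ?_
          have := cosh_sub_one_le (x := Y x) (ε := 3 * s) (by linarith) (by linarith)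
          refine this.trans ?_
          gcongr
      _ ≤ (3 * s) ^ 2 * Real.exp (32 * C * (k + 2) ^ 2) := by
          rw [integral_const_mul]
          refine mul_le_mul_of_nonneg_left (hg.2.trans (Real.exp_le_exp.2 ?_)) (by positivity)
          have : (4 : ℝ) ≤ (k + 2) ^ 2 := by nlinarith [Nat.cast_nonneg (α := ℝ) k]
          nlinarith
  have hm : MomLE ν (2 * (k + 1)) X Λ := by
    refine MomLE.of_cosh (by omega) hXm hΛ0 (ic.sub (integrable_const 1)) (le_trans ?_ hΛ)
    refine mul_le_mul_of_nonneg_left ?_ (by positivity)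
    rw [integral_sub ic (integrable_const 1)]
    rw [integral_sub jc (integrable_const 1)] at hg2
    simp only [integral_const, probReal_univ, smul_eq_mul, mul_one] at hg2 ⊢
    nlinarith [mul_le_mul_of_nonneg_left hKle hκ]
  refine hm.of_abs_le (((hF _ (hD ha)).sub (hF _ (hD hb))).aestronglyMeasurable)
    (ae_of_all _ fun x => ?_)
  have : X x = 2 * (F x a - F x b) := by simp only [hX]; ring
  rw [this, abs_mul]
  norm_num
  linarith [abs_nonneg (F x a - F x b)]

end Comparison

/-! ### The polar sector -/

section Sector

/-- The point `i (1 - h) e^{iθ}` of the disk, at height `h` over the boundary. -/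
noncomputable def pt (h θ : ℝ) : ℂ :=
  Complex.I * ((1 - h : ℝ) : ℂ) * Complex.exp (Complex.I * (θ : ℂ))

/-- The points `pt h θ` with `b ≤ h ≤ H` and `|θ| ≤ H`. -/
def sector (b H : ℝ) : Set ℂ := {z | ∃ h θ : ℝ, b ≤ h ∧ h ≤ H ∧ |θ| ≤ H ∧ z = pt h θ}

lemma domain_eq_sector (N : ℕ) (δ : ℝ) :
    domain N δ = sector ((N : ℝ) ^ (-1 + δ)) ((N : ℝ) ^ (-δ)) := by
  ext z
  constructor
  · rintro ⟨r, θ, h1, h2, h3, rfl⟩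
    exact ⟨1 - r, θ, by linarith, by linarith, h3, by rw [pt]; congr 3; ring⟩
  · rintro ⟨h, θ, h1, h2, h3, rfl⟩
    exact ⟨1 - h, θ, by linarith, by linarith, h3, rfl⟩

lemma norm_pt {h θ : ℝ} (hh : h ≤ 1) : ‖pt h θ‖ = 1 - h := by
  rw [pt, norm_mul, norm_mul, Complex.norm_I, Complex.norm_real, mul_comm Complex.I (θ : ℂ),
    Complex.norm_exp_ofReal_mul_I, Real.norm_of_nonneg (by linarith)]
  ring

lemma ht_pt {h θ : ℝ} (hh : h ≤ 1) : ht (pt h θ) = h := by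
  rw [ht, norm_pt hh]; ring

lemma norm_pt_sub_pt_le {h h' θ θ' : ℝ} (h0 : 0 ≤ h) (h1 : h ≤ 1) :
    ‖pt h θ - pt h' θ'‖ ≤ |h - h'| + |θ - θ'| := by
  have e : pt h θ - pt h' θ' = Complex.I * ((h' - h : ℝ) : ℂ) * Complex.exp (Complex.I * (θ' : ℂ))
      + Complex.I * ((1 - h : ℝ) : ℂ) * Complex.exp (Complex.I * (θ' : ℂ)) *
        (Complex.exp (Complex.I * ((θ - θ' : ℝ) : ℂ)) - 1) := by
    have : Complex.exp (Complex.I * (θ : ℂ))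
        = Complex.exp (Complex.I * (θ' : ℂ)) * Complex.exp (Complex.I * ((θ - θ' : ℝ) : ℂ)) := by
      rw [← Complex.exp_add]; congr 1; push_cast; ring
    rw [pt, pt, this]
    push_cast
    ring
  rw [e]
  refine (norm_add_le _ _).trans (add_le_add ?_ ?_)
  · rw [norm_mul, norm_mul, Complex.norm_I, Complex.norm_real, mul_comm Complex.I (θ' : ℂ),
      Complex.norm_exp_ofReal_mul_I, Real.norm_eq_abs, abs_sub_comm]
    simp
  · rw [norm_mul, norm_mul, norm_mul, Complex.norm_I, Complex.norm_real,
      mul_comm Complex.I (θ' : ℂ), Complex.norm_exp_ofReal_mul_I,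
      Real.norm_of_nonneg (by linarith)]
    have := Real.norm_exp_I_mul_ofReal_sub_one_le (x := θ - θ')
    rw [Real.norm_eq_abs] at this
    have h2 : (0 : ℝ) ≤ ‖Complex.exp (Complex.I * ((θ - θ' : ℝ) : ℂ)) - 1‖ := norm_nonneg _
    nlinarith

/-- Polar coordinates of the points near `pt h θ`. -/
lemma exists_eq_pt {h θ r : ℝ} {w : ℂ} (h0 : 0 ≤ h) (h1 : h ≤ 1 / 4) (hr : r ≤ 1 / 4)
    (hw : ‖w - pt h θ‖ ≤ r) : ∃ h' θ', w = pt h' θ' ∧ |h' - h| ≤ r ∧ |θ' - θ| ≤ 2 * r := by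
  have hn : ‖pt h θ‖ = 1 - h := norm_pt (by linarith)
  have hne : pt h θ ≠ 0 := by rw [← norm_pos_iff, hn]; linarith
  have hr0 : 0 ≤ r := (norm_nonneg _).trans hw
  set u : ℂ := w / pt h θ - 1 with hu
  have hu1 : ‖u‖ ≤ 4 / 3 * r := by
    have : u = (w - pt h θ) / pt h θ := by rw [hu]; field_simp
    rw [this, norm_div, hn, div_le_iff₀ (by linarith)]
    nlinarith
  have hwu : w = pt h θ * (1 + u) := by rw [hu]; field_simp; ring
  have hlog := Complex.norm_log_one_add_le (z := u) (by linarith)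
  have hlog2 : ‖Complex.log (1 + u)‖ ≤ 2 * r := by
    refine hlog.trans ?_
    have hu0 := norm_nonneg u
    have h3 : (1 - ‖u‖)⁻¹ ≤ 3 / 2 := by
      rw [inv_le_comm₀ (by linarith) (by norm_num)]; linarith
    have h4 : ‖u‖ ^ 2 * (1 - ‖u‖)⁻¹ / 2 ≤ ‖u‖ ^ 2 * (3 / 2) / 2 := by gcongr
    nlinarith
  have hne1 : 1 + u ≠ 0 := by
    intro h0
    have : u = -1 := by linear_combination h0
    rw [this] at hu1
    simp at hu1
    linarith
  have hwn : ‖w‖ ≤ 1 + r := by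
    have := norm_le_norm_add_norm_sub (pt h θ) w
    rw [norm_sub_rev] at this
    linarith
  refine ⟨1 - ‖w‖, θ + (Complex.log (1 + u)).im, ?_, ?_, ?_⟩
  · rw [pt]
    have h5 : ‖w‖ = (1 - h) * ‖1 + u‖ := by rw [hwu, norm_mul, hn]
    have h6 : (1 + u : ℂ) = (‖1 + u‖ : ℝ) *
        Complex.exp (Complex.I * ((Complex.log (1 + u)).im : ℂ)) := by
      rw [Complex.log_im, mul_comm Complex.I]
      exact (Complex.norm_mul_exp_arg_mul_I _).symm
    have h7 : Complex.exp (Complex.I * ((θ + (Complex.log (1 + u)).im : ℝ) : ℂ))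
        = Complex.exp (Complex.I * (θ : ℂ)) *
          Complex.exp (Complex.I * ((Complex.log (1 + u)).im : ℂ)) := by
      rw [← Complex.exp_add]; congr 1; push_cast; ring
    rw [sub_sub_cancel, h5, h7]
    conv_lhs => rw [hwu, h6, pt]
    push_cast
    ring
  · have := abs_norm_sub_norm_le w (pt h θ)
    rw [hn] at this
    rw [show 1 - ‖w‖ - h = -(‖w‖ - (1 - h)) by ring, abs_neg]
    linarith
  · rw [add_sub_cancel_left]
    exact (Complex.abs_im_le_norm _).trans hlog2

lemma closedBall_subset_sector {b H h θ r : ℝ} (h0 : 0 ≤ h) (hr : r ≤ 1 / 4) (hH : H ≤ 1 / 4)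
    (hh : h ≤ H) (h1 : b ≤ h - r) (h2 : h + r ≤ H) (h3 : |θ| + 2 * r ≤ H) :
    Metric.closedBall (pt h θ) r ⊆ sector b H := by
  intro w hw
  rw [Metric.mem_closedBall, dist_eq_norm] at hw
  obtain ⟨h', θ', rfl, h4, h5⟩ := exists_eq_pt h0 (by linarith) hr hw
  rw [abs_le] at h4
  refine ⟨h', θ', by linarith, by linarith, ?_, rfl⟩
  have := abs_add_le (θ' - θ) θ
  rw [sub_add_cancel] at this
  linarith

lemma ht_of_mem_sector {b H : ℝ} (hH : H ≤ 1 / 4) {z : ℂ} (hz : z ∈ sector b H) :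
    b ≤ ht z ∧ ht z ≤ H := by
  obtain ⟨h, θ, h1, h2, -, rfl⟩ := hz
  rw [ht_pt (by linarith)]
  exact ⟨h1, h2⟩

lemma norm_lt_one_of_mem_sector {b H : ℝ} (hb : 0 < b) (hH : H ≤ 1 / 4) {z : ℂ}
    (hz : z ∈ sector b H) : ‖z‖ < 1 := by
  have := (ht_of_mem_sector hH hz).1
  unfold ht at this
  linarith

/-- Auxiliary points of the sector, separated from each other, from a given point, and from
points of heights at most `η`. -/
lemma exists_separated_points {b H η : ℝ} (k : ℕ) (hη : 0 < η) (hbη : b ≤ η)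
    (hηH : 64 * (k + 1) ^ 3 * η ≤ H) (hH : H ≤ 1 / 4) (a : ℂ) (ha : ‖a‖ < 1) :
    ∃ f : Fin k → ℂ, (∀ i, f i ∈ sector b H) ∧ (∀ i, 3 * η ≤ ht (f i)) ∧
      (∀ i, Sep (1 / (4 * (k + 1))) a (f i)) ∧
      (∀ i j, i ≠ j → Sep (1 / (4 * (k + 1))) (f i) (f j)) := by
  have hk : (0 : ℝ) ≤ k := Nat.cast_nonneg k
  have hH0 : 0 < H := lt_of_lt_of_le (by positivity) hηH
  -- the two scales at which the points are placed, depending on the height of `a`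
  obtain ⟨X, hX1, hX2, hX3⟩ : ∃ X, 4 * (k + 1) * η ≤ X ∧ X ≤ H ∧
      (2 * X ≤ ht a ∨ 2 * (k + 1) * ht a ≤ X) := by
    have hp1 : 1 ≤ ((k : ℝ) + 1) ^ 2 := by nlinarith
    by_cases hc : 8 * (k + 1) * η ≤ ht a
    · refine ⟨4 * (k + 1) * η, le_rfl, le_trans ?_ hηH, Or.inl (by linarith)⟩
      have : 4 * (k + 1) * η * 1 ≤ 4 * (k + 1) * η * (16 * (k + 1) ^ 2) := by
        gcongr; linarith
      nlinarith
    · push Not at hc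
      refine ⟨H, le_trans ?_ hηH, le_rfl, Or.inr ?_⟩
      · have : 4 * (k + 1) * η * 1 ≤ 4 * (k + 1) * η * (16 * (k + 1) ^ 2) := by
          gcongr; linarith
        nlinarith
      · refine le_trans ?_ hηH
        calc 2 * (k + 1) * ht a ≤ 2 * (k + 1) * (8 * (k + 1) * η) := by gcongr
          _ = 16 * (k + 1) ^ 2 * η * 1 := by ring
          _ ≤ 16 * (k + 1) ^ 2 * η * (4 * (k + 1)) := by gcongr; linarith
          _ = _ := by ring
  have hX0 : 0 < X := lt_of_lt_of_le (by positivity) hX1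
  have hi : ∀ i : Fin k, ((i : ℕ) : ℝ) + 1 ≤ k := fun i => by exact_mod_cast i.2
  have hlow : ∀ i : Fin k, X / (k + 1) ≤ X / ((i : ℕ) + 1) := fun i => by
    gcongr; exact i.2.le
  have hup : ∀ i : Fin k, X / ((i : ℕ) + 1) ≤ X := fun i => div_le_self hX0.le (by simp)
  have h4η : 4 * η ≤ X / (k + 1) := by rw [le_div_iff₀ (by positivity)]; linarith
  have hht : ∀ i : Fin k, ht (pt (X / ((i : ℕ) + 1)) 0) = X / ((i : ℕ) + 1) := fun i =>
    ht_pt (by linarith [hup i])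
  have hnorm : ∀ i : Fin k, ‖pt (X / ((i : ℕ) + 1)) 0‖ < 1 := fun i => by
    rw [norm_pt (by linarith [hup i])]
    linarith [hlow i]
  have hτ : 0 < 1 / (4 * ((k : ℝ) + 1)) := by positivity
  have hτ1 : 1 / (4 * ((k : ℝ) + 1)) ≤ 1 / 4 := by
    rw [div_le_div_iff₀ (by positivity) (by norm_num)]; linarith
  refine ⟨fun i => pt (X / ((i : ℕ) + 1)) 0, fun i => ⟨_, 0, ?_, (hup i).trans hX2, by simpa using
    hH0.le, rfl⟩, fun i => ?_, fun i => ?_, ?_⟩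
  · linarith [hlow i]
  · rw [hht]; linarith [hlow i]
  · rcases hX3 with hX3 | hX3
    · refine sep_of_ht (hnorm i) hτ (by linarith) ?_
      rw [hht]
      have : 0 < X / ((i : ℕ) + 1) := by positivity
      nlinarith [hup i]
    · refine (sep_of_ht ha hτ (by linarith) ?_).symm
      rw [hht]
      have h1 : 2 * ht a ≤ X / (k + 1) := by rw [le_div_iff₀ (by positivity)]; linarith
      have := ht_pos ha
      nlinarith [hlow i]
  · have key : ∀ i j : Fin k, i < j →
        Sep (1 / (4 * (k + 1))) (pt (X / ((i : ℕ) + 1)) 0) (pt (X / ((j : ℕ) + 1)) 0) := by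
      intro i j hij
      refine sep_of_ht (hnorm j) hτ (by linarith) ?_
      rw [hht, hht]
      have h1 : ((i : ℕ) : ℝ) + 2 ≤ (j : ℕ) + 1 := by exact_mod_cast Nat.succ_le_succ hij
      have h2 := hi j
      rw [← mul_div_assoc, div_le_div_iff₀ (by positivity) (by positivity)]
      have h3 : (1 + 4 * (1 / (4 * ((k : ℝ) + 1)))) * ((i : ℕ) + 1) ≤ (j : ℕ) + 1 := by
        have e : 4 * (1 / (4 * ((k : ℝ) + 1))) = 1 / (k + 1) := by field_simp
        rw [e]
        have : 1 / ((k : ℝ) + 1) * ((i : ℕ) + 1) ≤ 1 := by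
          rw [one_div_mul_eq_div, div_le_one (by positivity)]
          linarith [hi i]
        linarith
      nlinarith
    intro i j hij
    rcases lt_or_gt_of_ne hij with h | h
    · exact key i j h
    · exact (key j i h).symm

end Sector

/-! ### Routes to the root -/

section Routes

/-- The `i`-th step of the walk from `x j` to `x k` along the sequence `x`. -/
def legStep (x : ℤ → ℂ) (j k : ℤ) (i : ℕ) : ℂ × ℂ :=
  if j ≤ k then (x (j + i), x (j + i + 1)) else (x (j - i), x (j - i - 1))

lemma sum_legStep (x : ℤ → ℂ) (j k : ℤ) (Φ : ℂ → ℝ) :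
    ∑ i ∈ Finset.range (k - j).natAbs, (Φ (legStep x j k i).1 - Φ (legStep x j k i).2)
      = Φ (x j) - Φ (x k) := by
  unfold legStep
  by_cases h : j ≤ k
  · simp only [h, if_true]
    have := Finset.sum_range_sub' (fun i : ℕ => Φ (x (j + i))) (k - j).natAbs
    have e : j + ((k - j).natAbs : ℤ) = k := by omega
    rw [e] at this
    simp only [Nat.cast_add, Nat.cast_one, Nat.cast_zero, add_zero, ← add_assoc] at this
    exact this
  · simp only [h, if_false]
    have := Finset.sum_range_sub' (fun i : ℕ => Φ (x (j - i))) (k - j).natAbs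
    have e : j - ((k - j).natAbs : ℤ) = k := by omega
    rw [e] at this
    simp only [Nat.cast_add, Nat.cast_one, Nat.cast_zero, sub_zero, ← sub_sub] at this
    exact this

lemma legStep_spec (x : ℤ → ℂ) {j k : ℤ} {i : ℕ} (hi : i < (k - j).natAbs) :
    ∃ m m' : ℤ, m ∈ Set.uIcc j k ∧ m' ∈ Set.uIcc j k ∧ legStep x j k i = (x m, x m') ∧
      (m' = m + 1 ∨ m = m' + 1) ∧ (m = j + i ∨ m = j - i) := by
  unfold legStep
  by_cases h : j ≤ k
  · refine ⟨j + i, j + i + 1, ?_, ?_, by simp [h], Or.inl rfl, Or.inl rfl⟩ <;>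
    · rw [Set.uIcc_of_le h]; constructor <;> omega
  · refine ⟨j - i, j - i - 1, ?_, ?_, by simp [h], Or.inr (by ring), Or.inr rfl⟩ <;>
    · rw [Set.uIcc_of_ge (by omega)]; constructor <;> omega

/-- The first and the last index of the two legs of a route starting at level `k`. -/
def legEnds (M : ℕ) (k : ℤ) : Fin 2 → ℤ × ℤ := ![(k, -(M : ℤ)), (-(M : ℤ), 0)]

/-- A walk, in two legs and with steps of hyperbolic length of order `1 / M`, from a point close
to `z` to the root `pt (H / 2) 0`. On each leg the heights form the geometric sequence
`(H / 2) e^{j / M}`, and around each visited point a disk of relative size `t / 16` is contained in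
the sector. -/
structure IsRoute (b H t : ℝ) (M : ℕ) (z : ℂ) (x : Fin 2 → ℤ → ℂ) (k : ℤ) : Prop where
  near : ‖z - x 0 k‖ ≤ 3 * t * ht z
  join : x 0 (-(M : ℤ)) = x 1 (-(M : ℤ))
  root : x 1 0 = pt (H / 2) 0
  ht_eq : ∀ l, ∀ j ∈ Set.uIcc (legEnds M k l).1 (legEnds M k l).2,
    ht (x l j) = H / 2 * Real.exp (j / M)
  low : ∀ l, ∀ j ∈ Set.uIcc (legEnds M k l).1 (legEnds M k l).2, min (ht z) (H / 6) ≤ ht (x l j)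
  ball : ∀ l, ∀ j ∈ Set.uIcc (legEnds M k l).1 (legEnds M k l).2,
    Metric.closedBall (x l j) (t / 16 * ht (x l j)) ⊆ sector b H
  step : ∀ l, ∀ i < ((legEnds M k l).2 - (legEnds M k l).1).natAbs,
    ‖(legStep (x l) (legEnds M k l).1 (legEnds M k l).2 i).1
      - (legStep (x l) (legEnds M k l).1 (legEnds M k l).2 i).2‖
      ≤ 8 / M * ht (legStep (x l) (legEnds M k l).1 (legEnds M k l).2 i).1
  step' : ∀ l, ∀ i < ((legEnds M k l).2 - (legEnds M k l).1).natAbs,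
    ‖(legStep (x l) (legEnds M k l).1 (legEnds M k l).2 i).1
      - (legStep (x l) (legEnds M k l).1 (legEnds M k l).2 i).2‖
      ≤ 8 / M * ht (legStep (x l) (legEnds M k l).1 (legEnds M k l).2 i).2
  length : ∀ l, (((legEnds M k l).2 - (legEnds M k l).1).natAbs : ℝ)
    ≤ M * (|Real.log (2 * ht z / H)| + 3)

lemma IsRoute.sum_eq {b H t : ℝ} {M : ℕ} {z : ℂ} {x : Fin 2 → ℤ → ℂ} {k : ℤ}
    (h : IsRoute b H t M z x k) (Φ : ℂ → ℝ) :
    ∑ l, ∑ i ∈ Finset.range ((legEnds M k l).2 - (legEnds M k l).1).natAbs,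
      (Φ (legStep (x l) (legEnds M k l).1 (legEnds M k l).2 i).1
        - Φ (legStep (x l) (legEnds M k l).1 (legEnds M k l).2 i).2)
      = Φ (x 0 k) - Φ (pt (H / 2) 0) := by
  simp only [sum_legStep, Fin.sum_univ_two]
  have e0 : legEnds M k 0 = (k, -(M : ℤ)) := rfl
  have e1 : legEnds M k 1 = (-(M : ℤ), 0) := rfl
  rw [e0, e1, ← h.root, h.join]
  ring

lemma norm_legPoint_sub_le {h₀ A B : ℝ} {M : ℕ} (hM : 10 ≤ M) (hB : |B| ≤ 4) {j : ℤ}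
    (h0 : 0 < h₀) (h1 : h₀ * Real.exp (((j + 1 : ℤ) : ℝ) / M) ≤ 1) :
    ‖pt (h₀ * Real.exp ((j : ℝ) / M)) (A + B * (h₀ * Real.exp ((j : ℝ) / M)))
      - pt (h₀ * Real.exp (((j + 1 : ℤ) : ℝ) / M))
        (A + B * (h₀ * Real.exp (((j + 1 : ℤ) : ℝ) / M)))‖
      ≤ 8 / M * (h₀ * Real.exp ((j : ℝ) / M)) := by
  have hM' : (10 : ℝ) ≤ M := by exact_mod_cast hM
  set a := h₀ * Real.exp ((j : ℝ) / M) with ha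
  have ha0 : 0 < a := by positivity
  have e : h₀ * Real.exp (((j + 1 : ℤ) : ℝ) / M) = a * Real.exp (1 / M) := by
    rw [ha, mul_assoc, ← Real.exp_add]; congr 2; push_cast; ring
  rw [e] at h1 ⊢
  have hx0 : (0 : ℝ) < 1 / M := by positivity
  have hx1 : (1 : ℝ) / M ≤ 1 / 10 := by gcongr
  have hexp : Real.exp (1 / M) ≤ 1 + 8 / 5 * (1 / M) := by
    have := Real.exp_bound_div_one_sub_of_interval hx0.le (by linarith)
    refine this.trans ?_
    rw [div_le_iff₀ (by linarith)]
    nlinarith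
  have hexp1 : 1 ≤ Real.exp (1 / M) := Real.one_le_exp hx0.le
  have h2 : a ≤ 1 := by nlinarith
  refine (norm_pt_sub_pt_le ha0.le h2).trans ?_
  have e2 : A + B * a - (A + B * (a * Real.exp (1 / M))) = B * (a - a * Real.exp (1 / M)) := by ring
  have e3 : |a - a * Real.exp (1 / M)| = a * (Real.exp (1 / M) - 1) := by
    rw [abs_of_nonpos (by nlinarith)]; ring
  rw [e2, abs_mul, e3]
  have h5 : |B| * (a * (Real.exp (1 / M) - 1)) ≤ 4 * (a * (Real.exp (1 / M) - 1)) :=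
    mul_le_mul_of_nonneg_right hB (mul_nonneg ha0.le (by linarith))
  have h6 : a * (Real.exp (1 / M) - 1) ≤ a * (8 / 5 * (1 / M)) :=
    mul_le_mul_of_nonneg_left (by linarith) ha0.le
  calc _ ≤ 5 * (a * (8 / 5 * (1 / M))) := by linarith
    _ = 8 / M * a := by ring

/-- The level of the starting point of a route. -/
lemma exists_level {b H h t : ℝ} {M : ℕ} (hb : 0 < b) (hbH : b ≤ H / 8) (ht0 : 0 < t)
    (ht1 : t ≤ 1 / 2) (hM : 10 ≤ M) (hMt : 1 / (M : ℝ) ≤ t / 8) (h1 : b ≤ h) (h2 : h ≤ H) :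
    ∃ k : ℤ, b * (1 + t / 8) ≤ H / 2 * Real.exp (k / M) ∧
      H / 2 * Real.exp (k / M) ≤ H * (1 - t / 8) ∧ |H / 2 * Real.exp (k / M) - h| ≤ t * h ∧
      min h (H / 6) ≤ H / 2 * Real.exp (k / M) ∧ |(k : ℝ) / M - Real.log (2 * h / H)| ≤ 1 := by
  have hM0 : (0 : ℝ) < M := by
    have : (10 : ℝ) ≤ M := by exact_mod_cast hM
    linarith
  have h0 : 0 < h := by linarith
  have hH0 : 0 < H := by linarith
  set L := Real.log (2 * h / H) with hL
  have hexpL : H / 2 * Real.exp L = h := by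
    rw [hL, Real.exp_log (by positivity)]; field_simp
  have key : ∀ x : ℝ, H / 2 * Real.exp x = h * Real.exp (x - L) := by
    intro x
    rw [← hexpL, mul_assoc, ← Real.exp_add]; congr 2; ring
  have hup : ∀ y : ℝ, 0 ≤ y → y ≤ t / 4 → Real.exp y ≤ 1 + t / 2 := by
    intro y hy0 hy
    have := Real.exp_bound_div_one_sub_of_interval hy0 (by linarith)
    refine this.trans ?_
    rw [div_le_iff₀ (by linarith)]
    nlinarith
  by_cases hc : h ≤ H / 2
  · refine ⟨⌈(M : ℝ) * (L + t / 8)⌉, ?_⟩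
    set k := ⌈(M : ℝ) * (L + t / 8)⌉ with hk
    have k1 : L + t / 8 ≤ (k : ℝ) / M := by
      rw [le_div_iff₀ hM0, mul_comm]; exact Int.le_ceil _
    have k2 : (k : ℝ) / M ≤ L + t / 8 + 1 / M := by
      rw [div_le_iff₀ hM0]
      have := (Int.ceil_lt_add_one ((M : ℝ) * (L + t / 8))).le
      rw [← hk] at this
      refine this.trans (le_of_eq ?_)
      field_simp
    rw [key]
    have e1 : 1 + t / 8 ≤ Real.exp ((k : ℝ) / M - L) := by
      have := Real.add_one_le_exp ((k : ℝ) / M - L)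
      linarith
    have e2 : Real.exp ((k : ℝ) / M - L) ≤ 1 + t / 2 := hup _ (by linarith) (by linarith)
    refine ⟨by gcongr, ?_, ?_, ?_, ?_⟩
    · calc h * Real.exp ((k : ℝ) / M - L) ≤ H / 2 * (1 + t / 2) := by gcongr
        _ ≤ _ := by nlinarith
    · rw [abs_of_nonneg (by nlinarith)]; nlinarith
    · exact (min_le_left _ _).trans (by nlinarith)
    · rw [abs_of_nonneg (by linarith)]; linarith
  · push Not at hc
    refine ⟨⌊(M : ℝ) * (L - t / 6)⌋, ?_⟩
    set k := ⌊(M : ℝ) * (L - t / 6)⌋ with hk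
    have k1 : (k : ℝ) / M ≤ L - t / 6 := by
      rw [div_le_iff₀ hM0, mul_comm]; exact Int.floor_le _
    have k2 : L - t / 6 - 1 / M ≤ (k : ℝ) / M := by
      rw [le_div_iff₀ hM0]
      have := (Int.sub_one_lt_floor ((M : ℝ) * (L - t / 6))).le
      rw [← hk] at this
      refine le_trans (le_of_eq ?_) this
      field_simp
    rw [key]
    have e1 : 1 - t / 3 ≤ Real.exp ((k : ℝ) / M - L) := by
      have := Real.add_one_le_exp ((k : ℝ) / M - L)
      linarith
    have e2 : Real.exp ((k : ℝ) / M - L) ≤ 1 - t / 8 := by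
      have h3 : Real.exp ((k : ℝ) / M - L) ≤ Real.exp (-(t / 6)) := Real.exp_le_exp.2 (by linarith)
      refine h3.trans ?_
      rw [Real.exp_neg, inv_le_comm₀ (Real.exp_pos _) (by linarith)]
      have := Real.add_one_le_exp (t / 6)
      refine le_trans ?_ this
      rw [inv_le_iff_one_le_mul₀ (by linarith)]
      nlinarith
    have e0 := Real.exp_pos ((k : ℝ) / M - L)
    have e3 : h * (1 - t / 3) ≤ h * Real.exp ((k : ℝ) / M - L) := by gcongr
    refine ⟨?_, ?_, ?_, ?_, ?_⟩
    · nlinarith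
    · gcongr
    · rw [abs_of_nonpos (by nlinarith)]; nlinarith
    · exact (min_le_right _ _).trans (by nlinarith)
    · rw [abs_of_nonpos (by linarith)]; linarith

set_option maxHeartbeats 1000000 in
/-- Every point of the sector is close to the beginning of a route to the root. -/
lemma exists_route {b H t : ℝ} {M : ℕ} (hb : 0 < b) (hbH : b ≤ H / 8) (hH : H ≤ 1 / 4)
    (ht0 : 0 < t) (ht1 : t ≤ 1 / 2) (hM : 10 ≤ M) (hMt : 1 / (M : ℝ) ≤ t / 8) {z : ℂ}
    (hz : z ∈ sector b H) : ∃ x k, IsRoute b H t M z x k := by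
  obtain ⟨h, θ, h1, h2, hθ, rfl⟩ := hz
  have hM10 : (10 : ℝ) ≤ M := by exact_mod_cast hM
  have hM0 : (0 : ℝ) < M := by linarith
  have hH0 : 0 < H := by linarith
  obtain ⟨k, k1, k2, k3, k4, k5⟩ := exists_level hb hbH ht0 ht1 hM hMt h1 h2
  set E : ℤ → ℝ := fun j => H / 2 * Real.exp (j / M) with hE
  have hE0 : ∀ j, 0 < E j := fun j => by positivity
  have hmono : ∀ {i j : ℤ}, i ≤ j → E i ≤ E j := fun {i j} hij => by
    simp only [hE]; gcongr
  set e := Real.exp (-1) with he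
  have he1 : 1 / 3 ≤ e := by
    rw [he, Real.exp_neg, one_div, inv_le_inv₀ (by norm_num) (Real.exp_pos _)]
    linarith [Real.exp_one_lt_d9]
  have he2 : e ≤ 1 / 2 := by
    rw [he, Real.exp_neg, one_div, inv_le_inv₀ (Real.exp_pos _) (by norm_num)]
    linarith [Real.exp_one_gt_d9]
  have hHe1 : H / 6 ≤ H / 2 * e := by
    have := mul_le_mul_of_nonneg_left he1 (show 0 ≤ H / 2 by linarith)
    linarith
  have hHe2 : H / 2 * e ≤ H / 4 := by
    have := mul_le_mul_of_nonneg_left he2 (show 0 ≤ H / 2 by linarith)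
    linarith
  have hbt : b * (1 + t / 8) ≤ H / 6 := by
    have : b * (1 + t / 8) ≤ H / 8 * (1 + 1 / 16) :=
      mul_le_mul hbH (by linarith) (by linarith) (by linarith)
    linarith
  have hHt0 : 0 < H * t := by positivity
  have hHt : H / 2 ≤ H * (1 - t / 8) := by
    have := mul_le_mul_of_nonneg_left ht1 hH0.le
    linarith
  have hte0 : 0 < t / 2 * e := by positivity
  have hte : t / 2 * e ≤ 1 / 2 := by
    have : t / 2 * e ≤ 1 / 4 * (1 / 2) :=
      mul_le_mul (by linarith) he2 (by positivity) (by norm_num)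
    linarith
  have hEM : E (-M) = H / 2 * e := by
    simp only [hE, he]; congr 2; push_cast; field_simp
  have hEz : E 0 = H / 2 := by simp [hE]
  -- The first leg runs at the angle `θ (1 - t h' / H)` at height `h'`, so that it stays away from the
  -- sides of the sector; it ends at height `H / (2 e)`. The second leg turns to the angle `0`
  -- between the heights `H / (2 e)` and `H / 2`.
  set B : ℝ := -(θ * (1 - t / 2 * e) / (H / 2 * (1 - e))) with hB
  set x : Fin 2 → ℤ → ℂ := ![fun j => pt (E j) (θ + -(θ * t / H) * E j),
    fun j => pt (E j) (-(B * (H / 2)) + B * E j)] with hx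
  have hs0 : Set.uIcc (legEnds M k 0).1 (legEnds M k 0).2 = Set.uIcc k (-M) := rfl
  have hs1 : Set.uIcc (legEnds M k 1).1 (legEnds M k 1).2 = Set.Icc (-(M : ℤ)) 0 :=
    Set.uIcc_of_le (show -(M : ℤ) ≤ 0 by omega)
  -- the heights along the two legs
  have r0 : ∀ j ∈ Set.uIcc k (-(M : ℤ)),
      b * (1 + t / 8) ≤ E j ∧ E j ≤ H * (1 - t / 8) ∧ min h (H / 6) ≤ E j := by
    intro j hj
    have l1 : b * (1 + t / 8) ≤ E (-M) := by rw [hEM]; linarith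
    have l2 : E (-M) ≤ H * (1 - t / 8) := by rw [hEM]; linarith
    have l3 : min h (H / 6) ≤ E (-M) := (min_le_right _ _).trans (by rw [hEM]; linarith)
    rcases le_total k (-(M : ℤ)) with hc | hc
    · rw [Set.uIcc_of_le hc] at hj
      exact ⟨k1.trans (hmono hj.1), (hmono hj.2).trans l2, k4.trans (hmono hj.1)⟩
    · rw [Set.uIcc_of_ge hc] at hj
      exact ⟨l1.trans (hmono hj.1), (hmono hj.2).trans k2, l3.trans (hmono hj.1)⟩
  have r1 : ∀ j ∈ Set.Icc (-(M : ℤ)) 0,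
      H / 2 * e ≤ E j ∧ E j ≤ H / 2 := by
    intro j hj
    rw [← hEM, ← hEz]
    exact ⟨hmono hj.1, hmono hj.2⟩
  have hrange : ∀ l, ∀ j ∈ Set.uIcc (legEnds M k l).1 (legEnds M k l).2,
      b * (1 + t / 8) ≤ E j ∧ E j ≤ H * (1 - t / 8) ∧ min h (H / 6) ≤ E j := by
    intro l j hj
    fin_cases l
    · exact r0 j hj
    · have := r1 j (hs1 ▸ hj)
      refine ⟨?_, ?_, (min_le_right _ _).trans ?_⟩ <;> linarith
  have hB4 : |B| ≤ 4 := by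
    rw [hB, abs_neg, abs_div, abs_mul, abs_of_pos (show 0 < H / 2 * (1 - e) by linarith),
      abs_of_pos (show 0 < 1 - t / 2 * e by linarith), div_le_iff₀ (by linarith)]
    have : |θ| * (1 - t / 2 * e) ≤ H * 1 := by
      gcongr
      · linarith
      · linarith
    linarith
  have hA4 : |-(θ * t / H)| ≤ 4 := by
    rw [abs_neg, abs_div, abs_mul, abs_of_pos hH0, abs_of_pos ht0, div_le_iff₀ hH0]
    have := mul_le_mul hθ ht1 ht0.le hH0.le
    linarith
  have hht : ∀ l, ∀ j ∈ Set.uIcc (legEnds M k l).1 (legEnds M k l).2, ht (x l j) = E j := by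
    intro l j hj
    have := (hrange l j hj).2.1
    fin_cases l <;> exact ht_pt (by linarith)
  have hball : ∀ (j : ℤ) (φ : ℝ), b * (1 + t / 8) ≤ E j → E j ≤ H * (1 - t / 8) →
      |φ| ≤ H - t * E j / 6 →
      Metric.closedBall (pt (E j) φ) (t / 16 * E j) ⊆ sector b H := by
    intro j φ b1 b2 b3
    have b0 := hE0 j
    have d1 : b * (1 + t / 8) * (1 - t / 16) ≤ E j * (1 - t / 16) :=
      mul_le_mul_of_nonneg_right b1 (by linarith)
    have d2 : E j * (1 + t / 16) ≤ H * (1 - t / 8) * (1 + t / 16) :=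
      mul_le_mul_of_nonneg_right b2 (by linarith)
    have d3 : 0 ≤ b * t * (8 - t) := mul_nonneg (by positivity) (by linarith)
    have d4 : 0 < H * t * (8 + t) := by positivity
    have d5 : 0 < t * E j := by positivity
    have d6 : t * E j ≤ 1 / 2 * H := mul_le_mul ht1 (by nlinarith) b0.le (by norm_num)
    have d7 : 0 < H * t := by positivity
    refine closedBall_subset_sector b0.le ?_ hH ?_ ?_ ?_ ?_ <;> linarith
  have hstep0 : ∀ l, ∀ j, E (j + 1) ≤ 1 → ‖x l j - x l (j + 1)‖ ≤ 8 / M * E j := by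
    intro l j hj
    fin_cases l
    · exact norm_legPoint_sub_le hM hA4 (by linarith) hj
    · exact norm_legPoint_sub_le hM hB4 (by linarith) hj
  have hstep : ∀ l, ∀ i < ((legEnds M k l).2 - (legEnds M k l).1).natAbs,
      ‖(legStep (x l) (legEnds M k l).1 (legEnds M k l).2 i).1
        - (legStep (x l) (legEnds M k l).1 (legEnds M k l).2 i).2‖
        ≤ 8 / M * ht (legStep (x l) (legEnds M k l).1 (legEnds M k l).2 i).1 ∧
      ‖(legStep (x l) (legEnds M k l).1 (legEnds M k l).2 i).1
        - (legStep (x l) (legEnds M k l).1 (legEnds M k l).2 i).2‖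
        ≤ 8 / M * ht (legStep (x l) (legEnds M k l).1 (legEnds M k l).2 i).2 := by
    intro l i hi
    obtain ⟨m, m', hm, hm', e1, e2, -⟩ := legStep_spec (x l) hi
    simp only [e1, hht l m hm, hht l m' hm']
    have u1 := (hrange l m hm).2.1
    have u2 := (hrange l m' hm').2.1
    rcases e2 with rfl | rfl
    · have a1 := hstep0 l m (by linarith)
      have a2 := hmono (show m ≤ m + 1 by omega)
      exact ⟨a1, a1.trans (by gcongr)⟩
    · have a1 := hstep0 l m' (by linarith)
      have a2 := hmono (show m' ≤ m' + 1 by omega)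
      rw [norm_sub_rev]
      exact ⟨a1.trans (by gcongr), a1⟩
  have hh1 : h ≤ 1 := by linarith
  refine ⟨x, k, ?_, ?_, ?_, hht, ?_, ?_, fun l i hi => (hstep l i hi).1,
    fun l i hi => (hstep l i hi).2, ?_⟩
  · rw [ht_pt hh1]
    refine (norm_pt_sub_pt_le (by linarith) hh1).trans ?_
    rw [abs_sub_comm, show θ - (θ + -(θ * t / H) * E k) = θ * (t / H * E k) by ring, abs_mul,
      abs_of_pos (show 0 < t / H * E k by have := hE0 k; positivity)]
    have a1 : E k ≤ 2 * h := by
      have := (abs_le.1 k3).2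
      simp only [hE]
      nlinarith
    have a2 : |θ| * (t / H * E k) ≤ H * (t / H * (2 * h)) := by gcongr
    have a3 : H * (t / H * (2 * h)) = 2 * (t * h) := by field_simp
    have k3' : |E k - h| ≤ t * h := k3
    change |E k - h| + |θ| * (t / H * E k) ≤ _
    linarith
  · change pt (E (-M)) _ = pt (E (-M)) _
    congr 1
    rw [hEM, hB]
    have : (1 : ℝ) - e ≠ 0 := by linarith
    field_simp
    ring
  · change pt (E 0) _ = _
    rw [hEz]
    congr 1
    ring
  · intro l j hj
    rw [ht_pt hh1, hht l j hj]
    exact (hrange l j hj).2.2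
  · intro l j hj
    obtain ⟨b1, b2, -⟩ := hrange l j hj
    rw [hht l j hj]
    have hEj := hE0 j
    fin_cases l
    · refine hball j _ b1 b2 ?_
      have c1 : t * E j / H ≤ 1 := by
        rw [div_le_one hH0]
        have := mul_le_mul ht1 (show E j ≤ H by linarith) hEj.le (by norm_num)
        linarith
      rw [show θ + -(θ * t / H) * E j = θ * (1 - t * E j / H) by ring, abs_mul,
        abs_of_nonneg (show 0 ≤ 1 - t * E j / H by linarith)]
      have c2 : |θ| * (1 - t * E j / H) ≤ H * (1 - t * E j / H) :=
        mul_le_mul_of_nonneg_right hθ (by linarith)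
      have c3 : H * (1 - t * E j / H) = H - t * E j := by field_simp
      have : 0 < t * E j := by positivity
      linarith
    · refine hball j _ b1 b2 ?_
      obtain ⟨c1, c2⟩ := r1 j (hs1 ▸ hj)
      have c3 : 0 < H / 2 * (1 - e) := by linarith
      rw [show -(B * (H / 2)) + B * E j
          = θ * ((1 - t / 2 * e) * ((H / 2 - E j) / (H / 2 * (1 - e)))) by rw [hB]; ring, abs_mul]
      have c4 : 0 ≤ (H / 2 - E j) / (H / 2 * (1 - e)) := div_nonneg (by linarith) c3.le
      have c5 : (H / 2 - E j) / (H / 2 * (1 - e)) ≤ 1 := by rw [div_le_one c3]; linarith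
      have c6 : 0 < 1 - t / 2 * e := by linarith
      rw [abs_of_nonneg (mul_nonneg c6.le c4)]
      have c7 : |θ| * ((1 - t / 2 * e) * ((H / 2 - E j) / (H / 2 * (1 - e))))
          ≤ H * ((1 - t / 2 * e) * 1) := by gcongr
      have c8 : 0 ≤ H * t * (e - 1 / 3) := mul_nonneg (by positivity) (by linarith)
      have c9 : 0 ≤ t * (H / 2 - E j) := mul_nonneg ht0.le (by linarith)
      have c10 : 0 < H * t := by positivity
      linarith
  · intro l
    rw [ht_pt hh1]
    have hpos := abs_nonneg (Real.log (2 * h / H))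
    fin_cases l
    · change (((-(M : ℤ) - k).natAbs : ℕ) : ℝ) ≤ _
      rw [Nat.cast_natAbs]
      push_cast
      have k6 : |(k : ℝ)| ≤ M * (|Real.log (2 * h / H)| + 1) := by
        have : |(k : ℝ) / M| ≤ |Real.log (2 * h / H)| + 1 := by
          have := abs_sub_abs_le_abs_sub ((k : ℝ) / M) (Real.log (2 * h / H))
          linarith
        rw [abs_div, abs_of_pos hM0, div_le_iff₀ hM0] at this
        linarith
      have := abs_sub (-(M : ℝ)) k
      rw [abs_neg, abs_of_pos hM0] at this
      nlinarith
    · change (((0 - -(M : ℤ)).natAbs : ℕ) : ℝ) ≤ _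
      simp only [zero_sub, neg_neg, Int.natAbs_natCast]
      nlinarith

end Routes

/-! ### Moments of the increments under the biased measure -/

section Moments

variable {S : Type*} [MeasurableSpace S] {ν : Measure S}

lemma MomLE.finset_sum {ι : Type*} {m : ℕ} (hm : m ≠ 0) {Λ : ℝ} (hΛ : 0 ≤ Λ) (f : ι → S → ℝ)
    (s : Finset ι) (h : ∀ a ∈ s, MomLE ν m (f a) Λ) :
    MomLE ν m (fun x => ∑ a ∈ s, f a x) (s.card * Λ) := by
  classical
  induction s using Finset.induction_on with
  | empty => exact ⟨by simpa using aestronglyMeasurable_const, by simp⟩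
  | insert a s ha ih =>
    have h1 := (h a (Finset.mem_insert_self _ _)).add hm hΛ (by positivity)
      (ih fun b hb => h b (Finset.mem_insert_of_mem hb))
    simp only [Finset.sum_insert ha, Finset.card_insert_of_notMem ha]
    refine h1.mono (le_of_eq ?_)
    push_cast
    ring

/-- An exponential moment controls the moments of the positive part. -/
lemma MomLE.max_of_exp {m : ℕ} (hm : m ≠ 0) [IsProbabilityMeasure ν] {Y : S → ℝ}
    (hY : AEStronglyMeasurable Y ν) {K : ℝ} (hK : 0 ≤ K)
    (hi : Integrable (fun x => Real.exp (Y x)) ν) (h : ∫ x, Real.exp (Y x) ∂ν ≤ K) :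
    MomLE ν m (fun x => max (Y x) 0) (m.factorial * (1 + K)) := by
  have hm1 : (1 : ℝ) ≤ m.factorial := by
    exact_mod_cast Nat.one_le_iff_ne_zero.2 (Nat.factorial_ne_zero _)
  have hmeas : AEStronglyMeasurable (fun x => max (Y x) 0) ν := hY.sup aestronglyMeasurable_const
  have hpt : ∀ x, |max (Y x) 0| ^ m ≤ m.factorial * (1 + Real.exp (Y x)) := by
    intro x
    rw [abs_of_nonneg (le_max_right _ _)]
    have h1 := Real.pow_div_factorial_le_exp _ (le_max_right (Y x) 0) m
    rw [div_le_iff₀ (by positivity), mul_comm] at h1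
    refine h1.trans (mul_le_mul_of_nonneg_left ?_ (by positivity))
    rcases max_cases (Y x) 0 with ⟨e, -⟩ | ⟨e, -⟩ <;> rw [e]
    · linarith
    · rw [Real.exp_zero]; linarith [Real.exp_pos (Y x)]
  have hI : Integrable (fun x => (m.factorial : ℝ) * (1 + Real.exp (Y x))) ν :=
    ((integrable_const _).add hi).const_mul _
  have hI' : Integrable (fun x => |max (Y x) 0| ^ m) ν :=
    hI.mono' ((continuous_abs.comp_aestronglyMeasurable hmeas).pow m)
      (ae_of_all _ fun x => by rw [Real.norm_of_nonneg (by positivity)]; exact hpt x)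
  refine MomLE.of_integral hm hmeas (by positivity) hI' ?_
  refine (integral_mono hI' hI hpt).trans ?_
  rw [integral_const_mul, integral_add (integrable_const _) hi]
  simp only [integral_const, probReal_univ, smul_eq_mul, one_mul]
  calc (m.factorial : ℝ) * (1 + ∫ x, Real.exp (Y x) ∂ν) ≤ m.factorial * (1 + K) := by gcongr
    _ = (m.factorial * (1 + K)) ^ 1 := (pow_one _).symm
    _ ≤ _ := pow_le_pow_right₀ (by nlinarith) (Nat.one_le_iff_ne_zero.2 hm)

/-- Increments between points of a disk of small relative size, on a neighbourhood of which the
field is harmonic and has bounded moments. -/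
lemma momLE_of_closedBall {F : S → ℂ → ℝ} {m : ℕ} (hm : m ≠ 0) {a o y : ℂ} {R Λ : ℝ} (hR : 0 < R)
    (hΛ : 0 ≤ Λ) (hF : ∀ᵐ x ∂ν, InnerProductSpace.HarmonicOnNhd (F x) (Metric.closedBall a R))
    (hmom : ∀ z ∈ Metric.closedBall a R, MomLE ν m (fun x => F x z - F x o) Λ)
    (hy : ‖y - a‖ ≤ R / 2) : MomLE ν m (fun x => F x a - F x y) (64 * ‖a - y‖ / R * Λ) := by
  have ha := hmom a (Metric.mem_closedBall_self hR.le)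
  have hy' := hmom y (by rw [Metric.mem_closedBall, dist_eq_norm]; linarith)
  refine MomLE.of_le_circle hm (by positivity) hΛ ?_
    (Z := fun x θ => F x (circleMap a R θ) - F x o) ?_ (fun θ => hmom _ ?_) ?_
  · have := ha.1.sub hy'.1
    refine this.congr (ae_of_all _ fun x => ?_)
    simp
  · filter_upwards [hF] with x hx
    exact (continuous_comp_circleMap hR hx.continuousOn).sub continuous_const
  · rw [Metric.mem_closedBall, dist_eq_norm, norm_circleMap_sub_eq hR]
  · filter_upwards [hF] with x hx
    refine (abs_sub_le_circleDev hR hx (z := a) (w := y) ?_ hy (F x o)).trans (le_of_eq ?_)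
    · rw [sub_self, norm_zero]; positivity
    · rfl

/-- Increments near the point `p` of the bias `2 F(p) - 2 F(q)`. The large values of the mean
deviation `A` of the field from its value at the centre `a` of a circle around `p` have a
probability of order `e^{-A}` under the unbiased measure, while the bias is at most `e^{A/2}`, up to
factors that depend on increments between points far from `p`. -/
lemma momLE_near_base {F : S → ℂ → ℝ} {m : ℕ} (hm : m ≠ 0) {a p q q' z w : ℂ}
    {R L Λa Λb : ℝ} (hR : 0 < R) (hL : 0 ≤ L) (hΛa : 0 ≤ Λa) (hΛb : 0 ≤ Λb)
    [IsProbabilityMeasure ν]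
    (hF : ∀ᵐ x ∂ν, InnerProductSpace.HarmonicOnNhd (F x) (Metric.closedBall a R))
    (hmeas : ∀ u ∈ Metric.closedBall a R, AEMeasurable (fun x => F x u) ν)
    (hqm : AEMeasurable (fun x => F x q) ν) (hqm' : AEMeasurable (fun x => F x q') ν)
    (hp : ‖p - a‖ ≤ R / 10) (ha : MomLE ν m (fun x => F x a - F x q) Λa)
    (hb : MomLE ν m (fun x => F x a - F x q') Λb)
    (hexp : ∀ u, ‖u - a‖ = R → ∫⁻ x, ENNReal.ofReal (Real.exp (-(2 * F x p - 2 * F x q)) *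
      (1 + Real.exp (2 * F x u - 2 * F x q'))) ∂ν ≤ ENNReal.ofReal (2 * (1 + Real.exp L)))
    (hz : ‖z - a‖ ≤ R / 2) (hw : ‖w - a‖ ≤ R / 2) :
    MomLE ν m (fun x => F x z - F x w)
      (64 * ‖z - w‖ / R * (16 * (Λa + Λb) + 8 * L + 32 * m.factorial)) := by
  have hball : ∀ u, ‖u - a‖ ≤ R → u ∈ Metric.closedBall a R := fun u hu => by
    rwa [Metric.mem_closedBall, dist_eq_norm]
  have hzm := hmeas z (hball z (by linarith))
  have hwm := hmeas w (hball w (by linarith))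
  have hpm := hmeas p (hball p (by linarith))
  set c : ℝ := 64 * ‖z - w‖ / R with hc
  have hc0 : 0 ≤ c := by positivity
  have hmf : (1 : ℝ) ≤ m.factorial := by
    exact_mod_cast Nat.one_le_iff_ne_zero.2 (Nat.factorial_ne_zero _)
  set R₀ : S → ℝ := fun x => |F x a - F x q| + |F x a - F x q'| with hR₀
  have hR₀0 : ∀ x, 0 ≤ R₀ x := fun x => by positivity
  have hR₀m : MomLE ν m (fun x => 16 * R₀ x + 8 * L) (16 * (Λa + Λb) + 8 * L) :=
    ((ha.abs.add hm hΛa hΛb hb.abs).const_mul (by norm_num)).add hm (by positivity) (by positivity)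
      (MomLE.const hm (by positivity))
  set K : ℝ := 8 ^ m * m.factorial * Real.exp (-L) with hK
  set g : S → ℝ → ℝ := fun x θ => Real.exp (-(2 * F x p - 2 * F x q)) *
      (1 + Real.exp (2 * F x (circleMap a R θ) - 2 * F x q')) with hg
  have hgpos : ∀ x θ, 0 ≤ g x θ := fun x θ => by positivity
  have hgc : ∀ᵐ x ∂ν, Continuous (g x) := by
    filter_upwards [hF] with x hx
    have := continuous_comp_circleMap hR hx.continuousOn
    exact continuous_const.mul (continuous_const.add
      (Real.continuous_exp.comp ((continuous_const.mul this).sub continuous_const)))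
  have hpt : ∀ᵐ x ∂ν, ENNReal.ofReal (|F x z - F x w| ^ m) ≤ ENNReal.ofReal (c ^ m) *
      (ENNReal.ofReal (|16 * R₀ x + 8 * L| ^ m)
        + ENNReal.ofReal K * ∫⁻ θ, ENNReal.ofReal (g x θ) ∂angleMeasure) := by
    filter_upwards [hF, hgc] with x hx hgx
    set A := circleDev (F x) a R (F x a) with hA
    have hA0 : 0 ≤ A := circleDev_nonneg _ _ _ _
    have hFc := continuous_comp_circleMap hR hx.continuousOn
    have hgi : Integrable (g x) angleMeasure := integrable_angleMeasure hgx
    have h1 : |F x z - F x w| ≤ c * A := abs_sub_le_circleDev hR hx hz hw _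
    have h2 : 2 * F x p - 2 * F x q ≤ A / 2 + 2 * R₀ x := by
      have e1 := (le_abs_self _).trans (abs_sub_center_le_circleDev hR hx hp)
      have e2 := le_abs_self (F x a - F x q)
      have e3 := abs_nonneg (F x a - F x q')
      simp only [hR₀]
      linarith
    -- Jensen's inequality for the mean of the positive parts
    have h3 : Real.exp (A - 2 * R₀ x)
        ≤ ∫ θ, (1 + Real.exp (2 * F x (circleMap a R θ) - 2 * F x q')) ∂angleMeasure := by
      set v : ℝ → ℝ := fun θ => 2 * max (F x (circleMap a R θ) - F x q') 0 with hv
      have hvc : Continuous v :=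
        continuous_const.mul ((hFc.sub continuous_const).max continuous_const)
      have j1 : A - 2 * R₀ x ≤ ∫ θ, v θ ∂angleMeasure := by
        have e1 := (circleDev_eq_two_mul hR hx).1
        rw [← hA] at e1
        have e2 : ∫ θ, 2 * max (F x (circleMap a R θ) - F x a) 0 ∂angleMeasure
            ≤ ∫ θ, (v θ + 2 * R₀ x) ∂angleMeasure := by
          refine integral_mono (integrable_angleMeasure (continuous_const.mul
            ((hFc.sub continuous_const).max continuous_const)))
            (integrable_angleMeasure (hvc.add continuous_const)) fun θ => ?_
          simp only [hv, hR₀]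
          have b1 := neg_le_abs (F x a - F x q')
          have b2 := abs_nonneg (F x a - F x q)
          have b3 := abs_nonneg (F x a - F x q')
          have b4 := le_max_left (F x (circleMap a R θ) - F x q') 0
          have b5 := le_max_right (F x (circleMap a R θ) - F x q') 0
          have : max (F x (circleMap a R θ) - F x a) 0
              ≤ max (F x (circleMap a R θ) - F x q') 0 + |F x a - F x q'| :=
            max_le (by linarith) (by linarith)
          linarith
        rw [integral_add (integrable_angleMeasure hvc) (integrable_const _)] at e2
        simp only [integral_const, probReal_univ, smul_eq_mul, one_mul] at e2
        linarith
      have j2 := convexOn_exp.map_integral_le (μ := angleMeasure) (f := v)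
        Real.continuous_exp.continuousOn isClosed_univ (ae_of_all _ fun θ => Set.mem_univ _)
        (integrable_angleMeasure hvc) (integrable_angleMeasure (Real.continuous_exp.comp hvc))
      refine (Real.exp_le_exp.2 j1).trans (j2.trans ?_)
      refine integral_mono (integrable_angleMeasure (Real.continuous_exp.comp hvc))
        (integrable_angleMeasure (continuous_const.add (Real.continuous_exp.comp
          ((continuous_const.mul hFc).sub continuous_const)))) fun θ => ?_
      simp only [hv]
      rcases max_cases (F x (circleMap a R θ) - F x q') 0 with ⟨e, -⟩ | ⟨e, -⟩ <;> rw [e]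
      · rw [mul_sub]; linarith
      · rw [mul_zero, Real.exp_zero]
        linarith [Real.exp_pos (2 * F x (circleMap a R θ) - 2 * F x q')]
    have h4 : A ^ m ≤ |16 * R₀ x + 8 * L| ^ m + K * ∫ θ, g x θ ∂angleMeasure := by
      have hR₀x := hR₀0 x
      rw [abs_of_nonneg (by positivity)]
      have hgint : 0 ≤ ∫ θ, g x θ ∂angleMeasure := integral_nonneg (hgpos x)
      -- If `A` is large, then the weight `e^{-(2 F(p) - 2 F(q))} ≥ e^{-A/2 - 2 R₀}` costs less than
      -- the gain `e^{A - 2 R₀}`.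
      by_cases hcase : A ≤ 16 * R₀ x + 8 * L
      · have := pow_le_pow_left₀ hA0 hcase m
        have : 0 ≤ K * ∫ θ, g x θ ∂angleMeasure := by positivity
        linarith
      · push Not at hcase
        have k1 : Real.exp (A / 8 + L) ≤ ∫ θ, g x θ ∂angleMeasure := by
          simp only [hg]
          rw [integral_const_mul]
          calc Real.exp (A / 8 + L)
              ≤ Real.exp (-(2 * F x p - 2 * F x q)) * Real.exp (A - 2 * R₀ x) := by
                rw [← Real.exp_add]; exact Real.exp_le_exp.2 (by linarith)
            _ ≤ _ := mul_le_mul_of_nonneg_left h3 (Real.exp_pos _).le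
        have k2 := Real.pow_div_factorial_le_exp (A / 8) (by positivity) m
        rw [div_le_iff₀ (by positivity), div_pow, div_le_iff₀ (by positivity)] at k2
        have k3 : A ^ m ≤ K * ∫ θ, g x θ ∂angleMeasure := by
          calc A ^ m ≤ Real.exp (A / 8) * m.factorial * 8 ^ m := k2
            _ = K * Real.exp (A / 8 + L) := by
                rw [hK, Real.exp_add, Real.exp_neg]
                have := (Real.exp_pos L).ne'
                field_simp
            _ ≤ _ := by gcongr
        have : 0 ≤ (16 * R₀ x + 8 * L) ^ m := by positivity
        linarith
    rw [← ofReal_integral_eq_lintegral_ofReal hgi (ae_of_all _ (hgpos x)),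
      ← ENNReal.ofReal_mul (by positivity), ← ENNReal.ofReal_add (by positivity)
        (mul_nonneg (by positivity) (integral_nonneg (hgpos x))), ← ENNReal.ofReal_mul (by positivity)]
    refine ENNReal.ofReal_le_ofReal ?_
    calc |F x z - F x w| ^ m ≤ (c * A) ^ m := by gcongr
      _ = c ^ m * A ^ m := mul_pow _ _ _
      _ ≤ _ := by gcongr
  refine MomLE.of_lintegral hm (hzm.sub hwm).aestronglyMeasurable (by positivity) ?_
  refine (lintegral_mono_ae hpt).trans ?_
  have hint : ∫⁻ x, ∫⁻ θ, ENNReal.ofReal (g x θ) ∂angleMeasure ∂ν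
      ≤ ENNReal.ofReal (2 * (1 + Real.exp L)) := by
    refine lintegral_lintegral_le_of_continuous angleMeasure (f := fun x θ => ENNReal.ofReal (g x θ))
      ?_ (fun θ => ?_) fun θ => ?_
    · filter_upwards [hgc] with x hx
      exact ENNReal.continuous_ofReal.comp hx
    · have hum := hmeas (circleMap a R θ) (hball _ (norm_circleMap_sub_eq hR θ).le)
      exact (((hpm.const_mul 2).sub (hqm.const_mul 2)).neg.exp.mul
        (((hum.const_mul 2).sub (hqm'.const_mul 2)).exp.const_add 1)).ennreal_ofReal
    · exact hexp _ (norm_circleMap_sub_eq hR θ)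
  have hR₀meas : AEMeasurable (fun x => ENNReal.ofReal (|16 * R₀ x + 8 * L| ^ m)) ν :=
    ((continuous_abs.comp_aestronglyMeasurable hR₀m.1).pow m).aemeasurable.ennreal_ofReal
  rw [lintegral_const_mul' _ _ ENNReal.ofReal_ne_top, lintegral_add_left' hR₀meas,
    lintegral_const_mul' _ _ ENNReal.ofReal_ne_top, mul_pow,
    ENNReal.ofReal_mul (show 0 ≤ c ^ m by positivity)]
  refine mul_le_mul' le_rfl ?_
  have h5 := hR₀m.lintegral_le hm (by positivity)
  calc _ ≤ ENNReal.ofReal ((16 * (Λa + Λb) + 8 * L) ^ m)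
        + ENNReal.ofReal K * ENNReal.ofReal (2 * (1 + Real.exp L)) := by gcongr
    _ ≤ _ := by
        rw [← ENNReal.ofReal_mul (by positivity), ← ENNReal.ofReal_add (by positivity)
          (by positivity)]
        refine ENNReal.ofReal_le_ofReal ?_
        have e1 : K * (2 * (1 + Real.exp L)) ≤ (32 * m.factorial) ^ m := by
          have e2 : Real.exp (-L) * (1 + Real.exp L) ≤ 2 := by
            rw [mul_add, ← Real.exp_add, neg_add_cancel, Real.exp_zero, mul_one]
            have : Real.exp (-L) ≤ 1 := Real.exp_le_one_iff.2 (by linarith)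
            linarith
          calc K * (2 * (1 + Real.exp L))
              = 8 ^ m * (2 * m.factorial) * (Real.exp (-L) * (1 + Real.exp L)) := by rw [hK]; ring
            _ ≤ 8 ^ m * (2 * m.factorial) * 2 := by gcongr
            _ = 8 ^ m * (4 * m.factorial) := by ring
            _ ≤ 8 ^ m * (4 * m.factorial) ^ m := by
                gcongr
                exact le_self_pow₀ (by linarith) hm
            _ = _ := by rw [← mul_pow]; ring
        have e3 := pow_add_pow_le (x := 16 * (Λa + Λb) + 8 * L) (y := 32 * (m.factorial : ℝ))
          (by positivity) (by positivity) hm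
        linarith

end Moments

section Frame

variable {S E : Type*} [MeasurableSpace S] [MeasurableSpace E]

/-- The situation at a fixed large `N`: under the probability measure `ν` the field `F` is
harmonic in the sector, and its increments have nearly the same exponential moments as those of
the shifted Gaussian field. The base point `q` lies far below the top of the sector and far above
its bottom and the base point `p`. -/
structure Frame (ν : Measure S) (Q : Measure E) (F : S → ℂ → ℝ) (W : E → ℂ → ℝ) (U : Set ℂ)
    (b H : ℝ) (p q : ℂ) (k : ℕ) (C κ : ℝ) : Prop where
  comparison : IncrementComparison ν Q F (shiftedField Q W p q) (sector b H) p q (k + 1) κ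
  nonneg : 0 ≤ κ
  le_half : κ ≤ 1 / 2
  bound : IncrementBound Q W U C
  gaussian : IsCenteredGaussianField Q W U
  subset_ball : U ⊆ Metric.ball (0 : ℂ) 1
  sector_subset : sector b H ⊆ U
  left_mem : p ∈ U
  right_mem : q ∈ U
  meas : ∀ z ∈ U, AEMeasurable (fun x => F x z) ν
  harm : ∀ᵐ x ∂ν, InnerProductSpace.HarmonicOnNhd (F x) (sector b H)
  bot_pos : 0 < b
  top_le : H ≤ 1 / 4
  right_eq : q = pt (ht q) 0
  bot_le : 8 * b ≤ ht q
  left_le : 3 * ht p ≤ ht q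
  right_le : 64 * (k + 1) ^ 3 * ht q ≤ H

/-- The relative distance beyond which points count as separated. -/
noncomputable def sepScale (k : ℕ) : ℝ := 1 / (200 * (k + 1))

/-- The largest relative length of a step. -/
noncomputable def stepScale (k : ℕ) : ℝ := sepScale k / 32

/-- A bound for the moments of the steps away from the base point `p`. -/
noncomputable def stepConst (k : ℕ) (C : ℝ) : ℝ :=
  (2 * (k + 1)).factorial * Real.exp (32 * C * (k + 2) ^ 2)
    + 1100 * ((2 * (k + 1)).factorial * (1 + 2 * Real.exp (16 * C)))

/-- The order of the moments of a step of relative length `s`. -/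
noncomputable def stepSize (k : ℕ) (s κ : ℝ) : ℝ := (9 * s ^ 2 + κ) ^ (1 / (2 * (k + 1) : ℕ) : ℝ)

/-- The increments of the field over the steps in `D` of relative length `s ≤ stepScale k`,
starting at heights at least `h₀`, are of the size `Λ * stepSize k s κ`. -/
def StepBound (ν : Measure S) (F : S → ℂ → ℝ) (D : Set ℂ) (k : ℕ) (h₀ κ Λ : ℝ) : Prop :=
  ∀ x ∈ D, ∀ y ∈ D, h₀ ≤ ht x → ∀ s, 0 < s → s ≤ stepScale k → ‖x - y‖ ≤ s * ht x →
    MomLE ν (2 * (k + 1)) (fun ω => F ω x - F ω y) (Λ * stepSize k s κ)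

lemma sepScale_pos (k : ℕ) : 0 < sepScale k := by unfold sepScale; positivity

lemma sepScale_le (k : ℕ) : sepScale k ≤ 1 / 200 := by
  unfold sepScale
  gcongr
  have : (0 : ℝ) ≤ k := Nat.cast_nonneg k
  linarith

lemma sepScale_le' (k : ℕ) : sepScale k ≤ 1 / (4 * (k + 1)) := by
  unfold sepScale
  gcongr
  norm_num

lemma stepScale_pos (k : ℕ) : 0 < stepScale k := by
  have := sepScale_pos k
  unfold stepScale; positivity

lemma stepScale_le (k : ℕ) : stepScale k ≤ 1 / 6400 := by
  have := sepScale_le k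
  unfold stepScale; linarith

lemma stepSize_nonneg {k : ℕ} {s κ : ℝ} (hκ : 0 ≤ κ) : 0 ≤ stepSize k s κ := by
  unfold stepSize; positivity

lemma stepSize_pow {k : ℕ} {s κ : ℝ} (hκ : 0 ≤ κ) :
    stepSize k s κ ^ (2 * (k + 1)) = 9 * s ^ 2 + κ := by
  unfold stepSize
  rw [one_div, Real.rpow_inv_natCast_pow (by positivity) (by omega)]

lemma stepSize_le_one {k : ℕ} {s κ : ℝ} (hκ : 0 ≤ κ) (hκ1 : κ ≤ 1 / 2) (hs : 0 < s)
    (hs1 : s ≤ stepScale k) : stepSize k s κ ≤ 1 := by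
  have := stepScale_le k
  unfold stepSize
  exact Real.rpow_le_one (by positivity) (by nlinarith) (by positivity)

lemma le_stepSize {k : ℕ} {s κ : ℝ} (hκ : 0 ≤ κ) (hκ1 : κ ≤ 1 / 2) (hs : 0 < s)
    (hs1 : s ≤ stepScale k) : s ≤ stepSize k s κ := by
  have h0 := stepSize_nonneg (k := k) (s := s) hκ
  have h1 := stepSize_le_one hκ hκ1 hs hs1
  have h2 := stepSize_pow (k := k) (s := s) hκ
  have h3 : stepSize k s κ ^ (2 * (k + 1)) ≤ stepSize k s κ ^ 2 :=
    pow_le_pow_of_le_one h0 h1 (by omega)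
  refine le_of_sq_le_sq ?_ h0 |>.trans le_rfl
  nlinarith

variable {ν : Measure S} {Q : Measure E} {F : S → ℂ → ℝ} {W : E → ℂ → ℝ} {U : Set ℂ}
  {b H : ℝ} {p q : ℂ} {k : ℕ} {C κ : ℝ}

namespace Frame

lemma norm_lt_one (h : Frame ν Q F W U b H p q k C κ) {z : ℂ} (hz : z ∈ U) : ‖z‖ < 1 := by
  simpa using h.subset_ball hz

lemma ht_right_pos (h : Frame ν Q F W U b H p q k C κ) : 0 < ht q :=
  ht_pos (h.norm_lt_one h.right_mem)

lemma right_le_top (h : Frame ν Q F W U b H p q k C κ) : 64 * ht q ≤ H := by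
  have h1 := h.right_le
  have h2 : (1 : ℝ) ≤ (k + 1) ^ 3 := one_le_pow₀ (by linarith [Nat.cast_nonneg (α := ℝ) k])
  have := h.ht_right_pos
  nlinarith

lemma closedBall_subset (h : Frame ν Q F W U b H p q k C κ) :
    Metric.closedBall q (ht q / 16) ⊆ sector b H := by
  have h1 := h.right_le_top
  have h2 := h.ht_right_pos
  have h3 := h.top_le
  have h4 := h.bot_le
  conv_lhs => rw [h.right_eq]
  have e : ht (pt (ht q) 0) = ht q := ht_pt (by linarith)
  rw [e]
  refine closedBall_subset_sector h2.le ?_ h3 ?_ ?_ ?_ ?_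
  · linarith
  · linarith
  · linarith [h.bot_pos]
  · linarith
  · rw [abs_zero]; linarith

lemma momLE_of_sep [IsProbabilityMeasure ν] [IsProbabilityMeasure Q]
    (h : Frame ν Q F W U b H p q k C κ) {x y : ℂ} (hx : x ∈ sector b H) (hy : y ∈ sector b H)
    {s : ℝ} (hs : 0 < s) (hs1 : s ≤ stepScale k) (hxy : ‖x - y‖ ≤ s * ht x)
    (hxp : Sep (sepScale k) x p) (hxq : Sep (sepScale k) x q) :
    MomLE ν (2 * (k + 1)) (fun ω => F ω x - F ω y)
      ((2 * (k + 1)).factorial * Real.exp (32 * C * (k + 2) ^ 2) * stepSize k s κ) := by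
  have hτ := sepScale_pos k
  have hτ1 := sepScale_le k
  have hτ2 := sepScale_le' k
  have hq0 := h.ht_right_pos
  have hpn := h.norm_lt_one h.left_mem
  have hqn := h.norm_lt_one h.right_mem
  have hxn := h.norm_lt_one (h.sector_subset hx)
  obtain ⟨f, f1, f2, f3, f4⟩ := exists_separated_points (b := b) k hq0
    (by linarith [h.bot_le, h.bot_pos]) h.right_le h.top_le x hxn
  have hfn := fun i => h.norm_lt_one (h.sector_subset (f1 i))
  have hp0 := ht_pos hpn
  refine h.comparison.momLE_of_sep h.nonneg h.bound h.gaussian h.subset_ball h.sector_subset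
    h.left_mem h.right_mem h.meas hτ (by linarith) hs hs1 hx hy f1 hxy
    (fun i => (f3 i).mono hxn (hfn i) hτ2) (fun i j hij => (f4 i j hij).mono (hfn i) (hfn j) hτ2)
    hxp hxq (fun i => sep_of_ht hpn hτ (by linarith) ?_)
    (fun i => sep_of_ht hqn hτ (by linarith) ?_)
    (mul_nonneg (by positivity) (stepSize_nonneg h.nonneg)) ?_
  · nlinarith [f2 i, h.left_le]
  · nlinarith [f2 i]
  · rw [mul_pow, stepSize_pow h.nonneg, ← mul_assoc]
    refine mul_le_mul_of_nonneg_right (le_self_pow₀ ?_ (by omega))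
      (by have := h.nonneg; positivity)
    have h1 : (1 : ℝ) ≤ (2 * (k + 1)).factorial := by
      exact_mod_cast Nat.one_le_iff_ne_zero.2 (Nat.factorial_ne_zero _)
    have h2 : 1 ≤ Real.exp (32 * C * (k + 2) ^ 2) := by
      have := h.bound.one_le
      exact Real.one_le_exp (by positivity)
    nlinarith

/-- Increments near the base point `q`: pairing `q` with a nearby point `z` yields a bound for the
exponential moment of `2 F(q) - 2 F(z)`. -/
lemma momLE_near_right [IsProbabilityMeasure ν]
    (h : Frame ν Q F W U b H p q k C κ) {x y : ℂ} (hx : ‖x - q‖ ≤ ht q / 32)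
    (hy : ‖y - q‖ ≤ ht q / 32) :
    MomLE ν (2 * (k + 1)) (fun ω => F ω x - F ω y) (1024 * (‖x - y‖ / ht q)
      * ((2 * (k + 1)).factorial * (1 + 2 * Real.exp (16 * C)))) := by
  have hq0 := h.ht_right_pos
  have hR : 0 < ht q / 16 := by linarith
  have hpn := h.norm_lt_one h.left_mem
  have hqn := h.norm_lt_one h.right_mem
  have hp0 := ht_pos hpn
  have hqD : q ∈ sector b H := h.closedBall_subset (Metric.mem_closedBall_self hR.le)
  have hD : ∀ z, ‖z - q‖ ≤ ht q / 16 → z ∈ sector b H := fun z hz =>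
    h.closedBall_subset (by rwa [Metric.mem_closedBall, dist_eq_norm])
  have hexp : ∀ z, ‖z - q‖ = ht q / 16 →
      Integrable (fun ω => Real.exp (2 * F ω q - 2 * F ω z)) ν ∧
      ∫ ω, Real.exp (2 * F ω q - 2 * F ω z) ∂ν ≤ 2 * Real.exp (16 * C) := by
    intro z hz
    have hzD := hD z hz.le
    have hzn := h.norm_lt_one (h.sector_subset hzD)
    obtain ⟨f, f1, f2, -, f4⟩ := exists_separated_points (b := b) k hq0
      (by linarith [h.bot_le, h.bot_pos]) h.right_le h.top_le q hqn
    have hfn := fun i => h.norm_lt_one (h.sector_subset (f1 i))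
    have hzq : ht z ≤ 17 / 16 * ht q := by
      have := ht_sub_le z q
      linarith
    have hne : ∀ i w, ht w ≤ 2 * ht q → f i ≠ w := by
      rintro i w hw rfl
      linarith [f2 i]
    have hqz : ‖q - z‖ ≤ 1 / 2 / 8 * ht q := by rw [norm_sub_rev, hz]; linarith
    have hsep : ∀ w, ‖w‖ < 1 → Sep (1 / 2) q w →
        hypDist q z ≤ hypDist q w ∧ hypDist q z ≤ hypDist w z := fun w hw hs =>
      hypDist_le_of_sep hqn hzn hw (by norm_num) (by norm_num) hqz hs
    have hf : ∀ i, Sep (1 / 2) q (f i) := fun i =>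
      (sep_of_ht hqn (by norm_num) le_rfl (by linarith [f2 i])).symm
    have hqp : Sep (1 / 2) q p := sep_of_ht hpn (by norm_num) le_rfl (by linarith [h.left_le])
    have hpair : IndexedPairing p q (Fin.cons q f : Fin (k + 1) → ℂ)
        (Fin.cons z f : Fin (k + 1) → ℂ) := by
      refine IndexedPairing.cons ?_ hfn hpn hqn hqn hzn (fun i => hne i p ?_) (fun i => hne i q ?_)
        (fun i => hne i q ?_) (fun i => hne i z ?_) (hqp.ne hqn hpn (by norm_num)) ?_
        (fun i => (hsep _ (hfn i) (hf i)).1) (fun i => (hsep _ (hfn i) (hf i)).2)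
        (hsep _ hpn hqp).1 le_rfl
      · intro i j hij
        by_contra hne
        exact (f4 i j hne).ne (hfn i) (hfn j) (by positivity) hij
      · linarith [h.left_le]
      · linarith
      · linarith
      · linarith
      · rintro rfl
        simp only [sub_self, norm_zero] at hz
        linarith
    have hc1 : ∀ i, (Fin.cons q f : Fin (k + 1) → ℂ) i ∈ sector b H :=
      Fin.cases (by simpa using hqD) fun i => by simpa using f1 i
    have hd1 : ∀ i, (Fin.cons z f : Fin (k + 1) → ℂ) i ∈ sector b H :=
      Fin.cases (by simpa using hzD) fun i => by simpa using f1 i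
    have hi := h.comparison.integrable _ _ hc1 hd1 hpair
    have hcl := h.comparison.close _ _ hc1 hd1 hpair
    simp only [Fin.sum_univ_succ, Fin.cons_zero, Fin.cons_succ, sub_self, Finset.sum_const_zero,
      add_zero] at hi hcl
    refine ⟨hi, ?_⟩
    have hg := (h.bound.integral_exp_sign_le h.gaussian h.left_mem h.right_mem (ℓ := 1)
      (a := fun _ => q) (b := fun _ => z) (fun _ => h.right_mem) (fun _ => h.sector_subset hzD)
      one_pos le_rfl (fun _ => (hypDist_le_of_norm_sub_le hqn hzn (s := 1 / 16) (by norm_num)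
        (by linarith)).trans (by norm_num)) (fun _ => hypDist_nonneg hqn hzn) (fun _ => 1)
      (fun _ => by norm_num)).2
    simp only [Finset.univ_unique, Finset.sum_const, Finset.card_singleton, one_smul, one_mul,
      div_one, Nat.cast_one, one_pow] at hg
    have e : 8 * C * (1 + 1) = 16 * C := by ring
    rw [e] at hg
    have h1 := (abs_le.1 hcl).2
    have h2 : 0 ≤ ∫ x, Real.exp (2 * shiftedField Q W p q x q - 2 * shiftedField Q W p q x z) ∂Q :=
      integral_nonneg fun _ => (Real.exp_pos _).le
    nlinarith [h.le_half, h.nonneg]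
  have hharm : ∀ᵐ ω ∂ν, InnerProductSpace.HarmonicOnNhd (F ω) (Metric.closedBall q (ht q / 16)) := by
    filter_upwards [h.harm] with ω hω
    exact fun z hz => hω z (h.closedBall_subset hz)
  have hm := fun z hz => h.meas z (h.sector_subset (hD z hz))
  have key := MomLE.of_le_circle (m := 2 * (k + 1)) (ν := ν) (Y := fun ω => F ω x - F ω y)
    (Z := fun ω θ => max (2 * F ω q - 2 * F ω (circleMap q (ht q / 16) θ)) 0)
    (c := 1024 * (‖x - y‖ / ht q))
    (Λ := (2 * (k + 1)).factorial * (1 + 2 * Real.exp (16 * C))) (by omega) (by positivity)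
    (by positivity)
    ((hm x (by linarith)).sub (hm y (by linarith))).aestronglyMeasurable ?_ (fun θ => ?_) ?_
  · exact key
  · filter_upwards [hharm] with ω hω
    exact (continuous_const.sub (continuous_const.mul
      (continuous_comp_circleMap hR hω.continuousOn))).max continuous_const
  · have hz := norm_circleMap_sub_eq (a := q) hR θ
    exact MomLE.max_of_exp (by omega) (((h.meas q h.right_mem).const_mul 2).sub
      ((hm _ hz.le).const_mul 2)).aestronglyMeasurable (by positivity) (hexp _ hz).1 (hexp _ hz).2
  · filter_upwards [hharm] with ω hω
    have h1 := abs_sub_le_circleDev hR hω (z := x) (w := y) (by linarith) (by linarith) (F ω q)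
    rw [(circleDev_eq_two_mul hR hω).2] at h1
    refine h1.trans (le_of_eq ?_)
    congr 1
    · field_simp; ring
    · congr 1
      funext θ
      rw [abs_of_nonneg (le_max_right _ _), ← mul_sub, mul_max_of_nonneg _ _ (by norm_num), mul_zero]

/-- Steps that start away from `p`. They are compared with the Gaussian field directly if they also
start away from `q`. -/
lemma momLE_step [IsProbabilityMeasure ν] [IsProbabilityMeasure Q]
    (h : Frame ν Q F W U b H p q k C κ) {x y : ℂ} (hx : x ∈ sector b H) (hy : y ∈ sector b H)
    {s : ℝ} (hs : 0 < s) (hs1 : s ≤ stepScale k) (hxy : ‖x - y‖ ≤ s * ht x)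
    (hxp : Sep (sepScale k) x p) :
    MomLE ν (2 * (k + 1)) (fun ω => F ω x - F ω y) (stepConst k C * stepSize k s κ) := by
  have hρ := stepSize_nonneg (k := k) (s := s) h.nonneg
  have hρ1 := le_stepSize h.nonneg h.le_half hs hs1
  by_cases hxq : Sep (sepScale k) x q
  · refine (h.momLE_of_sep hx hy hs hs1 hxy hxp hxq).mono ?_
    refine mul_le_mul_of_nonneg_right ?_ hρ
    unfold stepConst
    have : 0 ≤ 1100 * ((2 * (k + 1)).factorial * (1 + 2 * Real.exp (16 * C))) := by positivity
    linarith
  · unfold Sep at hxq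
    push Not at hxq
    have hτ := sepScale_pos k
    have hτ1 := sepScale_le k
    have hs2 := stepScale_le k
    have hq0 := h.ht_right_pos
    have hx0 := ht_pos (h.norm_lt_one (h.sector_subset hx))
    have h1 := ht_sub_le x q
    have h2 : ‖x - q‖ ≤ 1 / 200 * (ht x + ht q) := hxq.le.trans (by gcongr)
    have h3 : ht x ≤ 1.02 * ht q := by norm_num; linarith
    have h4 : ‖x - y‖ ≤ 1 / 6400 * ht x := hxy.trans (by gcongr; linarith)
    have h5 : ‖y - q‖ ≤ ‖x - q‖ + ‖x - y‖ := by
      have := norm_add_le (x - q) (y - x)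
      rw [norm_sub_rev y x] at this
      simpa using this
    norm_num at h3
    refine (h.momLE_near_right (by linarith) (by linarith)).mono ?_
    have h6 : ‖x - y‖ / ht q ≤ 1.03 * stepSize k s κ := by
      rw [div_le_iff₀ hq0]
      norm_num
      nlinarith
    have hcst : 0 ≤ ((2 * (k + 1)).factorial * (1 + 2 * Real.exp (16 * C)) : ℝ) := by positivity
    unfold stepConst
    norm_num at h6
    calc _ ≤ 1024 * (103 / 100 * stepSize k s κ)
          * ((2 * (k + 1)).factorial * (1 + 2 * Real.exp (16 * C))) := by gcongr
      _ ≤ 1100 * ((2 * (k + 1)).factorial * (1 + 2 * Real.exp (16 * C))) * stepSize k s κ := by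
          nlinarith [mul_nonneg hρ hcst]
      _ ≤ _ := by
          refine mul_le_mul_of_nonneg_right ?_ hρ
          have : 0 ≤ ((2 * (k + 1)).factorial * Real.exp (32 * C * (k + 2) ^ 2) : ℝ) := by positivity
          linarith

end Frame

/-- Summation along a route: increments to the root. -/
lemma StepBound.momLE_root {h₀ Λ : ℝ} (h : StepBound ν F (sector b H) k h₀ κ Λ) (hΛ : 0 ≤ Λ)
    (hκ : 0 ≤ κ) (hκ1 : κ ≤ 1 / 2) (hb : 0 < b) (hbH : b ≤ H / 8) (hH : H ≤ 1 / 4) {z : ℂ}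
    (hz : z ∈ sector b H) (hz0 : h₀ ≤ ht z) (hH0 : h₀ ≤ H / 6) {L : ℝ}
    (hL : |Real.log (2 * ht z / H)| ≤ L) :
    MomLE ν (2 * (k + 1)) (fun ω => F ω z - F ω (pt (H / 2) 0))
      (51 / stepScale k * (L + 3) * Λ) := by
  set s₀ := stepScale k with hs₀
  have s0 : 0 < s₀ := stepScale_pos k
  have s1 : s₀ ≤ 1 / 6400 := stepScale_le k
  set M := ⌈24 / s₀⌉₊ with hM
  have hM1 : 24 / s₀ ≤ M := Nat.le_ceil _
  have hM2 : (M : ℝ) ≤ 25 / s₀ := by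
    have := (Nat.ceil_lt_add_one (show 0 ≤ 24 / s₀ by positivity)).le
    refine this.trans ?_
    rw [← sub_nonneg]
    have : 25 / s₀ - (24 / s₀ + 1) = (1 - s₀) / s₀ := by field_simp; ring
    rw [this]
    exact div_nonneg (by linarith) s0.le
  have hM0 : (0 : ℝ) < M := lt_of_lt_of_le (by positivity) hM1
  have hM10 : (10 : ℝ) ≤ M := by
    refine le_trans ?_ hM1
    rw [le_div_iff₀ s0]; linarith
  have hMs : 24 / (M : ℝ) ≤ s₀ := by
    rw [div_le_iff₀ hM0]
    rw [div_le_iff₀ s0] at hM1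
    linarith
  have hL0 : 0 ≤ L := (abs_nonneg _).trans hL
  obtain ⟨x, j, hr⟩ := exists_route (t := s₀ / 3) hb hbH hH (by positivity) (by linarith)
    (by exact_mod_cast hM10) (by
      have e : 1 / (M : ℝ) = 24 / M / 24 := by field_simp
      rw [e]; linarith) hz
  have hmem : ∀ l, ∀ i ∈ Set.uIcc (legEnds M j l).1 (legEnds M j l).2, x l i ∈ sector b H := by
    intro l i hi
    refine hr.ball l i hi (Metric.mem_closedBall_self ?_)
    have : 0 < H := by linarith
    rw [hr.ht_eq l i hi]; positivity
  have hlow : ∀ l, ∀ i ∈ Set.uIcc (legEnds M j l).1 (legEnds M j l).2, h₀ ≤ ht (x l i) :=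
    fun l i hi => (le_min hz0 hH0).trans (hr.low l i hi)
  have hsize : Λ * stepSize k s₀ κ ≤ Λ :=
    mul_le_of_le_one_right hΛ (stepSize_le_one hκ hκ1 s0 le_rfl)
  have hj0 : j ∈ Set.uIcc (legEnds M j 0).1 (legEnds M j 0).2 := Set.left_mem_uIcc
  have h1 : MomLE ν (2 * (k + 1)) (fun ω => F ω z - F ω (x 0 j)) Λ :=
    (h z hz _ (hmem 0 j hj0) hz0 s₀ s0 le_rfl
      (hr.near.trans (le_of_eq (by ring)))).mono hsize
  have h2 : ∀ l, ∀ i ∈ Finset.range ((legEnds M j l).2 - (legEnds M j l).1).natAbs,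
      MomLE ν (2 * (k + 1)) (fun ω =>
        F ω (legStep (x l) (legEnds M j l).1 (legEnds M j l).2 i).1
        - F ω (legStep (x l) (legEnds M j l).1 (legEnds M j l).2 i).2) Λ := by
    intro l i hi
    have hi' := Finset.mem_range.1 hi
    obtain ⟨m, m', hm, hm', e, -⟩ := legStep_spec (x l) hi'
    have hst := hr.step l i hi'
    rw [e] at hst ⊢
    refine (h _ (hmem l m hm) _ (hmem l m' hm') (hlow l m hm) s₀ s0 le_rfl
      (hst.trans ?_)).mono hsize
    have e2 : 8 / (M : ℝ) = 24 / M / 3 := by field_simp; norm_num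
    have : 0 < ht (x l m) := by
      have : 0 < H := by linarith
      rw [hr.ht_eq l m hm]; positivity
    rw [e2]
    gcongr
    linarith
  have h3 := fun l => MomLE.finset_sum (m := 2 * (k + 1)) (by omega) hΛ _ _ (h2 l)
  have h4 := h1.add (by omega) hΛ (by positivity) ((h3 0).add (by omega) (by positivity)
    (by positivity) (h3 1))
  have h5 : (fun ω => F ω z - F ω (pt (H / 2) 0)) = fun ω => F ω z - F ω (x 0 j)
      + (∑ i ∈ Finset.range ((legEnds M j 0).2 - (legEnds M j 0).1).natAbs,
          (F ω (legStep (x 0) (legEnds M j 0).1 (legEnds M j 0).2 i).1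
            - F ω (legStep (x 0) (legEnds M j 0).1 (legEnds M j 0).2 i).2)
        + ∑ i ∈ Finset.range ((legEnds M j 1).2 - (legEnds M j 1).1).natAbs,
          (F ω (legStep (x 1) (legEnds M j 1).1 (legEnds M j 1).2 i).1
            - F ω (legStep (x 1) (legEnds M j 1).1 (legEnds M j 1).2 i).2)) := by
    funext ω
    have := hr.sum_eq (F ω)
    rw [Fin.sum_univ_two] at this
    rw [this]
    ring
  rw [h5]
  refine h4.mono ?_
  simp only [Finset.card_range]
  have l0 := hr.length 0
  have l1 := hr.length 1
  have l2 : (M : ℝ) * (|Real.log (2 * ht z / H)| + 3) ≤ 25 / s₀ * (L + 3) := by gcongr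
  have l3 : 1 ≤ 1 / s₀ * (L + 3) := by
    rw [one_div_mul_eq_div, le_div_iff₀ s0]; linarith
  have e : 51 / s₀ * (L + 3) * Λ
      = 1 / s₀ * (L + 3) * Λ + (25 / s₀ * (L + 3) * Λ + 25 / s₀ * (L + 3) * Λ) := by ring
  rw [e]
  gcongr ?_ + (?_ * Λ + ?_ * Λ)
  · nlinarith
  · linarith
  · linarith

end Frame

section NearBase

variable {S E : Type*} [MeasurableSpace S] [MeasurableSpace E]

/-- The additional input near the base point `p`: the field is harmonic on a disk around a point
`pt (1.02 ht p) θ` just above `p`, and its exponential moments on the boundary of this disk are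
controlled under the measure without the bias. -/
structure NearBase (ν : Measure S) (F : S → ℂ → ℝ) (b H : ℝ) (p q q' : ℂ) (θ L : ℝ) : Prop where
  left_eq : p = pt (ht p) θ
  angle_le : |θ| ≤ H
  mem : q' ∈ sector b H
  ht_le : 51 / 50 * ht p ≤ ht q'
  harm : ∀ᵐ x ∂ν, InnerProductSpace.HarmonicOnNhd (F x)
    (Metric.closedBall (pt (51 / 50 * ht p) θ) (51 / 200 * ht p))
  meas : ∀ u ∈ Metric.closedBall (pt (51 / 50 * ht p) θ) (51 / 200 * ht p),
    AEMeasurable (fun x => F x u) ν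
  nonneg : 0 ≤ L
  exp_le : ∀ u, ‖u - pt (51 / 50 * ht p) θ‖ = 51 / 200 * ht p →
    ∫⁻ x, ENNReal.ofReal (Real.exp (-(2 * F x p - 2 * F x q)) *
      (1 + Real.exp (2 * F x u - 2 * F x q'))) ∂ν ≤ ENNReal.ofReal (2 * (1 + Real.exp L))

/-- A bound for the moments of all steps, in terms of bounds `l` for the logarithmic number of
scales and `L` for the exponential moments near `p`. -/
noncomputable def stepMoment (k : ℕ) (C l L : ℝ) : ℝ :=
  stepConst k C + 300 * (64 * (51 / stepScale k * (l + 3) * stepConst k C) + 8 * L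
    + 32 * (2 * (k + 1)).factorial)

variable {ν : Measure S} {Q : Measure E} {F : S → ℂ → ℝ} {W : E → ℂ → ℝ} {U : Set ℂ}
  {b H : ℝ} {p q : ℂ} {k : ℕ} {C κ : ℝ}

lemma stepConst_pos (k : ℕ) (C : ℝ) : 0 < stepConst k C := by unfold stepConst; positivity

lemma Frame.stepBound_far [IsProbabilityMeasure ν] [IsProbabilityMeasure Q]
    (h : Frame ν Q F W U b H p q k C κ) :
    StepBound ν F (sector b H) k (51 / 50 * ht p) κ (stepConst k C) := by
  intro x hx y hy h0 s hs hs1 hxy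
  have hpn := h.norm_lt_one h.left_mem
  refine h.momLE_step hx hy hs hs1 hxy (sep_of_ht hpn (sepScale_pos k) ?_ ?_)
  · linarith [sepScale_le k]
  · nlinarith [sepScale_le k, ht_pos hpn]

/-- All steps are controlled: those separated from `p` directly, the others by harmonicity in a disk
around `p`. -/
lemma Frame.stepBound [IsProbabilityMeasure ν] [IsProbabilityMeasure Q]
    (h : Frame ν Q F W U b H p q k C κ) {q' : ℂ} {θ L l : ℝ} (hn : NearBase ν F b H p q q' θ L)
    (hl : ∀ r, b ≤ r → r ≤ H → |Real.log (2 * r / H)| ≤ l) :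
    StepBound ν F (sector b H) k 0 κ (stepMoment k C l L) := by
  have hpn := h.norm_lt_one h.left_mem
  have hp0 := ht_pos hpn
  have hq0 := h.ht_right_pos
  have hqH := h.right_le_top
  have hH1 := h.top_le
  have hb0 := h.bot_pos
  have hbq := h.bot_le
  have hpq := h.left_le
  have hsc := stepConst_pos k C
  have hs0 := stepScale_pos k
  have hl0 : 0 ≤ l := (abs_nonneg _).trans (hl H (by linarith) le_rfl)
  have hL0 := hn.nonneg
  set Λ₁ := 51 / stepScale k * (l + 3) * stepConst k C with hΛ₁
  have hΛ₁0 : 0 ≤ Λ₁ := by positivity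
  have hroot : ∀ z ∈ sector b H, 51 / 50 * ht p ≤ ht z →
      MomLE ν (2 * (k + 1)) (fun ω => F ω z - F ω (pt (H / 2) 0)) Λ₁ := fun z hz hz0 =>
    h.stepBound_far.momLE_root hsc.le h.nonneg h.le_half hb0 (by linarith) hH1 hz hz0
      (by linarith) (hl _ (ht_of_mem_sector hH1 hz).1 (ht_of_mem_sector hH1 hz).2)
  intro x hx y hy _ s hs hs1 hxy
  have hρ := stepSize_nonneg (k := k) (s := s) h.nonneg
  have hρ1 := le_stepSize h.nonneg h.le_half hs hs1
  by_cases hxp : Sep (sepScale k) x p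
  · refine (h.momLE_step hx hy hs hs1 hxy hxp).mono (mul_le_mul_of_nonneg_right ?_ hρ)
    unfold stepMoment
    rw [← hΛ₁]
    have : 0 ≤ 300 * (64 * Λ₁ + 8 * L + 32 * (2 * (k + 1)).factorial) := by positivity
    linarith
  have hτ1 := sepScale_le k
  have hx0 := ht_pos (h.norm_lt_one (h.sector_subset hx))
  have hbp : b ≤ 51 / 50 * ht p := by
    by_contra hcon
    push Not at hcon
    refine hxp (sep_of_ht hpn (sepScale_pos k) (by linarith) ?_)
    nlinarith [(ht_of_mem_sector hH1 hx).1]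
  unfold Sep at hxp
  push Not at hxp
  -- The centre `a` lies slightly above `p`, high enough for the moment bound away from `p`.
  set a := pt (51 / 50 * ht p) θ with ha
  have hhta : ht a = 51 / 50 * ht p := ht_pt (by linarith)
  have haD : a ∈ sector b H := ⟨_, θ, hbp, by linarith, hn.angle_le, rfl⟩
  have hpa : ‖p - a‖ ≤ ht p / 50 := by
    conv_lhs => rw [hn.left_eq]
    rw [ha]
    refine (norm_pt_sub_pt_le hp0.le (by linarith)).trans ?_
    rw [sub_self, abs_zero, add_zero, abs_of_nonpos (by linarith)]
    linarith
  have hdiff : ∀ w ∈ sector b H, 51 / 50 * ht p ≤ ht w →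
      MomLE ν (2 * (k + 1)) (fun ω => F ω a - F ω w) (2 * Λ₁) := by
    intro w hw hw0
    have := (hroot a haD hhta.ge).sub (by omega) hΛ₁0 hΛ₁0 (hroot w hw hw0)
    simp only [sub_sub_sub_cancel_right] at this
    exact this.mono (by linarith)
  have hqD : q ∈ sector b H := h.closedBall_subset (Metric.mem_closedBall_self (by linarith))
  have h1 := ht_sub_le x p
  have h2 : ‖x - p‖ ≤ 1 / 200 * (ht x + ht p) := hxp.le.trans (by gcongr)
  have h3 : ht x ≤ 102 / 100 * ht p := by linarith
  have h4 : ‖x - y‖ ≤ 1 / 6400 * ht x := hxy.trans (by gcongr; linarith [stepScale_le k])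
  have h5 : ‖x - a‖ ≤ ‖x - p‖ + ‖p - a‖ := norm_sub_le_norm_sub_add_norm_sub _ _ _
  have h6 : ‖y - a‖ ≤ ‖y - x‖ + ‖x - a‖ := norm_sub_le_norm_sub_add_norm_sub _ _ _
  rw [norm_sub_rev y x] at h6
  have key := momLE_near_base (m := 2 * (k + 1)) (by omega) (R := 51 / 200 * ht p) (by linarith)
    hL0 (by positivity) (by positivity) hn.harm hn.meas (h.meas q h.right_mem)
    (h.meas q' (h.sector_subset hn.mem)) (p := p) (by linarith) (hdiff q hqD (by linarith))
    (hdiff q' hn.mem hn.ht_le) hn.exp_le (z := x) (w := y) (by linarith) (by linarith)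
  refine key.mono ?_
  have h7 : 64 * ‖x - y‖ / (51 / 200 * ht p) ≤ 300 * stepSize k s κ := by
    rw [div_le_iff₀ (by linarith)]
    have : ‖x - y‖ ≤ stepSize k s κ * (102 / 100 * ht p) :=
      hxy.trans (mul_le_mul hρ1 h3 hx0.le hρ)
    nlinarith [mul_nonneg hρ hp0.le]
  unfold stepMoment
  rw [← hΛ₁]
  calc _ ≤ 300 * stepSize k s κ *
        (16 * (2 * Λ₁ + 2 * Λ₁) + 8 * L + 32 * (2 * (k + 1)).factorial) := by gcongr
    _ = 300 * (64 * Λ₁ + 8 * L + 32 * (2 * (k + 1)).factorial) * stepSize k s κ := by ring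
    _ ≤ _ := mul_le_mul_of_nonneg_right (by linarith) hρ

/-- Short steps inside the sector have small moments. -/
lemma Frame.momLE_inner (h : Frame ν Q F W U b H p q k C κ) {t s Λ : ℝ} (ht0 : 0 < t)
    (hst : s ≤ t / 32) (hΛ : 0 ≤ Λ) {o x y : ℂ} (hxn : ‖x‖ < 1)
    (hroot : ∀ z ∈ sector b H, MomLE ν (2 * (k + 1)) (fun ω => F ω z - F ω o) Λ)
    (hball : Metric.closedBall x (t / 16 * ht x) ⊆ sector b H) (hxy : ‖x - y‖ ≤ s * ht x) :
    MomLE ν (2 * (k + 1)) (fun ω => F ω x - F ω y) (1024 * (s / t) * Λ) := by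
  have hx0 := ht_pos hxn
  have hR : 0 < t / 16 * ht x := by positivity
  have key := momLE_of_closedBall (m := 2 * (k + 1)) (ν := ν) (F := F) (o := o) (y := y) (by omega)
    hR hΛ (by
      filter_upwards [h.harm] with ω hω
      exact fun z hz => hω z (hball hz)) (fun z hz => hroot z (hball hz)) (by
      rw [norm_sub_rev]
      have : s * ht x ≤ t / 32 * ht x := by gcongr
      linarith)
  refine key.mono ?_
  gcongr
  rw [div_le_iff₀ hR]
  calc 64 * ‖x - y‖ ≤ 64 * (s * ht x) := by gcongr
    _ = 1024 * (s / t) * (t / 16 * ht x) := by field_simp; ring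

end NearBase

/-! ### Chains of short steps -/

section Chains

lemma abs_log_sub_log_le {τ h h' : ℝ} (hτ : 0 < τ) (hτ1 : τ ≤ 1 / 3) (hh : 0 < h) (hh' : 0 < h')
    (hd : |h - h'| < τ * (h + h')) : |Real.log h - Real.log h'| ≤ 3 * τ := by
  have key : ∀ x y : ℝ, 0 < x → 0 < y → x - y < τ * (x + y) → Real.log x - Real.log y ≤ 3 * τ := by
    intro x y hx hy hxy
    rw [← Real.log_div hx.ne' hy.ne']
    refine (Real.log_le_sub_one_of_pos (by positivity)).trans ?_
    rw [sub_le_iff_le_add, div_le_iff₀ hy]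
    by_contra hcon
    push Not at hcon
    have h1 := mul_lt_mul_of_pos_left hcon (show 0 < 1 - τ by linarith)
    have h2 : 0 ≤ τ * y * (1 - 3 * τ) := mul_nonneg (by positivity) (by linarith)
    linarith
  rw [abs_lt] at hd
  rw [abs_le]
  constructor
  · have := key h' h hh' hh (by linarith)
    linarith
  · exact key h h' hh hh' (by linarith)

/-- Along a sequence of points with geometrically growing heights only a bounded number of points
is close to a given point. -/
lemma card_not_sep_le {h₀ : ℝ} (hh₀ : 0 < h₀) {M : ℕ} (hM : 768 ≤ M) {x : ℤ → ℂ} {I : Set ℤ}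
    (hx : ∀ i ∈ I, ht (x i) = h₀ * Real.exp (i / M)) {w : ℂ} (hw : ‖w‖ < 1) {j σ : ℤ}
    (hσ : σ = 1 ∨ σ = -1) (A : Finset ℕ)
    (hA : ∀ i ∈ A, ∃ m ∈ I, |m - (j + σ * i)| ≤ 1 ∧ ¬ Sep (256 / M) (x m) w) :
    A.card ≤ 1540 := by
  -- Points that are not separated have comparable heights, which confines the index `m` to the
  -- distance `768` from `M log (ht w / h₀)`, and `i` to a window of length `1536 + 2`.
  have hM' : (768 : ℝ) ≤ M := by exact_mod_cast hM
  have hw0 := ht_pos hw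
  have key : ∀ i ∈ A, ∃ m : ℤ, |m - (j + σ * i)| ≤ 1 ∧
      |(m : ℝ) - M * (Real.log (ht w) - Real.log h₀)| ≤ 768 := by
    intro i hi
    obtain ⟨m, hm, h0, hs⟩ := hA i hi
    refine ⟨m, h0, ?_⟩
    unfold Sep at hs
    push Not at hs
    have hpos : 0 < ht (x m) := by rw [hx m hm]; positivity
    have h1 := abs_log_sub_log_le (by positivity)
      (by rw [div_le_iff₀ (by positivity)]; linarith) hpos hw0
      ((abs_ht_sub_le _ _).trans_lt hs)
    rw [hx m hm, Real.log_mul hh₀.ne' (Real.exp_pos _).ne', Real.log_exp] at h1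
    have e : (m : ℝ) - M * (Real.log (ht w) - Real.log h₀)
        = M * (Real.log h₀ + m / M - Real.log (ht w)) := by field_simp; ring
    rw [e, abs_mul, abs_of_pos (by positivity : (0 : ℝ) < M)]
    calc (M : ℝ) * |Real.log h₀ + m / M - Real.log (ht w)| ≤ M * (3 * (256 / M)) := by gcongr
      _ = 768 := by field_simp; norm_num
  rcases A.eq_empty_or_nonempty with hA | hA
  · rw [hA]; simp
  obtain ⟨i₀, hi₀, hmin⟩ := A.exists_min_image id hA
  have hsub : A ⊆ Finset.Icc i₀ (i₀ + 1538) := by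
    intro i hi
    rw [Finset.mem_Icc]
    refine ⟨hmin i hi, ?_⟩
    obtain ⟨m, hm, hm1⟩ := key i hi
    obtain ⟨m₀, hm₀, hm₁⟩ := key i₀ hi₀
    have hle : i₀ ≤ i := hmin i hi
    have h1 : |(m : ℝ) - m₀| ≤ 1536 := by
      rw [abs_le] at hm1 hm₁ ⊢
      constructor <;> linarith
    have h2 : |m - m₀| ≤ 1536 := by exact_mod_cast h1
    rw [abs_le] at hm hm₀ h2
    rcases hσ with rfl | rfl <;> omega
  refine (Finset.card_le_card hsub).trans ?_
  rw [Nat.card_Icc]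
  omega

/-- A decomposition of the increment from a point `z'` close to `z` to a point `y'` close to `y`
into increments over short steps `(a j, c j)`, `j ∈ T`, inside the sector, of which only a bounded
number starts close to any given point. -/
structure IsChain {ι : Type*} (b H t : ℝ) (M : ℕ) (l : ℝ) (z y z' y' : ℂ) (T : Finset ι)
    (a c : ι → ℂ) : Prop where
  near_left : ‖z - z'‖ ≤ 3 * t * ht z
  near_right : ‖y - y'‖ ≤ 3 * t * ht y
  left_mem : z' ∈ sector b H
  right_mem : y' ∈ sector b H
  sum_eq : ∀ Φ : ℂ → ℝ, ∑ j ∈ T, (Φ (a j) - Φ (c j)) = Φ z' - Φ y'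
  mem : ∀ j ∈ T, a j ∈ sector b H
  mem' : ∀ j ∈ T, c j ∈ sector b H
  ball : ∀ j ∈ T, Metric.closedBall (a j) (t / 16 * ht (a j)) ⊆ sector b H
  step : ∀ j ∈ T, ‖a j - c j‖ ≤ 8 / M * ht (a j)
  card_le : (T.card : ℝ) ≤ 4 * (M * (l + 3))
  card_not_sep_le : ∀ w : ℂ, ‖w‖ < 1 → ∀ B ⊆ T, (∀ j ∈ B, ¬ Sep (256 / M) (a j) w) →
    B.card ≤ 4 * 1540

lemma exists_chain {b H t l : ℝ} {M : ℕ} (hb : 0 < b) (hbH : b ≤ H / 8) (hH : H ≤ 1 / 4)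
    (ht0 : 0 < t) (ht1 : t ≤ 1 / 2) (hM : 768 ≤ M) (hMt : 1 / (M : ℝ) ≤ t / 8)
    (hl : ∀ r, b ≤ r → r ≤ H → |Real.log (2 * r / H)| ≤ l) {z y : ℂ}
    (hz : z ∈ sector b H) (hy : y ∈ sector b H) :
    ∃ (z' y' : ℂ) (T : Finset (Σ _ : Fin 2 × Fin 2, ℕ)) (a c : (Σ _ : Fin 2 × Fin 2, ℕ) → ℂ),
      IsChain b H t M l z y z' y' T a c := by
  classical
  have hM' : (768 : ℝ) ≤ M := by exact_mod_cast hM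
  obtain ⟨x₀, k₀, r₀⟩ := exists_route hb hbH hH ht0 ht1 (by omega) hMt hz
  obtain ⟨x₁, k₁, r₁⟩ := exists_route hb hbH hH ht0 ht1 (by omega) hMt hy
  set x : Fin 2 → Fin 2 → ℤ → ℂ := ![x₀, x₁] with hx
  set k : Fin 2 → ℤ := ![k₀, k₁] with hk
  set w : Fin 2 → ℂ := ![z, y] with hw
  have hr : ∀ e, IsRoute b H t M (w e) (x e) (k e) := by
    intro e; fin_cases e
    · exact r₀
    · exact r₁
  have hwD : ∀ e, w e ∈ sector b H := by
    intro e; fin_cases e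
    · exact hz
    · exact hy
  have hH0 : 0 < H := by linarith
  set n : Fin 2 × Fin 2 → ℕ :=
    fun e => ((legEnds M (k e.1) e.2).2 - (legEnds M (k e.1) e.2).1).natAbs with hn
  set st : Fin 2 × Fin 2 → ℕ → ℂ × ℂ := fun e i =>
    legStep (x e.1 e.2) (legEnds M (k e.1) e.2).1 (legEnds M (k e.1) e.2).2 i with hst
  -- the steps of the route from `y'` are traversed backwards
  set a : (Σ _ : Fin 2 × Fin 2, ℕ) → ℂ :=
    fun j => if j.1.1 = 0 then (st j.1 j.2).1 else (st j.1 j.2).2 with ha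
  set c : (Σ _ : Fin 2 × Fin 2, ℕ) → ℂ :=
    fun j => if j.1.1 = 0 then (st j.1 j.2).2 else (st j.1 j.2).1 with hc
  have hspec : ∀ e, ∀ i < n e, ∃ m m' : ℤ,
      m ∈ Set.uIcc (legEnds M (k e.1) e.2).1 (legEnds M (k e.1) e.2).2 ∧
      m' ∈ Set.uIcc (legEnds M (k e.1) e.2).1 (legEnds M (k e.1) e.2).2 ∧
      st e i = (x e.1 e.2 m, x e.1 e.2 m') := by
    intro e i hi
    obtain ⟨m, m', h1, h2, h3, -⟩ := legStep_spec (x e.1 e.2) hi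
    exact ⟨m, m', h1, h2, h3⟩
  have hxmem : ∀ e l, ∀ m ∈ Set.uIcc (legEnds M (k e) l).1 (legEnds M (k e) l).2,
      x e l m ∈ sector b H := by
    intro e l m hm
    refine (hr e).ball l m hm (Metric.mem_closedBall_self ?_)
    rw [(hr e).ht_eq l m hm]; positivity
  have hpos : ∀ e i, i < n e → (st e i).1 ∈ sector b H ∧ (st e i).2 ∈ sector b H ∧
      Metric.closedBall (st e i).1 (t / 16 * ht (st e i).1) ⊆ sector b H ∧
      Metric.closedBall (st e i).2 (t / 16 * ht (st e i).2) ⊆ sector b H := by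
    intro e i hi
    obtain ⟨m, m', h1, h2, h3⟩ := hspec e i hi
    rw [h3]
    exact ⟨hxmem _ _ _ h1, hxmem _ _ _ h2, (hr e.1).ball _ _ h1, (hr e.1).ball _ _ h2⟩
  refine ⟨x₀ 0 k₀, x₁ 0 k₁, Finset.univ.sigma fun e => Finset.range (n e), a, c, ?_⟩
  have hT : ∀ j : (Σ _ : Fin 2 × Fin 2, ℕ),
      j ∈ Finset.univ.sigma (fun e => Finset.range (n e)) ↔ j.2 < n j.1 := by
    intro j; simp
  refine ⟨r₀.near, r₁.near, hxmem 0 0 k₀ Set.left_mem_uIcc, hxmem 1 0 k₁ Set.left_mem_uIcc,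
    ?_, ?_, ?_, ?_, ?_, ?_, ?_⟩
  · intro Φ
    rw [Finset.sum_sigma, Fintype.sum_prod_type, Fin.sum_univ_two]
    have s0 := r₀.sum_eq Φ
    have s1 := r₁.sum_eq Φ
    have e0 : ∑ l, ∑ i ∈ Finset.range (n (0, l)), (Φ (a ⟨(0, l), i⟩) - Φ (c ⟨(0, l), i⟩))
        = Φ (x₀ 0 k₀) - Φ (pt (H / 2) 0) := by
      rw [← s0]; rfl
    have e1 : ∑ l, ∑ i ∈ Finset.range (n (1, l)), (Φ (a ⟨(1, l), i⟩) - Φ (c ⟨(1, l), i⟩))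
        = -(Φ (x₁ 0 k₁) - Φ (pt (H / 2) 0)) := by
      rw [← s1, ← Finset.sum_neg_distrib]
      refine Finset.sum_congr rfl fun l _ => ?_
      rw [← Finset.sum_neg_distrib]
      refine Finset.sum_congr rfl fun i _ => ?_
      rw [neg_sub]; rfl
    rw [e0, e1]; ring
  · intro j hj
    have := hpos j.1 j.2 ((hT j).1 hj)
    simp only [ha]; split_ifs
    · exact this.1
    · exact this.2.1
  · intro j hj
    have := hpos j.1 j.2 ((hT j).1 hj)
    simp only [hc]; split_ifs
    · exact this.2.1
    · exact this.1
  · intro j hj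
    have := hpos j.1 j.2 ((hT j).1 hj)
    simp only [ha]; split_ifs
    · exact this.2.2.1
    · exact this.2.2.2
  · intro j hj
    have h1 := (hr j.1.1).step j.1.2 j.2 ((hT j).1 hj)
    have h2 := (hr j.1.1).step' j.1.2 j.2 ((hT j).1 hj)
    simp only [ha, hc]; split_ifs
    · exact h1
    · rw [norm_sub_rev]; exact h2
  · rw [Finset.card_sigma]
    push_cast
    simp only [Finset.card_range]
    have h1 : ∀ e : Fin 2 × Fin 2, (n e : ℝ) ≤ M * (l + 3) := by
      intro e
      refine ((hr e.1).length e.2).trans ?_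
      have := ht_of_mem_sector hH (hwD e.1)
      have := hl _ this.1 this.2
      gcongr
    calc ∑ e, (n e : ℝ) ≤ ∑ _e : Fin 2 × Fin 2, M * (l + 3) := Finset.sum_le_sum fun e _ => h1 e
      _ = _ := by simp
  · intro v hv B hBT hB
    -- in each leg, the starting points have indices in a bounded window
    have hfib : ∀ e : Fin 2 × Fin 2, (B.filter fun j => j.1 = e).card ≤ 1540 := by
      intro e
      set F := B.filter fun j => j.1 = e with hF
      have hinj : Set.InjOn (fun j : (Σ _ : Fin 2 × Fin 2, ℕ) => j.2) F := by
        rintro ⟨e₁, i₁⟩ h1 ⟨e₂, i₂⟩ h2 h12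
        simp only [hF, Finset.coe_filter, Set.mem_ofPred_eq] at h1 h2 h12
        rw [h1.2, h2.2, h12]
      rw [← Finset.card_image_of_injOn hinj]
      refine card_not_sep_le (h₀ := H / 2) (by positivity) hM (fun i hi => (hr e.1).ht_eq e.2 i hi)
        hv (j := (legEnds M (k e.1) e.2).1)
        (σ := if (legEnds M (k e.1) e.2).1 ≤ (legEnds M (k e.1) e.2).2 then 1 else -1)
        (by split_ifs <;> simp) _ fun i hi => ?_
      obtain ⟨⟨e', i'⟩, hj, rfl⟩ := Finset.mem_image.1 hi
      obtain ⟨hjB, hje⟩ := Finset.mem_filter.1 hj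
      simp only at hje
      subst hje
      have hlt : i' < n e' := (hT _).1 (hBT hjB)
      have hns := hB _ hjB
      simp only [ha, hst, legStep] at hns
      simp only [hn] at hlt
      by_cases hjk : (legEnds M (k e'.1) e'.2).1 ≤ (legEnds M (k e'.1) e'.2).2
      · simp only [hjk, if_true] at hns ⊢
        rw [Set.uIcc_of_le hjk]
        split_ifs at hns
        · exact ⟨_, ⟨by omega, by omega⟩, by simp, hns⟩
        · exact ⟨_, ⟨by omega, by omega⟩, by simp, hns⟩
      · simp only [hjk, if_false] at hns ⊢
        rw [Set.uIcc_of_ge (by omega)]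
        split_ifs at hns
        · exact ⟨_, ⟨by omega, by omega⟩, by rw [abs_le]; omega, hns⟩
        · exact ⟨_, ⟨by omega, by omega⟩, by rw [abs_le]; omega, hns⟩
    calc B.card = ∑ e : Fin 2 × Fin 2, (B.filter fun j => j.1 = e).card :=
          Finset.card_eq_sum_card_fiberwise fun j _ => Finset.mem_univ _
      _ ≤ ∑ _e : Fin 2 × Fin 2, 1540 := Finset.sum_le_sum fun e _ => hfib e
      _ = _ := by simp

end Chains

/-! ### Expansion along chains -/

section Expansion

/-- Among the tuples with entries in finite sets, those with an entry in a set of bounded size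
that is determined by the other entries. -/
lemma card_filter_piFinset_le {ι : Type*} [DecidableEq ι] [Inhabited ι] {ℓ c n : ℕ}
    (T : Fin ℓ → Finset ι) (hT : ∀ j, (T j).card ≤ n) (i : Fin ℓ) (R : (Fin ℓ → ι) → Finset ι)
    (hR : ∀ x v, R (Function.update x i v) = R x) (hc : ∀ x, (R x).card ≤ c) :
    ((Fintype.piFinset T).filter fun x => x i ∈ R x).card ≤ c * n ^ (ℓ - 1) := by
  set T' : Fin ℓ → Finset ι := Function.update T i {default} with hT'
  have hsub : (Fintype.piFinset T).filter (fun x => x i ∈ R x) ⊆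
      (Fintype.piFinset T').biUnion fun x => (R x).image fun v => Function.update x i v := by
    intro x hx
    obtain ⟨hx1, hx2⟩ := Finset.mem_filter.1 hx
    refine Finset.mem_biUnion.2 ⟨Function.update x i default, ?_, ?_⟩
    · rw [Fintype.mem_piFinset] at hx1 ⊢
      intro j
      rcases eq_or_ne j i with rfl | hj
      · simp [hT']
      · simpa [hT', hj] using hx1 j
    · rw [hR]
      exact Finset.mem_image.2 ⟨x i, hx2, by simp⟩
  refine (Finset.card_le_card hsub).trans ((Finset.card_biUnion_le_card_mul _ _ c fun x _ =>
    Finset.card_image_le.trans (hc x)).trans ?_)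
  rw [mul_comm]
  refine Nat.mul_le_mul_left _ ?_
  rw [Fintype.card_piFinset, ← Finset.mul_prod_erase _ _ (Finset.mem_univ i)]
  have h1 : (T' i).card = 1 := by simp [hT']
  rw [h1, one_mul]
  calc ∏ j ∈ Finset.univ.erase i, (T' j).card ≤ ∏ _j ∈ Finset.univ.erase i, n := by
        refine Finset.prod_le_prod' fun j hj => ?_
        have : T' j = T j := by simp [hT', Finset.ne_of_mem_erase hj]
        rw [this]
        exact hT j
    _ = n ^ (ℓ - 1) := by simp

open scoped Classical in
/-- Tuples of short steps whose starting points are not all separated from each other and from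
two given points are few. -/
lemma card_not_separated_le {ι : Type*} [Inhabited ι] {ℓ c n : ℕ} {τ : ℝ} {p q : ℂ}
    (hp : ‖p‖ < 1) (hq : ‖q‖ < 1) (T : Fin ℓ → Finset ι) (hT : ∀ j, (T j).card ≤ n)
    (a : Fin ℓ → ι → ℂ) (ha : ∀ i, ∀ v ∈ T i, ‖a i v‖ < 1)
    (hc : ∀ i, ∀ w : ℂ, ‖w‖ < 1 → ∀ B ⊆ T i, (∀ v ∈ B, ¬ Sep τ (a i v) w) → B.card ≤ c) :
    ((Fintype.piFinset T).filter fun x => ¬ ((∀ i, Sep τ (a i (x i)) p) ∧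
      (∀ i, Sep τ (a i (x i)) q) ∧ ∀ i j, i ≠ j → Sep τ (a i (x i)) (a j (x j)))).card
      ≤ ℓ * ((2 + ℓ) * (c * n ^ (ℓ - 1))) := by
  set R : ℂ → Fin ℓ → Finset ι := fun w i => (T i).filter fun v => ¬ Sep τ (a i v) w with hRdef
  have hRc : ∀ w i, ‖w‖ < 1 → (R w i).card ≤ c := fun w i hw =>
    hc i w hw _ (Finset.filter_subset _ _) fun v hv => (Finset.mem_filter.1 hv).2
  set A : ℂ → Fin ℓ → Finset (Fin ℓ → ι) := fun w i =>
    (Fintype.piFinset T).filter fun x => x i ∈ R w i with hA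
  set D : Fin ℓ → Fin ℓ → Finset (Fin ℓ → ι) := fun i j =>
    (Fintype.piFinset T).filter fun x =>
      x i ∈ if j ≠ i ∧ x j ∈ T j then R (a j (x j)) i else ∅ with hD
  have hAc : ∀ w i, ‖w‖ < 1 → (A w i).card ≤ c * n ^ (ℓ - 1) := fun w i hw =>
    card_filter_piFinset_le T hT i (fun _ => R w i) (fun _ _ => rfl) fun _ => hRc w i hw
  have hDc : ∀ i j, (D i j).card ≤ c * n ^ (ℓ - 1) := by
    intro i j
    refine card_filter_piFinset_le T hT i
      (fun x => if j ≠ i ∧ x j ∈ T j then R (a j (x j)) i else ∅) (fun x v => ?_) fun x => ?_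
    · by_cases hj : j = i
      · simp [hj]
      · simp [hj]
    · split_ifs with h
      · exact hRc _ _ (ha j _ h.2)
      · simp
  have hsub : ((Fintype.piFinset T).filter fun x => ¬ ((∀ i, Sep τ (a i (x i)) p) ∧
      (∀ i, Sep τ (a i (x i)) q) ∧ ∀ i j, i ≠ j → Sep τ (a i (x i)) (a j (x j)))) ⊆
      Finset.univ.biUnion fun i => (A p i ∪ A q i) ∪ Finset.univ.biUnion fun j => D i j := by
    intro x hx
    obtain ⟨hx1, hx2⟩ := Finset.mem_filter.1 hx
    have hxT := Fintype.mem_piFinset.1 hx1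
    simp only [Finset.mem_biUnion, Finset.mem_univ, true_and, Finset.mem_union]
    by_contra hcon
    push Not at hcon
    have hAn : ∀ w i, x ∉ A w i → Sep τ (a i (x i)) w := by
      intro w i hn
      by_contra hs
      exact hn (Finset.mem_filter.2 ⟨hx1, Finset.mem_filter.2 ⟨hxT i, hs⟩⟩)
    refine hx2 ⟨fun i => hAn p i (hcon i).1.1, fun i => hAn q i (hcon i).1.2, fun i j hij => ?_⟩
    by_contra hs
    refine (hcon i).2 j (Finset.mem_filter.2 ⟨hx1, ?_⟩)
    rw [if_pos ⟨hij.symm, hxT j⟩]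
    exact Finset.mem_filter.2 ⟨hxT i, hs⟩
  refine (Finset.card_le_card hsub).trans (Finset.card_biUnion_le.trans ?_)
  calc ∑ i : Fin ℓ, ((A p i ∪ A q i) ∪ Finset.univ.biUnion fun j => D i j).card
      ≤ ∑ _i : Fin ℓ, (2 + ℓ) * (c * n ^ (ℓ - 1)) := by
        refine Finset.sum_le_sum fun i _ => ?_
        refine (Finset.card_union_le _ _).trans ?_
        have h1 := Finset.card_union_le (A p i) (A q i)
        have h2 : (Finset.univ.biUnion fun j => D i j).card ≤ ℓ * (c * n ^ (ℓ - 1)) := by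
          refine Finset.card_biUnion_le.trans ((Finset.sum_le_sum fun j _ => hDc i j).trans ?_)
          simp
        have := hAc p i hp
        have := hAc q i hq
        rw [add_mul]
        omega
    _ = _ := by simp

variable {S E : Type*} [MeasurableSpace S] [MeasurableSpace E]
  {ν : Measure S} {Q : Measure E} {F : S → ℂ → ℝ} {W : E → ℂ → ℝ} {U : Set ℂ}
  {b H : ℝ} {p q : ℂ} {k : ℕ} {C κ : ℝ}

/-- The constant in the moment bounds for the Gaussian field. -/
noncomputable def gaussConst (k : ℕ) (C : ℝ) : ℝ := (2 * (k + 1)).factorial * Real.exp (16 * C)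

/-- The error in the comparison of the products of increments along chains. The first summand
bounds the contribution of the tuples of separated steps, the second one that of the remaining
tuples, whose number is smaller by a factor of order `1 / M`. -/
noncomputable def chainError (k M : ℕ) (C κ l t Λ : ℝ) : ℝ :=
  (4 * (M * (l + 3))) ^ (k + 1) * ((4 * (k + 1) * 3 ^ (k + 1) + 1)
      * Real.exp (8 * C * ((k + 1) + (k + 1) ^ 2)) * ((24 / M) ^ (k + 2) + κ / (24 / M) ^ (k + 1)))
    + (k + 1) * ((3 + k) * (6160 * (4 * (M * (l + 3))) ^ k))
      * ((2 + k) * ((16384 / (M * t) * Λ) ^ (k + 1) + (48 / M * gaussConst k C) ^ (k + 1)))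

lemma Frame.momLE_gauss (h : Frame ν Q F W U b H p q k C κ) {x y : ℂ} (hx : x ∈ sector b H)
    (hy : y ∈ sector b H) {s : ℝ} (hs : 0 < s) (hs1 : s ≤ 1 / 4) (hxy : ‖x - y‖ ≤ s * ht x) :
    MomLE Q (2 * (k + 1)) (fun ω => shiftedField Q W p q ω x - shiftedField Q W p q ω y)
      (gaussConst k C * (3 * s)) := by
  have hxn := h.norm_lt_one (h.sector_subset hx)
  have hyn := h.norm_lt_one (h.sector_subset hy)
  exact h.bound.momLE_shiftedField h.gaussian h.left_mem h.right_mem (by omega)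
    (h.sector_subset hx) (h.sector_subset hy) (by linarith) (by linarith)
    (hypDist_le_of_norm_sub_le hxn hyn hs1 hxy) (hypDist_nonneg hxn hyn)

lemma gaussConst_ge_one {k : ℕ} {C : ℝ} (hC : 1 ≤ C) : 1 ≤ gaussConst k C := by
  have h1 : (1 : ℝ) ≤ (2 * (k + 1)).factorial := by
    exact_mod_cast Nat.one_le_iff_ne_zero.2 (Nat.factorial_ne_zero _)
  have h2 : 1 ≤ Real.exp (16 * C) := Real.one_le_exp (by linarith)
  unfold gaussConst; nlinarith

/-- Comparison of products of increments between the end points of chains, by expansion over the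
steps. The tuples of separated steps are compared by means of the exponential moments; the other
tuples are few and contribute little. -/
lemma Frame.abs_integral_prod_chain_sub_le [IsProbabilityMeasure ν] [IsProbabilityMeasure Q]
    (h : Frame ν Q F W U b H p q k C κ) {ι : Type*} [Inhabited ι] {t l Λ : ℝ} {M : ℕ} (ht0 : 0 < t)
    (hM : 768 ≤ M) (hMt : 256 / (M : ℝ) ≤ t) (hl : 0 ≤ l) (hΛ : 1 ≤ Λ) {o : ℂ}
    (hroot : ∀ z ∈ sector b H, MomLE ν (2 * (k + 1)) (fun ω => F ω z - F ω o) Λ)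
    {z y z' y' : Fin (k + 1) → ℂ} {T : Fin (k + 1) → Finset ι} {a c : Fin (k + 1) → ι → ℂ}
    (hch : ∀ i, IsChain b H t M l (z i) (y i) (z' i) (y' i) (T i) (a i) (c i)) :
    |∫ ω, ∏ i, (2 * F ω (z' i) - 2 * F ω (y' i)) ∂ν
      - ∫ ω, ∏ i, (2 * shiftedField Q W p q ω (z' i) - 2 * shiftedField Q W p q ω (y' i)) ∂Q|
      ≤ chainError k M C κ l t Λ := by
  classical
  have hM' : (768 : ℝ) ≤ M := by exact_mod_cast hM
  have hM0 : (0 : ℝ) < M := by linarith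
  have hpn := h.norm_lt_one h.left_mem
  have hqn := h.norm_lt_one h.right_mem
  have hκ0 := h.nonneg
  have hC1 := h.bound.one_le
  have hg1 := gaussConst_ge_one (k := k) hC1
  set G := shiftedField Q W p q with hG
  have hs1 : 8 / (M : ℝ) ≤ 1 / 4 := by rw [div_le_div_iff₀ hM0 (by norm_num)]; linarith
  have hexpF : ∀ Φ : ℂ → ℝ, ∏ i, (2 * Φ (z' i) - 2 * Φ (y' i))
      = ∑ x ∈ Fintype.piFinset T, ∏ i, (2 * Φ (a i (x i)) - 2 * Φ (c i (x i))) := by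
    intro Φ
    rw [← Finset.prod_univ_sum T fun i v => 2 * Φ (a i v) - 2 * Φ (c i v)]
    exact Finset.prod_congr rfl fun i _ => ((hch i).sum_eq fun w => 2 * Φ w).symm
  have hmF : ∀ i, ∀ v ∈ T i, MomLE ν (2 * (k + 1))
      (fun ω => 2 * F ω (a i v) - 2 * F ω (c i v)) (16384 / (M * t) * Λ) := by
    intro i v hv
    have han := h.norm_lt_one (h.sector_subset ((hch i).mem v hv))
    have h1 := (h.momLE_inner ht0 (s := 8 / M) (by
      have e : 8 / (M : ℝ) = 256 / M / 32 := by field_simp; norm_num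
      rw [e]; linarith) (by linarith) han hroot ((hch i).ball v hv)
      ((hch i).step v hv)).const_mul (c := 2) (by norm_num)
    simp only [mul_sub] at h1
    refine h1.mono (le_of_eq ?_)
    field_simp
    norm_num
  have hmG : ∀ i, ∀ v ∈ T i, MomLE Q (2 * (k + 1))
      (fun ω => 2 * G ω (a i v) - 2 * G ω (c i v)) (48 / M * gaussConst k C) := by
    intro i v hv
    have h1 := (h.momLE_gauss ((hch i).mem v hv) ((hch i).mem' v hv) (by positivity) hs1
      ((hch i).step v hv)).const_mul (c := 2) (by norm_num)
    simp only [mul_sub] at h1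
    refine h1.mono (le_of_eq ?_)
    field_simp
    norm_num
  have hF0 : 0 < 16384 / (M * t) * Λ := by positivity
  have hG0 : 0 < 48 / M * gaussConst k C := by positivity
  have hpF : ∀ x ∈ Fintype.piFinset T, _ := fun x hx =>
    integral_prod_le_of_momLE (fun _ => hF0) fun i => hmF i (x i) (Fintype.mem_piFinset.1 hx i)
  have hpG : ∀ x ∈ Fintype.piFinset T, _ := fun x hx =>
    integral_prod_le_of_momLE (fun _ => hG0) fun i => hmG i (x i) (Fintype.mem_piFinset.1 hx i)
  simp_rw [hexpF]
  rw [integral_finsetSum _ fun x hx => (hpF x hx).1, integral_finsetSum _ fun x hx => (hpG x hx).1,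
    ← Finset.sum_sub_distrib]
  set e₁ : ℝ := (4 * (k + 1) * 3 ^ (k + 1) + 1)
      * Real.exp (8 * C * ((k + 1) + (k + 1) ^ 2)) * ((24 / M) ^ (k + 2) + κ / (24 / M) ^ (k + 1))
    with he₁
  set e₂ : ℝ := (2 + k) * ((16384 / (M * t) * Λ) ^ (k + 1) + (48 / M * gaussConst k C) ^ (k + 1))
    with he₂
  have he₁0 : 0 ≤ e₁ := by positivity
  have he₂0 : 0 ≤ e₂ := by positivity
  set good : (Fin (k + 1) → ι) → Prop := fun x => (∀ i, Sep (256 / M) (a i (x i)) p) ∧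
      (∀ i, Sep (256 / M) (a i (x i)) q) ∧
      ∀ i j, i ≠ j → Sep (256 / M) (a i (x i)) (a j (x j)) with hgood
  have hterm : ∀ x ∈ Fintype.piFinset T,
      |∫ ω, ∏ i, (2 * F ω (a i (x i)) - 2 * F ω (c i (x i))) ∂ν
        - ∫ ω, ∏ i, (2 * G ω (a i (x i)) - 2 * G ω (c i (x i))) ∂Q|
      ≤ e₁ + if ¬ good x then e₂ else 0 := by
    intro x hx
    have hxT := Fintype.mem_piFinset.1 hx
    by_cases hgx : good x
    · rw [if_neg (not_not.2 hgx), add_zero]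
      have h1 := h.comparison.abs_integral_prod_sub_le hκ0 h.bound h.gaussian h.subset_ball
        h.sector_subset h.left_mem h.right_mem h.meas (τ := 256 / M) (s := 8 / M) (by positivity)
        (by rw [div_le_one hM0]; linarith) (by positivity)
        (le_of_eq (by field_simp; norm_num)) (a := fun i => a i (x i)) (b := fun i => c i (x i))
        (fun i => (hch i).mem _ (hxT i)) (fun i => (hch i).mem' _ (hxT i))
        (fun i => (hch i).step _ (hxT i)) hgx.2.2 hgx.1 hgx.2.1
      refine h1.trans (le_of_eq ?_)
      rw [he₁]
      have e : 3 * (8 / (M : ℝ)) = 24 / M := by ring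
      rw [e]
      push_cast
      ring
    · rw [if_pos hgx]
      have h1 := (hpF x hx).2
      have h2 := (hpG x hx).2
      simp only [Finset.prod_const, Finset.card_univ, Fintype.card_fin] at h1 h2
      refine (abs_sub _ _).trans ((add_le_add h1 h2).trans ?_)
      rw [he₂]
      push_cast
      linarith
  refine (Finset.abs_sum_le_sum_abs _ _).trans ((Finset.sum_le_sum hterm).trans ?_)
  rw [Finset.sum_add_distrib, Finset.sum_const, ← Finset.sum_filter, Finset.sum_const, nsmul_eq_mul,
    nsmul_eq_mul]
  set n : ℕ := ⌊4 * ((M : ℝ) * (l + 3))⌋₊ with hn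
  have hnle : (n : ℝ) ≤ 4 * (M * (l + 3)) := Nat.floor_le (by positivity)
  have hTn : ∀ i, (T i).card ≤ n := fun i => Nat.le_floor (hch i).card_le
  have hc1 : ((Fintype.piFinset T).card : ℝ) ≤ (4 * (M * (l + 3))) ^ (k + 1) := by
    have : (Fintype.piFinset T).card ≤ n ^ (k + 1) := by
      rw [Fintype.card_piFinset]
      refine (Finset.prod_le_prod' fun i _ => hTn i).trans (by simp)
    calc ((Fintype.piFinset T).card : ℝ) ≤ (n : ℝ) ^ (k + 1) := by exact_mod_cast this
      _ ≤ _ := by gcongr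
  have hc2 : (((Fintype.piFinset T).filter fun x => ¬ good x).card : ℝ)
      ≤ (k + 1) * ((3 + k) * (6160 * (4 * (M * (l + 3))) ^ k)) := by
    have h1 := card_not_separated_le (c := 6160) (τ := 256 / M) hpn hqn T hTn a
      (fun i v hv => h.norm_lt_one (h.sector_subset ((hch i).mem v hv)))
      (fun i w hw B hB hBs => (hch i).card_not_sep_le w hw B hB hBs)
    rw [Nat.add_sub_cancel] at h1
    calc (((Fintype.piFinset T).filter fun x => ¬ good x).card : ℝ)
        ≤ ((k + 1 : ℕ) : ℝ) * ((2 + (k + 1 : ℕ)) * (6160 * (n : ℝ) ^ k)) := by exact_mod_cast h1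
      _ = (k + 1) * ((3 + k) * (6160 * (n : ℝ) ^ k)) := by push_cast; ring
      _ ≤ _ := by gcongr
  unfold chainError
  rw [← he₁, ← he₂]
  gcongr

/-- Comparison of products of increments between arbitrary points of the sector. The end points
are first moved a little into the interior of the sector, at the cost of the first two error terms,
and then joined by chains of short steps. -/
lemma Frame.abs_integral_prod_sub_le [IsProbabilityMeasure ν] [IsProbabilityMeasure Q]
    (h : Frame ν Q F W U b H p q k C κ) {t l Λ : ℝ} {M : ℕ} (ht0 : 0 < t)
    (hM : 768 ≤ M) (hMt : 256 / (M : ℝ) ≤ t) (ht1 : 3 * t ≤ stepScale k)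
    (hl : ∀ r, b ≤ r → r ≤ H → |Real.log (2 * r / H)| ≤ l) (hΛ : 1 ≤ Λ) {o : ℂ}
    (hroot : ∀ z ∈ sector b H, MomLE ν (2 * (k + 1)) (fun ω => F ω z - F ω o) Λ)
    (hstep : StepBound ν F (sector b H) k 0 κ Λ) (hτ₁ : 4 * Λ * stepSize k (3 * t) κ ≤ 1)
    (hτ₂ : 36 * gaussConst k C * t ≤ 1) {z y : Fin (k + 1) → ℂ}
    (hz : ∀ i, z i ∈ sector b H) (hy : ∀ i, y i ∈ sector b H) :
    Integrable (fun ω => ∏ i, (2 * F ω (z i) - 2 * F ω (y i))) ν ∧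
    Integrable (fun ω => ∏ i, (2 * shiftedField Q W p q ω (z i)
      - 2 * shiftedField Q W p q ω (y i))) Q ∧
    |∫ ω, ∏ i, (2 * F ω (z i) - 2 * F ω (y i)) ∂ν
      - ∫ ω, ∏ i, (2 * shiftedField Q W p q ω (z i) - 2 * shiftedField Q W p q ω (y i)) ∂Q|
      ≤ 2 ^ (k + 1) * ((k + 2) * (4 * Λ * stepSize k (3 * t) κ * (4 * Λ) ^ (k + 1)))
        + 2 ^ (k + 1) * ((k + 2) * (36 * gaussConst k C * t
          * (192 * gaussConst k C * (l + 3)) ^ (k + 1)))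
        + chainError k M C κ l t Λ := by
  have hM' : (768 : ℝ) ≤ M := by exact_mod_cast hM
  have hM0 : (0 : ℝ) < M := by linarith
  have hb0 := h.bot_pos
  have hbq := h.bot_le
  have hqH := h.right_le_top
  have hq0 := h.ht_right_pos
  have hH1 := h.top_le
  have hg1 := gaussConst_ge_one (k := k) h.bound.one_le
  have hl0 : 0 ≤ l := (abs_nonneg _).trans (hl H (by linarith) le_rfl)
  have hss := stepScale_le k
  have hρ0 := stepSize_nonneg (k := k) (s := 3 * t) h.nonneg
  have hρ1 := le_stepSize h.nonneg h.le_half (by positivity) ht1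
  have hs1 : 8 / (M : ℝ) ≤ 1 / 4 := by rw [div_le_div_iff₀ hM0 (by norm_num)]; linarith
  choose z' y' T a c hch using fun i => exists_chain (t := t) (M := M) hb0 (by linarith) hH1 ht0
    (by linarith) hM (by
      have e : 1 / (M : ℝ) = 256 / M / 256 := by field_simp
      rw [e]; linarith) hl (hz i) (hy i)
  have hm : 2 * (k + 1) ≠ 0 := by omega
  have hFz : ∀ {v w}, v ∈ sector b H → w ∈ sector b H → ‖v - w‖ ≤ 3 * t * ht v →
      MomLE ν (2 * (k + 1)) (fun ω => F ω v - F ω w) (Λ * stepSize k (3 * t) κ) :=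
    fun {v w} hv hw hvw => hstep v hv w hw (ht_pos (h.norm_lt_one (h.sector_subset hv))).le _
      (by positivity) ht1 hvw
  have hΛρ : 0 ≤ Λ * stepSize k (3 * t) κ := by positivity
  have hgt : 0 ≤ gaussConst k C * (3 * (3 * t)) := by positivity
  have r1 := integral_prod_sub_prod_le_of_momLE (ν := ν) (ℓ := k + 1)
    (X := fun i ω => 2 * F ω (z i) - 2 * F ω (y i))
    (X' := fun i ω => 2 * F ω (z' i) - 2 * F ω (y' i)) (τ := 4 * Λ * stepSize k (3 * t) κ)
    (Λ := 4 * Λ) (by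
      have : 0 < stepSize k (3 * t) κ := lt_of_lt_of_le (by positivity) hρ1
      positivity) hτ₁ (by linarith) (fun i => by
      have := ((hFz (hz i) (hch i).left_mem (hch i).near_left).sub hm hΛρ hΛρ
        (hFz (hy i) (hch i).right_mem (hch i).near_right)).const_mul (c := 2) (by norm_num)
      refine (this.mono (Λ' := 4 * Λ * stepSize k (3 * t) κ) (le_of_eq (by ring))).of_abs_le ?_ ?_
      · refine this.1.congr (ae_of_all _ fun ω => ?_)
        dsimp only; ring
      · refine ae_of_all _ fun ω => le_of_eq ?_
        congr 1; ring) (fun i => by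
      have := ((hroot _ (hch i).left_mem).sub hm (by linarith) (by linarith)
        (hroot _ (hch i).right_mem)).const_mul (c := 2) (by norm_num)
      refine (this.mono (Λ' := 4 * Λ) (le_of_eq (by ring))).of_abs_le ?_ ?_
      · refine this.1.congr (ae_of_all _ fun ω => ?_)
        dsimp only; ring
      · refine ae_of_all _ fun ω => le_of_eq ?_
        congr 1; ring)
  set G := shiftedField Q W p q with hG
  have r2 := integral_prod_sub_prod_le_of_momLE (ν := Q) (ℓ := k + 1)
    (X := fun i ω => 2 * G ω (z i) - 2 * G ω (y i))
    (X' := fun i ω => 2 * G ω (z' i) - 2 * G ω (y' i)) (τ := 36 * gaussConst k C * t)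
    (Λ := 192 * gaussConst k C * (l + 3)) (by positivity) hτ₂ (by nlinarith) (fun i => by
      have := ((h.momLE_gauss (hz i) (hch i).left_mem (s := 3 * t) (by positivity) (by linarith)
        (hch i).near_left).sub hm hgt hgt (h.momLE_gauss (hy i) (hch i).right_mem (s := 3 * t)
        (by positivity) (by linarith) (hch i).near_right)).const_mul (c := 2) (by norm_num)
      refine (this.mono (Λ' := 36 * gaussConst k C * t) (le_of_eq (by ring))).of_abs_le ?_ ?_
      · refine this.1.congr (ae_of_all _ fun ω => ?_)
        dsimp only; ring
      · refine ae_of_all _ fun ω => le_of_eq ?_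
        congr 1; ring) (fun i => by
      have := (MomLE.finset_sum (ν := Q) hm (by positivity)
        (fun v ω => G ω (a i v) - G ω (c i v)) (T i) fun v hv =>
          h.momLE_gauss ((hch i).mem v hv) ((hch i).mem' v hv) (s := 8 / M) (by positivity) hs1
            ((hch i).step v hv)).const_mul (c := 2) (by norm_num)
      have hs : ∀ ω, ∑ v ∈ T i, (G ω (a i v) - G ω (c i v)) = G ω (z' i) - G ω (y' i) :=
        fun ω => (hch i).sum_eq (G ω)
      simp only [hs] at this
      refine (this.mono (Λ' := 192 * gaussConst k C * (l + 3)) ?_).of_abs_le ?_ ?_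
      · have h1 := (hch i).card_le
        have h2 : 0 ≤ gaussConst k C * (3 * (8 / M)) := by positivity
        have h3 := mul_le_mul_of_nonneg_right h1 h2
        have h4 : 4 * (M * (l + 3)) * (gaussConst k C * (3 * (8 / M)))
            = 96 * gaussConst k C * (l + 3) := by field_simp; norm_num
        linarith
      · refine this.1.congr (ae_of_all _ fun ω => ?_)
        dsimp only; ring
      · refine ae_of_all _ fun ω => le_of_eq ?_
        congr 1; ring)
  have r3 := h.abs_integral_prod_chain_sub_le ht0 hM hMt hl0 hΛ hroot hch
  refine ⟨r1.1, r2.1, ?_⟩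
  have e1 := r1.2.2
  have e2 := r2.2.2
  rw [← hG] at r3
  push_cast at e1 e2
  have e3 : (1 : ℝ) + (k + 1) = k + 2 := by ring
  rw [e3] at e1 e2
  rw [abs_le] at e1 e2 r3 ⊢
  constructor <;> linarith

end Expansion

/-! ### The field near the base point -/

/-- Two points at distance `r` are closer to each other than to a point `f` that lies much higher,
when `r²` is small compared to the product of the heights. -/
lemma hypDist_le_of_higher {u d f : ℂ} {r : ℝ} (hu : ‖u‖ < 1) (hd : ‖d‖ < 1) (hf : ‖f‖ < 1)
    (hr : ‖u - d‖ ≤ r) (h1 : 2 * ht u ≤ ht f) (h2 : 2 * ht d ≤ ht f)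
    (h3 : 8 * r ^ 2 ≤ ht f * ht u) (h4 : 8 * r ^ 2 ≤ ht f * ht d) :
    hypDist u d ≤ hypDist u f ∧ hypDist u d ≤ hypDist f d := by
  have key : ∀ x y : ℂ, ‖x‖ < 1 → ‖y‖ < 1 → 2 * ht x ≤ ht f → ‖x - y‖ ≤ r →
      8 * r ^ 2 ≤ ht f * ht y → hypDist x y ≤ hypDist x f := by
    intro x y hx hy hxf hxy hry
    refine hypDist_le_hypDist hx hy hx hf ?_
    have g1 := gap_le_two_ht f
    have g2 := ht_le_gap hy
    have g3 := gap_pos hx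
    have hf0 := ht_pos hf
    have hy0 := ht_pos hy
    have a1 : ‖x - y‖ ^ 2 ≤ r ^ 2 := pow_le_pow_left₀ (norm_nonneg _) hxy 2
    have a2 : ht f / 2 ≤ ‖x - f‖ := by
      have := ht_sub_le f x
      rw [norm_sub_rev] at this
      linarith
    have a3 : (ht f / 2) ^ 2 ≤ ‖x - f‖ ^ 2 := pow_le_pow_left₀ (by linarith) a2 2
    have a4 : ‖x - y‖ ^ 2 * (1 - ‖f‖ ^ 2) ≤ ‖x - f‖ ^ 2 * (1 - ‖y‖ ^ 2) := by
      calc ‖x - y‖ ^ 2 * (1 - ‖f‖ ^ 2) ≤ r ^ 2 * (2 * ht f) :=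
            mul_le_mul a1 g1 (gap_pos hf).le (sq_nonneg _)
        _ ≤ (ht f / 2) ^ 2 * ht y := by nlinarith
        _ ≤ ‖x - f‖ ^ 2 * (1 - ‖y‖ ^ 2) := mul_le_mul a3 g2 hy0.le (sq_nonneg _)
    calc _ = ‖x - y‖ ^ 2 * (1 - ‖f‖ ^ 2) * (1 - ‖x‖ ^ 2) := by ring
      _ ≤ ‖x - f‖ ^ 2 * (1 - ‖y‖ ^ 2) * (1 - ‖x‖ ^ 2) := mul_le_mul_of_nonneg_right a4 g3.le
      _ = _ := by ring
  refine ⟨key u d hu hd h1 hr h4, ?_⟩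
  rw [hypDist_comm u d, hypDist_comm f d]
  exact key d u hd hu h2 (by rwa [norm_sub_rev]) h3

section

variable {S E : Type*} [MeasurableSpace S] [MeasurableSpace E] {P : Measure S} {Q : Measure E}
  {F : S → ℂ → ℝ} {W : E → ℂ → ℝ} {U : Set ℂ} {b H : ℝ} {p q u : ℂ} {k : ℕ} {κ : ℝ}

/-- The perturbation of the bias that moves the base point from `p` to `u`. -/
lemma BiasComparison.integral_exp_le (h : BiasComparison P Q F W (sector b H) p q (k + 1) κ)
    (hb : 0 < b) (hH : H ≤ 1 / 4) (hp : p ∈ sector b H) (hu : u ∈ sector b H)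
    (hq : ‖q‖ < 1) {r : ℝ} (hr : ‖u - p‖ ≤ r) (hbq : b ≤ ht q)
    (hqH : 64 * (k + 1) ^ 3 * ht q ≤ H) (huq : 2 * ht u ≤ ht q) (hpu : 2 * ht p ≤ ht u)
    (hr1 : 8 * r ^ 2 ≤ ht q * ht p) :
    Integrable (fun x => Real.exp (2 * F x u - 2 * F x q)) P ∧
    ∫ x, Real.exp (2 * F x u - 2 * F x q) ∂P
      ≤ (1 + κ) * ∫ x, Real.exp (2 * W x u - 2 * W x q) ∂Q := by
  have hpn := norm_lt_one_of_mem_sector hb hH hp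
  have hun := norm_lt_one_of_mem_sector hb hH hu
  have hp0 := ht_pos hpn
  have hu0 := ht_pos hun
  have hy0 : 0 < ht q := ht_pos hq
  obtain ⟨f, f1, f2, -, f4⟩ := exists_separated_points k hy0 hbq hqH hH p hpn
  have hfn := fun i => norm_lt_one_of_mem_sector hb hH (f1 i)
  have hne : ∀ {v w : ℂ}, ht v < ht w → w ≠ v := by
    rintro v w hvw rfl
    exact lt_irrefl _ hvw
  have hy1 : 8 * r ^ 2 ≤ ht q * ht u := by nlinarith
  have hclose : ∀ w, ‖w‖ < 1 → ht q ≤ ht w →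
      hypDist u p ≤ hypDist u w ∧ hypDist u p ≤ hypDist w p := fun w hw hyw =>
    hypDist_le_of_higher hun hpn hw hr (by linarith) (by linarith) (by nlinarith) (by nlinarith)
  have hpair : IndexedPairing p q (Fin.cons u f : Fin (k + 1) → ℂ)
      (Fin.cons p f : Fin (k + 1) → ℂ) := by
    refine IndexedPairing.cons (fun i j hij => ?_) hfn hpn hq hun hpn
      (fun i => hne ?_) (fun i => hne ?_) (fun i => hne ?_) (fun i => hne ?_)
      (hne ?_) (fun e => hne (v := p) (w := q) (by linarith) e.symm)
      (fun i => (hclose _ (hfn i) ?_).1) (fun i => (hclose _ (hfn i) ?_).2) le_rfl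
      (hclose _ hq le_rfl).2
    · by_contra hne
      exact (f4 i j hne).ne (hfn i) (hfn j) (by positivity) hij
    all_goals first | linarith [f2 i] | linarith
  have hc : ∀ e ∈ sector b H, ∀ i, (Fin.cons e f : Fin (k + 1) → ℂ) i ∈ sector b H :=
    fun e he => Fin.cases (by simpa using he) fun i => by simpa using f1 i
  have h1 := h.integrable _ _ (hc u hu) (hc p hp) hpair
  have h2 := h.close _ _ (hc u hu) (hc p hp) hpair
  have e : ∀ G : ℂ → ℝ, (2 * G p - 2 * G q) + ∑ i, (2 * G ((Fin.cons u f : Fin (k + 1) → ℂ) i)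
      - 2 * G ((Fin.cons p f : Fin (k + 1) → ℂ) i)) = 2 * G u - 2 * G q := by
    intro G
    rw [Fin.sum_univ_succ]
    simp
  simp only [e] at h1 h2
  exact ⟨h1, by linarith [(abs_le.1 h2).2]⟩

/-- Removing the bias: a bound under `P` yields one under the biased measure for the integrand
multiplied by the inverse bias. -/
lemma lintegral_biasedMeasure_le [IsProbabilityMeasure P] {q' : ℂ} {L : ℝ}
    (hZ : 1 / 2 ≤ ∫ x, Real.exp (2 * F x p - 2 * F x q) ∂P)
    (hI : Integrable (fun x => Real.exp (2 * F x u - 2 * F x q')) P)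
    (hL : ∫ x, Real.exp (2 * F x u - 2 * F x q') ∂P ≤ Real.exp L) :
    ∫⁻ x, ENNReal.ofReal (Real.exp (-(2 * F x p - 2 * F x q)) *
      (1 + Real.exp (2 * F x u - 2 * F x q'))) ∂(biasedMeasure P F p q)
      ≤ ENNReal.ofReal (2 * (1 + Real.exp L)) := by
  rw [biasedMeasure, lintegral_tilted]
  set Z := ∫ x, Real.exp (2 * F x p - 2 * F x q) ∂P with hZdef
  have hZ0 : 0 < Z := by linarith
  have e : ∀ x, ENNReal.ofReal (Real.exp (2 * F x p - 2 * F x q) / Z) *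
      ENNReal.ofReal (Real.exp (-(2 * F x p - 2 * F x q)) *
        (1 + Real.exp (2 * F x u - 2 * F x q')))
      = ENNReal.ofReal ((1 + Real.exp (2 * F x u - 2 * F x q')) / Z) := by
    intro x
    rw [← ENNReal.ofReal_mul (by positivity)]
    congr 1
    rw [Real.exp_neg]
    have := Real.exp_ne_zero (2 * F x p - 2 * F x q)
    field_simp
  simp only [e]
  have hI' : Integrable (fun x => (1 + Real.exp (2 * F x u - 2 * F x q')) / Z) P :=
    ((integrable_const _).add hI).div_const _
  rw [← ofReal_integral_eq_lintegral_ofReal hI' (ae_of_all _ fun x => by positivity)]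
  refine ENNReal.ofReal_le_ofReal ?_
  rw [integral_div, integral_add (integrable_const _) hI, div_le_iff₀ hZ0]
  simp only [integral_const, probReal_univ, smul_eq_mul, mul_one]
  nlinarith [Real.exp_pos L]

end

/-! ### The variance of the field -/

section

variable {E : Type*} [MeasurableSpace E] {Q : Measure E} {W : E → ℂ → ℝ} {U : Set ℂ}

lemma zeta_mul_circleExp (j : ℕ) (θ : ℝ) :
    zeta j * (Circle.exp (Real.pi / 2 + θ) : ℂ) = pt (2 / (Real.exp j + 1)) θ := by
  have h1 : Real.tanh ((j : ℝ) / 2) = 1 - 2 / (Real.exp j + 1) := by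
    rw [Real.tanh_eq_sinh_div_cosh, Real.sinh_eq, Real.cosh_eq]
    have e1 : Real.exp (j : ℝ) = Real.exp ((j : ℝ) / 2) * Real.exp ((j : ℝ) / 2) := by
      rw [← Real.exp_add]; congr 1; ring
    have e2 : Real.exp (-((j : ℝ) / 2)) = (Real.exp ((j : ℝ) / 2))⁻¹ := Real.exp_neg _
    have e3 := Real.exp_pos ((j : ℝ) / 2)
    rw [e1, e2]
    field_simp
    ring
  rw [zeta, h1, pt, Circle.coe_exp]
  have h2 : Complex.exp (((Real.pi / 2 + θ : ℝ) : ℂ) * Complex.I)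
      = Complex.I * Complex.exp (Complex.I * (θ : ℂ)) := by
    rw [show ((Real.pi / 2 + θ : ℝ) : ℂ) * Complex.I
      = (Real.pi : ℂ) / 2 * Complex.I + Complex.I * (θ : ℂ) by push_cast; ring, Complex.exp_add,
      Complex.exp_pi_div_two_mul_I]
  rw [h2]
  ring

lemma exists_pt_mem (hUi : U ∈ 𝓝[Metric.ball (0 : ℂ) 1] Complex.I) :
    ∃ H > 0, H ≤ 1 / 4 ∧ ∀ h θ : ℝ, 0 < h → h ≤ H → |θ| ≤ H → pt h θ ∈ U := by
  obtain ⟨ρ, hρ, hρU⟩ := Metric.mem_nhdsWithin_iff.1 hUi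
  refine ⟨min (1 / 4) (ρ / 4), by positivity, min_le_left _ _, fun h θ h0 h1 h2 => ?_⟩
  have h3 := min_le_left (1 / 4) (ρ / 4)
  have h4 := min_le_right (1 / 4) (ρ / 4)
  refine hρU ⟨?_, ?_⟩
  · have e : Complex.I = pt 0 0 := by simp [pt]
    rw [Metric.mem_ball, dist_eq_norm, e]
    refine (norm_pt_sub_pt_le h0.le (by linarith)).trans_lt ?_
    rw [sub_zero, sub_zero, abs_of_pos h0]
    linarith
  · rw [Metric.mem_ball, dist_zero_right, norm_pt (by linarith)]
    linarith

lemma hypDist_pt_le_one {h h' θ : ℝ} (h0 : 0 < h) (hh : h ≤ h') (h1 : h' < 1)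
    (he : h' * (2 - h) ≤ Real.exp 1 * (h * (2 - h'))) : hypDist (pt h θ) (pt h' θ) ≤ 1 := by
  set x := ‖diskAut (pt h θ) (pt h' θ)‖ with hx
  have hD : 0 < h + h' - h * h' := by nlinarith
  have hsub : ‖pt h' θ - pt h θ‖ ≤ h' - h := by
    refine (norm_pt_sub_pt_le (by linarith) h1.le).trans ?_
    rw [sub_self, abs_zero, add_zero, abs_of_nonneg (by linarith)]
  have hx1 : x ≤ (h' - h) / (h + h' - h * h') := by
    rw [← sq_le_sq₀ (norm_nonneg _) (div_nonneg (by linarith) hD.le), norm_diskAut_sq,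
      norm_pt h1.le, norm_pt (by linarith), div_pow]
    have hs : ‖pt h' θ - pt h θ‖ ^ 2 ≤ (h' - h) ^ 2 :=
      pow_le_pow_left₀ (norm_nonneg _) hsub 2
    have hg : 0 < (1 - (1 - h') ^ 2) * (1 - (1 - h) ^ 2) := by
      apply mul_pos <;> nlinarith
    rw [div_le_div_iff₀ (by positivity) (by positivity)]
    have e : (h + h' - h * h') ^ 2 = (h' - h) ^ 2 + (1 - (1 - h') ^ 2) * (1 - (1 - h) ^ 2) := by
      ring
    rw [e]
    nlinarith
  have hx2 : x < 1 := lt_of_le_of_lt hx1 (by rw [div_lt_one hD]; nlinarith)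
  unfold hypDist
  rw [← hx]
  refine (Real.log_le_log (div_pos (by linarith [norm_nonneg (diskAut (pt h θ) (pt h' θ))])
    (by linarith)) ?_).trans_eq (Real.log_exp 1)
  rw [div_le_iff₀ (by linarith)]
  rw [le_div_iff₀ hD] at hx1
  have hexp := Real.exp_pos 1
  have : x * (1 + Real.exp 1) ≤ Real.exp 1 - 1 := by
    refine le_of_mul_le_mul_right ?_ hD
    nlinarith [mul_le_mul_of_nonneg_left hx1 (show (0 : ℝ) ≤ 1 + Real.exp 1 by linarith)]
  linarith

/-- The variance of the field at height `h` is at most of the order `log (1 / h)`. -/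
lemma IsBRWLike.exists_sq_le (hW : IsBRWLike Q W U) (hUD : U ⊆ Metric.ball (0 : ℂ) 1)
    (hUi : U ∈ 𝓝[Metric.ball (0 : ℂ) 1] Complex.I) :
    ∃ V H : ℝ, 0 < V ∧ 0 < H ∧ H ≤ 1 / 4 ∧ ∀ h θ : ℝ, 0 < h → h ≤ H → |θ| ≤ H →
      pt h θ ∈ U ∧ ∫ x, W x (pt h θ) ^ 2 ∂Q ≤ V * (1 - Real.log h) := by
  obtain ⟨C, hC⟩ := hW.exists_incrementBound hUD
  obtain ⟨K, hK, ⟨C', hC'⟩, -⟩ := hW.branching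
  obtain ⟨H, hH0, hH1, hH⟩ := exists_pt_mem hUi
  obtain ⟨M, hM⟩ := isCompact_univ.exists_bound_of_continuousOn hK.continuousOn
  have hM0 : 0 ≤ M := (norm_nonneg _).trans (hM (1, 1) trivial)
  have hC1 := hC.one_le
  refine ⟨2 * (1 + M + |C'|) + 2 * C, H / 3, by positivity, by positivity, by linarith,
    fun h θ h0 h1 h2 => ⟨hH h θ h0 (by linarith) (by linarith), ?_⟩⟩
  have hx : 1 ≤ (2 - h) / h := by rw [le_div_iff₀ h0]; linarith
  set j := ⌊Real.log ((2 - h) / h)⌋₊ with hj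
  have hj1 : (j : ℝ) ≤ Real.log ((2 - h) / h) := Nat.floor_le (Real.log_nonneg hx)
  have hj2 : Real.log ((2 - h) / h) < j + 1 := Nat.lt_floor_add_one _
  have hj3 : Real.exp j * h ≤ 2 - h := by
    rw [← le_div_iff₀ h0, ← Real.exp_log (show 0 < (2 - h) / h by linarith)]
    exact Real.exp_le_exp.2 hj1
  have hj4 : 2 - h ≤ Real.exp j * Real.exp 1 * h := by
    rw [← div_le_iff₀ h0, ← Real.exp_log (show 0 < (2 - h) / h by linarith), ← Real.exp_add]
    exact Real.exp_le_exp.2 hj2.le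
  have he := Real.exp_pos (j : ℝ)
  have he1 : Real.exp 1 ≤ 2.7182818286 := Real.exp_one_lt_d9.le
  set h' := 2 / (Real.exp j + 1) with hh'
  have h'0 : 0 < h' := by positivity
  have e1 : h' * (Real.exp j + 1) = 2 := by rw [hh']; field_simp
  have hle : h ≤ h' := by
    rw [hh', le_div_iff₀ (by positivity)]; linarith
  have hle3 : h' ≤ 3 * h := by
    rw [hh', div_le_iff₀ (by positivity)]
    nlinarith [mul_le_mul_of_nonneg_left he1 (mul_pos he h0).le]
  have hmem := hH h θ h0 (by linarith) (by linarith)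
  have hmem' := hH h' θ h'0 (by linarith) (by linarith)
  have hd : hypDist (pt h θ) (pt h' θ) ≤ 1 := by
    refine hypDist_pt_le_one h0 hle (by linarith) ?_
    have e2 : 2 - h' = h' * Real.exp j := by linarith
    rw [e2]
    nlinarith [mul_le_mul_of_nonneg_left hj4 h'0.le]
  have hd0 := hypDist_nonneg (y := pt h θ) (z := pt h' θ) (by simpa using hUD hmem)
    (by simpa using hUD hmem')
  -- on the grid the variance is given by the branching structure
  have hgrid : ∫ x, W x (pt h' θ) ^ 2 ∂Q ≤ j / 2 + M + |C'| := by
    have hz := zeta_mul_circleExp j θ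
    have := hC' j j (Real.pi / 2 + θ) (Real.pi / 2 + θ) (by rw [hz]; exact hmem')
      (by rw [hz]; exact hmem')
    have hKM := hM (Circle.exp (Real.pi / 2 + θ), Circle.exp (Real.pi / 2 + θ)) trivial
    rw [Real.norm_eq_abs] at hKM
    rw [branchError, hz, branchHeight, fieldCov] at this
    simp only [sub_self, zero_div, Real.sin_zero, if_true, min_self] at this
    have e3 : ∀ x, W x (pt h' θ) ^ 2 = W x (pt h' θ) * W x (pt h' θ) := fun x => sq _
    simp_rw [e3]
    linarith [(abs_le.1 this).2, (abs_le.1 hKM).2, le_abs_self C']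
  have hinc := hC.sq_le _ hmem _ hmem' hd
  have hlog : (j : ℝ) ≤ 1 - Real.log h := by
    refine hj1.trans ?_
    rw [Real.log_div (by linarith) h0.ne']
    have : Real.log (2 - h) ≤ 1 := by
      have := Real.log_le_sub_one_of_pos (show 0 < 2 - h by linarith)
      linarith
    linarith
  have hlog0 : 0 ≤ -Real.log h := by
    have := Real.log_nonpos h0.le (by linarith)
    linarith
  have i1 := hW.gaussian.integrable_mul (eval_mem_fieldSpan hmem') (eval_mem_fieldSpan hmem')
  have hs := sub_mem (eval_mem_fieldSpan (W := W) hmem) (eval_mem_fieldSpan hmem')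
  have i2 := hW.gaussian.integrable_mul hs hs
  simp only [Pi.sub_apply] at i2
  calc ∫ x, W x (pt h θ) ^ 2 ∂Q
      ≤ ∫ x, (2 * (W x (pt h' θ) * W x (pt h' θ)) +
          2 * ((W x (pt h θ) - W x (pt h' θ)) * (W x (pt h θ) - W x (pt h' θ)))) ∂Q := by
        refine integral_mono_of_nonneg (ae_of_all _ fun x => sq_nonneg _)
          ((i1.const_mul 2).add (i2.const_mul 2)) (ae_of_all _ fun x => ?_)
        dsimp only
        nlinarith [sq_nonneg (W x (pt h θ) - 2 * W x (pt h' θ))]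
    _ = 2 * ∫ x, W x (pt h' θ) ^ 2 ∂Q + 2 * ∫ x, (W x (pt h θ) - W x (pt h' θ)) ^ 2 ∂Q := by
        rw [integral_add (i1.const_mul 2) (i2.const_mul 2), integral_const_mul,
          integral_const_mul]
        simp_rw [← sq]
    _ ≤ 2 * (j / 2 + M + |C'|) + 2 * (C * 1) := by
        gcongr
        refine hinc.trans ?_
        gcongr
        exact pow_le_one₀ hd0 hd
    _ ≤ _ := by nlinarith [abs_nonneg C']

lemma IsCenteredGaussianField.integral_exp_le (h : IsCenteredGaussianField Q W U) {z w : ℂ}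
    (hz : z ∈ U) (hw : w ∈ U) :
    ∫ x, Real.exp (2 * W x z - 2 * W x w) ∂Q
      ≤ Real.exp (4 * (∫ x, W x z ^ 2 ∂Q + ∫ x, W x w ^ 2 ∂Q)) := by
  rw [(h.integral_exp (inc_mem_fieldSpan hz hw)).2]
  refine Real.exp_le_exp.2 ?_
  have i1 := h.integrable_mul (eval_mem_fieldSpan hz) (eval_mem_fieldSpan hz)
  have i2 := h.integrable_mul (eval_mem_fieldSpan hw) (eval_mem_fieldSpan hw)
  have : ∫ x, (2 * W x z - 2 * W x w) ^ 2 ∂Q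
      ≤ ∫ x, (8 * (W x z * W x z) + 8 * (W x w * W x w)) ∂Q := by
    refine integral_mono_of_nonneg (ae_of_all _ fun x => sq_nonneg _)
      ((i1.const_mul 8).add (i2.const_mul 8)) (ae_of_all _ fun x => ?_)
    dsimp only
    nlinarith [sq_nonneg (W x z + W x w)]
  rw [integral_add (i1.const_mul 8) (i2.const_mul 8), integral_const_mul,
    integral_const_mul] at this
  simp_rw [← sq] at this
  linarith

lemma IsCenteredGaussianField.one_le_integral_exp (h : IsCenteredGaussianField Q W U) {z w : ℂ}
    (hz : z ∈ U) (hw : w ∈ U) : 1 ≤ ∫ x, Real.exp (2 * W x z - 2 * W x w) ∂Q := by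
  rw [(h.integral_exp (inc_mem_fieldSpan hz hw)).2]
  exact Real.one_le_exp (div_nonneg (integral_nonneg fun x => sq_nonneg _) (by norm_num))

end

/-! ### The estimate at a fixed scale -/

/-- The positions of two pairs of base points `p`, `q` and `p'`, `q'` in two nested sectors. The
point `p'` lies below `p` inside the larger sector, at a height small compared to that of `p`, and
`q'` lies in the smaller sector far above `p`. For a point `u` near `p`, the perturbation of
`2 F(p') - 2 F(q')` by the pair `(u, p')` is then admissible, and it is equal to
`2 F(u) - 2 F(q')`. -/
structure BasePoints (k : ℕ) (b H b' H' : ℝ) (p q p' q' : ℂ) (θ θ' : ℝ) : Prop where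
  bot_pos : 0 < b'
  bot_le_bot : b' ≤ b
  top_le_top : H ≤ H'
  top_le : H' ≤ 1 / 4
  left_eq : p = pt (ht p) θ
  angle_le : |θ| ≤ H
  right_eq : q = pt (ht q) 0
  bot_le : 8 * b ≤ ht q
  left_le : 3 * ht p ≤ ht q
  right_le : 64 * (k + 2) ^ 3 * ht q ≤ H
  left_eq' : p' = pt (ht p') θ'
  left_mem' : p' ∈ sector b' H'
  right_mem' : q' ∈ sector b H
  right_le' : 64 * (k + 1) ^ 3 * ht q' ≤ H'
  left_le' : 4 * ht p ≤ ht q'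
  angle_sub_le : |θ - θ'| ≤ ht p / 4
  left_le_left : 4 * ht p' ≤ ht p
  sq_le : 32 * ht p ^ 2 ≤ ht q' * ht p'
  bot_le_left : 8 * b' ≤ ht p

namespace BasePoints

variable {k : ℕ} {b H b' H' : ℝ} {p q p' q' : ℂ} {θ θ' : ℝ}

lemma ht_left_pos (h : BasePoints k b H b' H' p q p' q' θ θ') : 0 < ht p := by
  linarith [h.bot_le_left, h.bot_pos]

lemma ht_right_le (h : BasePoints k b H b' H' p q p' q' θ θ') : 64 * ht q ≤ H := by
  have h1 := h.right_le
  have h2 : 0 < ht q := by linarith [h.ht_left_pos, h.left_le]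
  have h3 : (1 : ℝ) ≤ (k + 2) ^ 3 := one_le_pow₀ (by have : (0 : ℝ) ≤ k := k.cast_nonneg; linarith)
  nlinarith

lemma sector_subset (h : BasePoints k b H b' H' p q p' q' θ θ') : sector b H ⊆ sector b' H' := by
  rintro _ ⟨r, φ, h1, h2, h3, rfl⟩
  exact ⟨r, φ, h.bot_le_bot.trans h1, h2.trans h.top_le_top, h3.trans h.top_le_top, rfl⟩

lemma ball_subset (h : BasePoints k b H b' H' p q p' q' θ θ') (hH : H + ht p ≤ H') :
    Metric.closedBall (pt (51 / 50 * ht p) θ) (51 / 200 * ht p) ⊆ sector b' H' := by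
  have h0 := h.ht_left_pos
  have h1 := h.ht_right_le
  have h2 := h.left_le
  have h3 := h.top_le
  have h4 := h.top_le_top
  have h5 := h.bot_le_left
  have h6 := h.angle_le
  have h7 := h.bot_pos
  exact closedBall_subset_sector (by linarith) (by linarith) h3 (by linarith) (by linarith)
    (by linarith) (by linarith)

lemma near (h : BasePoints k b H b' H' p q p' q' θ θ') {u : ℂ}
    (hu : ‖u - pt (51 / 50 * ht p) θ‖ ≤ 51 / 200 * ht p) :
    2 * ht u ≤ ht q' ∧ 2 * ht p' ≤ ht u ∧ ‖u - p'‖ ≤ 2 * ht p := by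
  have h0 := h.ht_left_pos
  have h1 := h.ht_right_le
  have h2 := h.left_le
  have h3 := h.top_le
  have h4 := h.top_le_top
  have e : ht (pt (51 / 50 * ht p) θ) = 51 / 50 * ht p := ht_pt (by linarith)
  have h5 := abs_le.1 (abs_ht_sub_le u (pt (51 / 50 * ht p) θ))
  rw [e] at h5
  have h6 := h.left_le'
  have h7 := h.left_le_left
  refine ⟨by linarith, by linarith, ?_⟩
  have h8 : ‖pt (51 / 50 * ht p) θ - p'‖ ≤ |51 / 50 * ht p - ht p'| + |θ - θ'| := by
    conv_lhs => rw [h.left_eq']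
    exact norm_pt_sub_pt_le (by linarith) (by linarith)
  have h9 : 0 ≤ ht p' := by
    have := (ht_of_mem_sector h.top_le h.left_mem').1
    linarith [h.bot_pos]
  rw [abs_of_nonneg (by linarith)] at h8
  have := norm_sub_le_norm_sub_add_norm_sub u (pt (51 / 50 * ht p) θ) p'
  linarith [h.angle_sub_le]

end BasePoints

section

variable {S E : Type*} [MeasurableSpace S] [MeasurableSpace E] {P : Measure S} {Q : Measure E}
  {F : S → ℂ → ℝ} {W : E → ℂ → ℝ} {U : Set ℂ} {k : ℕ} {b H b' H' C κ κ' : ℝ}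
  {p q p' q' : ℂ} {θ θ' : ℝ}

/-- Under the biased measure the field satisfies the hypotheses of the moment estimates. The
comparison for the second pair of base points provides the control near `p`. -/
lemma BasePoints.frame [IsProbabilityMeasure P]
    (g : BasePoints k b H b' H' p q p' q' θ θ') (hH : H + ht p ≤ H')
    (hC : IncrementBound Q W U C) (hW : IsCenteredGaussianField Q W U)
    (hU : U ⊆ Metric.ball (0 : ℂ) 1) (hsU : sector b' H' ⊆ U)
    (hF : ∀ z ∈ U, AEMeasurable (fun x => F x z) P)
    (hharm : ∀ᵐ x ∂P, InnerProductSpace.HarmonicOnNhd (F x) (sector b' H'))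
    (h : BiasComparison P Q F W (sector b H) p q (k + 1) κ) (hκ0 : 0 ≤ κ) (hκ : κ ≤ 1 / 8)
    (h' : BiasComparison P Q F W (sector b' H') p' q' (k + 1) κ') (hκ' : κ' ≤ 1)
    {V : ℝ} (hV0 : 0 ≤ V) (hV : ∀ u ∈ sector b' H', ∫ x, W x u ^ 2 ∂Q ≤ V) :
    Integrable (fun x => Real.exp (2 * F x p - 2 * F x q)) P ∧
    Frame (biasedMeasure P F p q) Q F W U b H p q k C (4 * κ) ∧
    NearBase (biasedMeasure P F p q) F b H p q q' θ (8 * V + 1) := by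
  have hp0 := g.ht_left_pos
  have hq64 := g.ht_right_le
  have hpq := g.left_le
  have hq0 : 0 < ht q := by linarith
  have hb := g.bot_pos
  have hbb := g.bot_le_bot
  have hHH := g.top_le_top
  have hH' := g.top_le
  have hbq := g.bot_le
  have hpa := g.angle_le
  have hk : (0 : ℝ) ≤ k := k.cast_nonneg
  have hps : p ∈ sector b' H' := ⟨ht p, θ, by linarith [g.bot_le_left], by linarith,
    by linarith, g.left_eq⟩
  have hqs : q ∈ sector b H := ⟨ht q, 0, by linarith, by linarith, by
    rw [abs_zero]; linarith, g.right_eq⟩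
  have hpU := hsU hps
  have hsub := g.sector_subset
  have hqU := hsU (hsub hqs)
  have hpn := norm_lt_one_of_mem_sector hb hH' hps
  have hqn := norm_lt_one_of_mem_sector hb hH' (hsub hqs)
  obtain ⟨f, f1, f2, -, f4⟩ := exists_separated_points (b := b) (H := H) (k + 1) hq0
    (by linarith) (by have := g.right_le; push_cast; convert this using 3; ring) (by linarith) p hpn
  have hfn := fun i => norm_lt_one_of_mem_sector hb hH' (hsub (f1 i))
  have hτ : (1 : ℝ) / (4 * ((k + 1 : ℕ) + 1)) ≤ 1 / 4 := by
    gcongr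
    push_cast
    linarith
  have hff : IndexedPairing p q f f := by
    refine IndexedPairing.of_sep (τ := 1 / (4 * ((k + 1 : ℕ) + 1))) (by positivity) (by linarith)
      hpn hqn hfn hfn (fun i => ?_) f4 f4
      (fun i => sep_of_ht hpn (by positivity) (by linarith) ?_)
      (fun i => sep_of_ht hqn (by positivity) (by linarith) ?_)
    · rw [sub_self, norm_zero]
      have := ht_pos (hfn i)
      positivity
    · nlinarith [f2 i]
    · nlinarith [f2 i]
  obtain ⟨i1, i2, i3⟩ := h.incrementComparison hW hpU hqU (hsub.trans hsU) (by linarith) f1 hff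
  have hac : biasedMeasure P F p q ≪ P := tilted_absolutelyContinuous _ _
  have hball := g.ball_subset hH
  have hqs' := g.right_mem'
  have hqn' := norm_lt_one_of_mem_sector hb hH' (hsub hqs')
  have hqU' := hsU (hsub hqs')
  refine ⟨i1, ⟨i3, by linarith, by linarith, hC, hW, hU, hsub.trans hsU, hpU, hqU,
    fun z hz => (hF z hz).mono_ac hac, ?_, by linarith, by linarith, g.right_eq, hbq, hpq, ?_⟩,
    ⟨g.left_eq, hpa, hqs', by linarith [g.left_le'], ?_, fun u hu => (hF u (hsU (hball hu))).mono_ac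
      hac, by linarith, fun u hu => ?_⟩⟩
  · filter_upwards [hac.ae_le hharm] with x hx
    exact hx.mono hsub
  · refine le_trans ?_ g.right_le
    gcongr
    linarith
  · filter_upwards [hac.ae_le hharm] with x hx
    exact hx.mono hball
  · have hus : u ∈ sector b' H' := hball (by rw [Metric.mem_closedBall, dist_eq_norm, hu])
    obtain ⟨n1, n2, n3⟩ := g.near hu.le
    have hsq := g.sq_le
    obtain ⟨j1, j2⟩ := h'.integral_exp_le hb hH' g.left_mem' hus hqn' n3
      (by linarith [(ht_of_mem_sector (by linarith) hqs').1]) g.right_le' n1 n2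
      (by linarith)
    refine lintegral_biasedMeasure_le ?_ j1 (j2.trans ?_)
    · have := hW.one_le_integral_exp hpU hqU
      linarith
    · have hu2 := hW.integral_exp_le (hsU hus) hqU'
      have he0 : 0 ≤ ∫ x, Real.exp (2 * W x u - 2 * W x q') ∂Q :=
        integral_nonneg fun x => (Real.exp_pos _).le
      have h2 : (2 : ℝ) ≤ Real.exp 1 := by linarith [Real.add_one_le_exp (1 : ℝ)]
      calc _ ≤ Real.exp 1 * Real.exp (4 * (V + V)) := by
            refine mul_le_mul (by linarith) (hu2.trans (Real.exp_le_exp.2 ?_)) he0 (by positivity)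
            linarith [hV u hus, hV q' (hsub hqs')]
        _ = _ := by rw [← Real.exp_add]; congr 1; ring

/-- The comparison of the products of increments under the bias, at a fixed scale. -/
lemma BasePoints.abs_biased_sub_le [IsProbabilityMeasure P] [IsProbabilityMeasure Q]
    (g : BasePoints k b H b' H' p q p' q' θ θ') (hH : H + ht p ≤ H')
    (hC : IncrementBound Q W U C) (hW : IsCenteredGaussianField Q W U)
    (hU : U ⊆ Metric.ball (0 : ℂ) 1) (hsU : sector b' H' ⊆ U)
    (hF : ∀ z ∈ U, AEMeasurable (fun x => F x z) P)
    (hharm : ∀ᵐ x ∂P, InnerProductSpace.HarmonicOnNhd (F x) (sector b' H'))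
    (h : BiasComparison P Q F W (sector b H) p q (k + 1) κ) (hκ0 : 0 ≤ κ) (hκ : κ ≤ 1 / 8)
    (h' : BiasComparison P Q F W (sector b' H') p' q' (k + 1) κ') (hκ' : κ' ≤ 1)
    {V : ℝ} (hV0 : 0 ≤ V) (hV : ∀ u ∈ sector b' H', ∫ x, W x u ^ 2 ∂Q ≤ V)
    {t l Λ : ℝ} {M : ℕ} (ht0 : 0 < t) (hM : 768 ≤ M) (hMt : 256 / (M : ℝ) ≤ t)
    (ht1 : 3 * t ≤ stepScale k) (hl : ∀ r, b ≤ r → r ≤ H → |Real.log (2 * r / H)| ≤ l)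
    (hΛ : 1 ≤ Λ) (hΛ₁ : 51 / stepScale k * (l + 3) * stepMoment k C l (8 * V + 1) ≤ Λ)
    (hΛ₂ : stepMoment k C l (8 * V + 1) ≤ Λ) (hτ₁ : 4 * Λ * stepSize k (3 * t) (4 * κ) ≤ 1)
    (hτ₂ : 36 * gaussConst k C * t ≤ 1) {z y : Fin (k + 1) → ℂ}
    (hz : ∀ i, z i ∈ sector b H) (hy : ∀ i, y i ∈ sector b H) :
    Integrable (fun x => Real.exp (2 * F x p - 2 * F x q)) P ∧
    Integrable (fun x => Real.exp (2 * F x p - 2 * F x q) * ∏ i, (2 * F x (z i) - 2 * F x (y i))) P ∧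
    Integrable (fun x => ∏ i, (2 * shiftedField Q W p q x (z i)
      - 2 * shiftedField Q W p q x (y i))) Q ∧
    |(∫ x, Real.exp (2 * F x p - 2 * F x q) * ∏ i, (2 * F x (z i) - 2 * F x (y i)) ∂P)
        / (∫ x, Real.exp (2 * F x p - 2 * F x q) ∂P)
      - ∫ x, ∏ i, (2 * shiftedField Q W p q x (z i) - 2 * shiftedField Q W p q x (y i)) ∂Q|
      ≤ 2 ^ (k + 1) * ((k + 2) * (4 * Λ * stepSize k (3 * t) (4 * κ) * (4 * Λ) ^ (k + 1)))
        + 2 ^ (k + 1) * ((k + 2) * (36 * gaussConst k C * t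
          * (192 * gaussConst k C * (l + 3)) ^ (k + 1)))
        + chainError k M C (4 * κ) l t Λ := by
  obtain ⟨i1, fr, nb⟩ := g.frame hH hC hW hU hsU hF hharm h hκ0 hκ h' hκ' hV0 hV
  have hprob : IsProbabilityMeasure (biasedMeasure P F p q) := isProbabilityMeasure_tilted i1
  have hst := fr.stepBound nb hl
  have hb := g.bot_pos
  have hbb := g.bot_le_bot
  have hHH := g.top_le_top
  have hH' := g.top_le
  have hq64 := g.ht_right_le
  have hbq := g.bot_le
  have hl0 : 0 ≤ l := (abs_nonneg _).trans (hl b le_rfl (by linarith))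
  have hsm : 0 ≤ stepMoment k C l (8 * V + 1) := by
    have := stepConst_pos k C
    have := stepScale_pos k
    unfold stepMoment
    positivity
  have hroot : ∀ w ∈ sector b H, MomLE (biasedMeasure P F p q) (2 * (k + 1))
      (fun x => F x w - F x (pt (H / 2) 0)) Λ := by
    intro w hw
    have hwh := ht_of_mem_sector (by linarith) hw
    exact (hst.momLE_root hsm fr.nonneg fr.le_half (by linarith) (by linarith) (by linarith) hw
      (by linarith) (by linarith) (hl _ hwh.1 hwh.2)).mono hΛ₁
  have hstep : StepBound (biasedMeasure P F p q) F (sector b H) k 0 (4 * κ) Λ :=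
    fun x hx y hy h0 s hs hs1 hxy => (hst x hx y hy h0 s hs hs1 hxy).mono
      (mul_le_mul_of_nonneg_right hΛ₂ (stepSize_nonneg fr.nonneg))
  obtain ⟨r1, r2, r3⟩ := fr.abs_integral_prod_sub_le ht0 hM hMt ht1 hl hΛ hroot hstep hτ₁ hτ₂ hz hy
  refine ⟨i1, ?_, r2, ?_⟩
  · simpa only [smul_eq_mul] using (integrable_tilted_iff i1 _).1 r1
  · convert r3 using 3
    rw [biasedMeasure, integral_tilted, ← integral_div]
    refine integral_congr_ae (ae_of_all _ fun x => ?_)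
    simp only [smul_eq_mul]
    ring

end

/-! ### The size of the error terms -/

lemma eventually_mul_pow_mul_exp_le {α β c : ℝ} (hβ : 0 < β) (hαβ : α < β) (hc : 0 < c) (K : ℝ)
    (m : ℕ) : ∀ᶠ x : ℝ in atTop, K * (x + 4) ^ m * Real.exp (-(c * x ^ β)) ≤ Real.exp (-x ^ α) := by
  have h1 := (isLittleO_rpow_exp_pos_mul_atTop (m / β) (half_pos hc)).comp_tendsto
    (tendsto_rpow_atTop hβ)
  have h2 := h1.def (show 0 < 1 / ((|K| + 1) * 5 ^ m) by positivity)
  have h3 := (tendsto_rpow_atTop (show 0 < β - α by linarith)).eventually_ge_atTop (2 / c)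
  filter_upwards [h2, h3, eventually_ge_atTop 1] with x h2 h3 hx
  have hx0 : 0 < x := by linarith
  simp only [Function.comp_apply, Real.norm_eq_abs, Real.abs_exp] at h2
  rw [← Real.rpow_mul hx0.le, mul_div_cancel₀ _ hβ.ne', Real.rpow_natCast,
    abs_of_nonneg (by positivity)] at h2
  have h4 : x ^ β = x ^ (β - α) * x ^ α := by rw [← Real.rpow_add hx0]; ring_nf
  have h5 : x ^ α ≤ c / 2 * x ^ β := by
    have h0 : 0 ≤ x ^ α := by positivity
    have h6 : 1 ≤ c / 2 * x ^ (β - α) := by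
      rw [div_le_iff₀ hc] at h3
      linarith
    rw [h4, ← mul_assoc]
    nlinarith
  have h6 : K * (x + 4) ^ m ≤ Real.exp (c / 2 * x ^ β) := by
    calc K * (x + 4) ^ m ≤ (|K| + 1) * (5 * x) ^ m := by
          gcongr
          · linarith [le_abs_self K]
          · linarith
      _ = (|K| + 1) * 5 ^ m * x ^ m := by rw [mul_pow]; ring
      _ ≤ (|K| + 1) * 5 ^ m * (1 / ((|K| + 1) * 5 ^ m) * Real.exp (c / 2 * x ^ β)) := by gcongr
      _ = _ := by field_simp
  calc _ ≤ Real.exp (c / 2 * x ^ β) * Real.exp (-(c * x ^ β)) := by gcongr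
    _ = Real.exp (-(c / 2 * x ^ β)) := by rw [← Real.exp_add]; ring_nf
    _ ≤ _ := Real.exp_le_exp.2 (by linarith)

lemma eventually_mul_exp_rpow_le {β δ : ℝ} (hβ : β < 1) (hδ : 0 < δ) (K a : ℝ) :
    ∀ᶠ x : ℝ in atTop, K * Real.exp (a * x ^ β) ≤ Real.exp (δ * x) := by
  have h3 := (tendsto_rpow_atTop (show 0 < 1 - β by linarith)).eventually_ge_atTop (2 * |a| / δ)
  have h4 : Tendsto (fun x : ℝ => Real.exp (δ / 2 * x)) atTop atTop :=
    Real.tendsto_exp_atTop.comp (tendsto_id.const_mul_atTop (half_pos hδ))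
  filter_upwards [h3, h4.eventually_ge_atTop K, eventually_ge_atTop 1] with x h3 h4 hx
  have hx0 : 0 < x := by linarith
  have h5 : x = x ^ (1 - β) * x ^ β := by
    rw [← Real.rpow_add hx0]; ring_nf; exact (Real.rpow_one x).symm
  have h6 : a * x ^ β ≤ δ / 2 * x := by
    have h0 : 0 ≤ x ^ β := by positivity
    rw [div_le_iff₀ hδ] at h3
    calc a * x ^ β ≤ |a| * x ^ β := by gcongr; exact le_abs_self a
      _ ≤ (x ^ (1 - β) * δ / 2) * x ^ β := by gcongr; linarith
      _ = δ / 2 * (x ^ (1 - β) * x ^ β) := by ring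
      _ = _ := by rw [← h5]
  calc _ ≤ Real.exp (δ / 2 * x) * Real.exp (δ / 2 * x) := by gcongr
    _ = _ := by rw [← Real.exp_add]; ring_nf

lemma chainError_le {k M : ℕ} {C κ l t Λ : ℝ} (hl : 0 ≤ l) (ht : 0 < t) (ht1 : t ≤ 1)
    (hM : 1 ≤ M * t ^ (k + 2)) (hκ : κ * M ^ (2 * (k + 1)) ≤ t) :
    chainError k M C κ l t Λ ≤
      ((4 * (l + 3)) ^ (k + 1) * ((4 * (k + 1) * 3 ^ (k + 1) + 1)
        * Real.exp (8 * C * ((k + 1) + (k + 1) ^ 2)) * (24 ^ (k + 2) + 1))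
      + (k + 1) * ((3 + k) * (6160 * (4 * (l + 3)) ^ k))
        * ((2 + k) * (|16384 * Λ| ^ (k + 1) + |48 * gaussConst k C| ^ (k + 1)))) * t := by
  have hM0 : (0 : ℝ) < M := by
    by_contra hneg
    have : (M : ℝ) = 0 := le_antisymm (not_lt.1 hneg) M.cast_nonneg
    rw [this] at hM
    linarith
  have hMt : 1 / (M * t ^ (k + 1)) ≤ t := by
    rw [div_le_iff₀ (by positivity)]
    calc 1 ≤ M * t ^ (k + 2) := hM
      _ = _ := by ring
  have hMt' : 1 / (M : ℝ) ≤ t := by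
    refine le_trans ?_ hMt
    gcongr
    exact mul_le_of_le_one_right hM0.le (pow_le_one₀ ht.le ht1)
  have e1 : (4 * (M * (l + 3))) ^ (k + 1) * ((4 * (k + 1) * 3 ^ (k + 1) + 1)
      * Real.exp (8 * C * ((k + 1) + (k + 1) ^ 2)) * ((24 / M) ^ (k + 2) + κ / (24 / M) ^ (k + 1)))
      = (4 * (l + 3)) ^ (k + 1) * ((4 * (k + 1) * 3 ^ (k + 1) + 1)
      * Real.exp (8 * C * ((k + 1) + (k + 1) ^ 2)) * (24 ^ (k + 2) * (1 / M)
        + κ * M ^ (2 * (k + 1)) / 24 ^ (k + 1))) := by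
    have : (4 * (M * (l + 3))) ^ (k + 1) = (4 * (l + 3)) ^ (k + 1) * (M : ℝ) ^ (k + 1) := by
      rw [← mul_pow]; ring
    rw [this]
    have e : (M : ℝ) ^ (k + 1) * ((24 / M) ^ (k + 2) + κ / (24 / M) ^ (k + 1))
        = 24 ^ (k + 2) * (1 / M) + κ * M ^ (2 * (k + 1)) / 24 ^ (k + 1) := by
      rw [div_pow, div_pow, mul_comm 2 (k + 1), pow_mul]
      field_simp
      ring
    rw [← e]; ring
  have e2 : (6160 * (4 * (M * (l + 3))) ^ k)
      * ((16384 / (M * t) * Λ) ^ (k + 1) + (48 / M * gaussConst k C) ^ (k + 1))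
      = 6160 * (4 * (l + 3)) ^ k * ((16384 * Λ) ^ (k + 1) * (1 / (M * t ^ (k + 1)))
        + (48 * gaussConst k C) ^ (k + 1) * (1 / M)) := by
    have : (4 * (M * (l + 3))) ^ k = (4 * (l + 3)) ^ k * (M : ℝ) ^ k := by
      rw [← mul_pow]; ring
    rw [this]
    have e : (M : ℝ) ^ k * ((16384 / (M * t) * Λ) ^ (k + 1) + (48 / M * gaussConst k C) ^ (k + 1))
        = (16384 * Λ) ^ (k + 1) * (1 / (M * t ^ (k + 1)))
          + (48 * gaussConst k C) ^ (k + 1) * (1 / M) := by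
      rw [div_mul_eq_mul_div, div_mul_eq_mul_div, div_pow, div_pow, mul_pow (M : ℝ) t]
      field_simp
      ring
    rw [← e]; ring
  have e3 : (k + 1) * ((3 + k) * (6160 * (4 * (M * (l + 3))) ^ k))
      * ((2 + k) * ((16384 / (M * t) * Λ) ^ (k + 1) + (48 / M * gaussConst k C) ^ (k + 1)))
      = (k + 1) * ((3 + k) * (6160 * (4 * (l + 3)) ^ k)) * ((2 + k) *
        ((16384 * Λ) ^ (k + 1) * (1 / (M * t ^ (k + 1)))
        + (48 * gaussConst k C) ^ (k + 1) * (1 / M))) := by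
    linear_combination (k + 1) * (3 + k) * (2 + k) * e2
  unfold chainError
  rw [e1, e3]
  have i1 : κ * M ^ (2 * (k + 1)) / 24 ^ (k + 1) ≤ t := by
    rw [div_le_iff₀ (by positivity)]
    have : (1 : ℝ) ≤ 24 ^ (k + 1) := one_le_pow₀ (by norm_num)
    nlinarith
  have i2 : (24 : ℝ) ^ (k + 2) * (1 / M) + κ * M ^ (2 * (k + 1)) / 24 ^ (k + 1)
      ≤ (24 ^ (k + 2) + 1) * t := by
    rw [add_mul, one_mul]
    gcongr
  have i3 : (16384 * Λ) ^ (k + 1) * (1 / (M * t ^ (k + 1)))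
      + (48 * gaussConst k C) ^ (k + 1) * (1 / M)
      ≤ (|16384 * Λ| ^ (k + 1) + |48 * gaussConst k C| ^ (k + 1)) * t := by
    have j : ∀ a : ℝ, a ^ (k + 1) ≤ |a| ^ (k + 1) := fun a =>
      (le_abs_self _).trans_eq (abs_pow a (k + 1))
    rw [add_mul]
    refine add_le_add (mul_le_mul (j _) hMt (by positivity) (by positivity))
      (mul_le_mul (j _) hMt' (by positivity) (by positivity))
  have mono : ∀ a c y d : ℝ, 0 ≤ a → 0 ≤ c → y ≤ d * t → a * (c * y) ≤ a * (c * d) * t := by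
    intro a c y d ha hc hy
    calc a * (c * y) ≤ a * (c * (d * t)) := by gcongr
      _ = _ := by ring
  exact (add_le_add (mono _ _ _ _ (by positivity) (by positivity) i2)
    (mono _ _ _ _ (by positivity) (by positivity) i3)).trans_eq (add_mul _ _ _).symm

lemma stepSize_le {k : ℕ} {t κ : ℝ} (ht : 0 < t) (hκ0 : 0 ≤ κ) (hκ : κ ≤ t ^ 2) :
    stepSize k (3 * t) κ ≤ 82 * t ^ (1 / (k + 1) : ℝ) := by
  unfold stepSize
  have h1 : 9 * (3 * t) ^ 2 + κ ≤ 82 * t ^ (2 : ℝ) := by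
    rw [Real.rpow_two]; nlinarith
  calc _ ≤ (82 * t ^ (2 : ℝ)) ^ (1 / (2 * (k + 1) : ℕ) : ℝ) := by
        gcongr
    _ = 82 ^ (1 / (2 * (k + 1) : ℕ) : ℝ) * t ^ (1 / (k + 1) : ℝ) := by
        rw [Real.mul_rpow (by norm_num) (by positivity), ← Real.rpow_mul ht.le]
        congr 2
        push_cast
        field_simp
    _ ≤ 82 ^ (1 : ℝ) * t ^ (1 / (k + 1) : ℝ) := by
        gcongr
        · norm_num
        · rw [div_le_one (by positivity)]
          exact_mod_cast (by omega : 1 ≤ 2 * (k + 1))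
    _ = _ := by rw [Real.rpow_one]

set_option maxHeartbeats 1000000 in
/-- For `t` and `M` suitable functions of `x = log N`, all error terms are negligible. -/
lemma exists_errors_le (k : ℕ) {α : ℝ} (hα0 : 0 < α) (hα : α < 1) {δ : ℝ} (hδ : 0 < δ)
    (C A K : ℝ) (hA : 1 ≤ A) (hK : 0 ≤ K) :
    ∃ (t : ℝ → ℝ) (M : ℝ → ℕ), ∀ᶠ x in atTop, 0 < t x ∧ 768 ≤ M x ∧ 256 / (M x : ℝ) ≤ t x ∧
      3 * t x ≤ stepScale k ∧
      4 * (A * (x + 4) ^ 2) * stepSize k (3 * t x) (4 * (K * Real.exp (-(δ * x)))) ≤ 1 ∧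
      36 * gaussConst k C * t x ≤ 1 ∧
      2 ^ (k + 1) * ((k + 2) * (4 * (A * (x + 4) ^ 2)
          * stepSize k (3 * t x) (4 * (K * Real.exp (-(δ * x)))) * (4 * (A * (x + 4) ^ 2)) ^ (k + 1)))
        + 2 ^ (k + 1) * ((k + 2) * (36 * gaussConst k C * t x
          * (192 * gaussConst k C * (x + 1 + 3)) ^ (k + 1)))
        + chainError k (M x) C (4 * (K * Real.exp (-(δ * x)))) (x + 1) (t x) (A * (x + 4) ^ 2)
        ≤ Real.exp (-x ^ α) := by
  obtain ⟨β, hβ1, hβ2⟩ := exists_between hα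
  have hβ0 : 0 < β := hα0.trans hβ1
  set c : ℝ := 1 / (k + 1) with hc
  have hc0 : 0 < c := by positivity
  have hc1 : c ≤ 1 := by
    rw [hc, div_le_one (by positivity)]
    have : (0 : ℝ) ≤ k := k.cast_nonneg
    linarith
  set g := gaussConst k C with hg
  have hg0 : 0 < g := by rw [hg]; unfold gaussConst; positivity
  set t : ℝ → ℝ := fun x => Real.exp (-x ^ β) with ht
  set M : ℝ → ℕ := fun x => ⌈Real.exp ((k + 2) * x ^ β)⌉₊ with hM
  -- Powers of `x` are absorbed since `α < β`. The separated tuples contribute `1 / M` and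
  -- `κ M ^ (2 (k + 1))`, which is small because `κ = O(e^{-δ x})` and `β < 1`; the other tuples
  -- contribute `1 / (M t ^ (k + 1)) = e^{-x ^ β}`.
  refine ⟨t, M, ?_⟩
  set K₁ : ℝ := 2 ^ (k + 1) * ((k + 2) * (82 * (4 * A) ^ (k + 2))) with hK₁
  set K₂ : ℝ := 2 ^ (k + 1) * ((k + 2) * (36 * g * (192 * g) ^ (k + 1))) with hK₂
  set K₃ : ℝ := 4 ^ (k + 1) * ((4 * (k + 1) * 3 ^ (k + 1) + 1)
        * Real.exp (8 * C * ((k + 1) + (k + 1) ^ 2)) * (24 ^ (k + 2) + 1)) with hK₃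
  set K₄ : ℝ := (k + 1) * ((3 + k) * (6160 * 4 ^ k))
        * ((2 + k) * ((16384 * A) ^ (k + 1) + (48 * g) ^ (k + 1))) with hK₄
  have hA0 : 0 < A := by linarith
  have hK₁0 : 0 ≤ K₁ := by positivity
  have hK₂0 : 0 ≤ K₂ := by positivity
  have hK₃0 : 0 ≤ K₃ := by positivity
  have hK₄0 : 0 ≤ K₄ := by positivity
  have small : ∀ L m, ∀ᶠ x : ℝ in atTop, L * (x + 4) ^ m * Real.exp (-(c * x ^ β)) ≤ 1 := by
    intro L m
    filter_upwards [eventually_mul_pow_mul_exp_le hβ0 hβ1 hc0 L m, eventually_ge_atTop 0]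
      with x h1 h2
    exact h1.trans (Real.exp_le_one_iff.2 (by have : 0 ≤ x ^ α := by positivity
                                              linarith))
  filter_upwards [eventually_ge_atTop 1, small 768 0, small (3 / stepScale k) 0,
    small (4 * A * 82) 2, small (36 * g) 0,
    eventually_mul_pow_mul_exp_le hβ0 hβ1 hc0 (K₁ + K₂ + K₃ + K₄) (3 * (k + 1) + 2),
    eventually_mul_exp_rpow_le hβ2 hδ (4 * K) 2,
    eventually_mul_exp_rpow_le hβ2 hδ (4 * K * 2 ^ (2 * (k + 1))) ((k + 2) * (2 * (k + 1)) + 1)]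
    with x hx s1 s2 s3 s4 s5 s6 s7
  have hxβ : 0 ≤ x ^ β := by positivity
  have ht0 : 0 < t x := Real.exp_pos _
  have hts : t x ≤ Real.exp (-(c * x ^ β)) := Real.exp_le_exp.2 (by
    have := mul_le_mul_of_nonneg_right hc1 hxβ
    linarith only [this])
  have hs1 : Real.exp (-(c * x ^ β)) ≤ 1 :=
    Real.exp_le_one_iff.2 (by have := mul_nonneg hc0.le hxβ; linarith)
  have ht1 : t x ≤ 1 := hts.trans hs1
  simp only [pow_zero, mul_one] at s1 s2 s4
  set s := Real.exp (-(c * x ^ β)) with hs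
  have hs0 : 0 < s := Real.exp_pos _
  have hMlow : Real.exp ((k + 2) * x ^ β) ≤ M x := Nat.le_ceil _
  have hMup : (M x : ℝ) ≤ 2 * Real.exp ((k + 2) * x ^ β) := by
    have h1 : 1 ≤ Real.exp ((k + 2) * x ^ β) := Real.one_le_exp (by positivity)
    have := (Nat.ceil_lt_add_one (Real.exp_pos ((k + 2) * x ^ β)).le).le
    linarith
  have hMt : 1 ≤ M x * t x ^ (k + 2) := by
    calc (1 : ℝ) = Real.exp ((k + 2) * x ^ β) * t x ^ (k + 2) := by
          rw [ht, ← Real.exp_nat_mul, ← Real.exp_add, ← Real.exp_zero]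
          congr 1
          push_cast
          ring
      _ ≤ _ := by gcongr
  have hM2 : 1 ≤ M x * t x ^ 2 := hMt.trans (by
    gcongr ?_ * ?_
    exact pow_le_pow_of_le_one ht0.le ht1 (by omega))
  have ht768 : 768 * t x ≤ 1 := by linarith
  have hM0 : (0 : ℝ) < M x := (Real.exp_pos _).trans_le hMlow
  have hMt1 : 768 ≤ M x * t x := by
    calc (768 : ℝ) ≤ 768 * (M x * t x ^ 2) := by linarith only [hM2]
      _ = M x * t x * (768 * t x) := by ring
      _ ≤ M x * t x := mul_le_of_le_one_right (by positivity) ht768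
  have hexp : Real.exp (-(δ * x)) = 1 / Real.exp (δ * x) := by rw [Real.exp_neg, one_div]
  have hκ : 4 * (K * Real.exp (-(δ * x))) ≤ t x ^ 2 := by
    have e : t x ^ 2 = 1 / Real.exp (2 * x ^ β) := by
      rw [ht, ← Real.exp_nat_mul, one_div, ← Real.exp_neg]
      congr 1; push_cast; ring
    rw [hexp, e, le_div_iff₀ (Real.exp_pos _), ← mul_assoc, mul_one_div, div_mul_eq_mul_div,
      div_le_one (Real.exp_pos _)]
    exact s6
  have hκ0 : 0 ≤ 4 * (K * Real.exp (-(δ * x))) := by positivity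
  have hκM : 4 * (K * Real.exp (-(δ * x))) * M x ^ (2 * (k + 1)) ≤ t x := by
    have e : t x = 1 / Real.exp (x ^ β) := by rw [ht, one_div, ← Real.exp_neg]
    calc _ ≤ 4 * (K * Real.exp (-(δ * x))) * (2 * Real.exp ((k + 2) * x ^ β)) ^ (2 * (k + 1)) := by
          gcongr
      _ = 4 * K * 2 ^ (2 * (k + 1)) * Real.exp ((k + 2) * (2 * (k + 1)) * x ^ β)
          / Real.exp (δ * x) := by
          rw [hexp, mul_pow, ← Real.exp_nat_mul]
          push_cast
          ring_nf
      _ ≤ t x := by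
          rw [div_le_iff₀ (Real.exp_pos _), e, div_mul_eq_mul_div, one_mul,
            le_div_iff₀ (Real.exp_pos _), mul_assoc, ← Real.exp_add]
          refine le_trans (le_of_eq ?_) s7
          ring_nf
  have hss := stepSize_le (k := k) ht0 hκ0 hκ
  have e1 : t x ^ (1 / (k + 1) : ℝ) = s := by
    rw [ht, hs, ← Real.exp_mul, ← hc]
    congr 1; ring
  rw [e1] at hss
  have hss0 := stepSize_nonneg (k := k) (s := 3 * t x) hκ0
  set σ := stepSize k (3 * t x) (4 * (K * Real.exp (-(δ * x)))) with hσ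
  have hx4 : 1 ≤ x + 4 := by linarith
  refine ⟨ht0, ?_, ?_, ?_, ?_, ?_, ?_⟩
  · have : (768 : ℝ) ≤ M x := hMt1.trans (mul_le_of_le_one_right hM0.le ht1)
    exact_mod_cast this
  · rw [div_le_iff₀ hM0]; linarith
  · have := stepScale_pos k
    rw [div_mul_eq_mul_div, div_le_one this] at s2
    linarith
  · calc _ ≤ 4 * (A * (x + 4) ^ 2) * (82 * s) := by gcongr
      _ = 4 * A * 82 * (x + 4) ^ 2 * s := by ring
      _ ≤ 1 := s3
  · exact (mul_le_mul_of_nonneg_left hts (by positivity)).trans s4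
  · refine le_trans ?_ s5
    have t1 : 2 ^ (k + 1) * ((k + 2) * (4 * (A * (x + 4) ^ 2) * σ
        * (4 * (A * (x + 4) ^ 2)) ^ (k + 1))) ≤ K₁ * (x + 4) ^ (3 * (k + 1) + 2) * s := by
      calc _ ≤ 2 ^ (k + 1) * ((k + 2) * (4 * (A * (x + 4) ^ 2) * (82 * s)
            * (4 * (A * (x + 4) ^ 2)) ^ (k + 1))) := by gcongr
        _ = K₁ * (x + 4) ^ (2 * (k + 2)) * s := by
            rw [hK₁, show 4 * (A * (x + 4) ^ 2) = 4 * A * (x + 4) ^ 2 by ring,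
              mul_pow _ ((x + 4) ^ 2), ← pow_mul]
            ring
        _ ≤ _ := by
            gcongr; omega
    have t2 : 2 ^ (k + 1) * ((k + 2) * (36 * g * t x * (192 * g * (x + 1 + 3)) ^ (k + 1)))
        ≤ K₂ * (x + 4) ^ (3 * (k + 1) + 2) * s := by
      calc _ = K₂ * (x + 4) ^ (k + 1) * t x := by
            rw [hK₂, show x + 1 + 3 = x + 4 by ring, mul_pow _ (x + 4)]
            ring
        _ ≤ _ := by
            gcongr <;> omega
    have t3 := chainError_le (C := C) (Λ := A * (x + 4) ^ 2) (show 0 ≤ x + 1 by linarith) ht0 ht1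
      hMt hκM
    have t4 : ((4 * (x + 1 + 3)) ^ (k + 1) * ((4 * (k + 1) * 3 ^ (k + 1) + 1)
        * Real.exp (8 * C * ((k + 1) + (k + 1) ^ 2)) * (24 ^ (k + 2) + 1))
      + (k + 1) * ((3 + k) * (6160 * (4 * (x + 1 + 3)) ^ k))
        * ((2 + k) * (|16384 * (A * (x + 4) ^ 2)| ^ (k + 1) + |48 * gaussConst k C| ^ (k + 1)))) * t x
        ≤ (K₃ + K₄) * (x + 4) ^ (3 * (k + 1) + 2) * s := by
      have u1 : (4 * (x + 1 + 3)) ^ (k + 1) * ((4 * (k + 1) * 3 ^ (k + 1) + 1)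
          * Real.exp (8 * C * ((k + 1) + (k + 1) ^ 2)) * (24 ^ (k + 2) + 1))
          ≤ K₃ * (x + 4) ^ (3 * (k + 1) + 2) := by
        calc _ = K₃ * (x + 4) ^ (k + 1) := by
              rw [hK₃, show x + 1 + 3 = x + 4 by ring, mul_pow]; ring
          _ ≤ _ := by
              gcongr <;> omega
      have u2 : (k + 1) * ((3 + k) * (6160 * (4 * (x + 1 + 3)) ^ k))
          * ((2 + k) * (|16384 * (A * (x + 4) ^ 2)| ^ (k + 1) + |48 * gaussConst k C| ^ (k + 1)))
          ≤ K₄ * (x + 4) ^ (3 * (k + 1) + 2) := by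
        rw [abs_of_nonneg (by positivity), ← hg, abs_of_nonneg (by positivity)]
        have v : (16384 * (A * (x + 4) ^ 2)) ^ (k + 1) + (48 * g) ^ (k + 1)
            ≤ ((16384 * A) ^ (k + 1) + (48 * g) ^ (k + 1)) * (x + 4) ^ (2 * (k + 1)) := by
          rw [add_mul, ← mul_assoc, mul_pow _ ((x + 4) ^ 2), ← pow_mul]
          gcongr
          exact le_mul_of_one_le_right (by positivity) (one_le_pow₀ hx4)
        calc _ ≤ (k + 1) * ((3 + k) * (6160 * (4 * (x + 1 + 3)) ^ k)) * ((2 + k) *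
              (((16384 * A) ^ (k + 1) + (48 * g) ^ (k + 1)) * (x + 4) ^ (2 * (k + 1)))) := by
              have : 0 ≤ x + 1 + 3 := by linarith
              gcongr
          _ = K₄ * (x + 4) ^ (k + 2 * (k + 1)) := by
              rw [hK₄, show x + 1 + 3 = x + 4 by ring, mul_pow 4 (x + 4), pow_add]; ring
          _ ≤ _ := mul_le_mul_of_nonneg_left (pow_le_pow_right₀ hx4 (by omega)) hK₄0
      rw [add_mul K₃]
      refine mul_le_mul (add_le_add u1 u2) hts ht0.le (by positivity)
    linarith

/-! ### The positions of the base points -/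

/-- The height of the base point `ω ζ_{n₀}`. -/
noncomputable def leftHeight (N : ℕ) (δ : ℝ) : ℝ := 2 / (Real.exp (n0 N δ) + 1)

/-- The height of the base point `i ζ_{b^*}`. -/
noncomputable def rightHeight (η : ℕ → ℕ) (N : ℕ) (δ : ℝ) : ℝ := 2 / (Real.exp (bStar η N δ) + 1)

lemma hypDist_zero_left (z : ℂ) : hypDist 0 z = Real.log ((1 + ‖z‖) / (1 - ‖z‖)) := by
  simp [hypDist, diskAut]

lemma two_div_exp_add_one_le {b X : ℝ} (hX : 0 < X) (h : Real.log (1 / X) ≤ b) :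
    2 / (Real.exp b + 1) ≤ 2 * X := by
  have h1 : 1 / X ≤ Real.exp b := by
    rw [← Real.exp_log (show 0 < 1 / X by positivity)]; exact Real.exp_le_exp.2 h
  rw [div_le_iff₀ (by positivity)]
  rw [div_le_iff₀ hX] at h1
  nlinarith

lemma exp_neg_le_two_div {b : ℝ} (hb : 0 ≤ b) : Real.exp (-b) ≤ 2 / (Real.exp b + 1) := by
  have := Real.one_le_exp hb
  rw [le_div_iff₀ (by positivity), Real.exp_neg, mul_add, inv_mul_cancel₀ (Real.exp_ne_zero _)]
  have : (Real.exp b)⁻¹ ≤ 1 := inv_le_one_of_one_le₀ this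
  linarith

/-- The height of `i ζ_{b^*}` is `N^{-2δ}` up to the factor caused by the step of the heights
`b_k`. -/
lemma bStar_bounds {η : ℕ → ℕ} {N : ℕ} {δ : ℝ} (hs : 1 ≤ n0 N δ / η N)
    (h0 : 0 < (N : ℝ) ^ (-2 * δ)) (h1 : (N : ℝ) ^ (-2 * δ) < 1) :
    Real.log (1 / (N : ℝ) ^ (-2 * δ)) ≤ bStar η N δ ∧
    (bStar η N δ : ℝ) ≤ Real.log (2 / (N : ℝ) ^ (-2 * δ)) + (n0 N δ / η N : ℕ) := by
  set X := (N : ℝ) ^ (-2 * δ) with hX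
  set s := n0 N δ / η N with hsdef
  have hs1 : (1 : ℝ) ≤ s := by exact_mod_cast hs
  have hbH : ∀ k, (bHeight η N δ k : ℝ) = k * s := fun k => by rw [bHeight]; push_cast; rfl
  set A := {k : ℕ | ∀ z ∈ Metric.ball (0 : ℂ) 1, (bHeight η N δ k : ℝ) < hypDist 0 z →
    1 - X < ‖z‖} with hA
  have hmem : ⌈Real.log (2 / X) / s⌉₊ ∈ A := by
    intro z hz hlt
    rw [Metric.mem_ball, dist_zero_right] at hz
    have h2 : Real.log (2 / X) ≤ bHeight η N δ ⌈Real.log (2 / X) / s⌉₊ := by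
      rw [hbH, ← div_le_iff₀ (by linarith)]
      exact Nat.le_ceil _
    have h3 := h2.trans_lt hlt
    rw [hypDist_zero_left, Real.log_lt_log_iff (by positivity)
      (div_pos (by positivity) (by linarith)), div_lt_div_iff₀ h0 (by linarith)] at h3
    nlinarith [norm_nonneg z]
  have hr : rIndex η N δ ∈ A := Nat.sInf_mem ⟨_, hmem⟩
  constructor
  · by_contra hlt
    push Not at hlt
    have h2 := hr ((1 - X : ℝ) : ℂ) (by
      rw [Metric.mem_ball, dist_zero_right, Complex.norm_real, Real.norm_of_nonneg (by linarith)]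
      linarith)
    rw [hypDist_zero_left, Complex.norm_real, Real.norm_of_nonneg (by linarith)] at h2
    refine lt_irrefl _ (h2 (hlt.trans_le (Real.log_le_log (by positivity) ?_)))
    rw [div_le_div_iff₀ h0 (by linarith)]
    nlinarith
  · have h2 : (rIndex η N δ : ℝ) ≤ ⌈Real.log (2 / X) / s⌉₊ := by
      exact_mod_cast Nat.sInf_le hmem
    have h3 : (⌈Real.log (2 / X) / s⌉₊ : ℝ) < Real.log (2 / X) / s + 1 :=
      Nat.ceil_lt_add_one (div_nonneg (Real.log_nonneg (by rw [le_div_iff₀ h0]; linarith))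
        (by linarith))
    rw [bStar, hbH]
    calc _ ≤ (Real.log (2 / X) / s + 1) * s := by gcongr; linarith
      _ = _ := by field_simp

lemma natCast_rpow_eq_exp {N : ℕ} (hN : 1 ≤ N) (a : ℝ) :
    (N : ℝ) ^ a = Real.exp (a * Real.log N) := by
  rw [Real.rpow_def_of_pos (by exact_mod_cast hN), mul_comm]

lemma tendsto_log_natCast : Tendsto (fun N : ℕ => Real.log N) atTop atTop :=
  Real.tendsto_log_atTop.comp tendsto_natCast_atTop_atTop

lemma eventually_mul_exp_le {a a' : ℝ} (h : a' < a) (c : ℝ) :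
    ∀ᶠ x : ℝ in atTop, c * Real.exp (-(a * x)) ≤ Real.exp (-(a' * x)) := by
  have h4 : Tendsto (fun x : ℝ => Real.exp ((a - a') * x)) atTop atTop :=
    Real.tendsto_exp_atTop.comp (tendsto_id.const_mul_atTop (by linarith))
  filter_upwards [h4.eventually_ge_atTop c] with x hx
  calc _ ≤ Real.exp ((a - a') * x) * Real.exp (-(a * x)) := by gcongr
    _ = _ := by rw [← Real.exp_add]; ring_nf

lemma n0_bounds {N : ℕ} {δ : ℝ} (hN : 1 ≤ N) (hδ : 0 < δ) (hδ1 : δ < 1) :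
    (1 - δ) * Real.log N - 1 ≤ n0 N δ ∧ (n0 N δ : ℝ) ≤ (1 - δ) * Real.log N + 1 := by
  have hlog : 0 ≤ Real.log N := Real.log_nonneg (by exact_mod_cast hN)
  have h1 : Real.log N ≤ nN N := Nat.le_ceil _
  have h2 : (nN N : ℝ) < Real.log N + 1 := Nat.ceil_lt_add_one hlog
  have h3 : (n0 N δ : ℝ) ≤ (1 - δ) * nN N :=
    Nat.floor_le (mul_nonneg (by linarith) (Nat.cast_nonneg _))
  have h4 : (1 - δ) * nN N < n0 N δ + 1 := Nat.lt_floor_add_one _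
  constructor <;> nlinarith

/-- The sizes of the heights of the base points, in terms of `log N`. -/
lemma eventually_heights {η : ℕ → ℕ} (hη : Tendsto η atTop atTop)
    (hη' : Tendsto (fun N : ℕ => (η N : ℝ) / Real.log N) atTop (𝓝 0)) {δ ε : ℝ} (hδ : 0 < δ)
    (hδ1 : δ < 1 / 2) (hε : 0 < ε) : ∀ᶠ N : ℕ in atTop,
    1 / 3 * Real.exp (-((1 - δ) * Real.log N)) ≤ leftHeight N δ ∧
    leftHeight N δ ≤ 6 * Real.exp (-((1 - δ) * Real.log N)) ∧
    Real.exp (-(n0 N δ : ℝ)) ≤ 3 * Real.exp (-((1 - δ) * Real.log N)) ∧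
    Real.exp (-((2 * δ + ε) * Real.log N)) ≤ rightHeight η N δ ∧
    rightHeight η N δ ≤ 2 * Real.exp (-(2 * δ * Real.log N)) := by
  have e1 := tendsto_log_natCast.eventually_ge_atTop 8
  have e2 : ∀ᶠ N : ℕ in atTop, 4 / ε ≤ η N :=
    (tendsto_natCast_atTop_atTop.comp hη).eventually_ge_atTop (4 / ε)
  have e3 := hη'.eventually_lt_const (show (0 : ℝ) < 1 / 4 by norm_num)
  have e4 := tendsto_log_natCast.eventually_ge_atTop (2 / ε)
  filter_upwards [e1, e2, e3, e4, eventually_ge_atTop 1] with N e1 e2 e3 e4 hN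
  have hη0 : (0 : ℝ) < η N := lt_of_lt_of_le (by positivity) e2
  rw [div_lt_iff₀ (by linarith)] at e3
  obtain ⟨n1, n2⟩ := n0_bounds hN hδ (by linarith)
  set x := Real.log N with hx
  have h3 : Real.exp 1 ≤ 3 := Real.exp_one_lt_d9.le.trans (by norm_num)
  have h30 := Real.exp_pos 1
  have l1 : Real.exp (-(n0 N δ : ℝ)) ≤ 3 * Real.exp (-((1 - δ) * x)) := by
    calc _ ≤ Real.exp (1 + -((1 - δ) * x)) := Real.exp_le_exp.2 (by linarith)
      _ ≤ _ := by rw [Real.exp_add]; gcongr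
  have l2 : 1 / 3 * Real.exp (-((1 - δ) * x)) ≤ Real.exp (-(n0 N δ : ℝ)) := by
    have h4 : 1 / 3 ≤ Real.exp (-1) := by
      rw [Real.exp_neg, ← one_div]; gcongr
    calc _ ≤ Real.exp (-1) * Real.exp (-((1 - δ) * x)) := by gcongr
      _ = Real.exp (-1 + -((1 - δ) * x)) := by rw [Real.exp_add]
      _ ≤ _ := Real.exp_le_exp.2 (by linarith)
  have hs : 1 ≤ n0 N δ / η N := by
    rw [Nat.one_le_div_iff (by exact_mod_cast hη0)]
    have : (η N : ℝ) ≤ n0 N δ := by nlinarith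
    exact_mod_cast this
  have hs2 : ((n0 N δ / η N : ℕ) : ℝ) ≤ ε / 2 * x := by
    refine Nat.cast_div_le.trans ?_
    rw [div_le_iff₀ hη0]
    rw [div_le_iff₀ hε] at e2
    have : (n0 N δ : ℝ) ≤ 2 * x := by nlinarith
    calc (n0 N δ : ℝ) ≤ 2 * x := this
      _ ≤ (η N * ε / 2) * x := by gcongr; linarith
      _ = _ := by ring
  have hX := natCast_rpow_eq_exp hN (-2 * δ)
  rw [← hx] at hX
  obtain ⟨b1, b2⟩ := bStar_bounds hs (by rw [hX]; exact Real.exp_pos _) (by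
    rw [hX, Real.exp_lt_one_iff]
    nlinarith)
  refine ⟨l2.trans (exp_neg_le_two_div (Nat.cast_nonneg _)), ?_, l1, ?_, ?_⟩
  · refine (two_div_exp_add_one_le (Real.exp_pos (-(n0 N δ : ℝ))) ?_).trans (by linarith)
    rw [one_div, Real.log_inv, Real.log_exp, neg_neg]
  · refine le_trans (Real.exp_le_exp.2 ?_) (exp_neg_le_two_div (Nat.cast_nonneg _))
    rw [hX, Real.log_div (by norm_num) (Real.exp_ne_zero _), Real.log_exp] at b2
    have h5 : Real.log 2 ≤ 1 := by linarith [Real.log_two_lt_d9]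
    rw [div_le_iff₀ hε] at e4
    linarith
  · refine (two_div_exp_add_one_le (by rw [hX]; exact Real.exp_pos _) b1).trans_eq ?_
    rw [hX]; ring_nf

lemma direction_mul_zeta {N : ℕ} {δ : ℝ} {ω : ℂ} (hω : ω ∈ directions N δ) :
    ∃ θ, |θ| < (N : ℝ) ^ (-δ) ∧ ω * zeta (n0 N δ) = pt (leftHeight N δ) θ := by
  obtain ⟨h, h1, rfl⟩ := hω
  refine ⟨h * Real.exp (-(n0 N δ : ℝ)), ?_, ?_⟩
  · rw [abs_mul, abs_of_pos (Real.exp_pos _)]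
    calc _ < (N : ℝ) ^ (-δ) * Real.exp (n0 N δ) * Real.exp (-(n0 N δ : ℝ)) := by gcongr
      _ = _ := by rw [mul_assoc, ← Real.exp_add]; simp
  · rw [leftHeight, ← zeta_mul_circleExp, Circle.coe_exp, mul_comm]
    congr 2
    ring

/-- The direction closest to a given angle. -/
lemma exists_direction {N : ℕ} {δ θ : ℝ} (h : |θ| + Real.exp (-(n0 N δ : ℝ)) < (N : ℝ) ^ (-δ)) :
    ∃ ω ∈ directions N δ, ∃ θ', ω * zeta (n0 N δ) = pt (leftHeight N δ) θ' ∧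
      |θ - θ'| ≤ Real.exp (-(n0 N δ : ℝ)) := by
  set e := Real.exp (-(n0 N δ : ℝ)) with he
  have he0 : 0 < e := Real.exp_pos _
  have he1 : Real.exp (n0 N δ) * e = 1 := by rw [he, ← Real.exp_add]; simp
  set m : ℤ := ⌊θ / e⌋ with hm
  have m1 : (m : ℝ) * e ≤ θ := by rw [← le_div_iff₀ he0]; exact Int.floor_le _
  have m2 : θ < (m + 1) * e := by rw [← div_lt_iff₀ he0]; exact Int.lt_floor_add_one _
  have hdist : |θ - m * e| ≤ e := by rw [abs_le]; constructor <;> linarith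
  refine ⟨_, ⟨m, ?_, rfl⟩, m * e, ?_, hdist⟩
  · have h1 : |(m : ℝ)| * e < (N : ℝ) ^ (-δ) := by
      have : |(m : ℝ) * e| ≤ |θ| + |θ - m * e| := by
        have := abs_sub_abs_le_abs_sub (m * e) θ
        rw [abs_sub_comm] at this
        linarith
      rw [abs_mul, abs_of_pos he0] at this
      linarith
    calc |(m : ℝ)| = |(m : ℝ)| * e * Real.exp (n0 N δ) := by
          rw [mul_assoc, mul_comm e, he1, mul_one]
      _ < _ := by gcongr
  · rw [leftHeight, ← zeta_mul_circleExp, Circle.coe_exp, mul_comm]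
    congr 2
    ring

lemma I_mul_zeta_bStar (η : ℕ → ℕ) (N : ℕ) (δ : ℝ) :
    Complex.I * zeta (bStar η N δ) = pt (rightHeight η N δ) 0 := by
  rw [rightHeight, ← zeta_mul_circleExp, mul_comm, Circle.coe_exp, add_zero]
  push_cast
  rw [Complex.exp_pi_div_two_mul_I]

lemma two_div_exp_nat_le_one (m : ℕ) : 2 / (Real.exp m + 1) ≤ 1 := by
  rw [div_le_one (by positivity)]
  linarith [Real.one_le_exp (Nat.cast_nonneg (α := ℝ) m)]

/-- For large `N` the base points for two parameters `δ' < δ` are in good position, provided that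
`ω' ζ_{n₀}` lies in the domain for `δ'`. -/
lemma eventually_basePoints (k : ℕ) {η : ℕ → ℕ} (hη : Tendsto η atTop atTop)
    (hη' : Tendsto (fun N : ℕ => (η N : ℝ) / Real.log N) atTop (𝓝 0)) {δ δ' : ℝ} (hδ : 0 < δ)
    (hδ1 : δ < 1 / 20) (hδ'1 : 3 / 5 * δ < δ') (hδ'2 : δ' < 4 / 5 * δ) :
    ∀ᶠ N : ℕ in atTop, (N : ℝ) ^ (-1 + δ') ≤ leftHeight N δ' → ∀ ω ∈ directions N δ,
      ∃ ω' ∈ directions N δ', ∃ θ θ', BasePoints k ((N : ℝ) ^ (-1 + δ)) ((N : ℝ) ^ (-δ))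
        ((N : ℝ) ^ (-1 + δ')) ((N : ℝ) ^ (-δ')) (ω * zeta (n0 N δ))
        (Complex.I * zeta (bStar η N δ)) (ω' * zeta (n0 N δ')) (Complex.I * zeta (bStar η N δ'))
        θ θ' ∧ (N : ℝ) ^ (-δ) + ht (ω * zeta (n0 N δ)) ≤ (N : ℝ) ^ (-δ') := by
  have ev : ∀ {a a' : ℝ}, a' < a → ∀ c : ℝ, ∀ᶠ N : ℕ in atTop,
      c * Real.exp (-(a * Real.log N)) ≤ Real.exp (-(a' * Real.log N)) := fun h c =>
    tendsto_log_natCast.eventually (eventually_mul_exp_le h c)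
  have hε : 0 < δ / 10 := by positivity
  filter_upwards [eventually_ge_atTop 1, eventually_heights hη hη' hδ (by linarith) hε,
    eventually_heights hη hη' (show 0 < δ' by linarith) (by linarith) hε,
    ev (show 0 < δ' by linarith) 4, ev (show 2 * δ + δ / 10 < 1 - δ by linarith) 18,
    ev (show δ < 2 * δ by linarith) (128 * (k + 2) ^ 3),
    ev (show δ' < 2 * δ' by linarith) (128 * (k + 1) ^ 3),
    ev (show 2 * δ' + δ / 10 < 1 - δ by linarith) 24, ev (show δ < 2 * δ' by linarith) 2,
    ev (show 1 - δ < 1 - δ' by linarith) 72, ev (show δ' < δ by linarith) 8,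
    ev (show (2 * δ' + δ / 10) + (1 - δ') < 2 * (1 - δ) by linarith) 3456,
    ev (show δ < 1 - δ by linarith) 1, ev (show δ < 1 - δ' by linarith) 3]
    with N hN ⟨h1, h2, _, h4, h5⟩ ⟨g1, g2, g3, g4, g5⟩ c1 c2 c3 c4 c5 c6 c7 c8 c9 c10 c11
    hgood ω hω
  have q1 : (N : ℝ) ^ (-1 + δ) = Real.exp (-((1 - δ) * Real.log N)) := by
    rw [natCast_rpow_eq_exp hN]; ring_nf
  have q2 : (N : ℝ) ^ (-δ) = Real.exp (-(δ * Real.log N)) := by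
    rw [natCast_rpow_eq_exp hN]; ring_nf
  have q3 : (N : ℝ) ^ (-1 + δ') = Real.exp (-((1 - δ') * Real.log N)) := by
    rw [natCast_rpow_eq_exp hN]; ring_nf
  have q4 : (N : ℝ) ^ (-δ') = Real.exp (-(δ' * Real.log N)) := by
    rw [natCast_rpow_eq_exp hN]; ring_nf
  obtain ⟨θ, hθ, hp⟩ := direction_mul_zeta hω
  rw [zero_mul, neg_zero, Real.exp_zero] at c1
  set x := Real.log N with hx
  have c9' : 3456 * Real.exp (-((1 - δ) * x)) ^ 2
      ≤ Real.exp (-((2 * δ' + δ / 10) * x)) * Real.exp (-((1 - δ') * x)) := by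
    rw [← Real.exp_nat_mul, ← Real.exp_add]
    convert c9 using 3 <;> push_cast <;> ring
  rw [q2] at hθ
  obtain ⟨ω', hω', θ', hp', hθ'⟩ := exists_direction (N := N) (δ := δ') (θ := θ) (by
    rw [q4]
    linarith [Real.exp_pos (-(δ * x))])
  have hq := I_mul_zeta_bStar η N δ
  have hq' := I_mul_zeta_bStar η N δ'
  have zp : ht (ω * zeta (n0 N δ)) = leftHeight N δ := by
    rw [hp]; exact ht_pt (two_div_exp_nat_le_one _)
  have zp' : ht (ω' * zeta (n0 N δ')) = leftHeight N δ' := by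
    rw [hp']; exact ht_pt (two_div_exp_nat_le_one _)
  have zq : ht (Complex.I * zeta (bStar η N δ)) = rightHeight η N δ := by
    rw [hq]; exact ht_pt (two_div_exp_nat_le_one _)
  have zq' : ht (Complex.I * zeta (bStar η N δ')) = rightHeight η N δ' := by
    rw [hq']; exact ht_pt (two_div_exp_nat_le_one _)
  refine ⟨ω', hω', θ, θ', ?_, ?_⟩
  · have hlp : 0 < leftHeight N δ := by unfold leftHeight; positivity
    have hrq' : 0 < rightHeight η N δ' := by unfold rightHeight; positivity
    have s1 : leftHeight N δ ^ 2 ≤ 36 * Real.exp (-((1 - δ) * x)) ^ 2 := by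
      calc _ ≤ (6 * Real.exp (-((1 - δ) * x))) ^ 2 := by gcongr
        _ = _ := by ring
    have s2 : Real.exp (-((2 * δ' + δ / 10) * x)) * (1 / 3 * Real.exp (-((1 - δ') * x)))
        ≤ rightHeight η N δ' * leftHeight N δ' := by gcongr
    have hk : (0 : ℝ) ≤ k := k.cast_nonneg
    have r1 : 64 * ((k : ℝ) + 2) ^ 3 * rightHeight η N δ ≤ Real.exp (-(δ * x)) := by
      calc _ ≤ 64 * ((k : ℝ) + 2) ^ 3 * (2 * Real.exp (-(2 * δ * x))) := by gcongr
        _ = 128 * ((k : ℝ) + 2) ^ 3 * Real.exp (-(2 * δ * x)) := by ring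
        _ ≤ _ := c3
    have r2 : 64 * ((k : ℝ) + 1) ^ 3 * rightHeight η N δ' ≤ Real.exp (-(δ' * x)) := by
      calc _ ≤ 64 * ((k : ℝ) + 1) ^ 3 * (2 * Real.exp (-(2 * δ' * x))) := by gcongr
        _ = 128 * ((k : ℝ) + 1) ^ 3 * Real.exp (-(2 * δ' * x)) := by ring
        _ ≤ _ := c4
    have a1 := Real.exp_pos (-((1 - δ) * x))
    have a2 := Real.exp_pos (-((1 - δ') * x))
    have a3 := Real.exp_pos (-(δ * x))
    have a4 := Real.exp_pos (-(δ' * x))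
    have hθ1 : |θ'| ≤ |θ| + |θ - θ'| := by
      have := abs_sub_abs_le_abs_sub θ' θ
      rw [abs_sub_comm] at this
      linarith
    constructor
    · rw [q3]; exact a2
    · rw [q1, q3]; linarith
    · rw [q2, q4]; linarith
    · rw [q4]; linarith
    · rw [zp]; exact hp
    · rw [q2]; exact hθ.le
    · rw [zq]; exact hq
    · rw [q1, zq]; linarith
    · rw [zp, zq]; linarith
    · rw [q2, zq]; exact r1
    · rw [zp']; exact hp'
    · refine ⟨leftHeight N δ', θ', hgood, ?_, ?_, hp'⟩
      · rw [q4]; linarith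
      · rw [q4]; linarith
    · refine ⟨rightHeight η N δ', 0, ?_, ?_, ?_, hq'⟩
      · rw [q1]; linarith
      · rw [q2]; linarith
      · rw [q2, abs_zero]; exact a3.le
    · rw [q4, zq']; exact r2
    · rw [zp, zq']; linarith
    · rw [zp]; linarith
    · rw [zp, zp']; linarith
    · rw [zp, zq', zp']; linarith
    · rw [q3, zp]; linarith
  · rw [zp, q2, q4]; linarith

/-! ### Choice of the second parameter -/

/-- If the fractional part of `(1 - δ) n` is at least `1 / 2`, then `ω ζ_{n₀}` lies above the lower
boundary of the domain. -/
lemma rpow_le_leftHeight {N : ℕ} {δ : ℝ} (hN : 1 ≤ N) (hδ : 0 < δ) (hδ1 : δ < 1)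
    (hx : 3 ≤ Real.exp ((1 - δ) * Real.log N)) (h : (n0 N δ : ℝ) + 1 / 2 ≤ (1 - δ) * nN N) :
    (N : ℝ) ^ (-1 + δ) ≤ leftHeight N δ := by
  have hlog : 0 ≤ Real.log N := Real.log_nonneg (by exact_mod_cast hN)
  have h2 : (nN N : ℝ) < Real.log N + 1 := Nat.ceil_lt_add_one hlog
  have h3 : (n0 N δ : ℝ) ≤ 1 / 2 + (1 - δ) * Real.log N := by nlinarith
  have h4 : Real.exp (1 / 2) ≤ 5 / 3 := by
    have e : Real.exp (1 / 2) ^ 2 = Real.exp 1 := by rw [← Real.exp_nat_mul]; norm_num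
    have := Real.exp_one_lt_d9
    nlinarith [Real.exp_pos (1 / 2)]
  have e : (N : ℝ) ^ (-1 + δ) = (Real.exp ((1 - δ) * Real.log N))⁻¹ := by
    rw [natCast_rpow_eq_exp hN, ← Real.exp_neg]; ring_nf
  set X := Real.exp ((1 - δ) * Real.log N) with hX
  have h5 : Real.exp (n0 N δ) ≤ 5 / 3 * X := by
    calc _ ≤ Real.exp (1 / 2 + (1 - δ) * Real.log N) := Real.exp_le_exp.2 h3
      _ ≤ _ := by rw [Real.exp_add]; gcongr
  rw [e, leftHeight, ← one_div, div_le_div_iff₀ (by linarith) (by positivity)]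
  linarith

/-- For infinitely many given `N`, a generic parameter `δ` is such that the fractional part of
`(1 - δ) n` exceeds `1 / 2` infinitely often, by Baire's theorem. -/
lemma exists_frequently_le_leftHeight {p : ℕ → Prop} (hp : ∃ᶠ N in atTop, p N) {a b : ℝ}
    (hab : a < b) (ha : 0 ≤ a) (hb : b ≤ 1) :
    ∃ δ, a < δ ∧ δ < b ∧ ∃ᶠ N in atTop, p N ∧ (N : ℝ) ^ (-1 + δ) ≤ leftHeight N δ := by
  set O : ℕ → Set ℝ := fun m => ⋃ N : ℕ, ⋃ _ : m ≤ N ∧ p N, ⋃ j : ℤ,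
    {y | (j : ℝ) + 1 / 2 < (1 - y) * nN N} ∩ {y | (1 - y) * nN N < j + 1} with hO
  have hopen : ∀ m, IsOpen (O m) := fun m =>
    isOpen_iUnion fun N => isOpen_iUnion fun _ => isOpen_iUnion fun j =>
      (isOpen_lt (by fun_prop) (by fun_prop)).inter (isOpen_lt (by fun_prop) (by fun_prop))
  have hdense : ∀ m, Dense (O m) := by
    intro m
    rw [Metric.dense_iff]
    intro y r hr
    obtain ⟨N, hpN, hmN, hNr⟩ := (hp.and_eventually ((eventually_ge_atTop m).and
      (tendsto_log_natCast.eventually_gt_atTop (1 / r)))).exists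
    have hn : 1 / r < nN N := hNr.trans_le (Nat.le_ceil _)
    have hn0 : (0 : ℝ) < nN N := lt_trans (by positivity) hn
    set j := ⌊(1 - y) * nN N⌋ with hj
    have j1 : (j : ℝ) ≤ (1 - y) * nN N := Int.floor_le _
    have j2 : (1 - y) * nN N < j + 1 := Int.lt_floor_add_one _
    have e : (1 - (1 - (j + 3 / 4) / nN N)) * nN N = (j : ℝ) + 3 / 4 := by field_simp; ring
    refine ⟨1 - (j + 3 / 4) / nN N, ?_, ?_⟩
    · rw [Metric.mem_ball, Real.dist_eq]
      have e2 : 1 - ((j : ℝ) + 3 / 4) / nN N - y = ((1 - y) * nN N - (j + 3 / 4)) / nN N := by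
        field_simp; ring
      rw [e2, abs_div, abs_of_pos hn0, div_lt_iff₀ hn0]
      rw [div_lt_iff₀ hr] at hn
      have : |(1 - y) * nN N - ((j : ℝ) + 3 / 4)| ≤ 1 := by
        rw [abs_le]; constructor <;> linarith
      linarith
    · simp only [hO, Set.mem_iUnion]
      refine ⟨N, ⟨hmN, hpN⟩, j, ?_, ?_⟩
      · rw [Set.mem_ofPred_eq, e]; linarith
      · rw [Set.mem_ofPred_eq, e]; linarith
  obtain ⟨δ, hδ, hδO⟩ := (dense_iInter_of_isOpen_nat hopen hdense).inter_open_nonempty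
    (Set.Ioo a b) isOpen_Ioo ⟨(a + b) / 2, by constructor <;> linarith⟩ |>.imp fun _ h => h
  have hδ0 : 0 < δ := ha.trans_lt hδ.1
  have hδ1 : δ < 1 := hδ.2.trans_le hb
  have hlarge : ∀ᶠ N : ℕ in atTop, 3 ≤ Real.exp ((1 - δ) * Real.log N) :=
    (Real.tendsto_exp_atTop.comp (tendsto_log_natCast.const_mul_atTop
      (show 0 < 1 - δ by linarith))).eventually_ge_atTop 3
  obtain ⟨m₀, hm₀⟩ := eventually_atTop.1 hlarge
  refine ⟨δ, hδ.1, hδ.2, frequently_atTop.2 fun m => ?_⟩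
  have h1 := Set.mem_iInter.1 hδO (max (max m m₀) 1)
  simp only [hO, Set.mem_iUnion] at h1
  obtain ⟨N, ⟨hmN, hpN⟩, j, h2, h3⟩ := h1
  rw [Set.mem_ofPred_eq] at h2 h3
  have hN1 : 1 ≤ N := (le_max_right _ _).trans hmN
  refine ⟨N, ((le_max_left _ _).trans (le_max_left _ _)).trans hmN, hpN,
    rpow_le_leftHeight hN1 hδ0 hδ1 (hm₀ N (((le_max_right _ _).trans (le_max_left _ _)).trans hmN))
      ?_⟩
  have h4 : (n0 N δ : ℝ) ≤ (1 - δ) * nN N :=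
    Nat.floor_le (mul_nonneg (by linarith) (Nat.cast_nonneg _))
  have h5 : (n0 N δ : ℤ) < j + 1 := by exact_mod_cast h4.trans_lt h3
  have h6 : (n0 N δ : ℝ) ≤ j := by exact_mod_cast Int.lt_add_one_iff.1 h5
  linarith

/-! ### The asymptotic estimate -/

section

variable {S : ℕ → Type*} [∀ N, MeasurableSpace (S N)] {P : ∀ N, Measure (S N)}
  {WN : ∀ N, S N → ℂ → ℝ} {E : Type*} [MeasurableSpace E] {Q : Measure E} {W : E → ℂ → ℝ}
  {U : Set ℂ} {η : ℕ → ℕ} {ℓ : ℕ}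

/-- The comparison of exponential moments in `MEM`, at given `δ` and `N` and with the constant
`C`. -/
def MomentBound (ℓ : ℕ) (η : ℕ → ℕ) (P : ∀ N, Measure (S N)) (WN : ∀ N, S N → ℂ → ℝ)
    (Q : Measure E) (W : E → ℂ → ℝ) (δ C : ℝ) (N : ℕ) : Prop :=
  ∀ ω ∈ directions N δ, ∀ B ∈ perturbedBiases ℓ η N δ ω,
    Integrable (fun x => Real.exp (B (WN N x))) (P N) ∧
    |(∫ x, Real.exp (B (WN N x)) ∂(P N)) - ∫ x, Real.exp (B (W x)) ∂Q|
      ≤ C * (N : ℝ) ^ (-δ) * ∫ x, Real.exp (B (W x)) ∂Q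

lemma MomentBound.biasComparison {δ C : ℝ} {N : ℕ} (h : MomentBound ℓ η P WN Q W δ C N) {ω : ℂ}
    (hω : ω ∈ directions N δ) :
    BiasComparison (P N) Q (WN N) W (sector ((N : ℝ) ^ (-1 + δ)) ((N : ℝ) ^ (-δ)))
      (ω * zeta (n0 N δ)) (Complex.I * zeta (bStar η N δ)) ℓ (|C| * (N : ℝ) ^ (-δ)) := by
  rw [← domain_eq_sector]
  refine ⟨fun c d hc hd hcd => (h ω hω _ (hcd.mem_perturbedBiases hc hd)).1,
    fun c d hc hd hcd => (h ω hω _ (hcd.mem_perturbedBiases hc hd)).2.trans ?_⟩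
  refine mul_le_mul_of_nonneg_right ?_ (integral_nonneg fun x => (Real.exp_pos _).le)
  gcongr
  exact le_abs_self C

/-- At given `δ` and `N`, the expectations of the products of increments exist, and they differ by
at most `r`. -/
def ProductComparison (ℓ : ℕ) (η : ℕ → ℕ) (P : ∀ N, Measure (S N)) (WN : ∀ N, S N → ℂ → ℝ)
    (Q : Measure E) (W : E → ℂ → ℝ) (δ r : ℝ) (N : ℕ) : Prop :=
  ∀ ω ∈ directions N δ, ∀ z y : Fin ℓ → ℂ,
    (∀ i, z i ∈ domain N δ) → (∀ i, y i ∈ domain N δ) →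
    Integrable (fun x => Real.exp (baseBias η N δ ω (WN N x))) (P N) ∧
    Integrable (fun x => Real.exp (baseBias η N δ ω (WN N x)) *
      ∏ i, incBias (z i) (y i) (WN N x)) (P N) ∧
    Integrable (fun x => ∏ i, incBias (z i) (y i)
      (fun ζ => biasMean Q W (baseBias η N δ ω) ζ + W x ζ)) Q ∧
    |biasedExp (P N) (WN N) (baseBias η N δ ω) (fun F => ∏ i, incBias (z i) (y i) F)
        - ∫ x, ∏ i, incBias (z i) (y i)
            (fun ζ => biasMean Q W (baseBias η N δ ω) ζ + W x ζ) ∂Q| ≤ r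

lemma abs_log_two_mul_div_le {N : ℕ} {δ r : ℝ} (hN : 1 ≤ N) (hδ : 0 < δ)
    (h1 : (N : ℝ) ^ (-1 + δ) ≤ r) (h2 : r ≤ (N : ℝ) ^ (-δ)) :
    |Real.log (2 * r / (N : ℝ) ^ (-δ))| ≤ Real.log N + 1 := by
  have hlog : 0 ≤ Real.log N := Real.log_nonneg (by exact_mod_cast hN)
  rw [natCast_rpow_eq_exp hN] at h1 h2 ⊢
  have hr : 0 < r := (Real.exp_pos _).trans_le h1
  have l1 := (Real.le_log_iff_exp_le hr).2 h1
  have l2 := (Real.log_le_iff_le_exp hr).2 h2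
  rw [Real.log_div (by positivity) (Real.exp_ne_zero _), Real.log_exp,
    Real.log_mul (by norm_num) hr.ne', abs_le]
  have := Real.log_two_gt_d9
  have := Real.log_two_lt_d9
  constructor <;> nlinarith

lemma exists_stepMoment_le (k : ℕ) (C : ℝ) {V : ℝ} (hV : 0 ≤ V) :
    ∃ A, 1 ≤ A ∧ ∀ x : ℝ, 0 ≤ x → stepMoment k C (x + 1) (8 * (V * (1 + x)) + 1) ≤ A * (x + 4) ^ 2 ∧
      51 / stepScale k * (x + 1 + 3) * stepMoment k C (x + 1) (8 * (V * (1 + x)) + 1)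
        ≤ A * (x + 4) ^ 2 := by
  have hs := stepScale_pos k
  have hc := stepConst_pos k C
  set s := 51 / stepScale k with hsdef
  have hs0 : 0 < s := by positivity
  set A₁ := stepConst k C + 300 * (64 * (s * stepConst k C) + 8 * (8 * V + 1)
    + 32 * (2 * (k + 1)).factorial) with hA₁
  have hA₁0 : 0 ≤ A₁ := by positivity
  refine ⟨A₁ * (s + 1) + 1, by nlinarith, fun x hx => ?_⟩
  have h1 : stepMoment k C (x + 1) (8 * (V * (1 + x)) + 1) ≤ A₁ * (x + 4) := by
    unfold stepMoment
    rw [← hsdef, show x + 1 + 3 = x + 4 by ring]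
    have j1 : stepConst k C ≤ stepConst k C * (x + 4) :=
      le_mul_of_one_le_right hc.le (by linarith)
    have j2 : ((2 * (k + 1)).factorial : ℝ) ≤ (2 * (k + 1)).factorial * (x + 4) :=
      le_mul_of_one_le_right (by positivity) (by linarith)
    have j3 : 8 * (V * (1 + x)) + 1 ≤ (8 * V + 1) * (x + 4) := by nlinarith
    rw [hA₁]
    linarith
  have h2 : 1 ≤ x + 4 := by linarith
  constructor
  · calc _ ≤ A₁ * (x + 4) := h1
      _ ≤ (A₁ * (s + 1) + 1) * (x + 4) ^ 2 := by
        gcongr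
        · nlinarith
        · exact le_self_pow₀ h2 (by norm_num)
  · calc _ ≤ s * (x + 1 + 3) * (A₁ * (x + 4)) := by gcongr
      _ = s * A₁ * (x + 4) ^ 2 := by ring
      _ ≤ _ := by
        gcongr
        nlinarith

/-- The comparison of products for those large `N` for which the second base point lies in its
domain. -/
lemma eventually_productComparison [∀ N, IsProbabilityMeasure (P N)] [IsProbabilityMeasure Q]
    (hUD : U ⊆ Metric.ball (0 : ℂ) 1) (hUi : U ∈ 𝓝[Metric.ball (0 : ℂ) 1] Complex.I)
    (hWN : ∀ N, ∀ z ∈ U, AEMeasurable (fun x => WN N x z) (P N)) (hW : IsBRWLike Q W U)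
    (hη : Tendsto η atTop atTop)
    (hη' : Tendsto (fun N : ℕ => (η N : ℝ) / Real.log N) atTop (𝓝 0)) (k : ℕ) {δ δ' α C₁ C₂ : ℝ}
    (hδ : 0 < δ) (hδ1 : δ < 1 / 20) (hδ'1 : 3 / 5 * δ < δ') (hδ'2 : δ' < 4 / 5 * δ)
    (hα0 : 0 < α) (hα : α < 1)
    (hharm : ∀ᶠ N : ℕ in atTop,
      ∀ᵐ x ∂(P N), InnerProductSpace.HarmonicOnNhd (WN N x) (domain N δ'))
    (h₁ : ∀ᶠ N : ℕ in atTop, MomentBound (k + 1) η P WN Q W δ C₁ N)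
    (h₂ : ∀ᶠ N : ℕ in atTop, MomentBound (k + 1) η P WN Q W δ' C₂ N) :
    ∀ᶠ N : ℕ in atTop, (N : ℝ) ^ (-1 + δ') ≤ leftHeight N δ' →
      ProductComparison (k + 1) η P WN Q W δ (Real.exp (-(Real.log N) ^ α)) N := by
  obtain ⟨C, hC⟩ := hW.exists_incrementBound hUD
  obtain ⟨V, H₀, hV, hH₀, -, hVH⟩ := hW.exists_sq_le hUD hUi
  obtain ⟨A, hA, hstep⟩ := exists_stepMoment_le k C hV.le
  obtain ⟨t, M, htM⟩ := exists_errors_le k hα0 hα hδ C A |C₁| hA (abs_nonneg _)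
  have hδ'0 : 0 < δ' := by linarith
  have ev : ∀ {a a' : ℝ}, a' < a → ∀ c : ℝ, ∀ᶠ N : ℕ in atTop,
      c * Real.exp (-(a * Real.log N)) ≤ Real.exp (-(a' * Real.log N)) := fun h c =>
    tendsto_log_natCast.eventually (eventually_mul_exp_le h c)
  filter_upwards [eventually_ge_atTop 1, eventually_basePoints k hη hη' hδ hδ1 hδ'1 hδ'2, hharm,
    h₁, h₂, tendsto_log_natCast.eventually htM, ev hδ (8 * |C₁|), ev hδ'0 |C₂|, ev hδ'0 (1 / H₀)]
    with N hN hbase hharm h₁ h₂ hpar c1 c2 c3 hgood ω hω z y hz hy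
  obtain ⟨ω', hω', θ, θ', g, hH⟩ := hbase hgood ω hω
  have q2 : (N : ℝ) ^ (-δ) = Real.exp (-(δ * Real.log N)) := by
    rw [natCast_rpow_eq_exp hN]; ring_nf
  have q4 : (N : ℝ) ^ (-δ') = Real.exp (-(δ' * Real.log N)) := by
    rw [natCast_rpow_eq_exp hN]; ring_nf
  simp only [zero_mul, neg_zero, Real.exp_zero] at c1 c2 c3
  rw [one_div_mul_eq_div, div_le_one hH₀, ← q4] at c3
  have hlog : 0 ≤ Real.log N := Real.log_nonneg (by exact_mod_cast hN)
  have hN0 : (0 : ℝ) < N := by exact_mod_cast hN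
  have hsec : ∀ u ∈ sector ((N : ℝ) ^ (-1 + δ')) ((N : ℝ) ^ (-δ')),
      u ∈ U ∧ ∫ x, W x u ^ 2 ∂Q ≤ V * (1 + Real.log N) := by
    rintro _ ⟨h, φ, i1, i2, i3, rfl⟩
    have h0 : 0 < h := (Real.rpow_pos_of_pos hN0 _).trans_le i1
    obtain ⟨j1, j2⟩ := hVH h φ h0 (i2.trans c3) (i3.trans c3)
    refine ⟨j1, j2.trans (mul_le_mul_of_nonneg_left ?_ hV.le)⟩
    rw [natCast_rpow_eq_exp hN] at i1
    have := (Real.le_log_iff_exp_le h0).2 i1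
    nlinarith
  obtain ⟨p1, p2, p3, p4, p5, p6, p7⟩ := hpar
  rw [domain_eq_sector] at hharm
  simp only [domain_eq_sector] at hz hy
  have b1 := h₁.biasComparison hω
  rw [q2] at b1
  have main := g.abs_biased_sub_le hH hC hW.gaussian hUD (fun u hu => (hsec u hu).1) (hWN N) hharm
    (q2 ▸ b1) (by positivity) (by linarith) (h₂.biasComparison hω') (by rw [q4]; exact c2)
    (by positivity) (fun u hu => (hsec u hu).2) p1 p2 p3 p4
    (fun r r1 r2 => abs_log_two_mul_div_le hN hδ r1 r2)
    (hA.trans (le_mul_of_one_le_right (by linarith) (one_le_pow₀ (by linarith))))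
    (hstep _ hlog).2 (hstep _ hlog).1 p5 p6 hz hy
  exact ⟨main.1, main.2.1, main.2.2.1, main.2.2.2.trans p7⟩

/-- Without increments there is nothing to compare, and only the integrability of the bias is
needed. -/
lemma MomentBound.productComparison_zero [IsProbabilityMeasure Q] [∀ N, IsProbabilityMeasure (P N)]
    {δ C : ℝ} {N : ℕ} (h : MomentBound 0 η P WN Q W δ C N) {r : ℝ} (hr : 0 ≤ r) :
    ProductComparison 0 η P WN Q W δ r N := by
  intro ω hω z y hz hy
  have hpair : IndexedPairing (ω * zeta (n0 N δ)) (Complex.I * zeta (bStar η N δ)) z y :=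
    ⟨fun i => i.elim0, fun i => i.elim0, fun i => i.elim0, fun i => i.elim0, fun i => i.elim0,
      fun i => i.elim0, fun i => i.elim0, fun i => i.elim0⟩
  have h1 := (h ω hω _ (hpair.mem_perturbedBiases hz hy)).1
  simp only [Finset.univ_eq_empty, Finset.sum_empty, add_zero] at h1
  have hpos := integral_exp_pos h1
  refine ⟨h1, by simpa using h1, by simp, ?_⟩
  simp only [biasedExp, Finset.univ_eq_empty, Finset.prod_empty, mul_one, integral_const,
    probReal_univ, smul_eq_mul]
  rw [div_self hpos.ne', sub_self, abs_zero]
  exact hr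

end

end LogField

theorem proposition6p4
    {S : ℕ → Type*} [∀ N, MeasurableSpace (S N)]
    (P : ∀ N, Measure (S N)) [∀ N, IsProbabilityMeasure (P N)]
    (WN : ∀ N, S N → ℂ → ℝ)
    {E : Type*} [MeasurableSpace E] (Q : Measure E) [IsProbabilityMeasure Q]
    (W : E → ℂ → ℝ)
    (U : Set ℂ) (hU : IsOpen U) (hUD : U ⊆ Metric.ball (0 : ℂ) 1)
    (hUi : U ∈ 𝓝[Metric.ball (0 : ℂ) 1] Complex.I)
    (hWN : ∀ N, ∀ z ∈ U, AEMeasurable (fun x => WN N x z) (P N))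
    (hW : LogField.IsBRWLike Q W U)
    (η : ℕ → ℕ) (hη : Tendsto η atTop atTop)
    (hη' : Tendsto (fun N : ℕ => (η N : ℝ) / Real.log N) atTop (𝓝 0))
    (ℓ : ℕ) (hMEM : LogField.MEM ℓ η P WN Q W) :
    ∃ δ₀ > 0, ∀ δ : ℝ, 0 < δ → δ < δ₀ → ∀ α : ℝ, 0 < α → α < 1 →
      ∃ C : ℝ, ∀ᶠ N : ℕ in atTop, ∀ ω ∈ LogField.directions N δ,
        ∀ z y : Fin ℓ → ℂ,
          (∀ i, z i ∈ LogField.domain N δ) → (∀ i, y i ∈ LogField.domain N δ) →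
          Integrable (fun x => Real.exp (LogField.baseBias η N δ ω (WN N x))) (P N) ∧
          Integrable (fun x => Real.exp (LogField.baseBias η N δ ω (WN N x)) *
            ∏ i, LogField.incBias (z i) (y i) (WN N x)) (P N) ∧
          Integrable (fun x => ∏ i, LogField.incBias (z i) (y i)
            (fun ζ => LogField.biasMean Q W (LogField.baseBias η N δ ω) ζ + W x ζ)) Q ∧
          |LogField.biasedExp (P N) (WN N) (LogField.baseBias η N δ ω)
                (fun F => ∏ i, LogField.incBias (z i) (y i) F)
              - ∫ x, ∏ i, LogField.incBias (z i) (y i)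
                  (fun ζ => LogField.biasMean Q W (LogField.baseBias η N δ ω) ζ + W x ζ) ∂Q|
            ≤ C * Real.exp (-(Real.log N) ^ α) := by
  obtain ⟨δ₁, hδ₁, hM⟩ := hMEM
  refine ⟨min δ₁ (1 / 20), by positivity, fun δ hδ hδlt α hα0 hα1 => ⟨1, ?_⟩⟩
  have hδ1 : δ < δ₁ := hδlt.trans_le (min_le_left _ _)
  have hδ2 : δ < 1 / 20 := hδlt.trans_le (min_le_right _ _)
  obtain ⟨-, C₁, h₁⟩ := hM δ hδ hδ1
  have h₁' : ∀ᶠ N : ℕ in atTop, LogField.MomentBound ℓ η P WN Q W δ C₁ N := h₁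
  simp only [one_mul]
  change ∀ᶠ N : ℕ in atTop,
    LogField.ProductComparison ℓ η P WN Q W δ (Real.exp (-(Real.log N) ^ α)) N
  rcases ℓ with - | k
  · filter_upwards [h₁'] with N hN
    exact hN.productComparison_zero (Real.exp_pos _).le
  by_contra hcon
  -- The exceptional `N` share a parameter for which the second base point lies in its domain.
  obtain ⟨δ', hδ'1, hδ'2, hbad⟩ := LogField.exists_frequently_le_leftHeight
    (not_eventually.1 hcon) (show 3 / 5 * δ < 4 / 5 * δ by linarith) (by linarith) (by linarith)
  obtain ⟨hharm, C₂, h₂⟩ := hM δ' (by linarith) (by linarith)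
  obtain ⟨N, ⟨hN1, hN2⟩, hN3⟩ := (hbad.and_eventually
    (LogField.eventually_productComparison hUD hUi hWN hW hη hη' k hδ hδ2 hδ'1 hδ'2 hα0 hα1 hharm
      h₁' h₂)).exists
  exact hN1 (hN3 hN2)
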